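/- Let $\omega>0$. Let $q\in H^{-1}_{\rm loc}(\mathbb R)$ (a linear functional on the compactly supported functions of $H^1(\mathbb R)$ that is $H^1$-bounded on functions supported in any fixed compact interval) be real-valued and $\omega$-periodic. Let $\mu$ be a finite real signed Borel measure on $[0,\omega)$, equivalently $\mu=\mu_R$ for a left-continuous real function $R=R_+-R_-$ of bounded variation, where $R_\pm$ are the nondecreasing left-continuous functions generating the measures $\mu_\pm$ of the Jordan decomposition $\mu=\mu_+-\mu_-$. Let $r$ be the $\omega$-periodic extension of $\mu$ to $\mathbb R$, acting as $\langle rf,g\rangle=\int\overline{f}\,g\,dr$ on $H^1$ functions. "$R_\pm$ is a pure jump function with only finitely many jumps (if any)" means that $\mu_\pm$ is a finite sum of point masses. Let $T$ be the self-adjoint operator $-d^2/dx^2+q$ in $L^2(\mathbb R)$ with form domain $H^1(\mathbb R)$. For $\theta\in\mathbb R$ let $T_\theta$ be the self-adjoint operator $-d^2/dx^2+q$ in $L^2([0,\omega])$ with form domain $\{g\in H^1((0,\omega)) : g(\omega)=e^{i\theta}g(0)\}$. If $T\ge cI$ with $c>0$, then $T^{-1/2}rT^{-1/2}$ denotes the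 bounded operator $B$ in $L^2(\mathbb R)$ with $(u,Bv)=\int_{\mathbb R}\overline{T^{-1/2}u}\;T^{-1/2}v\,dr$ for all $u,v$; $T_\theta^{-1/2}rT_\theta^{-1/2}$ is defined in the same way in $L^2([0,\omega])$, with $\int_{[0,\omega)}\cdots\,d\mu$. (i) Suppose $T_\theta\ge c_\theta I$ for some $c_\theta>0$. Then the bounded operator $T_\theta^{-1/2}rT_\theta^{-1/2}$ exists, and it has infinitely many positive (resp., negative) eigenvalues unless $R_+$ (resp., $R_-$) is a pure jump function with only finitely many jumps (if any). (ii) Suppose $T\ge cI$ for some $c>0$. Then the bounded operator $T^{-1/2}rT^{-1/2}$ exists, and: - Its spectrum is the union of $\{0\}$ and of a family of nondegenerate compact intervals in $\mathbb R\setminus\{0\}$, all but finitely many of which lie in $(-\varepsilon,\varepsilon)$, for every $\varepsilon>0$. Infinitely many of them lie in $(0,\infty)$ (resp., $(-\infty,0)$), and hence accumulate at $0$, unless $R_+$ (resp., $R_-$) is a pure jump function with only finitely many jumps (if any). - The conditional stability set of $-\psi''+q\psi=zr\psi$, that is, the set of all $z\in\mathbb R$ for which this equation has a nontrivial bounded solution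 $\psi\in H^1_{\rm loc}(\mathbb R)$, is the union of a family of nondegenerate compact intervals in $\mathbb R\setminus\{0\}$, only finitely many of which meet any given bounded interval. Infinitely many of them lie in $(0,\infty)$ (resp., $(-\infty,0)$), and hence tend to $+\infty$ (resp., $-\infty$), unless $R_+$ (resp., $R_-$) is a pure jump function with only finitely many jumps (if any). - $T^{-1/2}rT^{-1/2}$ has no nonzero eigenvalue. It has no eigenvalue at all if no nonempty open subset of $\mathbb R$ is a null set of $|r|$. -/

import Mathlib

open MeasureTheory Set Filter Topology
open scoped ComplexConjugate InnerProductSpace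

noncomputable section

namespace PeriodicSL

/-! ### Sobolev functions on the line

Functions in `H¹` are represented by their (unique) continuous representatives. -/

/-- `f ∈ H¹_loc(ℝ)`: `f` is locally absolutely continuous and its a.e. derivative is in `L²_loc`. -/
def IsH1Loc (f : ℝ → ℂ) : Prop :=
  (∀ a b : ℝ, AbsolutelyContinuousOnInterval f a b) ∧
    ∀ a b : ℝ, MemLp (deriv f) 2 (volume.restrict (Icc a b))

/-- `f ∈ H¹(ℝ)`. -/
def IsH1 (f : ℝ → ℂ) : Prop :=
  IsH1Loc f ∧ MemLp f 2 volume ∧ MemLp (deriv f) 2 volume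

theorem IsH1Loc.ae_differentiableAt {f : ℝ → ℂ} (hf : IsH1Loc f) :
    ∀ᵐ x : ℝ, DifferentiableAt ℝ f x := by
  have h : LocallyBoundedVariationOn f univ := by
    intro a b _ _
    have h1 := (hf.1 a b).boundedVariationOn
    refine h1.mono ?_
    rw [univ_inter]
    exact Icc_subset_uIcc
  exact h.ae_differentiableAt

theorem IsH1Loc.continuous {f : ℝ → ℂ} (hf : IsH1Loc f) : Continuous f := by
  rw [continuous_iff_continuousAt]
  intro x
  have h := (hf.1 (x - 1) (x + 1)).continuousOn
  refine h.continuousAt ?_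
  rw [uIcc_of_le (by linarith)]
  exact Icc_mem_nhds (by linarith) (by linarith)

theorem IsH1Loc.zero : IsH1Loc (0 : ℝ → ℂ) := by
  constructor
  · intro a b
    exact (LipschitzOnWith.of_dist_le_mul (K := 0) (by simp)).absolutelyContinuousOnInterval
  · intro a b
    have : deriv (0 : ℝ → ℂ) = 0 := by ext x; simp
    rw [this]
    exact MemLp.zero

theorem IsH1Loc.add {f g : ℝ → ℂ} (hf : IsH1Loc f) (hg : IsH1Loc g) : IsH1Loc (f + g) := by
  refine ⟨fun a b => (hf.1 a b).add (hg.1 a b), fun a b => ?_⟩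
  refine MemLp.ae_eq ?_ ((hf.2 a b).add (hg.2 a b))
  refine ae_restrict_of_ae ?_
  filter_upwards [hf.ae_differentiableAt, hg.ae_differentiableAt] with x h1 h2
  rw [Pi.add_apply, deriv_add h1 h2]

theorem IsH1Loc.conj {f : ℝ → ℂ} (hf : IsH1Loc f) : IsH1Loc (fun x => conj (f x)) := by
  constructor
  · intro a b
    have h := hf.1 a b
    rw [absolutelyContinuousOnInterval_iff] at h ⊢
    simpa [Complex.dist_conj_conj] using h
  · intro a b
    have : deriv (fun x => conj (f x)) = fun x => conj (deriv f x) := by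
      ext x
      exact deriv.star (f := f) (x := x)
    rw [this]
    exact (hf.2 a b).star

theorem IsH1Loc.mul {f g : ℝ → ℂ} (hf : IsH1Loc f) (hg : IsH1Loc g) :
    IsH1Loc (fun x => f x * g x) := by
  refine ⟨fun a b => (hf.1 a b).smul (hg.1 a b), fun a b => ?_⟩
  have hb : ∀ {k : ℝ → ℂ}, IsH1Loc k → MemLp k ⊤ (volume.restrict (Icc a b)) := by
    intro k hk
    obtain ⟨C, hC⟩ := isCompact_Icc.exists_bound_of_continuousOn
      (hk.continuous.continuousOn (s := Icc a b))
    exact memLp_top_of_bound hk.continuous.aestronglyMeasurable C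
      ((ae_restrict_iff' measurableSet_Icc).2 (Eventually.of_forall hC))
  have h1 : MemLp (fun x => g x * deriv f x) 2 (volume.restrict (Icc a b)) :=
    MemLp.mul (hf.2 a b) (hb hg)
  have h2 : MemLp (fun x => f x * deriv g x) 2 (volume.restrict (Icc a b)) :=
    MemLp.mul (hg.2 a b) (hb hf)
  refine MemLp.ae_eq ?_ (h1.add h2)
  refine ae_restrict_of_ae ?_
  filter_upwards [hf.ae_differentiableAt, hg.ae_differentiableAt] with x h1 h2
  rw [deriv_fun_mul h1 h2, Pi.add_apply]
  ring

theorem IsH1Loc.const_smul {f : ℝ → ℂ} (c : ℂ) (hf : IsH1Loc f) : IsH1Loc (c • f) := by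
  refine ⟨fun a b => (hf.1 a b).const_smul c, fun a b => ?_⟩
  have : deriv (c • f) = c • deriv f := by
    ext x
    simp [Pi.smul_def]
  rw [this]
  exact (hf.2 a b).const_smul c

/-- The space of compactly supported `H¹` functions on the line. -/
def H1c : Submodule ℂ (ℝ → ℂ) where
  carrier := {f | IsH1Loc f ∧ HasCompactSupport f}
  add_mem' hf hg := ⟨hf.1.add hg.1, hf.2.add hg.2⟩
  zero_mem' := ⟨IsH1Loc.zero, HasCompactSupport.zero⟩
  smul_mem' c _ hf := ⟨hf.1.const_smul c, hf.2.smul_left (f := fun _ => c)⟩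

/-- The product of a compactly supported `H¹` function and an `H¹_loc` function. -/
def mulH1c (v : H1c) (f : ℝ → ℂ) (hf : IsH1Loc f) : H1c :=
  ⟨fun x => v.1 x * f x, v.2.1.mul hf, v.2.2.mul_right⟩

/-- The `H¹(ℝ)` norm. -/
def h1Norm (f : ℝ → ℂ) : ℝ :=
  Real.sqrt ((∫ x, ‖f x‖ ^ 2) + ∫ x, ‖deriv f x‖ ^ 2)

/-! ### Distributions in `H⁻¹_loc(ℝ)` -/

/-- `H⁻¹_loc(ℝ)`, the dual space of compactly supported `H¹` functions: linear functionals which,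
on functions supported in a fixed compact interval, are bounded in the `H¹` norm. -/
structure HNegOneLoc where
  /-- the (bilinear) pairing `h ↦ ⟨q, h⟩` -/
  pair : H1c →ₗ[ℂ] ℂ
  bounded : ∀ ρ : ℝ, ∃ C : ℝ, ∀ h : H1c, (∀ x, ρ < |x| → h.1 x = 0) → ‖pair h‖ ≤ C * h1Norm h.1

/-- `q` is real-valued. -/
def HNegOneLoc.IsReal (q : HNegOneLoc) : Prop :=
  ∀ h k : H1c, (∀ x, k.1 x = conj (h.1 x)) → q.pair k = conj (q.pair h)

/-- `q` is periodic with period `ω`. -/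
def HNegOneLoc.IsPeriodic (q : HNegOneLoc) (ω : ℝ) : Prop :=
  ∀ h k : H1c, (∀ x, k.1 x = h.1 (x - ω)) → q.pair k = q.pair h

/-- The distributional pairing `⟨-f'' + q f, v⟩`, for `f ∈ H¹_loc` and a compactly supported
`H¹` function `v`. -/
def weakSchrodinger (q : HNegOneLoc) (f : ℝ → ℂ) (hf : IsH1Loc f) (v : H1c) : ℂ :=
  (∫ x, deriv v.1 x * deriv f x) + q.pair (mulH1c v f hf)

/-! ### The weight `r`: a periodic signed measure

The weight is given by a finite signed measure `μ` on one period `[0, ω)`.  The two measures of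
its Jordan decomposition correspond to the nondecreasing functions `R₊` and `R₋`. -/

/-- The measure is a finite sum of point masses (the associated nondecreasing function is a pure
jump function with finitely many jumps, if any). -/
def FinitelyManyJumps (ν : Measure ℝ) : Prop :=
  ∃ F : Finset ℝ, ν ((F : Set ℝ)ᶜ) = 0

/-- The `ω`-periodic extension to the line of a measure carried by `[0, ω)`. -/
def periodicExt (ω : ℝ) (ν : Measure ℝ) : Measure ℝ :=
  Measure.sum fun n : ℤ => ν.map fun x => x + n * ω

/-- `R₊` on `[0, ω)`. -/
abbrev posPart (μ : SignedMeasure ℝ) : Measure ℝ := μ.toJordanDecomposition.posPart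

/-- `R₋` on `[0, ω)`. -/
abbrev negPart (μ : SignedMeasure ℝ) : Measure ℝ := μ.toJordanDecomposition.negPart

/-- `∫ h dr` over one period. -/
def periodPair (μ : SignedMeasure ℝ) (h : ℝ → ℂ) : ℂ :=
  (∫ x, h x ∂(posPart μ)) - ∫ x, h x ∂(negPart μ)

/-- `∫ h dr` over the line, where `r` is the `ω`-periodic extension of `μ`. -/
def linePair (ω : ℝ) (μ : SignedMeasure ℝ) (h : ℝ → ℂ) : ℂ :=
  (∫ x, h x ∂(periodicExt ω (posPart μ))) - ∫ x, h x ∂(periodicExt ω (negPart μ))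

/-! ### Operators, given through their graphs -/

section Abstract

variable {H : Type*} [NormedAddCommGroup H] [InnerProductSpace ℂ H]

/-- `A ≥ c I` for the operator with graph `A`. -/
def BoundedBelow (A : H → H → Prop) (c : ℝ) : Prop :=
  ∀ u w, A u w → c * ‖u‖ ^ 2 ≤ (⟪u, w⟫_ℂ).re

/-- `K = A^(-1/2)` for the operator with graph `A`: `K` is bounded, nonnegative, `K² = A⁻¹`. -/
def IsInvSqrt [CompleteSpace H] (A : H → H → Prop) (K : H →L[ℂ] H) : Prop :=
  K.IsPositive ∧ ∀ u w, A u w ↔ u = K (K w)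

end Abstract

/-- `L²(ℝ; dx)`. -/
abbrev L2Line : Type := Lp ℂ 2 (volume : Measure ℝ)

/-- `L²([0, ω]; dx)`. -/
abbrev L2Period (ω : ℝ) : Type := Lp ℂ 2 (volume.restrict (Icc 0 ω) : Measure ℝ)

/-- The graph of `T = -d²/dx² + q` in `L²(ℝ)`, the self-adjoint operator given by the form with
domain `H¹(ℝ)`: `T u = w` iff `u ∈ H¹(ℝ)` and `-u'' + q u = w` as distributions. -/
def lineOp (q : HNegOneLoc) (u w : L2Line) : Prop :=
  ∃ (f : ℝ → ℂ) (hf : IsH1 f), u =ᵐ[volume] f ∧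
    ∀ v : H1c, weakSchrodinger q f hf.1 v = ∫ x, v.1 x * w x

/-- `B = T^(-1/2) r T^(-1/2)` in `L²(ℝ)` with `K = T^(-1/2)`: the bounded operator with
`(u, B v) = ∫ conj (K u) (K v) dr`. -/
def IsLineBS (ω : ℝ) (μ : SignedMeasure ℝ) (K B : L2Line →L[ℂ] L2Line) : Prop :=
  ∀ u v : L2Line, ∃ f g : ℝ → ℂ, IsH1 f ∧ IsH1 g ∧ K u =ᵐ[volume] f ∧ K v =ᵐ[volume] g ∧
    ⟪u, B v⟫_ℂ = linePair ω μ fun x => conj (f x) * g x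

/-! ### Quasi-periodic boundary conditions -/

/-- The form domain `{g ∈ H¹((0, ω)) | g(ω) = e^{iθ} g(0)}`, each function being extended to the
line by `g(x + ω) = e^{iθ} g(x)`. -/
def IsQuasiPeriodic (ω θ : ℝ) (f : ℝ → ℂ) : Prop :=
  IsH1Loc f ∧ ∀ x, f (x + ω) = Complex.exp (Complex.I * θ) * f x

/-- The tent function of half-width `ω`; its translates by multiples of `ω` sum to `1`. -/
def tent (ω : ℝ) (x : ℝ) : ℂ := ((max 0 (1 - |x| / ω) : ℝ) : ℂ)

theorem tent_mem {ω : ℝ} (hω : 0 < ω) : tent ω ∈ H1c := by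
  have hL : LipschitzWith (Real.toNNReal (1 / ω)) (tent ω) := by
    refine LipschitzWith.of_dist_le_mul fun x y => ?_
    rw [Real.coe_toNNReal _ (by positivity)]
    unfold tent
    rw [Complex.dist_eq, ← Complex.ofReal_sub, Complex.norm_real, Real.dist_eq, Real.norm_eq_abs]
    calc |max 0 (1 - |x| / ω) - max 0 (1 - |y| / ω)|
        ≤ |(1 - |x| / ω) - (1 - |y| / ω)| := by
          have := abs_max_sub_max_le_abs (1 - |x| / ω) (1 - |y| / ω) 0
          rwa [max_comm _ (0 : ℝ), max_comm _ (0 : ℝ)] at this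
      _ = 1 / ω * |(|y| - |x|)| := by
          rw [show (1 - |x| / ω) - (1 - |y| / ω) = 1 / ω * (|y| - |x|) by ring, abs_mul,
            abs_of_pos (by positivity)]
      _ ≤ 1 / ω * |x - y| := by
          refine mul_le_mul_of_nonneg_left ?_ (by positivity)
          rw [abs_sub_comm x y]
          exact abs_abs_sub_abs_le y x
  refine ⟨⟨fun a b => (hL.lipschitzOnWith).absolutelyContinuousOnInterval, fun a b => ?_⟩, ?_⟩
  · refine MemLp.of_bound (C := 1 / ω) (aestronglyMeasurable_deriv _ _) ?_
    refine Eventually.of_forall fun x => ?_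
    have := norm_deriv_le_of_lipschitz (x₀ := x) hL
    rwa [Real.coe_toNNReal _ (by positivity)] at this
  · refine HasCompactSupport.intro (isCompact_Icc (a := -ω) (b := ω)) fun x hx => ?_
    have h : ω < |x| := by
      by_contra hc
      exact hx (abs_le.1 (not_lt.1 hc))
    have : 1 - |x| / ω ≤ 0 := by
      rw [sub_nonpos, le_div_iff₀ hω]
      linarith
    simp [tent, max_eq_left this]

/-- The sesquilinear form of `T_θ`: `∫_0^ω conj(v') f' dx` plus the pairing over one period of `q`
with the `ω`-periodic function `conj(v) f`, which is `⟨q, tent · conj(v) f⟩`. -/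
def thetaForm {ω : ℝ} (hω : 0 < ω) (q : HNegOneLoc) (v f : ℝ → ℂ) (hv : IsH1Loc v)
    (hf : IsH1Loc f) : ℂ :=
  (∫ x in Icc 0 ω, conj (deriv v x) * deriv f x) +
    q.pair (mulH1c ⟨tent ω, tent_mem hω⟩ (fun x => conj (v x) * f x) (hv.conj.mul hf))

/-- The graph of `T_θ` in `L²([0, ω])`, the operator associated with the form `thetaForm` on the
quasi-periodic `H¹` functions. -/
def thetaOp {ω : ℝ} (hω : 0 < ω) (θ : ℝ) (q : HNegOneLoc) (u w : L2Period ω) : Prop :=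
  ∃ (f : ℝ → ℂ) (hf : IsQuasiPeriodic ω θ f), u =ᵐ[volume.restrict (Icc 0 ω)] f ∧
    ∀ (v : ℝ → ℂ) (hv : IsQuasiPeriodic ω θ v),
      thetaForm hω q v f hv.1 hf.1 = ∫ x in Icc 0 ω, conj (v x) * w x

/-- `B = T_θ^(-1/2) r T_θ^(-1/2)` in `L²([0, ω])` with `K = T_θ^(-1/2)`. -/
def IsThetaBS (ω θ : ℝ) (μ : SignedMeasure ℝ) (K B : L2Period ω →L[ℂ] L2Period ω) : Prop :=
  ∀ u v : L2Period ω, ∃ f g : ℝ → ℂ, IsQuasiPeriodic ω θ f ∧ IsQuasiPeriodic ω θ g ∧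
    K u =ᵐ[volume.restrict (Icc 0 ω)] f ∧ K v =ᵐ[volume.restrict (Icc 0 ω)] g ∧
    ⟪u, B v⟫_ℂ = periodPair μ fun x => conj (f x) * g x

/-! ### The conditional stability set -/

/-- The energies `z ∈ ℝ` for which `-ψ'' + q ψ = z r ψ` has a nontrivial bounded solution on the
line. -/
def conditionalStabilitySet (ω : ℝ) (q : HNegOneLoc) (μ : SignedMeasure ℝ) : Set ℝ :=
  {z | ∃ (ψ : ℝ → ℂ) (hψ : IsH1Loc ψ), (∃ x, ψ x ≠ 0) ∧ (∃ C : ℝ, ∀ x, ‖ψ x‖ ≤ C) ∧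
    ∀ v : H1c, weakSchrodinger q ψ hψ v = z * linePair ω μ fun x => v.1 x * ψ x}

/-- The union of the compact intervals `[a, b]`, `(a, b) ∈ 𝓘`. -/
def unionIntervals (𝓘 : Set (ℝ × ℝ)) : Set ℝ := ⋃ p ∈ 𝓘, Icc p.1 p.2

end PeriodicSL

end

/-!
Periodic Schrödinger operators `-d²/dx² + q` with weight `r`, and the Birman–Schwinger operators
`T^(-1/2) r T^(-1/2)`.

Both `q` and `r` are periodic real distributions in `H⁻¹_loc`, and by the Riesz representation
theorem on the periodic `H¹` functions each has the form `p - p''` with a periodic `H¹_loc` function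
`p` (`HNegOneLoc.IsPeriodic.exists_potential`, `Weight.exists_potential`). All sesquilinear forms become
integrals of the density `dens`, in which only a periodic function in `L²_loc` multiplies `H¹`
functions. They are represented by bounded operators on the Hilbert spaces `H¹(ℝ)` and the periodic
`H¹` functions (both instances of `FormDomain`): `potOp s` for the weight, `lineA` for `T`, and
`twistOp κ` for `T_θ` with `θ = κ ω`, after multiplication by `e^{-iκx}` has turned quasi-periodic
functions into periodic ones.

If the form of `A` is coercive, an isomorphism `U` of `L²` with the form domain implements
`A^(-1/2)`, and the Birman–Schwinger operator is the operator of the weight transported by `U`. So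
its eigenvalues and its spectrum are those of the pencil `R f = λ A f` in the form domain, with `R`
the operator of the weight (`exists_birmanSchwinger`).

On one period, `R` is compact (`Weight.isCompactOperator`). If `R₊` is not a finite sum of jumps,
the measure charges any number of disjoint open sets, and test functions in them which almost miss
the negative part span spaces of any finite dimension where the form of `r` is positive definite
(`Weight.exists_orthogonal`); by the min-max principle there are infinitely many positive
eigenvalues (`exists_eigenvalue_le`, `exists_thetaBS`).

On the line, the nonzero spectrum of the pencil is the union over `κ ∈ [0, 2π/ω]` of the eigenvalues
of the pencils on the fibres (`not_bijective_pencil_iff`). In one direction, cut-offs of a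
quasi-periodic solution form a Weyl sequence (`not_bounded_below_of_isSol`). In the other direction,
a compactly supported function is a finite sum of quasi-periodic functions on a large number of
periods, at quasi-momenta `2πj/(Nω)`, so that bounds on the fibres which are uniform in `κ` give a
bound on the line (`bounded_below_of_fibres`). Lower bounds pass from the line to the fibres by
cutting off as well (`twistOp_lower_bound`).

The min-max values of the pencils on the fibres depend continuously on `κ`, so each of them runs
through a compact interval, a band (`exists_bands`). A band cannot be a single point: a number
`λ ≠ 0` that is an eigenvalue on all fibres would give the differential equation infinitely many
Floquet multipliers, while its solution space is finite dimensional (`finite_multipliers`,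
`exists_injective_pencil`). Unique continuation behind this finiteness comes from an energy estimate
on short intervals (`eq_zero_of_energy`, `exists_injective`), because the coefficients are only
distributions. The same Floquet theory shows that a nontrivial bounded solution yields a
quasi-periodic one (`exists_quasiPeriodic_of_bounded`), so the conditional stability set consists of
the inverses of the band points, and that no nontrivial solution lies in `H¹(ℝ)`
(`eq_zero_of_isH1`), so there are no nonzero eigenvalues. Finally, `0` is in the spectrum
(`Weight.not_bijective_potOp`), and it is an eigenvalue only if some nonempty open set is a null set
of `|r|` (`Weight.eq_zero_of_potOp`).
-/

noncomputable section

namespace PeriodicSL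

/-! ### Calculus of locally `H¹` functions -/

/-- `w ∈ L²_loc` is the distributional derivative of `f`, expressed through the fundamental theorem
of calculus. -/
def HasWeakDeriv (f w : ℝ → ℂ) : Prop :=
  (∀ a b : ℝ, MemLp w 2 (volume.restrict (Icc a b))) ∧ ∀ x y : ℝ, ∫ t in x..y, w t = f y - f x

theorem intervalIntegrable_of_memLp_loc {w : ℝ → ℂ}
    (hw : ∀ a b : ℝ, MemLp w 2 (volume.restrict (Icc a b))) (a b : ℝ) :
    IntervalIntegrable w volume a b := by
  rw [intervalIntegrable_iff]
  have h := (hw (min a b) (max a b)).integrable (by norm_num)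
  exact IntegrableOn.mono_set h Ioc_subset_Icc_self

theorem locallyIntegrable_of_memLp_loc {w : ℝ → ℂ}
    (hw : ∀ a b : ℝ, MemLp w 2 (volume.restrict (Icc a b))) : LocallyIntegrable w volume := by
  rw [locallyIntegrable_iff]
  intro k hk
  obtain ⟨a, b, hab⟩ := bddBelow_bddAbove_iff_subset_Icc.1 ⟨hk.bddBelow, hk.bddAbove⟩
  exact IntegrableOn.mono_set ((hw a b).integrable (by norm_num)) hab

theorem absolutelyContinuousOnInterval_const {X : Type*} [PseudoMetricSpace X] (c : X) (a b : ℝ) :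
    AbsolutelyContinuousOnInterval (fun _ : ℝ => c) a b :=
  (LipschitzOnWith.of_dist_le_mul (K := 0) (by simp)).absolutelyContinuousOnInterval

theorem AbsolutelyContinuousOnInterval.lipschitz_comp {X Y : Type*} [PseudoMetricSpace X]
    [PseudoMetricSpace Y] {f : ℝ → X} {a b : ℝ} (hf : AbsolutelyContinuousOnInterval f a b)
    {L : X → Y} (hL : ∀ x y, dist (L x) (L y) ≤ dist x y) :
    AbsolutelyContinuousOnInterval (fun x => L (f x)) a b := by
  rw [absolutelyContinuousOnInterval_iff] at hf ⊢
  intro ε hε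
  obtain ⟨δ, hδ, h⟩ := hf ε hε
  exact ⟨δ, hδ, fun E hE hs =>
    (Finset.sum_le_sum fun i _ => hL _ _).trans_lt (h E hE hs)⟩

theorem HasWeakDeriv.absolutelyContinuousOnInterval {f w : ℝ → ℂ} (h : HasWeakDeriv f w)
    (a b : ℝ) : AbsolutelyContinuousOnInterval f a b := by
  have hi := intervalIntegrable_of_memLp_loc h.1 a b
  have hre : IntervalIntegrable (fun x => (w x).re) volume a b :=
    ⟨hi.1.re, hi.2.re⟩
  have him : IntervalIntegrable (fun x => (w x).im) volume a b :=
    ⟨hi.1.im, hi.2.im⟩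
  have h1 := hre.absolutelyContinuousOnInterval_intervalIntegral (c := a) (by simp)
  have h2 := him.absolutelyContinuousOnInterval_intervalIntegral (c := a) (by simp)
  have e : f = (fun _ => f a) +
      (((fun x => ∫ t in a..x, (w t).re) • fun _ => (1 : ℂ)) +
        ((fun x => ∫ t in a..x, (w t).im) • fun _ => Complex.I)) := by
    ext x
    have hx := intervalIntegrable_of_memLp_loc h.1 a x
    have e1 : ∫ t in a..x, (w t).re = (∫ t in a..x, w t).re := by
      have := Complex.reCLM.intervalIntegral_comp_comm hx
      simpa using this
    have e2 : ∫ t in a..x, (w t).im = (∫ t in a..x, w t).im := by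
      have := Complex.imCLM.intervalIntegral_comp_comm hx
      simpa using this
    simp only [Pi.add_apply, Pi.smul_apply', e1, e2, h.2 a x, Complex.real_smul, mul_one]
    rw [Complex.re_add_im]
    ring
  rw [e]
  exact (absolutelyContinuousOnInterval_const _ _ _).add
    ((h1.smul (absolutelyContinuousOnInterval_const _ _ _)).add
      (h2.smul (absolutelyContinuousOnInterval_const _ _ _)))

theorem HasWeakDeriv.hasDerivAt_ae {f w : ℝ → ℂ} (h : HasWeakDeriv f w) :
    ∀ᵐ x : ℝ, HasDerivAt f (w x) x := by
  filter_upwards [_root_.LocallyIntegrable.ae_hasDerivAt_integral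
    (locallyIntegrable_of_memLp_loc h.1)] with x hx
  have := (hx 0).add_const (f 0)
  refine this.congr_of_eventuallyEq (Eventually.of_forall fun y => ?_)
  simp [h.2 0 y]

theorem HasWeakDeriv.deriv_ae {f w : ℝ → ℂ} (h : HasWeakDeriv f w) : deriv f =ᵐ[volume] w :=
  h.hasDerivAt_ae.mono fun _ hx => hx.deriv

theorem HasWeakDeriv.isH1Loc {f w : ℝ → ℂ} (h : HasWeakDeriv f w) : IsH1Loc f :=
  ⟨h.absolutelyContinuousOnInterval, fun a b =>
    (h.1 a b).ae_eq (ae_restrict_of_ae h.deriv_ae.symm)⟩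

theorem IsH1Loc.hasWeakDeriv {f : ℝ → ℂ} (hf : IsH1Loc f) : HasWeakDeriv f (deriv f) := by
  refine ⟨hf.2, fun x y => ?_⟩
  have hi := intervalIntegrable_of_memLp_loc hf.2 x y
  have hre : AbsolutelyContinuousOnInterval (fun t => (f t).re) x y :=
    AbsolutelyContinuousOnInterval.lipschitz_comp (hf.1 x y) fun z w => by
      rw [Complex.dist_eq, Real.dist_eq, ← Complex.sub_re]
      exact Complex.abs_re_le_norm _
  have him : AbsolutelyContinuousOnInterval (fun t => (f t).im) x y :=
    AbsolutelyContinuousOnInterval.lipschitz_comp (hf.1 x y) fun z w => by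
      rw [Complex.dist_eq, Real.dist_eq, ← Complex.sub_im]
      exact Complex.abs_im_le_norm _
  have e1 : ∫ t in x..y, (deriv f t).re = ∫ t in x..y, deriv (fun t => (f t).re) t := by
    refine intervalIntegral.integral_congr_ae ?_
    filter_upwards [hf.ae_differentiableAt] with t ht _
    exact ((Complex.reCLM.hasFDerivAt.comp_hasDerivAt t ht.hasDerivAt).deriv).symm
  have e2 : ∫ t in x..y, (deriv f t).im = ∫ t in x..y, deriv (fun t => (f t).im) t := by
    refine intervalIntegral.integral_congr_ae ?_
    filter_upwards [hf.ae_differentiableAt] with t ht _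
    exact ((Complex.imCLM.hasFDerivAt.comp_hasDerivAt t ht.hasDerivAt).deriv).symm
  have c1 := Complex.reCLM.intervalIntegral_comp_comm hi
  have c2 := Complex.imCLM.intervalIntegral_comp_comm hi
  simp only [Complex.reCLM_apply, Complex.imCLM_apply] at c1 c2
  apply Complex.ext
  · rw [← c1, e1, hre.integral_deriv_eq_sub, Complex.sub_re]
  · rw [← c2, e2, him.integral_deriv_eq_sub, Complex.sub_im]

theorem IsH1Loc.integral_deriv {f : ℝ → ℂ} (hf : IsH1Loc f) (x y : ℝ) :
    ∫ t in x..y, deriv f t = f y - f x := hf.hasWeakDeriv.2 x y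

/-- Being locally `H¹` is a local property. -/
theorem IsH1Loc.of_eqOn {f : ℝ → ℂ}
    (h : ∀ M : ℝ, ∃ g, IsH1Loc g ∧ EqOn f g (Ioo (-M) M)) : IsH1Loc f := by
  have key : ∀ a b : ℝ, ∃ g, IsH1Loc g ∧ EqOn f g (Icc a b) ∧
      EqOn (deriv f) (deriv g) (Icc a b) := by
    intro a b
    obtain ⟨g, hg, hfg⟩ := h (max |a| |b| + 1)
    have hs : Icc a b ⊆ Ioo (-(max |a| |b| + 1)) (max |a| |b| + 1) := by
      intro x hx
      have h1 := neg_abs_le a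
      have h2 := le_abs_self b
      have h3 := le_max_left |a| |b|
      have h4 := le_max_right |a| |b|
      exact ⟨by linarith [hx.1], by linarith [hx.2]⟩
    refine ⟨g, hg, hfg.mono hs, fun x hx => ?_⟩
    exact ((hfg.eventuallyEq_of_mem (isOpen_Ioo.mem_nhds (hs hx))).deriv_eq)
  refine HasWeakDeriv.isH1Loc (w := deriv f) ⟨fun a b => ?_, fun x y => ?_⟩
  · obtain ⟨g, hg, -, hd⟩ := key a b
    refine (hg.2 a b).ae_eq ?_
    filter_upwards [ae_restrict_mem measurableSet_Icc] with x hx using (hd hx).symm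
  · obtain ⟨g, hg, he, hd⟩ := key (min x y) (max x y)
    rw [he ⟨min_le_left _ _, le_max_left _ _⟩, he ⟨min_le_right _ _, le_max_right _ _⟩,
      ← hg.integral_deriv]
    exact intervalIntegral.integral_congr hd

theorem memLp_loc_comp_add {w : ℝ → ℂ} (hw : ∀ a b : ℝ, MemLp w 2 (volume.restrict (Icc a b)))
    (c a b : ℝ) : MemLp (fun x => w (x + c)) 2 (volume.restrict (Icc a b)) := by
  have h := hw (a + c) (b + c)
  have mp : MeasurePreserving (fun x : ℝ => x + c) (volume.restrict (Icc a b))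
      (volume.restrict (Icc (a + c) (b + c))) := by
    have := (measurePreserving_add_right volume c).restrict_preimage
      (s := Icc (a + c) (b + c)) measurableSet_Icc
    simpa [preimage_add_const_Icc] using this
  exact h.comp_measurePreserving mp

theorem deriv_comp_add (f : ℝ → ℂ) (c : ℝ) :
    deriv (fun x => f (x + c)) = fun x => deriv f (x + c) := by
  ext x
  exact deriv_comp_add_const f c x

theorem IsH1Loc.comp_add {f : ℝ → ℂ} (hf : IsH1Loc f) (c : ℝ) : IsH1Loc fun x => f (x + c) := by
  refine HasWeakDeriv.isH1Loc (w := fun x => deriv f (x + c)) ⟨memLp_loc_comp_add hf.2 c, ?_⟩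
  intro x y
  rw [intervalIntegral.integral_comp_add_right (fun t => deriv f t), hf.integral_deriv]

theorem IsH1Loc.comp_neg {f : ℝ → ℂ} (hf : IsH1Loc f) : IsH1Loc fun x => f (-x) := by
  refine HasWeakDeriv.isH1Loc (w := fun x => -deriv f (-x)) ⟨fun a b => ?_, fun x y => ?_⟩
  · have mp : MeasurePreserving (fun x : ℝ => -x) (volume.restrict (Icc a b))
        (volume.restrict (Icc (-b) (-a))) := by
      have := (Measure.measurePreserving_neg (volume : Measure ℝ)).restrict_preimage
        (s := Icc (-b) (-a)) measurableSet_Icc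
      simpa using this
    exact ((hf.2 (-b) (-a)).comp_measurePreserving mp).neg
  · rw [intervalIntegral.integral_neg, intervalIntegral.integral_comp_neg (fun t => deriv f t),
      hf.integral_deriv]
    ring

theorem deriv_comp_neg' (f : ℝ → ℂ) : deriv (fun x => f (-x)) = fun x => -deriv f (-x) := by
  ext x
  exact deriv_comp_neg f x

theorem IsH1Loc.deriv_mul_ae {f g : ℝ → ℂ} (hf : IsH1Loc f) (hg : IsH1Loc g) :
    ∀ᵐ x : ℝ, deriv (fun x => f x * g x) x = deriv f x * g x + f x * deriv g x := by
  filter_upwards [hf.ae_differentiableAt, hg.ae_differentiableAt] with x h1 h2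
  rw [deriv_fun_mul h1 h2]

theorem deriv_conj (f : ℝ → ℂ) : deriv (fun x => conj (f x)) = fun x => conj (deriv f x) := by
  ext x
  exact deriv.star (f := f) (x := x)

theorem IsH1Loc.sub {f g : ℝ → ℂ} (hf : IsH1Loc f) (hg : IsH1Loc g) : IsH1Loc (f - g) := by
  have := hf.add (hg.const_smul (-1))
  have e : f - g = f + (-1 : ℂ) • g := by ext x; simp [sub_eq_add_neg]
  rwa [e]

theorem IsH1Loc.of_lipschitz {f : ℝ → ℂ} {K : NNReal} (hf : LipschitzWith K f) : IsH1Loc f := by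
  refine ⟨fun a b => (hf.lipschitzOnWith).absolutelyContinuousOnInterval, fun a b => ?_⟩
  refine MemLp.of_bound (C := K) (aestronglyMeasurable_deriv _ _) ?_
  exact Eventually.of_forall fun x => norm_deriv_le_of_lipschitz (x₀ := x) hf

theorem IsH1Loc.const (c : ℂ) : IsH1Loc fun _ => c :=
  IsH1Loc.of_lipschitz (K := 0) (LipschitzWith.const c)

theorem IsH1Loc.of_contDiff {f : ℝ → ℂ} (hf : ContDiff ℝ 1 f) : IsH1Loc f := by
  refine ⟨fun a b => hf.contDiffOn.absolutelyContinuousOnInterval, fun a b => ?_⟩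
  have hc : Continuous (deriv f) := hf.continuous_deriv le_rfl
  obtain ⟨C, hC⟩ := isCompact_Icc.exists_bound_of_continuousOn (hc.continuousOn (s := Icc a b))
  exact MemLp.of_bound hc.aestronglyMeasurable C
    ((ae_restrict_iff' measurableSet_Icc).2 (Eventually.of_forall hC))

/-- The projection of the line to `[a, b]`. -/
def clamp (a b x : ℝ) : ℝ := max a (min x b)

theorem clamp_of_mem {a b x : ℝ} (hx : x ∈ Icc a b) : clamp a b x = x := by
  unfold clamp; rw [min_eq_left hx.2, max_eq_right hx.1]

theorem clamp_of_le {a b x : ℝ} (hx : x ≤ a) : clamp a b x = a := by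
  unfold clamp; exact max_eq_left ((min_le_left _ _).trans hx)

theorem clamp_of_ge {a b x : ℝ} (hab : a ≤ b) (hx : b ≤ x) : clamp a b x = b := by
  unfold clamp; rw [min_eq_right hx, max_eq_right hab]

theorem IsH1Loc.hasWeakDeriv_clamp {f : ℝ → ℂ} (hf : IsH1Loc f) {a b : ℝ} (hab : a ≤ b) :
    HasWeakDeriv (fun x => f (clamp a b x)) ((Ioc a b).indicator (deriv f)) := by
  refine ⟨fun c d => (hf.2 c d).indicator measurableSet_Ioc, ?_⟩
  have hii : ∀ x y, IntervalIntegrable ((Ioc a b).indicator (deriv f)) volume x y :=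
    intervalIntegrable_of_memLp_loc fun c d => (hf.2 c d).indicator measurableSet_Ioc
  -- it suffices to integrate from `a`
  have key : ∀ y, ∫ t in a..y, (Ioc a b).indicator (deriv f) t = f (clamp a b y) - f a := by
    intro y
    rcases le_total y a with hy | hy
    · rw [clamp_of_le hy, sub_self, intervalIntegral.integral_symm,
        intervalIntegral.integral_of_le hy, setIntegral_eq_zero_of_forall_eq_zero, neg_zero]
      intro t ht
      exact indicator_of_notMem (fun h => not_lt.2 ht.2 h.1) _
    · rw [← hf.integral_deriv, intervalIntegral.integral_of_le hy,
        setIntegral_indicator measurableSet_Ioc, Ioc_inter_Ioc, max_self,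
        intervalIntegral.integral_of_le (by unfold clamp; exact le_max_left _ _)]
      have : min y b = clamp a b y := by
        unfold clamp
        rw [max_eq_right (le_min hy hab)]
      rw [this]
  intro x y
  rw [← intervalIntegral.integral_add_adjacent_intervals (hii x a) (hii a y),
    intervalIntegral.integral_symm, key, key]
  ring

/-! ### The one-dimensional Sobolev inequality -/

theorem integrableOn_of_memLp_mul {f g : ℝ → ℂ} {s : Set ℝ} (hf : MemLp f 2 (volume.restrict s))
    (hg : MemLp g 2 (volume.restrict s)) : IntegrableOn (fun x => f x * g x) s :=
  hf.integrable_mul hg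

theorem IsH1Loc.memLp {f : ℝ → ℂ} (hf : IsH1Loc f) (a b : ℝ) :
    MemLp f 2 (volume.restrict (Icc a b)) := by
  obtain ⟨C, hC⟩ := isCompact_Icc.exists_bound_of_continuousOn
    (hf.continuous.continuousOn (s := Icc a b))
  exact MemLp.of_bound hf.continuous.aestronglyMeasurable C
    ((ae_restrict_iff' measurableSet_Icc).2 (Eventually.of_forall hC))

theorem integrable_norm_sq_of_memLp {f : ℝ → ℂ} {m : Measure ℝ} (hf : MemLp f 2 m) :
    Integrable (fun x => ‖f x‖ ^ 2) m := by
  simpa using hf.integrable_norm_pow (p := 2) (by norm_num)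

theorem IsH1Loc.norm_sub_le {f : ℝ → ℂ} (hf : IsH1Loc f) {a b x y : ℝ} (hx : x ∈ Icc a b)
    (hy : y ∈ Icc a b) : ‖f x - f y‖ ≤ ∫ t in Icc a b, ‖deriv f t‖ := by
  have hi : IntegrableOn (fun t => ‖deriv f t‖) (Icc a b) :=
    ((hf.2 a b).integrable (by norm_num)).norm
  rw [← hf.integral_deriv y x]
  refine (intervalIntegral.norm_integral_le_integral_norm_uIoc).trans ?_
  refine setIntegral_mono_set hi (Eventually.of_forall fun t => norm_nonneg _) ?_
  refine LE.le.eventuallyLE ?_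
  intro t ht
  rcases le_total x y with h | h
  · rw [uIoc_of_ge h] at ht; exact ⟨hx.1.trans ht.1.le, ht.2.trans hy.2⟩
  · rw [uIoc_of_le h] at ht; exact ⟨hy.1.trans ht.1.le, ht.2.trans hx.2⟩

/-- Sobolev inequality: the supremum is form bounded with relative bound zero. -/
theorem IsH1Loc.norm_sq_le {f : ℝ → ℂ} (hf : IsH1Loc f) {a b : ℝ} (hab : a < b) {ε : ℝ}
    (hε : 0 < ε) {x : ℝ} (hx : x ∈ Icc a b) :
    ‖f x‖ ^ 2 ≤ ε * (∫ t in Icc a b, ‖deriv f t‖ ^ 2) +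
      (1 / (b - a) + 1 / ε) * ∫ t in Icc a b, ‖f t‖ ^ 2 := by
  have hh : IsH1Loc fun x => conj (f x) * f x := hf.conj.mul hf
  have hd : ∀ᵐ t ∂(volume.restrict (Icc a b)), ‖deriv (fun x => conj (f x) * f x) t‖ ≤
      ε * ‖deriv f t‖ ^ 2 + 1 / ε * ‖f t‖ ^ 2 := by
    refine ae_restrict_of_ae ?_
    filter_upwards [hf.conj.deriv_mul_ae hf] with t ht
    rw [ht, deriv_conj]
    refine (norm_add_le _ _).trans ?_
    rw [norm_mul, norm_mul, RCLike.norm_conj, RCLike.norm_conj]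
    have h0 : 0 ≤ (ε * ‖deriv f t‖ - ‖f t‖) ^ 2 / ε := by positivity
    have : (ε * ‖deriv f t‖ - ‖f t‖) ^ 2 / ε =
        ε * ‖deriv f t‖ ^ 2 + 1 / ε * ‖f t‖ ^ 2 - 2 * (‖deriv f t‖ * ‖f t‖) := by
      field_simp; ring
    rw [this] at h0
    linarith [mul_comm ‖f t‖ ‖deriv f t‖]
  have i1 := (integrable_norm_sq_of_memLp (hf.2 a b)).const_mul ε
  have i2 := (integrable_norm_sq_of_memLp (hf.memLp a b))
  have hD : ∫ t in Icc a b, ‖deriv (fun x => conj (f x) * f x) t‖ ≤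
      ε * (∫ t in Icc a b, ‖deriv f t‖ ^ 2) + 1 / ε * ∫ t in Icc a b, ‖f t‖ ^ 2 := by
    rw [← integral_const_mul, ← integral_const_mul, ← integral_add i1 (i2.const_mul _)]
    exact integral_mono_ae ((hh.2 a b).integrable (by norm_num)).norm
      (i1.add (i2.const_mul _)) hd
  set D := ε * (∫ t in Icc a b, ‖deriv f t‖ ^ 2) + 1 / ε * ∫ t in Icc a b, ‖f t‖ ^ 2 with hDdef
  have hpt : ∀ y ∈ Icc a b, ‖f x‖ ^ 2 - D ≤ ‖f y‖ ^ 2 := by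
    intro y hy
    have h1 := (hh.norm_sub_le hx hy).trans hD
    have h2 : conj (f x) * f x - conj (f y) * f y = ((‖f x‖ ^ 2 - ‖f y‖ ^ 2 : ℝ) : ℂ) := by
      rw [RCLike.conj_mul, RCLike.conj_mul]; push_cast; rfl
    rw [h2, Complex.norm_real, Real.norm_eq_abs] at h1
    linarith [le_abs_self (‖f x‖ ^ 2 - ‖f y‖ ^ 2)]
  have h3 : (‖f x‖ ^ 2 - D) * (b - a) ≤ ∫ t in Icc a b, ‖f t‖ ^ 2 := by
    have := setIntegral_mono_on (μ := volume) (s := Icc a b) (f := fun _ => ‖f x‖ ^ 2 - D)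
      (g := fun t => ‖f t‖ ^ 2) (by simp) i2 measurableSet_Icc hpt
    simpa [hab.le, mul_comm] using this
  have hba : 0 < b - a := by linarith
  have h4 : ‖f x‖ ^ 2 - D ≤ (1 / (b - a)) * ∫ t in Icc a b, ‖f t‖ ^ 2 := by
    rw [one_div, inv_mul_eq_div, le_div_iff₀ hba]; exact h3
  rw [hDdef] at h4
  linarith

/-! ### Coercive forms on Hilbert spaces -/

section Abstract

variable {H L : Type*} [NormedAddCommGroup H] [InnerProductSpace ℂ H] [CompleteSpace H]
  [NormedAddCommGroup L] [InnerProductSpace ℂ L] [CompleteSpace L]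

theorem denseRange_of_forall_inner_eq_zero {E : Type*} [NormedAddCommGroup E]
    [NormedSpace ℂ E] (M : E →L[ℂ] H) (h : ∀ x, (∀ y, ⟪x, M y⟫_ℂ = 0) → x = 0) :
    DenseRange M := by
  have h1 : (M.range)ᗮ = ⊥ := by
    rw [Submodule.eq_bot_iff]
    intro x hx
    refine h x fun y => ?_
    rw [Submodule.mem_orthogonal'] at hx
    exact hx (M y) ⟨y, rfl⟩
  have h2 := (Submodule.topologicalClosure_eq_top_iff (K := M.range)).2 h1
  exact (Submodule.dense_iff_topologicalClosure_eq_top.2 h2)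

theorem surjective_of_bounded_below {E : Type*} [NormedAddCommGroup E] [NormedSpace ℂ E]
    [CompleteSpace E] (M : E →L[ℂ] H) {c : ℝ} (hc : 0 < c) (hb : ∀ x, c * ‖x‖ ≤ ‖M x‖)
    (h : ∀ x, (∀ y, ⟪x, M y⟫_ℂ = 0) → x = 0) : Function.Bijective M := by
  have hanti : AntilipschitzWith (Real.toNNReal c⁻¹) M := by
    refine M.antilipschitz_of_bound fun x => ?_
    rw [Real.coe_toNNReal _ (by positivity), inv_mul_eq_div, le_div_iff₀ hc]
    linarith [hb x]
  refine ⟨hanti.injective, ?_⟩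
  rw [← range_eq_univ]
  have h1 := hanti.isClosed_range M.uniformContinuous
  rw [← h1.closure_eq]
  exact (denseRange_of_forall_inner_eq_zero M h).closure_range

/-- A symmetric operator which is bounded below is bijective. -/
theorem bijective_of_symmetric_of_bounded_below (M : H →L[ℂ] H)
    (hM : ∀ x y, ⟪M x, y⟫_ℂ = ⟪x, M y⟫_ℂ) {c : ℝ} (hc : 0 < c) (hb : ∀ x, c * ‖x‖ ≤ ‖M x‖) :
    Function.Bijective M := by
  refine surjective_of_bounded_below M hc hb fun x hx => ?_
  have h1 : M x = 0 := by
    rw [← inner_self_eq_zero (𝕜 := ℂ), hM]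
    exact hx (M x)
  have := hb x
  rw [h1, norm_zero] at this
  have h2 : ‖x‖ ≤ 0 := by
    by_contra hcon
    have := mul_pos hc (not_le.1 hcon)
    linarith
  exact norm_le_zero_iff.1 h2

theorem bounded_below_of_coercive {E : Type*} [NormedAddCommGroup E] [InnerProductSpace ℂ E]
    {A : E →L[ℂ] E} {a : ℝ} (h : ∀ f, a * ‖f‖ ^ 2 ≤ (⟪f, A f⟫_ℂ).re) (f : E) : a * ‖f‖ ≤ ‖A f‖ := by
  rcases eq_or_ne f 0 with rfl | hf
  · simp
  have h1 := (h f).trans ((Complex.re_le_norm _).trans (norm_inner_le_norm f (A f)))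
  have h2 : 0 < ‖f‖ := norm_pos_iff.2 hf
  by_contra hcon
  push Not at hcon
  nlinarith

/-- The inverse square root of the operator of a coercive form. If `t(f, g) = ⟪f, A g⟫` is a
coercive Hermitian form on `H` and `H` is densely and injectively included in `L` by `J`, then
`K = J ∘ U` for a suitable isomorphism `U` of `L` with `H` which carries the inner product of `L`
to `t`. -/
theorem exists_form_iso (J : H →L[ℂ] L) (hJ : Function.Injective J) (hd : DenseRange J)
    (A : H →L[ℂ] H) (hA : ∀ x y, ⟪A x, y⟫_ℂ = ⟪x, A y⟫_ℂ) {a : ℝ} (ha : 0 < a)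
    (hco : ∀ f, a * ‖f‖ ^ 2 ≤ (⟪f, A f⟫_ℂ).re) :
    ∃ U : L ≃L[ℂ] H, (∀ u v, ⟪U u, A (U v)⟫_ℂ = ⟪u, v⟫_ℂ) ∧ (J ∘L (U : L →L[ℂ] H)).IsPositive := by
  have hbij := bijective_of_symmetric_of_bounded_below A hA ha (bounded_below_of_coercive hco)
  let Ae : H ≃L[ℂ] H := ContinuousLinearEquiv.ofBijective A
    (LinearMap.ker_eq_bot.2 hbij.1) (LinearMap.range_eq_top.2 hbij.2)
  have hAe : ∀ x, A (Ae.symm x) = x := fun x => Ae.apply_symm_apply x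
  have hAe' : ∀ x, Ae.symm (A x) = x := fun x => Ae.symm_apply_apply x
  have hsymm : ∀ x y, ⟪Ae.symm x, y⟫_ℂ = ⟪x, Ae.symm y⟫_ℂ := fun x y => by
    conv_lhs => rw [← hAe y]
    rw [← hA, hAe]
  let F : L →L[ℂ] H := (Ae.symm : H →L[ℂ] H) ∘L J.adjoint
  have hF : ∀ u, A (F u) = J.adjoint u := fun u => hAe _
  let G : L →L[ℂ] L := J ∘L F
  have hG : ∀ u v, ⟪F u, A (F v)⟫_ℂ = ⟪G u, v⟫_ℂ := fun u v => by
    rw [hF, ContinuousLinearMap.adjoint_inner_right]; rfl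
  have hGsymm : ∀ u v, ⟪G u, v⟫_ℂ = ⟪u, G v⟫_ℂ := fun u v => by
    rw [← hG, ← hA, hF, ContinuousLinearMap.adjoint_inner_left]; rfl
  have hGpos : G.IsPositive := by
    rw [ContinuousLinearMap.isPositive_iff_complex]
    intro u
    have h1 := hco (F u)
    have h2 : (⟪F u, A (F u)⟫_ℂ).re = (⟪G u, u⟫_ℂ).re := by rw [hG]
    refine ⟨?_, ?_⟩
    · have := hGsymm u u
      rw [← inner_conj_symm u (G u)] at this
      exact (Complex.conj_eq_iff_real.1 this.symm).elim fun r hr => by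
        simp [hr]
    · change 0 ≤ (⟪G u, u⟫_ℂ).re
      rw [← h2]
      exact le_trans (by positivity) h1
  have hG0 : 0 ≤ G := (ContinuousLinearMap.nonneg_iff_isPositive G).2 hGpos
  let K : L →L[ℂ] L := CFC.sqrt G
  have hK0 : 0 ≤ K := CFC.sqrt_nonneg G
  have hKpos : K.IsPositive := (ContinuousLinearMap.nonneg_iff_isPositive K).1 hK0
  have hKK : ∀ u, K (K u) = G u := fun u => by
    have : K * K = G := CFC.sqrt_mul_sqrt_self G hG0
    rw [← this]; rfl
  have hKsymm : ∀ u v, ⟪K u, v⟫_ℂ = ⟪u, K v⟫_ℂ := fun u v => hKpos.isSymmetric u v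
  have hFK : ∀ u v, ⟪F u, A (F v)⟫_ℂ = ⟪K u, K v⟫_ℂ := fun u v => by
    rw [hG, ← hKK, hKsymm]
  have hnorm : ∀ u, ‖F u‖ ≤ Real.sqrt a⁻¹ * ‖K u‖ := fun u => by
    have h1 := hco (F u)
    rw [hFK, inner_self_eq_norm_sq_to_K] at h1
    have h2 : a * ‖F u‖ ^ 2 ≤ ‖K u‖ ^ 2 := by
      refine h1.trans_eq ?_
      norm_cast
    have h3 : ‖F u‖ ^ 2 ≤ a⁻¹ * ‖K u‖ ^ 2 := by
      rw [inv_mul_eq_div, le_div_iff₀ ha]; linarith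
    calc ‖F u‖ = Real.sqrt (‖F u‖ ^ 2) := (Real.sqrt_sq (norm_nonneg _)).symm
      _ ≤ Real.sqrt (a⁻¹ * ‖K u‖ ^ 2) := Real.sqrt_le_sqrt h3
      _ = _ := by rw [Real.sqrt_mul (by positivity), Real.sqrt_sq (norm_nonneg _)]
  have hadj : ∀ u, J.adjoint u = 0 → u = 0 := fun u hu => by
    refine hd.induction_on (p := fun v => ⟪v, u⟫_ℂ = 0) u ?_ ?_ |> inner_self_eq_zero.1
    · exact isClosed_eq (by fun_prop) continuous_const
    · intro f
      rw [← ContinuousLinearMap.adjoint_inner_right, hu, inner_zero_right]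
  have hKd : DenseRange K := denseRange_of_forall_inner_eq_zero K fun x hx => by
    have h1 : K x = 0 := by
      rw [← inner_self_eq_zero (𝕜 := ℂ), hKsymm]; exact hx (K x)
    have h2 : F x = 0 := by
      have := hnorm x
      rw [h1, norm_zero, mul_zero] at this
      exact norm_le_zero_iff.1 this
    apply hadj
    rw [← hF, h2, map_zero]
  let U : L →L[ℂ] H := (F : L →ₗ[ℂ] H).extendOfNorm (K : L →ₗ[ℂ] L)
  have hU : ∀ u, U (K u) = F u := fun u =>
    LinearMap.extendOfNorm_eq (f := (F : L →ₗ[ℂ] H)) (e := (K : L →ₗ[ℂ] L)) hKd ⟨_, hnorm⟩ u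
  have hUA : ∀ u v, ⟪U u, A (U v)⟫_ℂ = ⟪u, v⟫_ℂ := fun u v => by
    refine hKd.induction_on₂ (p := fun u v => ⟪U u, A (U v)⟫_ℂ = ⟪u, v⟫_ℂ) ?_ ?_ u v
    · exact isClosed_eq (by fun_prop) (by fun_prop)
    · intro x y; rw [hU, hU, hFK]
  have hJU : J ∘L U = K := by
    ext1 u
    refine hKd.induction_on (p := fun u => J (U u) = K u) u ?_ fun x => ?_
    · exact isClosed_eq (by fun_prop) (by fun_prop)
    · rw [hU, hKK]; rfl
  have hUbij : Function.Bijective U := by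
    have hbelow : ∀ x, (Real.sqrt (‖A‖ + 1))⁻¹ * ‖x‖ ≤ ‖U x‖ := fun x => by
      have h1 : ‖x‖ ^ 2 ≤ (‖A‖ + 1) * ‖U x‖ ^ 2 := by
        have h2 : (‖x‖ ^ 2 : ℝ) = (⟪U x, A (U x)⟫_ℂ).re := by
          rw [hUA, inner_self_eq_norm_sq_to_K]; norm_cast
        rw [h2]
        refine (Complex.re_le_norm _).trans ((norm_inner_le_norm _ _).trans ?_)
        have := A.le_opNorm (U x)
        nlinarith [norm_nonneg (U x)]
      have hs : 0 < Real.sqrt (‖A‖ + 1) := Real.sqrt_pos.2 (by positivity)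
      rw [inv_mul_eq_div, div_le_iff₀ hs]
      refine le_of_sq_le_sq ?_ (by positivity)
      rw [mul_pow, Real.sq_sqrt (by positivity)]
      linarith
    refine surjective_of_bounded_below U (by positivity) hbelow fun x hx => ?_
    have h1 : J (Ae.symm x) = 0 := by
      rw [← inner_self_eq_zero (𝕜 := ℂ), ← ContinuousLinearMap.adjoint_inner_right, hsymm]
      have := hx (K (J (Ae.symm x)))
      rwa [hU] at this
    have h2 : Ae.symm x = 0 := hJ (by rw [h1, map_zero])
    rw [← hAe x, h2, map_zero]
  refine ⟨ContinuousLinearEquiv.ofBijective U (LinearMap.ker_eq_bot.2 hUbij.1)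
    (LinearMap.range_eq_top.2 hUbij.2), hUA, ?_⟩
  have : (J ∘L ((ContinuousLinearEquiv.ofBijective U (LinearMap.ker_eq_bot.2 hUbij.1)
    (LinearMap.range_eq_top.2 hUbij.2) : L ≃L[ℂ] H) : L →L[ℂ] H)) = K := hJU
  rw [this]
  exact hKpos

/-- The graph of the operator of the form `⟪f, A g⟫` is that of `K⁻²`. -/
theorem form_graph_iff {H L : Type*} [NormedAddCommGroup H] [InnerProductSpace ℂ H]
    [NormedAddCommGroup L] [InnerProductSpace ℂ L] {J : H →L[ℂ] L} {A : H →L[ℂ] H} {U : L ≃L[ℂ] H}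
    (hU : ∀ u v, ⟪U u, A (U v)⟫_ℂ = ⟪u, v⟫_ℂ) (hK : (J ∘L (U : L →L[ℂ] H)).IsPositive) (u w : L) :
    (∃ F, J F = u ∧ ∀ g, ⟪g, A F⟫_ℂ = ⟪J g, w⟫_ℂ) ↔
      u = (J ∘L (U : L →L[ℂ] H)) ((J ∘L (U : L →L[ℂ] H)) w) := by
  have key : ∀ y, (∀ g, ⟪g, A (U y)⟫_ℂ = ⟪J g, w⟫_ℂ) ↔ y = (J ∘L (U : L →L[ℂ] H)) w := by
    intro y
    have h1 : ∀ x, ⟪J (U x), w⟫_ℂ = ⟪x, (J ∘L (U : L →L[ℂ] H)) w⟫_ℂ := fun x =>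
      hK.isSymmetric x w
    constructor
    · intro h
      refine ext_inner_left ℂ fun x => ?_
      rw [← hU, h, h1]
    · intro h g
      obtain ⟨x, rfl⟩ := U.surjective g
      rw [hU, h1, h]
  constructor
  · rintro ⟨F, rfl, hF⟩
    obtain ⟨y, rfl⟩ := U.surjective F
    rw [← (key y).1 hF]; rfl
  · intro h
    exact ⟨U ((J ∘L (U : L →L[ℂ] H)) w), h.symm, (key _).2 rfl⟩

/-- If the operator of a form satisfying a Gårding inequality is bounded below by `c`, then so is
the form: the operator domain is a form core. -/
theorem form_lower_bound (J : H →L[ℂ] L) (hJ : Function.Injective J)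
    (A : H →L[ℂ] H) (hA : ∀ x y, ⟪A x, y⟫_ℂ = ⟪x, A y⟫_ℂ) {a C c : ℝ} (ha : 0 < a)
    (hgard : ∀ f, a * ‖f‖ ^ 2 ≤ (⟪f, A f⟫_ℂ).re + C * ‖J f‖ ^ 2)
    (hlow : ∀ F w, (∀ g, ⟪g, A F⟫_ℂ = ⟪J g, w⟫_ℂ) → c * ‖J F‖ ^ 2 ≤ (⟪J F, w⟫_ℂ).re) (f : H) :
    c * ‖J f‖ ^ 2 ≤ (⟪f, A f⟫_ℂ).re := by
  let A' : H →L[ℂ] H := A + (C : ℂ) • (J.adjoint ∘L J)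
  have hA'e : ∀ x y, ⟪x, A' y⟫_ℂ = ⟪x, A y⟫_ℂ + C * ⟪J x, J y⟫_ℂ := fun x y => by
    simp [A', ContinuousLinearMap.adjoint_inner_right]
  have hA'e' : ∀ x y, ⟪A' x, y⟫_ℂ = ⟪A x, y⟫_ℂ + C * ⟪J x, J y⟫_ℂ := fun x y => by
    simp [A', ContinuousLinearMap.adjoint_inner_left]
  have hA'sym : ∀ x y, ⟪A' x, y⟫_ℂ = ⟪x, A' y⟫_ℂ := fun x y => by rw [hA'e, hA'e', hA]
  have hco : ∀ f, a * ‖f‖ ^ 2 ≤ (⟪f, A' f⟫_ℂ).re := fun f => by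
    rw [hA'e, inner_self_eq_norm_sq_to_K]
    refine (hgard f).trans_eq ?_
    rw [Complex.add_re]
    congr 1
    norm_cast
    rw [Complex.re_ofReal_mul]
    rfl
  have hbij := bijective_of_symmetric_of_bounded_below A' hA'sym ha (bounded_below_of_coercive hco)
  let Ae : H ≃L[ℂ] H := ContinuousLinearEquiv.ofBijective A'
    (LinearMap.ker_eq_bot.2 hbij.1) (LinearMap.range_eq_top.2 hbij.2)
  have hAe : ∀ x, A' (Ae.symm x) = x := fun x => Ae.apply_symm_apply x
  have hJd : DenseRange J.adjoint := denseRange_of_forall_inner_eq_zero _ fun x hx => by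
    apply hJ
    rw [map_zero, ← inner_self_eq_zero (𝕜 := ℂ), ← ContinuousLinearMap.adjoint_inner_right]
    exact hx _
  have hdense : DenseRange ((Ae.symm : H →L[ℂ] H) ∘L J.adjoint) := by
    have := Ae.symm.surjective.denseRange.comp hJd Ae.symm.continuous
    exact this
  refine hdense.induction_on (p := fun f => c * ‖J f‖ ^ 2 ≤ (⟪f, A f⟫_ℂ).re) f ?_ fun w => ?_
  · exact isClosed_le (by fun_prop) (by fun_prop)
  · set F := ((Ae.symm : H →L[ℂ] H) ∘L J.adjoint) w with hFdef
    have hF : ∀ g, ⟪g, A F⟫_ℂ = ⟪J g, w - (C : ℂ) • J F⟫_ℂ := fun g => by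
      have h1 : ⟪g, A' F⟫_ℂ = ⟪J g, w⟫_ℂ := by
        have : A' F = J.adjoint w := hAe _
        rw [this, ContinuousLinearMap.adjoint_inner_right]
      rw [hA'e] at h1
      rw [inner_sub_right, inner_smul_right, ← h1]; ring
    refine (hlow F _ hF).trans_eq ?_
    rw [← hF]

end Abstract

/-! ### Eigenvalues of compact pencils -/

section Pencil

open Module.End

variable {H : Type*} [NormedAddCommGroup H] [InnerProductSpace ℂ H]

/-- The span of the eigenvectors of `B` with real eigenvalue larger than `s`. -/
def upperSpace (B : H →L[ℂ] H) (s : ℝ) : Submodule ℂ H :=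
  ⨆ t : {t : ℝ // s < t}, eigenspace (B : Module.End ℂ H) ((t : ℝ) : ℂ)

theorem eigenspace_le_upperSpace (B : H →L[ℂ] H) {s t : ℝ} (h : s < t) :
    eigenspace (B : Module.End ℂ H) (t : ℂ) ≤ upperSpace B s :=
  le_iSup (fun t : {t : ℝ // s < t} => eigenspace (B : Module.End ℂ H) ((t : ℝ) : ℂ)) ⟨t, h⟩

theorem upperSpace_antitone (B : H →L[ℂ] H) {s t : ℝ} (h : s ≤ t) :
    upperSpace B t ≤ upperSpace B s :=
  iSup_le fun r => eigenspace_le_upperSpace B (h.trans_lt r.2)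

theorem lt_inner_of_mem_upperSpace {B : H →L[ℂ] H} (hB : (B : H →ₗ[ℂ] H).IsSymmetric) {s : ℝ}
    {u : H} (hu : u ∈ upperSpace B s) (hu0 : u ≠ 0) : s * ‖u‖ ^ 2 < (⟪u, B u⟫_ℂ).re := by
  classical
  have hof := hB.orthogonalFamily_eigenspaces
  have hof' : OrthogonalFamily ℂ (fun t : {t : ℝ // s < t} =>
      eigenspace (B : Module.End ℂ H) ((t : ℝ) : ℂ)) fun t => Submodule.subtypeₗᵢ _ :=
    hof.comp (γ := {t : ℝ // s < t}) (f := fun t => ((t : ℝ) : ℂ))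
      (fun a b hab => Subtype.ext (Complex.ofReal_injective hab))
  obtain ⟨l, hl⟩ := (Submodule.mem_iSup_iff_exists_dfinsupp' _ u).1 hu
  rw [DFinsupp.sum] at hl
  have e1 : ⟪u, B u⟫_ℂ = ∑ t ∈ l.support, (((t : ℝ) * ‖l t‖ ^ 2 : ℝ) : ℂ) := by
    have e2 : B u = ∑ t ∈ l.support, ((((t : ℝ) : ℂ) • l t :
        eigenspace (B : Module.End ℂ H) ((t : ℝ) : ℂ)) : H) := by
      rw [← hl, map_sum]
      exact Finset.sum_congr rfl fun t _ => (mem_eigenspace_iff.1 (l t).2)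
    rw [e2]
    conv_lhs => rw [← hl]
    have := hof'.inner_sum (fun t => l t) (fun t => ((t : ℝ) : ℂ) • l t) l.support
    refine this.trans ?_
    refine Finset.sum_congr rfl fun t _ => ?_
    rw [inner_smul_right, inner_self_eq_norm_sq_to_K]
    push_cast; rfl
  have e3 : ‖u‖ ^ 2 = ∑ t ∈ l.support, ‖l t‖ ^ 2 := by
    rw [← hl]
    exact hof'.norm_sum (fun t => l t) l.support
  rw [e1, e3, ← Complex.ofReal_sum, Complex.ofReal_re, Finset.mul_sum]
  have hne : l.support.Nonempty := by
    rw [Finset.nonempty_iff_ne_empty]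
    intro h
    rw [h, Finset.sum_empty] at hl
    exact hu0 hl.symm
  refine Finset.sum_lt_sum_of_nonempty hne fun t ht => ?_
  have h1 : 0 < ‖l t‖ := norm_pos_iff.2 (DFinsupp.mem_support_iff.1 ht)
  have h2 := t.2
  have : 0 < ‖l t‖ ^ 2 := by positivity
  exact mul_lt_mul_of_pos_right h2 this

theorem map_mem_upperSpace (B : H →L[ℂ] H) {s : ℝ} {u : H} (hu : u ∈ upperSpace B s) :
    B u ∈ upperSpace B s := by
  refine Submodule.iSup_induction _ (motive := fun u => B u ∈ upperSpace B s) hu ?_ ?_ ?_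
  · intro t x hx
    have := mem_eigenspace_iff.1 hx
    change (B : Module.End ℂ H) x ∈ _
    rw [this]
    exact Submodule.smul_mem _ _ (eigenspace_le_upperSpace B t.2 hx)
  · rw [map_zero]; exact Submodule.zero_mem _
  · intro x y hx hy
    rw [map_add]; exact Submodule.add_mem _ hx hy

/-- The quadratic form of `R` is at most `s` times that of `A` on a subspace of codimension at
most `n`. -/
def PencilBound (R A : H →L[ℂ] H) (n : ℕ) (s : ℝ) : Prop :=
  ∃ v : Fin n → H, ∀ f, (∀ i, ⟪v i, f⟫_ℂ = 0) → (⟪f, R f⟫_ℂ).re ≤ s * (⟪f, A f⟫_ℂ).re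

theorem finrank_le_of_pencilBound_one {B : H →L[ℂ] H} (hB : (B : H →ₗ[ℂ] H).IsSymmetric) {s : ℝ}
    {n : ℕ} (h : PencilBound B 1 n s) :
    FiniteDimensional ℂ (upperSpace B s) ∧ Module.finrank ℂ (upperSpace B s) ≤ n := by
  obtain ⟨v, hv⟩ := h
  let T : upperSpace B s →ₗ[ℂ] (Fin n → ℂ) :=
    LinearMap.pi fun i => (innerₛₗ ℂ (v i)) ∘ₗ (upperSpace B s).subtype
  have hT : Function.Injective T := by
    rw [injective_iff_map_eq_zero]
    intro f hf
    by_contra h0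
    have h1 := hv f fun i => congrFun hf i
    have h2 := lt_inner_of_mem_upperSpace hB f.2 (fun h => h0 (Subtype.ext h))
    rw [one_apply_eq_self, inner_self_eq_norm_sq_to_K] at h1
    norm_cast at h1
    exact absurd h2 (not_lt.2 h1)
  have := FiniteDimensional.of_injective T hT
  refine ⟨this, ?_⟩
  have := LinearMap.finrank_le_finrank_of_injective hT
  simpa using this

/-- The `n`-th largest eigenvalue of the pencil `R f = λ A f`, by the min-max principle. -/
def bandValue (R A : H →L[ℂ] H) (n : ℕ) : ℝ := sInf {s : ℝ | 0 ≤ s ∧ PencilBound R A n s}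

theorem bandValue_nonneg (R A : H →L[ℂ] H) (n : ℕ) : 0 ≤ bandValue R A n :=
  Real.sInf_nonneg fun _ hs => hs.1

theorem bandValue_le {R A : H →L[ℂ] H} {n : ℕ} {s : ℝ} (hs : 0 ≤ s) (h : PencilBound R A n s) :
    bandValue R A n ≤ s := csInf_le ⟨0, fun _ hs => hs.1⟩ ⟨hs, h⟩

theorem PencilBound.mono {R A : H →L[ℂ] H} {n : ℕ} {s t : ℝ} (hA : ∀ f, 0 ≤ (⟪f, A f⟫_ℂ).re)
    (h : PencilBound R A n s) (hst : s ≤ t) : PencilBound R A n t := by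
  obtain ⟨v, hv⟩ := h
  exact ⟨v, fun f hf => (hv f hf).trans (mul_le_mul_of_nonneg_right hst (hA f))⟩

theorem pencilBound_of_coercive (R : H →L[ℂ] H) {A : H →L[ℂ] H} {a : ℝ} (ha : 0 < a)
    (hA : ∀ f, a * ‖f‖ ^ 2 ≤ (⟪f, A f⟫_ℂ).re) (n : ℕ) : PencilBound R A n (‖R‖ / a) := by
  refine ⟨0, fun f _ => ?_⟩
  refine (Complex.re_le_norm _).trans ((norm_inner_le_norm _ _).trans ?_)
  have h1 := R.le_opNorm f
  have h2 : ‖R‖ / a * (a * ‖f‖ ^ 2) ≤ ‖R‖ / a * (⟪f, A f⟫_ℂ).re :=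
    mul_le_mul_of_nonneg_left (hA f) (by positivity)
  have h3 : ‖R‖ / a * (a * ‖f‖ ^ 2) = ‖R‖ * ‖f‖ ^ 2 := by field_simp
  nlinarith [norm_nonneg f]

theorem PencilBound.of_bandValue_lt {R A : H →L[ℂ] H} {a : ℝ} (ha : 0 < a)
    (hA : ∀ f, a * ‖f‖ ^ 2 ≤ (⟪f, A f⟫_ℂ).re) {n : ℕ} {s : ℝ} (h : bandValue R A n < s) :
    PencilBound R A n s := by
  obtain ⟨t, ht, hts⟩ := exists_lt_of_csInf_lt
    (s := {s : ℝ | 0 ≤ s ∧ PencilBound R A n s})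
    ⟨‖R‖ / a, by positivity, pencilBound_of_coercive R ha hA n⟩ h
  exact ht.2.mono (fun f => le_trans (by positivity) (hA f)) hts.le

theorem one_coercive (f : H) : 1 * ‖f‖ ^ 2 ≤ (⟪f, (1 : H →L[ℂ] H) f⟫_ℂ).re := by
  rw [one_apply_eq_self, inner_self_eq_norm_sq_to_K, one_mul]
  norm_cast

variable [CompleteSpace H]

theorem finiteDimensional_upperSpace {B : H →L[ℂ] H} (hc : IsCompactOperator B)
    (hB : (B : H →ₗ[ℂ] H).IsSymmetric) {s : ℝ} (hs : 0 < s) :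
    FiniteDimensional ℂ (upperSpace B s) := by
  set W := (upperSpace B s).topologicalClosure with hW
  have hinv : ∀ v ∈ W, B v ∈ W := by
    intro v hv
    have h1 : B v ∈ closure (B '' (upperSpace B s : Set H)) :=
      image_closure_subset_closure_image B.continuous ⟨v, hv, rfl⟩
    refine closure_mono ?_ h1
    rintro _ ⟨u, hu, rfl⟩
    exact map_mem_upperSpace B hu
  have : CompleteSpace W := (upperSpace B s).isClosed_topologicalClosure.completeSpace_coe
  have hlow : ∀ v ∈ W, s * ‖v‖ ^ 2 ≤ (⟪v, B v⟫_ℂ).re := by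
    intro v hv
    have hcl : IsClosed {v : H | s * ‖v‖ ^ 2 ≤ (⟪v, B v⟫_ℂ).re} :=
      isClosed_le (by fun_prop) (by fun_prop)
    refine closure_minimal ?_ hcl hv
    intro u hu
    rcases eq_or_ne u 0 with rfl | h0
    · simp
    · exact (lt_inner_of_mem_upperSpace hB hu h0).le
  let S : W →L[ℂ] W := B.restrict hinv
  have hSc : IsCompactOperator S := hc.restrict' hinv
  have hbij := bijective_of_symmetric_of_bounded_below S (fun x y => hB x y) hs
    (bounded_below_of_coercive fun f => hlow f f.2)
  let Se : W ≃L[ℂ] W := ContinuousLinearEquiv.ofBijective S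
    (LinearMap.ker_eq_bot.2 hbij.1) (LinearMap.range_eq_top.2 hbij.2)
  have hid : IsCompactOperator (id : W → W) := by
    have h1 := hSc.clm_comp (Se.symm : W →L[ℂ] W)
    have h2 : (id : W → W) = (Se.symm : W →L[ℂ] W) ∘ S :=
      funext fun x => (Se.symm_apply_apply x).symm
    rw [h2]
    exact h1
  have hfd : FiniteDimensional ℂ W := FiniteDimensional.of_isCompactOperator_id (𝕜 := ℂ) hid
  exact Submodule.finiteDimensional_of_le (Submodule.le_topologicalClosure _)

/-- The largest eigenvalue of a compact symmetric operator bounds its quadratic form. -/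
theorem inner_le_of_hasEigenvalue_le {S : H →L[ℂ] H} (hc : IsCompactOperator S)
    (hS : (S : H →ₗ[ℂ] H).IsSymmetric) {s : ℝ} (hs : 0 ≤ s)
    (h : ∀ t : ℝ, HasEigenvalue (S : Module.End ℂ H) (t : ℂ) → t ≤ s) (u : H) :
    (⟪u, S u⟫_ℂ).re ≤ s * ‖u‖ ^ 2 := by
  have hSs : IsSelfAdjoint S := ContinuousLinearMap.isSelfAdjoint_iff_isSymmetric.2 hS
  have hsa : IsSelfAdjoint ((s : ℂ) • (1 : H →L[ℂ] H) - S) := by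
    refine IsSelfAdjoint.sub ?_ hSs
    rw [ContinuousLinearMap.isSelfAdjoint_iff_isSymmetric]
    intro x y
    simp only [ContinuousLinearMap.coe_coe, smul_apply, one_apply_eq_self,
      inner_smul_left, inner_smul_right, Complex.conj_ofReal]
  have hpos : 0 ≤ ((s : ℂ) • (1 : H →L[ℂ] H) - S) := by
    rw [StarOrderedRing.nonneg_iff_spectrum_nonneg (R := ℝ) _ hsa]
    intro x hx
    by_contra hneg
    push Not at hneg
    have h1 : (x : ℂ) ∈ spectrum ℂ ((s : ℂ) • (1 : H →L[ℂ] H) - S) :=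
      spectrum.algebraMap_mem ℂ hx
    have h2 : ((s - x : ℝ) : ℂ) ∈ spectrum ℂ S := by
      have h3 : (s : ℂ) • (1 : H →L[ℂ] H) = algebraMap ℂ (H →L[ℂ] H) (s : ℂ) :=
        (Algebra.algebraMap_eq_smul_one _).symm
      rw [h3, ← spectrum.singleton_sub_eq, Set.mem_sub] at h1
      obtain ⟨a, ha, b, hb, hab⟩ := h1
      rw [mem_singleton_iff] at ha
      subst ha
      have : b = ((s - x : ℝ) : ℂ) := by
        push_cast; rw [← hab]; ring
      rwa [← this]
    have h3 : ((s - x : ℝ) : ℂ) ≠ 0 := by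
      rw [Ne, Complex.ofReal_eq_zero]; linarith
    have := h _ ((hc.hasEigenvalue_iff_mem_spectrum h3).2 h2)
    linarith
  have h := ((ContinuousLinearMap.nonneg_iff_isPositive _).1 hpos).re_inner_nonneg_right u
  have e : (⟪u, ((s : ℂ) • (1 : H →L[ℂ] H) - S) u⟫_ℂ).re =
      s * ‖u‖ ^ 2 - (⟪u, S u⟫_ℂ).re := by
    have : ⟪u, ((s : ℂ) • (1 : H →L[ℂ] H) - S) u⟫_ℂ = s * ⟪u, u⟫_ℂ - ⟪u, S u⟫_ℂ := by
      rw [← inner_smul_right, ← inner_sub_right]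
      rfl
    rw [this, inner_self_eq_norm_sq_to_K, Complex.sub_re, Complex.re_ofReal_mul]
    norm_cast
  change 0 ≤ (⟪u, ((s : ℂ) • (1 : H →L[ℂ] H) - S) u⟫_ℂ).re at h
  rw [e] at h
  linarith

theorem inner_le_of_orthogonal_upperSpace {B : H →L[ℂ] H} (hc : IsCompactOperator B)
    (hB : (B : H →ₗ[ℂ] H).IsSymmetric) {s : ℝ} (hs : 0 ≤ s) {u : H}
    (hu : u ∈ (upperSpace B s)ᗮ) : (⟪u, B u⟫_ℂ).re ≤ s * ‖u‖ ^ 2 := by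
  have hinv : ∀ v ∈ (upperSpace B s)ᗮ, B v ∈ (upperSpace B s)ᗮ := by
    intro v hv
    rw [Submodule.mem_orthogonal] at hv ⊢
    intro w hw
    have := hB w v
    rw [← ContinuousLinearMap.coe_coe B, ← this]
    exact hv _ (map_mem_upperSpace B hw)
  let S := B.restrict hinv
  have hSc : IsCompactOperator S := hc.restrict' hinv
  refine inner_le_of_hasEigenvalue_le (S := S) hSc (fun x y => hB x y) hs (fun t ht => ?_) ⟨u, hu⟩
  by_contra hneg
  push Not at hneg
  obtain ⟨v, hv⟩ := ht.exists_hasEigenvector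
  have hv1 : B v = (t : ℂ) • (v : H) := congrArg Subtype.val hv.apply_eq_smul
  have hv2 : (v : H) ∈ upperSpace B s :=
    eigenspace_le_upperSpace B hneg (mem_eigenspace_iff.2 hv1)
  have hv3 : ⟪(v : H), v⟫_ℂ = 0 := (Submodule.mem_orthogonal _ _).1 v.2 _ hv2
  exact hv.2 (Subtype.ext (inner_self_eq_zero.1 hv3))

theorem pencilBound_one_of_finrank_le {B : H →L[ℂ] H} (hc : IsCompactOperator B)
    (hB : (B : H →ₗ[ℂ] H).IsSymmetric) {s : ℝ} (hs : 0 ≤ s) {n : ℕ}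
    (hfd : FiniteDimensional ℂ (upperSpace B s))
    (hn : Module.finrank ℂ (upperSpace B s) ≤ n) : PencilBound B 1 n s := by
  let b := Module.finBasis ℂ (upperSpace B s)
  refine ⟨fun i => if h : (i : ℕ) < Module.finrank ℂ (upperSpace B s) then b ⟨i, h⟩ else 0,
    fun f hf => ?_⟩
  have h1 : f ∈ (upperSpace B s)ᗮ := by
    rw [Submodule.mem_orthogonal]
    intro w hw
    have h2 := b.sum_repr ⟨w, hw⟩
    have h3 : w = ∑ i, b.repr ⟨w, hw⟩ i • (b i : H) := by
      have := congrArg (upperSpace B s).subtype h2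
      rw [map_sum] at this
      exact this.symm
    rw [h3, sum_inner]
    refine Finset.sum_eq_zero fun i _ => ?_
    have := hf ⟨i, i.2.trans_le hn⟩
    simp only [i.2, dite_true] at this
    rw [inner_smul_left, this, mul_zero]
  have h2 := inner_le_of_orthogonal_upperSpace hc hB hs h1
  refine h2.trans_eq ?_
  rw [one_apply_eq_self, inner_self_eq_norm_sq_to_K]
  norm_cast

theorem hasEigenvalue_bandValue {B : H →L[ℂ] H} (hc : IsCompactOperator B)
    (hB : (B : H →ₗ[ℂ] H).IsSymmetric) {n : ℕ} (h : 0 < bandValue B 1 n) :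
    HasEigenvalue (B : Module.End ℂ H) (bandValue B 1 n : ℂ) := by
  set l := bandValue B 1 n with hl
  by_contra hne
  have h0 : (l : ℂ) ≠ 0 := by rw [Ne, Complex.ofReal_eq_zero]; exact h.ne'
  have h1 : (l : ℂ) ∉ spectrum ℂ B := fun h1 =>
    hne ((hc.hasEigenvalue_iff_mem_spectrum h0).2 h1)
  have h2 : IsOpen (spectrum ℂ B)ᶜ := (spectrum.isClosed B).isOpen_compl
  obtain ⟨δ, hδ, hball⟩ := Metric.isOpen_iff.1 h2 _ h1
  set η := min (δ / 2) (l / 2) with hη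
  have hη0 : 0 < η := lt_min (by linarith) (by linarith)
  have hηδ : η < δ := (min_le_left _ _).trans_lt (by linarith)
  have hηl : η ≤ l / 2 := min_le_right _ _
  have hsub : upperSpace B (l - η) ≤ upperSpace B (l + η) := by
    refine iSup_le fun t => ?_
    rcases lt_or_ge (l + η) (t : ℝ) with ht | ht
    · exact eigenspace_le_upperSpace B ht
    · have htδ : ((t : ℝ) : ℂ) ∈ Metric.ball (l : ℂ) δ := by
        rw [Metric.mem_ball, Complex.dist_eq, ← Complex.ofReal_sub, Complex.norm_real,
          Real.norm_eq_abs, abs_lt]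
        exact ⟨by linarith [t.2], by linarith⟩
      have hns := hball htδ
      have ht0 : ((t : ℝ) : ℂ) ≠ 0 := by
        rw [Ne, Complex.ofReal_eq_zero]
        linarith [t.2]
      have : eigenspace (B : Module.End ℂ H) ((t : ℝ) : ℂ) = ⊥ := by
        by_contra hcon
        exact hns ((hc.hasEigenvalue_iff_mem_spectrum ht0).1 (hasEigenvalue_iff.2 hcon))
      rw [this]
      exact bot_le
  have h3 := PencilBound.of_bandValue_lt one_pos one_coercive
    (show bandValue B 1 n < l + η by rw [← hl]; linarith)
  obtain ⟨h4, h5⟩ := finrank_le_of_pencilBound_one hB h3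
  have h6 : FiniteDimensional ℂ (upperSpace B (l - η)) := Submodule.finiteDimensional_of_le hsub
  have h7 := (Submodule.finrank_mono hsub).trans h5
  have h8 := bandValue_le (by linarith)
    (pencilBound_one_of_finrank_le hc hB (by linarith) h6 h7)
  rw [← hl] at h8
  linarith

theorem exists_bandValue_eq {B : H →L[ℂ] H} (hc : IsCompactOperator B)
    (hB : (B : H →ₗ[ℂ] H).IsSymmetric) {l : ℝ} (hl : 0 < l)
    (h : HasEigenvalue (B : Module.End ℂ H) (l : ℂ)) : ∃ n, bandValue B 1 n = l := by
  have hfd := finiteDimensional_upperSpace hc hB hl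
  refine ⟨Module.finrank ℂ (upperSpace B l), le_antisymm
    (bandValue_le hl.le (pencilBound_one_of_finrank_le hc hB hl.le hfd le_rfl)) ?_⟩
  by_contra hlt
  push Not at hlt
  obtain ⟨s, hs1, hs2⟩ := exists_between hlt
  obtain ⟨h1, h2⟩ := finrank_le_of_pencilBound_one hB
    (PencilBound.of_bandValue_lt one_pos one_coercive hs1)
  have h3 := Submodule.eq_of_le_of_finrank_le (upperSpace_antitone B hs2.le) h2
  obtain ⟨v, hv⟩ := h.exists_hasEigenvector
  have hv1 : v ∈ upperSpace B l := by
    rw [h3]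
    exact eigenspace_le_upperSpace B hs2 hv.1
  have h4 := lt_inner_of_mem_upperSpace hB hv1 hv.2
  have h5 : B v = (l : ℂ) • v := hv.apply_eq_smul
  rw [h5, inner_smul_right, inner_self_eq_norm_sq_to_K, Complex.re_ofReal_mul] at h4
  norm_cast at h4
  exact lt_irrefl _ h4

theorem exists_bandValue_le {B : H →L[ℂ] H} (hc : IsCompactOperator B)
    (hB : (B : H →ₗ[ℂ] H).IsSymmetric) {ε : ℝ} (hε : 0 < ε) : ∃ n, bandValue B 1 n ≤ ε :=
  ⟨_, bandValue_le hε.le (pencilBound_one_of_finrank_le hc hB hε.le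
    (finiteDimensional_upperSpace hc hB hε) le_rfl)⟩

/-- A vanishing min-max value is attained: the form is nonpositive on a subspace of finite
codimension. -/
theorem pencilBound_zero_of_bandValue_eq_zero {B : H →L[ℂ] H} (hc : IsCompactOperator B)
    (hB : (B : H →ₗ[ℂ] H).IsSymmetric) {n : ℕ} (h : bandValue B 1 n = 0) :
    PencilBound B 1 n 0 := by
  classical
  have h1 : ∀ s : ℝ, 0 < s → FiniteDimensional ℂ (upperSpace B s) ∧
      Module.finrank ℂ (upperSpace B s) ≤ n := fun s hs =>
    finrank_le_of_pencilBound_one hB (PencilBound.of_bandValue_lt one_pos one_coercive (by rwa [h]))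
  -- the dimension of the upper space is bounded, so it stabilizes as `s` tends to `0`
  let P : ℕ → Prop := fun k => ∃ s : ℝ, 0 < s ∧ Module.finrank ℂ (upperSpace B s) = k
  obtain ⟨s₀, hs₀, hk⟩ : P (Nat.findGreatest P n) :=
    Nat.findGreatest_spec (P := P) (h1 1 one_pos).2 ⟨1, one_pos, rfl⟩
  have hstab : upperSpace B 0 ≤ upperSpace B s₀ := by
    refine iSup_le fun t => ?_
    have ht := t.2
    set s := min s₀ ((t : ℝ) / 2) with hs
    have hs0 : 0 < s := lt_min hs₀ (by linarith)
    have := (h1 s hs0).1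
    have hle : Module.finrank ℂ (upperSpace B s) ≤ Module.finrank ℂ (upperSpace B s₀) := by
      rw [hk]
      exact Nat.le_findGreatest (h1 s hs0).2 ⟨s, hs0, rfl⟩
    rw [Submodule.eq_of_le_of_finrank_le (upperSpace_antitone B (min_le_left _ _)) hle]
    exact eigenspace_le_upperSpace B ((min_le_right _ _).trans_lt (by linarith))
  have := (h1 s₀ hs₀).1
  exact pencilBound_one_of_finrank_le hc hB le_rfl (Submodule.finiteDimensional_of_le hstab)
    ((Submodule.finrank_mono hstab).trans (h1 s₀ hs₀).2)

variable {R : H →L[ℂ] H}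

/-- Reduction of a pencil to a compact operator by means of the square root of `A`. -/
theorem exists_reduction (hRc : IsCompactOperator R) (hR : (R : H →ₗ[ℂ] H).IsSymmetric)
    {A : H →L[ℂ] H} (hA : (A : H →ₗ[ℂ] H).IsSymmetric) {a : ℝ} (ha : 0 < a)
    (hco : ∀ f, a * ‖f‖ ^ 2 ≤ (⟪f, A f⟫_ℂ).re) :
    ∃ B : H →L[ℂ] H, IsCompactOperator B ∧ (B : H →ₗ[ℂ] H).IsSymmetric ∧
      (∀ n s, PencilBound R A n s ↔ PencilBound B 1 n s) ∧
      ∀ l : ℂ, HasEigenvalue (B : Module.End ℂ H) l ↔ ∃ f, f ≠ 0 ∧ R f = l • A f := by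
  obtain ⟨U, hU, -⟩ := exists_form_iso (ContinuousLinearMap.id ℂ H) Function.injective_id
    Function.surjective_id.denseRange A hA ha hco
  let B : H →L[ℂ] H := (U : H →L[ℂ] H).adjoint ∘L R ∘L (U : H →L[ℂ] H)
  have hB : ∀ u v, ⟪u, B v⟫_ℂ = ⟪U u, R (U v)⟫_ℂ := fun u v => by
    simp only [B, ContinuousLinearMap.comp_apply, ContinuousLinearMap.adjoint_inner_right]
    rfl
  have hB' : ∀ u v, ⟪B u, v⟫_ℂ = ⟪R (U u), U v⟫_ℂ := fun u v => by
    simp only [B, ContinuousLinearMap.comp_apply, ContinuousLinearMap.adjoint_inner_left]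
    rfl
  refine ⟨B, ?_, fun u v => ?_, fun n s => ⟨?_, ?_⟩, fun l => ?_⟩
  · exact (hRc.comp_clm (U : H →L[ℂ] H)).clm_comp (U : H →L[ℂ] H).adjoint
  · change ⟪B u, v⟫_ℂ = ⟪u, B v⟫_ℂ
    rw [hB, hB']
    exact hR _ _
  · rintro ⟨v, hv⟩
    refine ⟨fun i => (U : H →L[ℂ] H).adjoint (v i), fun f hf => ?_⟩
    have e := hU f f
    rw [hB, one_apply_eq_self, ← e]
    refine hv _ fun i => ?_
    rw [← hf i, ContinuousLinearMap.adjoint_inner_left]; rfl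
  · rintro ⟨v, hv⟩
    refine ⟨fun i => (U.symm : H →L[ℂ] H).adjoint (v i), fun f hf => ?_⟩
    obtain ⟨g, rfl⟩ := U.surjective f
    rw [hU, ← hB]
    refine hv _ fun i => ?_
    rw [← hf i, ContinuousLinearMap.adjoint_inner_left]
    congr 1
    exact (U.symm_apply_apply g).symm
  · have key : ∀ f, B f = l • f ↔ R (U f) = l • A (U f) := fun f => by
      constructor
      · intro h
        refine ext_inner_left ℂ fun y => ?_
        obtain ⟨x, rfl⟩ := U.surjective y
        rw [← hB, h, inner_smul_right, inner_smul_right, hU]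
      · intro h
        refine ext_inner_left ℂ fun x => ?_
        rw [hB, h, inner_smul_right, inner_smul_right, hU]
    constructor
    · intro h
      obtain ⟨v, hv⟩ := h.exists_hasEigenvector
      exact ⟨U v, fun h0 => hv.2 (U.injective (by rw [h0, map_zero])), (key v).1 hv.apply_eq_smul⟩
    · rintro ⟨f, hf, h⟩
      obtain ⟨v, rfl⟩ := U.surjective f
      refine hasEigenvalue_of_hasEigenvector (x := v) ⟨mem_eigenspace_iff.2 ((key v).2 h), ?_⟩
      rintro rfl
      exact hf (map_zero _)

/-- The band structure of a continuous family of pencils `R f = λ A(κ) f`: the positive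
eigenvalues fill nondegenerate compact intervals, the ranges of the min-max values. -/
theorem exists_bands (hRc : IsCompactOperator R) (hR : (R : H →ₗ[ℂ] H).IsSymmetric)
    {A : ℝ → H →L[ℂ] H} {T : ℝ} (hT : 0 ≤ T) (hcont : Continuous A)
    (hA : ∀ k, (A k : H →ₗ[ℂ] H).IsSymmetric) {a : ℝ} (ha : 0 < a)
    (hco : ∀ k ∈ Icc 0 T, ∀ f, a * ‖f‖ ^ 2 ≤ (⟪f, A k f⟫_ℂ).re)
    (hflat : ∀ l : ℝ, 0 < l → ∃ k ∈ Icc 0 T, ∀ f, R f = (l : ℂ) • A k f → f = 0) :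
    ∃ 𝓘 : Set (ℝ × ℝ), (∀ p ∈ 𝓘, 0 < p.1 ∧ p.1 < p.2) ∧
      (∀ ε : ℝ, 0 < ε → {p ∈ 𝓘 | ε ≤ p.2}.Finite) ∧
      ∀ l : ℝ, 0 < l → ((∃ p ∈ 𝓘, l ∈ Icc p.1 p.2) ↔
        ∃ k ∈ Icc 0 T, ∃ f, f ≠ 0 ∧ R f = (l : ℂ) • A k f) := by
  have hpos : ∀ k ∈ Icc 0 T, ∀ f, 0 ≤ (⟪f, A k f⟫_ℂ).re := fun k hk f =>
    le_trans (by positivity) (hco k hk f)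
  have hred := fun k (hk : k ∈ Icc 0 T) => exists_reduction hRc hR (hA k) ha (hco k hk)
  have hbv : ∀ k (B : H →L[ℂ] H), (∀ n s, PencilBound R (A k) n s ↔ PencilBound B 1 n s) →
      ∀ n, bandValue R (A k) n = bandValue B 1 n := fun k B h n => by
    unfold bandValue
    simp only [h]
  set Λ := ‖R‖ / a with hΛ
  have hΛ0 : 0 ≤ Λ := by positivity
  have hle : ∀ n, ∀ k ∈ Icc 0 T, bandValue R (A k) n ≤ Λ := fun n k hk =>
    bandValue_le hΛ0 (pencilBound_of_coercive R ha (hco k hk) n)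
  -- Lipschitz dependence of the min-max values on the operator `A`
  have hlip : ∀ n, ∀ k ∈ Icc 0 T, ∀ k' ∈ Icc 0 T,
      bandValue R (A k') n ≤ bandValue R (A k) n + Λ * (‖A k - A k'‖ / a) := by
    intro n k hk k' hk'
    set d := ‖A k - A k'‖ / a with hd
    have hd0 : 0 ≤ d := by positivity
    have h1 : ∀ s, bandValue R (A k) n < s → bandValue R (A k') n ≤ s * (1 + d) := by
      intro s hs
      have hs0 : 0 ≤ s := (bandValue_nonneg _ _ _).trans hs.le
      obtain ⟨v, hv⟩ := PencilBound.of_bandValue_lt ha (hco k hk) hs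
      refine bandValue_le (by positivity) ⟨v, fun f hf => (hv f hf).trans ?_⟩
      rw [mul_assoc]
      refine mul_le_mul_of_nonneg_left ?_ hs0
      have h2 : (⟪f, A k f⟫_ℂ).re = (⟪f, A k' f⟫_ℂ).re + (⟪f, (A k - A k') f⟫_ℂ).re := by
        rw [sub_apply, inner_sub_right, Complex.sub_re]; ring
      have h3 : (⟪f, (A k - A k') f⟫_ℂ).re ≤ ‖A k - A k'‖ * ‖f‖ ^ 2 := by
        refine (Complex.re_le_norm _).trans ((norm_inner_le_norm _ _).trans ?_)
        have := (A k - A k').le_opNorm f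
        nlinarith [norm_nonneg f]
      have h4 : ‖A k - A k'‖ * ‖f‖ ^ 2 = d * (a * ‖f‖ ^ 2) := by rw [hd]; field_simp
      have h5 := mul_le_mul_of_nonneg_left (hco k' hk' f) hd0
      linarith
    have h2 : bandValue R (A k') n ≤ bandValue R (A k) n * (1 + d) := by
      refine le_of_forall_pos_le_add fun ε hε => ?_
      have := h1 (bandValue R (A k) n + ε / (1 + d))
        (by linarith [show 0 < ε / (1 + d) by positivity])
      rw [add_mul, div_mul_cancel₀ _ (by positivity)] at this
      exact this
    have h3 := mul_le_mul_of_nonneg_right (hle n k hk) hd0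
    linarith
  have hbc : ∀ n, ContinuousOn (fun k => bandValue R (A k) n) (Icc 0 T) := by
    intro n k hk
    have h1 : Tendsto (fun k' => Λ * (‖A k - A k'‖ / a)) (𝓝[Icc 0 T] k) (𝓝 0) := by
      have : Continuous fun k' => Λ * (‖A k - A k'‖ / a) := by fun_prop
      have h2 := (this.tendsto k).mono_left (nhdsWithin_le_nhds (s := Icc 0 T))
      simpa using h2
    rw [ContinuousWithinAt, tendsto_iff_norm_sub_tendsto_zero]
    refine squeeze_zero' (Eventually.of_forall fun _ => norm_nonneg _) ?_ h1
    filter_upwards [self_mem_nhdsWithin] with k' hk'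
    rw [Real.norm_eq_abs, abs_le]
    have h3 := hlip n k hk k' hk'
    have h4 := hlip n k' hk' k hk
    rw [norm_sub_rev] at h4
    constructor <;> linarith
  have hanti : ∀ k ∈ Icc 0 T, ∀ m n, m ≤ n → bandValue R (A k) n ≤ bandValue R (A k) m := by
    intro k hk m n hmn
    refine le_of_forall_pos_le_add fun ε hε => ?_
    obtain ⟨v, hv⟩ := PencilBound.of_bandValue_lt (n := m) (R := R) ha (hco k hk)
      (lt_add_of_pos_right _ hε)
    refine bandValue_le (by linarith [bandValue_nonneg R (A k) m])
      ⟨fun i => if h : (i : ℕ) < m then v ⟨i, h⟩ else 0, fun f hf => hv f fun i => ?_⟩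
    have := hf ⟨i, i.2.trans_le hmn⟩
    simpa [i.2] using this
  have hsmall : ∀ ε : ℝ, 0 < ε → ∃ N, ∀ k ∈ Icc 0 T, ∀ n, N ≤ n → bandValue R (A k) n < ε := by
    intro ε hε
    have h1 : ∃ N, ∀ k ∈ Icc 0 T, bandValue R (A k) N < ε := by
      refine isCompact_Icc.induction_on (p := fun s => ∃ N, ∀ k ∈ Icc 0 T ∩ s,
        bandValue R (A k) N < ε) ⟨0, by simp⟩ ?_ ?_ ?_ |>
        fun ⟨N, hN⟩ => ⟨N, fun k hk => hN k ⟨hk, hk⟩⟩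
      · rintro s t hst ⟨N, hN⟩
        exact ⟨N, fun k hk => hN k ⟨hk.1, hst hk.2⟩⟩
      · rintro s t ⟨N, hN⟩ ⟨M, hM⟩
        refine ⟨max N M, fun k hk => ?_⟩
        rcases hk.2 with h | h
        · exact (hanti k hk.1 _ _ (le_max_left _ _)).trans_lt (hN k ⟨hk.1, h⟩)
        · exact (hanti k hk.1 _ _ (le_max_right _ _)).trans_lt (hM k ⟨hk.1, h⟩)
      · intro k hk
        obtain ⟨B, hBc, hB, hBp, -⟩ := hred k hk
        obtain ⟨N, hN⟩ := exists_bandValue_le hBc hB (half_pos hε)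
        rw [← hbv k B hBp] at hN
        have h2 : ∀ᶠ k' in 𝓝[Icc 0 T] k, bandValue R (A k') N < ε :=
          (hbc N k hk).eventually (gt_mem_nhds (by linarith))
        exact ⟨_, h2, N, fun k' hk' => hk'.2⟩
    obtain ⟨N, hN⟩ := h1
    exact ⟨N, fun k hk n hn => (hanti k hk _ _ hn).trans_lt (hN k hk)⟩
  have hpos' : ∀ n, ¬ PencilBound R 0 n 0 → ∀ k ∈ Icc 0 T, 0 < bandValue R (A k) n := by
    intro n hn k hk
    refine lt_of_le_of_ne (bandValue_nonneg _ _ _) fun h0 => hn ?_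
    obtain ⟨B, hBc, hB, hBp, -⟩ := hred k hk
    rw [hbv k B hBp] at h0
    obtain ⟨v, hv⟩ := (hBp n 0).2 (pencilBound_zero_of_bandValue_eq_zero hBc hB h0.symm)
    exact ⟨v, fun f hf => by simpa using hv f hf⟩
  have hzero : ∀ n, PencilBound R 0 n 0 → ∀ k, bandValue R (A k) n = 0 := by
    rintro n ⟨v, hv⟩ k
    exact le_antisymm (bandValue_le le_rfl ⟨v, fun f hf => by simpa using hv f hf⟩)
      (bandValue_nonneg _ _ _)
  let I : ℕ → Set ℝ := fun n => (fun k => bandValue R (A k) n) '' Icc 0 T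
  have hI : ∀ n, I n = Icc (sInf (I n)) (sSup (I n)) := fun n =>
    ContinuousOn.image_Icc hT (hbc n)
  have hne : ∀ n, (I n).Nonempty := fun n => ⟨_, 0, ⟨le_rfl, hT⟩, rfl⟩
  have hle' : ∀ n, sInf (I n) ≤ sSup (I n) := fun n => by
    have := hne n
    rwa [hI, nonempty_Icc] at this
  have heig : ∀ k ∈ Icc 0 T, ∀ n, 0 < bandValue R (A k) n →
      ∃ f, f ≠ 0 ∧ R f = (bandValue R (A k) n : ℂ) • A k f := by
    intro k hk n hn
    obtain ⟨B, hBc, hB, hBp, hBe⟩ := hred k hk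
    rw [hbv k B hBp] at hn ⊢
    exact (hBe _).1 (hasEigenvalue_bandValue hBc hB hn)
  refine ⟨(fun n => (sInf (I n), sSup (I n))) '' {n | ¬ PencilBound R 0 n 0}, ?_, ?_, ?_⟩
  · rintro _ ⟨n, hn, rfl⟩
    have hinf : sInf (I n) ∈ I n := (hI n).symm.subset (left_mem_Icc.2 (hle' n))
    have h0 : 0 < sInf (I n) := by
      obtain ⟨k, hk, h⟩ := hinf
      rw [← h]; exact hpos' n hn k hk
    refine ⟨h0, lt_of_le_of_ne (hle' n) fun heq => ?_⟩
    obtain ⟨k, hk, hk0⟩ := hflat _ h0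
    have h1 : bandValue R (A k) n = sInf (I n) := by
      have h2 : bandValue R (A k) n ∈ I n := ⟨k, hk, rfl⟩
      rw [hI n] at h2
      dsimp only at heq
      exact le_antisymm (h2.2.trans_eq heq.symm) h2.1
    obtain ⟨f, hf, hRf⟩ := heig k hk n (by rw [h1]; exact h0)
    rw [h1] at hRf
    exact hf (hk0 f hRf)
  · intro ε hε
    obtain ⟨N, hN⟩ := hsmall ε hε
    refine ((Set.finite_lt_nat N).image fun n => (sInf (I n), sSup (I n))).subset ?_
    rintro _ ⟨⟨n, hn, rfl⟩, hp⟩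
    refine ⟨n, ?_, rfl⟩
    by_contra hnN
    have hsup : sSup (I n) ∈ I n := (hI n).symm.subset (right_mem_Icc.2 (hle' n))
    obtain ⟨k, hk, h⟩ := hsup
    have h1 := hN k hk n (not_lt.1 hnN)
    dsimp only at h hp
    rw [← h] at hp
    linarith
  · intro l hl
    constructor
    · rintro ⟨_, ⟨n, hn, rfl⟩, hln⟩
      dsimp only at hln
      rw [← hI n] at hln
      obtain ⟨k, hk, rfl⟩ := hln
      exact ⟨k, hk, heig k hk n hl⟩
    · rintro ⟨k, hk, hf⟩
      obtain ⟨B, hBc, hB, hBp, hBe⟩ := hred k hk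
      obtain ⟨n, hn⟩ := exists_bandValue_eq hBc hB hl ((hBe _).2 hf)
      rw [← hbv k B hBp] at hn
      refine ⟨_, ⟨n, fun h0 => ?_, rfl⟩, ?_⟩
      · rw [hzero n h0 k] at hn
        exact hl.ne hn
      · dsimp only
        rw [← hI n]
        exact ⟨k, hk, hn⟩

end Pencil

/-! ### Form domains as Hilbert spaces -/

theorem ofReal_integral_norm_sq {f : ℝ → ℂ} {m : Measure ℝ} (hf : MemLp f 2 m) :
    ENNReal.ofReal (∫ x, ‖f x‖ ^ 2 ∂m) = ∫⁻ x, ‖f x‖ₑ ^ 2 ∂m := by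
  rw [ofReal_integral_eq_lintegral_ofReal (integrable_norm_sq_of_memLp hf)
    (Eventually.of_forall fun x => by positivity)]
  refine lintegral_congr fun x => ?_
  rw [ENNReal.ofReal_pow (norm_nonneg _), ofReal_norm]

theorem memLp_two_of_lintegral_lt_top {f : ℝ → ℂ} {m : Measure ℝ} (hf : AEStronglyMeasurable f m)
    (h : ∫⁻ x, ‖f x‖ₑ ^ 2 ∂m < ⊤) : MemLp f 2 m := by
  refine ⟨hf, ?_⟩
  rw [eLpNorm_lt_top_iff_lintegral_rpow_enorm_lt_top (by norm_num) (by norm_num)]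
  simpa using h

theorem lintegral_lt_top_of_memLp {f : ℝ → ℂ} {m : Measure ℝ} (hf : MemLp f 2 m) :
    ∫⁻ x, ‖f x‖ₑ ^ 2 ∂m < ⊤ := by
  rw [← ofReal_integral_norm_sq hf]
  exact ENNReal.ofReal_lt_top

/-- Coefficients: periodic functions which are locally square integrable. -/
structure PeriodicL2 (ω : ℝ) (b : ℝ → ℂ) : Prop where
  memLp_loc : ∀ c d : ℝ, MemLp b 2 (volume.restrict (Icc c d))
  periodic : ∀ x, b (x + ω) = b x

theorem PeriodicL2.aestronglyMeasurable {ω : ℝ} {b : ℝ → ℂ} (hb : PeriodicL2 ω b) :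
    AEStronglyMeasurable b volume :=
  (locallyIntegrable_of_memLp_loc hb.memLp_loc).aestronglyMeasurable

theorem restrict_Icc_eq_Ioc (a b : ℝ) :
    (volume.restrict (Icc a b) : Measure ℝ) = volume.restrict (Ioc a b) :=
  (restrict_Ioc_eq_restrict_Icc).symm

theorem lintegral_period {g : ℝ → ENNReal} {ω : ℝ} (hg : ∀ x, g (x + ω) = g x) (k : ℤ) :
    ∫⁻ x in Ioc (k * ω) ((k + 1) * ω), g x = ∫⁻ x in Ioc 0 ω, g x := by
  have hper : Function.Periodic g ω := hg
  have mp : MeasurePreserving (fun x : ℝ => x + k * ω) (volume.restrict (Ioc 0 ω))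
      (volume.restrict (Ioc (k * ω) ((k + 1) * ω))) := by
    have := (measurePreserving_add_right volume ((k : ℝ) * ω)).restrict_preimage
      (s := Ioc (k * ω) ((k + 1) * ω)) measurableSet_Ioc
    rw [preimage_add_const_Ioc] at this
    convert! this using 3 <;> ring
  have emb : MeasurableEmbedding (fun x : ℝ => x + k * ω) := measurableEmbedding_addRight _
  rw [← mp.lintegral_comp_emb emb]
  exact lintegral_congr fun x => hper.int_mul k x

theorem lintegral_eq_tsum_period {ω : ℝ} (hω : 0 < ω) (g : ℝ → ENNReal) :
    ∫⁻ x, g x = ∑' k : ℤ, ∫⁻ x in Ioc (k * ω) ((k + 1) * ω), g x := by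
  have h1 := iUnion_Ioc_zsmul hω
  have h2 := pairwise_disjoint_Ioc_zsmul ω
  rw [← setLIntegral_univ g, ← h1, lintegral_iUnion (fun k => measurableSet_Ioc) h2]
  refine tsum_congr fun k => ?_
  simp

/-- The trace inequality on one period. -/
theorem lintegral_mul_le {ω : ℝ} (hω : 0 < ω) {b : ℝ → ℂ} (hb : PeriodicL2 ω b) {ε : ℝ}
    (hε : 0 < ε) :
    ∃ C : ℝ, 0 ≤ C ∧ ∀ f : ℝ → ℂ, IsH1Loc f → ∀ k : ℤ,
      ∫⁻ x in Ioc (k * ω) ((k + 1) * ω), ‖b x * f x‖ₑ ^ 2 ≤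
        ENNReal.ofReal ε * (∫⁻ x in Ioc (k * ω) ((k + 1) * ω), ‖deriv f x‖ₑ ^ 2) +
        ENNReal.ofReal C * ∫⁻ x in Ioc (k * ω) ((k + 1) * ω), ‖f x‖ₑ ^ 2 := by
  set β := ∫ x in Icc 0 ω, ‖b x‖ ^ 2 with hβ
  have hβ0 : 0 ≤ β := integral_nonneg fun x => by positivity
  set η := ε / (β + 1) with hη
  have hη0 : 0 < η := by positivity
  refine ⟨(1 / ω + 1 / η) * β, by positivity, fun f hf k => ?_⟩
  have hkk : (k : ℝ) * ω < (k + 1) * ω := by nlinarith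
  set S : ENNReal := ENNReal.ofReal η * (∫⁻ x in Ioc (k * ω) ((k + 1) * ω), ‖deriv f x‖ₑ ^ 2) +
    ENNReal.ofReal (1 / ω + 1 / η) * ∫⁻ x in Ioc (k * ω) ((k + 1) * ω), ‖f x‖ₑ ^ 2 with hS
  have h1 : ∀ x ∈ Ioc ((k : ℝ) * ω) ((k + 1) * ω), ‖f x‖ₑ ^ 2 ≤ S := by
    intro x hx
    have h2 := hf.norm_sq_le hkk hη0 (Ioc_subset_Icc_self hx)
    have e : ((k : ℝ) + 1) * ω - k * ω = ω := by ring
    rw [e] at h2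
    have h3 := ENNReal.ofReal_le_ofReal h2
    rw [ENNReal.ofReal_pow (norm_nonneg _), ofReal_norm, ENNReal.ofReal_add (by positivity)
      (by positivity), ENNReal.ofReal_mul hη0.le, ENNReal.ofReal_mul (by positivity),
      ofReal_integral_norm_sq (hf.2 _ _), ofReal_integral_norm_sq (hf.memLp _ _),
      restrict_Icc_eq_Ioc] at h3
    exact h3
  have hb2 : ∫⁻ x in Ioc (k * ω) ((k + 1) * ω), ‖b x‖ₑ ^ 2 = ENNReal.ofReal β := by
    rw [lintegral_period (fun x => by rw [hb.periodic]) k, hβ,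
      ofReal_integral_norm_sq (hb.memLp_loc 0 ω), restrict_Icc_eq_Ioc]
  calc ∫⁻ x in Ioc (k * ω) ((k + 1) * ω), ‖b x * f x‖ₑ ^ 2
      ≤ ∫⁻ x in Ioc (k * ω) ((k + 1) * ω), ‖b x‖ₑ ^ 2 * S := by
        refine setLIntegral_mono' measurableSet_Ioc fun x hx => ?_
        rw [enorm_mul, mul_pow]
        exact mul_le_mul_right (h1 x hx) _
    _ = ENNReal.ofReal β * S := by
        rw [lintegral_mul_const'' _ (by
          exact (hb.aestronglyMeasurable.restrict.enorm.pow_const 2)), hb2]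
    _ ≤ _ := by
        rw [hS, mul_add, ← mul_assoc, ← mul_assoc, ← ENNReal.ofReal_mul hβ0,
          ← ENNReal.ofReal_mul hβ0]
        have e : β * η ≤ ε := by
          rw [hη, mul_div_assoc', div_le_iff₀ (by positivity)]
          nlinarith
        rw [mul_comm β (1 / ω + 1 / η)]
        gcongr

/-- A space of `H¹_loc` functions which is complete in the `H¹` norm with respect to the measure
`m` and on which multiplications by periodic `L²_loc` functions are form bounded with relative
bound zero. The two examples are `H¹(ℝ)` and the periodic functions. -/
structure FormDomain (ω : ℝ) where
  /-- the measure defining the norm -/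
  m : Measure ℝ
  /-- the functions in the space -/
  W : Submodule ℂ (ℝ → ℂ)
  ac : m ≪ volume
  isH1Loc : ∀ f ∈ W, IsH1Loc f
  memLp : ∀ f ∈ W, MemLp f 2 m
  memLp_deriv : ∀ f ∈ W, MemLp (deriv f) 2 m
  local_bound : ∀ M : ℝ, ∃ C : ℝ, 0 ≤ C ∧ ∀ f ∈ W,
    ∫ x in Icc (-M) M, ‖f x‖ ^ 2 ≤ C * (∫ x, ‖f x‖ ^ 2 ∂m) ∧
    ∫ x in Icc (-M) M, ‖deriv f x‖ ^ 2 ≤ C * ∫ x, ‖deriv f x‖ ^ 2 ∂m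
  closed : ∀ (F : ℕ → ℝ → ℂ) (f : ℝ → ℂ), (∀ n, F n ∈ W) →
    (∀ x, Tendsto (fun n => F n x) atTop (𝓝 (f x))) → IsH1Loc f → MemLp f 2 m →
    MemLp (deriv f) 2 m → f ∈ W
  trace : ∀ b, PeriodicL2 ω b → ∀ ε : ℝ, 0 < ε → ∃ C : ℝ, 0 ≤ C ∧ ∀ f ∈ W,
    ∫⁻ x, ‖b x * f x‖ₑ ^ 2 ∂m ≤ ENNReal.ofReal ε * (∫⁻ x, ‖deriv f x‖ₑ ^ 2 ∂m) +
      ENNReal.ofReal C * ∫⁻ x, ‖f x‖ₑ ^ 2 ∂m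

/-- The functions in a form domain, as a type carrying the `H¹` norm. -/
def FormDomain.Carrier {ω : ℝ} (X : FormDomain ω) : Type := X.W

namespace FormDomain

variable {ω : ℝ} (X : FormDomain ω)

instance : AddCommGroup X.Carrier := inferInstanceAs (AddCommGroup X.W)

instance : Module ℂ X.Carrier := inferInstanceAs (Module ℂ X.W)

variable {X}

/-- The function underlying an element of the form domain. -/
def Carrier.fn (f : X.Carrier) : ℝ → ℂ := f.1

instance : CoeFun X.Carrier fun _ => ℝ → ℂ := ⟨Carrier.fn⟩

/-- Build an element of the form domain. -/
def of (f : ℝ → ℂ) (hf : f ∈ X.W) : X.Carrier := ⟨f, hf⟩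

theorem coe_of (f : ℝ → ℂ) (hf : f ∈ X.W) : ((of f hf : X.Carrier) : ℝ → ℂ) = f := rfl

theorem coe_add (f g : X.Carrier) : ((f + g : X.Carrier) : ℝ → ℂ) = f.fn + g.fn := rfl

theorem coe_sub (f g : X.Carrier) : ((f - g : X.Carrier) : ℝ → ℂ) = f.fn - g.fn := rfl

theorem coe_ext {f g : X.Carrier} (h : ∀ x, f x = g x) : f = g := Subtype.ext (funext h)

theorem Carrier.mem (f : X.Carrier) : f.fn ∈ X.W := f.2

theorem Carrier.h1 (f : X.Carrier) : IsH1Loc f := X.isH1Loc _ f.mem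

theorem Carrier.memLp (f : X.Carrier) : MemLp f 2 X.m := X.memLp _ f.mem

theorem Carrier.memLp_deriv (f : X.Carrier) : MemLp (deriv f) 2 X.m := X.memLp_deriv _ f.mem

variable (X)

/-- The inclusion of the form domain in `L²`, as a linear map. -/
def toL2ₗ : X.Carrier →ₗ[ℂ] Lp ℂ 2 X.m where
  toFun f := (f.memLp).toLp f
  map_add' f g := MemLp.toLp_add (f.memLp) (g.memLp)
  map_smul' c f := MemLp.toLp_const_smul c (f.memLp)

theorem deriv_add_ae (f g : X.Carrier) :
    deriv (f.fn + g.fn) =ᵐ[X.m] deriv f + deriv g := by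
  refine X.ac.ae_le ?_
  filter_upwards [f.h1.ae_differentiableAt, g.h1.ae_differentiableAt] with x h1 h2
  rw [deriv_add h1 h2]; rfl

theorem deriv_smul_eq (c : ℂ) (f : ℝ → ℂ) : deriv (c • f) = c • deriv f := by
  ext x
  simp [Pi.smul_def]

/-- The derivative, as a linear map to `L²`. -/
def derivₗ : X.Carrier →ₗ[ℂ] Lp ℂ 2 X.m where
  toFun f := (f.memLp_deriv).toLp (deriv f)
  map_add' f g := by
    rw [← MemLp.toLp_add]
    exact (MemLp.toLp_eq_toLp_iff _ _).2 (X.deriv_add_ae f g)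
  map_smul' c f := by
    rw [RingHom.id_apply, ← MemLp.toLp_const_smul]
    exact (MemLp.toLp_eq_toLp_iff _ _).2 (Eventually.of_forall fun x =>
      congrFun (deriv_smul_eq c f) x)

theorem norm_toLp_sq {m : Measure ℝ} {f : ℝ → ℂ} (hf : MemLp f 2 m) :
    ‖hf.toLp f‖ ^ 2 = ∫ x, ‖f x‖ ^ 2 ∂m := by
  have h1 := L2.inner_def (𝕜 := ℂ) (hf.toLp f) (hf.toLp f)
  rw [inner_self_eq_norm_sq_to_K] at h1
  have h2 : (∫ a, ⟪hf.toLp f a, hf.toLp f a⟫_ℂ ∂m) = ((∫ x, ‖f x‖ ^ 2 ∂m : ℝ) : ℂ) := by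
    rw [← integral_complex_ofReal]
    refine integral_congr_ae ?_
    filter_upwards [hf.coeFn_toLp] with x hx
    rw [hx, inner_self_eq_norm_sq_to_K]
    push_cast; rfl
  rw [h2] at h1
  have h3 : ((‖hf.toLp f‖ ^ 2 : ℝ) : ℂ) = ((∫ x, ‖f x‖ ^ 2 ∂m : ℝ) : ℂ) := by
    rw [← h1]; push_cast; rfl
  exact Complex.ofReal_injective h3

theorem inner_toLp {m : Measure ℝ} {f g : ℝ → ℂ} (hf : MemLp f 2 m) (hg : MemLp g 2 m) :
    ⟪hf.toLp f, hg.toLp g⟫_ℂ = ∫ x, conj (f x) * g x ∂m := by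
  rw [L2.inner_def]
  refine integral_congr_ae ?_
  filter_upwards [hf.coeFn_toLp, hg.coeFn_toLp] with x hx hy
  rw [hx, hy, RCLike.inner_apply, mul_comm]

/-- Elements with vanishing `L²` norm vanish. -/
theorem toL2ₗ_injective : Function.Injective X.toL2ₗ := by
  rw [← LinearMap.ker_eq_bot, LinearMap.ker_eq_bot']
  intro f hf
  have h0 : ∫ x, ‖f x‖ ^ 2 ∂X.m = 0 := by
    rw [← norm_toLp_sq (f.memLp)]
    have : ‖(f.memLp).toLp f‖ = 0 := by rw [norm_eq_zero]; exact hf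
    rw [this]; norm_num
  refine coe_ext fun x => ?_
  obtain ⟨C, hC, h⟩ := X.local_bound (|x| + 1)
  have h1 := (h _ f.mem).1
  rw [h0, mul_zero] at h1
  have h2 : ∫ x in Icc (-(|x| + 1)) (|x| + 1), ‖f x‖ ^ 2 = 0 :=
    le_antisymm h1 (integral_nonneg fun x => by positivity)
  rw [setIntegral_eq_zero_iff_of_nonneg_ae (Eventually.of_forall fun x => by positivity)
    (integrable_norm_sq_of_memLp (f.h1.memLp _ _))] at h2
  have h3 : ∀ y ∈ Ioo (-(|x| + 1)) (|x| + 1), f y = 0 := by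
    have h4 : (f : ℝ → ℂ) =ᵐ[volume.restrict (Ioo (-(|x| + 1)) (|x| + 1))] 0 := by
      have h5 := ae_restrict_of_ae_restrict_of_subset
        (Ioo_subset_Icc_self (a := -(|x| + 1)) (b := |x| + 1)) h2
      filter_upwards [h5] with y hy
      simpa using hy
    exact Measure.eqOn_open_of_ae_eq h4 isOpen_Ioo f.h1.continuous.continuousOn continuousOn_const
  exact h3 x ⟨by linarith [neg_abs_le x], by linarith [le_abs_self x]⟩

/-- The embedding of the form domain defining its norm. -/
def graphₗ : X.Carrier →ₗ[ℂ] WithLp 2 (Lp ℂ 2 X.m × Lp ℂ 2 X.m) :=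
  (WithLp.linearEquiv 2 ℂ (Lp ℂ 2 X.m × Lp ℂ 2 X.m)).symm.toLinearMap ∘ₗ X.toL2ₗ.prod X.derivₗ

theorem graphₗ_injective : Function.Injective X.graphₗ := by
  intro f g h
  refine X.toL2ₗ_injective ?_
  have := congrArg (fun z : WithLp 2 (Lp ℂ 2 X.m × Lp ℂ 2 X.m) => z.fst) h
  exact this

instance : NormedAddCommGroup X.Carrier :=
  NormedAddCommGroup.induced _ _ X.graphₗ X.graphₗ_injective

theorem norm_eq (f : X.Carrier) : ‖f‖ = ‖X.graphₗ f‖ := rfl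

instance : InnerProductSpace ℂ X.Carrier where
  inner f g := ⟪X.graphₗ f, X.graphₗ g⟫_ℂ
  norm_smul_le c f := by rw [norm_eq, norm_eq, map_smul, norm_smul]
  norm_sq_eq_re_inner f := by rw [norm_eq]; exact norm_sq_eq_re_inner (𝕜 := ℂ) _
  conj_inner_symm f g := inner_conj_symm _ _
  add_left f g h := by rw [map_add, inner_add_left]
  smul_left f g c := by rw [map_smul, inner_smul_left]

theorem inner_eq (f g : X.Carrier) :
    ⟪f, g⟫_ℂ = ⟪X.toL2ₗ f, X.toL2ₗ g⟫_ℂ + ⟪X.derivₗ f, X.derivₗ g⟫_ℂ :=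
  WithLp.prod_inner_apply (𝕜 := ℂ) _ _

theorem norm_sq_eq (f : X.Carrier) : ‖f‖ ^ 2 = ‖X.toL2ₗ f‖ ^ 2 + ‖X.derivₗ f‖ ^ 2 := by
  rw [norm_eq, WithLp.prod_norm_sq_eq_of_L2]
  rfl

/-- The inclusion of the form domain in `L²`. -/
def J : X.Carrier →L[ℂ] Lp ℂ 2 X.m := X.toL2ₗ.mkContinuous 1 fun f => by
  rw [one_mul]
  refine le_of_sq_le_sq ?_ (norm_nonneg _)
  rw [X.norm_sq_eq]
  linarith [sq_nonneg ‖X.derivₗ f‖]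

/-- The derivative, as a bounded operator to `L²`. -/
def D : X.Carrier →L[ℂ] Lp ℂ 2 X.m := X.derivₗ.mkContinuous 1 fun f => by
  rw [one_mul]
  refine le_of_sq_le_sq ?_ (norm_nonneg _)
  rw [X.norm_sq_eq]
  linarith [sq_nonneg ‖X.toL2ₗ f‖]

theorem J_apply (f : X.Carrier) : X.J f = (f.memLp).toLp f := rfl

theorem D_apply (f : X.Carrier) : X.D f = (f.memLp_deriv).toLp (deriv f) := rfl

theorem norm_sq (f : X.Carrier) : ‖f‖ ^ 2 = ‖X.J f‖ ^ 2 + ‖X.D f‖ ^ 2 := X.norm_sq_eq f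

theorem norm_J_sq (f : X.Carrier) : ‖X.J f‖ ^ 2 = ∫ x, ‖f x‖ ^ 2 ∂X.m :=
  norm_toLp_sq f.memLp

theorem norm_D_sq (f : X.Carrier) : ‖X.D f‖ ^ 2 = ∫ x, ‖deriv f x‖ ^ 2 ∂X.m :=
  norm_toLp_sq f.memLp_deriv

theorem J_injective : Function.Injective X.J := X.toL2ₗ_injective

theorem norm_J_le (f : X.Carrier) : ‖X.J f‖ ≤ ‖f‖ := by
  refine le_of_sq_le_sq ?_ (norm_nonneg _)
  rw [X.norm_sq]; linarith [sq_nonneg ‖X.D f‖]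

theorem norm_D_le (f : X.Carrier) : ‖X.D f‖ ≤ ‖f‖ := by
  refine le_of_sq_le_sq ?_ (norm_nonneg _)
  rw [X.norm_sq]; linarith [sq_nonneg ‖X.J f‖]

/-- Point evaluations are bounded, locally uniformly. -/
theorem exists_norm_apply_le (M : ℝ) :
    ∃ C : ℝ, 0 ≤ C ∧ ∀ (f : X.Carrier), ∀ x ∈ Icc (-M) M, ‖f x‖ ≤ C * ‖f‖ := by
  obtain ⟨C, hC, h⟩ := X.local_bound (|M| + 1)
  set M' := |M| + 1 with hM'
  have hM0 : 0 < M' := by positivity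
  refine ⟨Real.sqrt ((1 + 1 / (2 * M') + 1) * C), Real.sqrt_nonneg _, fun f x hx => ?_⟩
  have hx' : x ∈ Icc (-M') M' := by
    have := le_abs_self M
    exact ⟨by linarith [hx.1], by linarith [hx.2]⟩
  have h1 := f.h1.norm_sq_le (show -M' < M' by linarith) one_pos hx'
  obtain ⟨h2, h3⟩ := h _ f.mem
  rw [← X.norm_J_sq] at h2
  rw [← X.norm_D_sq] at h3
  have h4 := X.norm_sq f
  have e : M' - -M' = 2 * M' := by ring
  rw [e] at h1
  refine le_of_sq_le_sq ?_ (by positivity)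
  rw [mul_pow, Real.sq_sqrt (by positivity)]
  have h5 : (1 / (2 * M') + 1 / 1) * ∫ t in Icc (-M') M', ‖f t‖ ^ 2 ≤
      (1 / (2 * M') + 1) * (C * ‖X.J f‖ ^ 2) := by
    rw [div_one]
    exact mul_le_mul_of_nonneg_left h2 (by positivity)
  rw [h4]
  have h6 : 0 ≤ 1 / (2 * M') := by positivity
  have h7 : 0 ≤ C * ‖X.J f‖ ^ 2 := by positivity
  have h8 : 0 ≤ C * ‖X.D f‖ ^ 2 := by positivity
  nlinarith [mul_nonneg h6 h8]

end FormDomain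

namespace FormDomain

variable {ω : ℝ} (X : FormDomain ω)

/-- Evaluation at a point, as a linear map. -/
def evₗ (x : ℝ) : X.Carrier →ₗ[ℂ] ℂ where
  toFun f := f x
  map_add' _ _ := rfl
  map_smul' _ _ := rfl

/-- Evaluation at a point. -/
def ev (x : ℝ) : X.Carrier →L[ℂ] ℂ :=
  (X.evₗ x).mkContinuousOfExistsBound <| by
    obtain ⟨C, -, h⟩ := X.exists_norm_apply_le |x|
    exact ⟨C, fun f => h f x ⟨neg_abs_le x, le_abs_self x⟩⟩

/-- The derivative on a compact interval, as a bounded operator. -/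
def localD (M : ℝ) : X.Carrier →L[ℂ] Lp ℂ 2 (volume.restrict (Icc (-M) M)) :=
  LinearMap.mkContinuousOfExistsBound
    { toFun := fun f => (f.h1.2 (-M) M).toLp (deriv f)
      map_add' := fun f g => by
        rw [← MemLp.toLp_add]
        refine (MemLp.toLp_eq_toLp_iff _ _).2 (ae_restrict_of_ae ?_)
        filter_upwards [f.h1.ae_differentiableAt, g.h1.ae_differentiableAt] with x h1 h2
        rw [coe_add, deriv_add h1 h2]; rfl
      map_smul' := fun c f => by
        rw [RingHom.id_apply, ← MemLp.toLp_const_smul]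
        exact (MemLp.toLp_eq_toLp_iff _ _).2 (Eventually.of_forall fun x =>
          congrFun (deriv_smul_eq c f) x) } <| by
    obtain ⟨C, hC, h⟩ := X.local_bound M
    refine ⟨Real.sqrt C, fun f => ?_⟩
    refine le_of_sq_le_sq ?_ (by positivity)
    rw [mul_pow, Real.sq_sqrt hC]
    change ‖(f.h1.2 (-M) M).toLp (deriv f)‖ ^ 2 ≤ _
    rw [norm_toLp_sq]
    refine (h _ f.mem).2.trans ?_
    rw [← X.norm_D_sq f]
    exact mul_le_mul_of_nonneg_left (pow_le_pow_left₀ (norm_nonneg _) (X.norm_D_le f) 2) hC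

/-- Pointwise limits whose derivatives converge in `L²` on compact intervals. -/
theorem exists_limit {F : ℕ → X.Carrier} (hF : CauchySeq F) :
    ∃ f : ℝ → ℂ, IsH1Loc f ∧ (∀ x, Tendsto (fun n => F n x) atTop (𝓝 (f x))) ∧
      ∀ M : ℝ, 0 < M → ∃ w : Lp ℂ 2 (volume.restrict (Icc (-M) M)),
        Tendsto (fun n => X.localD M (F n)) atTop (𝓝 w) ∧
        deriv f =ᵐ[volume.restrict (Ioo (-M) M)] w := by
  have hpt : ∀ x, ∃ y, Tendsto (fun n => F n x) atTop (𝓝 y) := fun x =>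
    cauchySeq_tendsto_of_complete ((X.ev x).uniformContinuous.comp_cauchySeq hF)
  choose f hf using hpt
  have key : ∀ M : ℝ, 0 < M → ∃ w : Lp ℂ 2 (volume.restrict (Icc (-M) M)),
      Tendsto (fun n => X.localD M (F n)) atTop (𝓝 w) ∧
      ∃ g, HasWeakDeriv g ((Icc (-M) M).indicator w) ∧ EqOn f g (Ioo (-M) M) := by
    intro M hM
    obtain ⟨w, hw⟩ := cauchySeq_tendsto_of_complete
      ((X.localD M).uniformContinuous.comp_cauchySeq hF)
    refine ⟨w, hw, fun x => f (-M) + ∫ t in (-M)..x, (Icc (-M) M).indicator w t, ?_, ?_⟩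
    · have hL : MemLp ((Icc (-M) M).indicator (w : ℝ → ℂ)) 2 volume :=
        (memLp_indicator_iff_restrict measurableSet_Icc).2 (Lp.memLp w)
      have hL' : ∀ a b : ℝ, MemLp ((Icc (-M) M).indicator (w : ℝ → ℂ)) 2
          (volume.restrict (Icc a b)) := fun a b => hL.restrict _
      refine ⟨hL', fun x y => ?_⟩
      have := intervalIntegral.integral_interval_sub_left
        (intervalIntegrable_of_memLp_loc hL' (-M) y) (intervalIntegrable_of_memLp_loc hL' (-M) x)
      rw [← this]; ring
    · intro x hx
      have hms : MeasurableSet (Ioc (-M) x) := measurableSet_Ioc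
      have hsub : Ioc (-M) x ⊆ Icc (-M) M := fun t ht => ⟨ht.1.le, ht.2.trans hx.2.le⟩
      have hfin : (volume.restrict (Icc (-M) M)) (Ioc (-M) x) ≠ ⊤ :=
        ((measure_lt_top _ _)).ne
      have hlim : Tendsto (fun n => ⟪indicatorConstLp 2 hms hfin (1 : ℂ), X.localD M (F n)⟫_ℂ) atTop
          (𝓝 ⟪indicatorConstLp 2 hms hfin (1 : ℂ), w⟫_ℂ) :=
        tendsto_const_nhds.inner hw
      simp only [L2.inner_indicatorConstLp_one, Measure.restrict_restrict hms,
        inter_eq_self_of_subset_left hsub] at hlim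
      have e1 : ∀ n, ∫ t in Ioc (-M) x, X.localD M (F n) t = F n x - F n (-M) := by
        intro n
        rw [← (F n).h1.integral_deriv, intervalIntegral.integral_of_le hx.1.le]
        refine integral_congr_ae (ae_restrict_of_ae_restrict_of_subset hsub ?_)
        exact ((F n).h1.2 (-M) M).coeFn_toLp
      simp only [e1] at hlim
      have h2 := tendsto_nhds_unique hlim ((hf x).sub (hf (-M)))
      have e2 : ∫ t in (-M)..x, (Icc (-M) M).indicator w t = ∫ t in Ioc (-M) x, w t := by
        rw [intervalIntegral.integral_of_le hx.1.le]
        exact setIntegral_congr_fun hms fun t ht => indicator_of_mem (hsub ht) _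
      simp only [e2, h2]
      ring
  have hH1 : IsH1Loc f := IsH1Loc.of_eqOn fun M => by
    obtain ⟨w, -, g, hg, hfg⟩ := key (|M| + 1) (by positivity)
    refine ⟨g, hg.isH1Loc, hfg.mono fun x hx => ?_⟩
    have := le_abs_self M
    exact ⟨by linarith [hx.1], by linarith [hx.2]⟩
  refine ⟨f, hH1, hf, fun M hM => ?_⟩
  obtain ⟨w, hw, g, hg, hfg⟩ := key M hM
  refine ⟨w, hw, ?_⟩
  filter_upwards [ae_restrict_of_ae hg.deriv_ae, ae_restrict_mem measurableSet_Ioo] with x h1 h2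
  rw [(hfg.eventuallyEq_of_mem (isOpen_Ioo.mem_nhds h2)).deriv_eq, h1,
    indicator_of_mem (Ioo_subset_Icc_self h2)]

instance : CompleteSpace X.Carrier := by
  refine Metric.complete_of_cauchySeq_tendsto fun F hF => ?_
  obtain ⟨f, hf, hpt, hloc⟩ := X.exists_limit hF
  obtain ⟨u, hu⟩ := cauchySeq_tendsto_of_complete (X.J.uniformContinuous.comp_cauchySeq hF)
  obtain ⟨w, hw⟩ := cauchySeq_tendsto_of_complete (X.D.uniformContinuous.comp_cauchySeq hF)
  have hfu : f =ᵐ[X.m] u := by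
    obtain ⟨ns, hns, hns'⟩ := (tendstoInMeasure_of_tendsto_Lp hu).exists_seq_tendsto_ae
    have h1 : ∀ᵐ x ∂X.m, ∀ n, X.J (F n) x = F n x :=
      ae_all_iff.2 fun n => (F n).memLp.coeFn_toLp
    filter_upwards [hns', h1] with x hx h1x
    refine tendsto_nhds_unique ((hpt x).comp hns.tendsto_atTop) ?_
    refine hx.congr fun i => ?_
    exact h1x _
  have hfw : deriv f =ᵐ[X.m] w := by
    obtain ⟨ns, hns, hns'⟩ := (tendstoInMeasure_of_tendsto_Lp hw).exists_seq_tendsto_ae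
    have h1 : ∀ᵐ x ∂X.m, ∀ n, X.D (F n) x = deriv (F n) x :=
      ae_all_iff.2 fun n => (F n).memLp_deriv.coeFn_toLp
    have h2 : ∀ M : ℕ, ∀ᵐ x ∂X.m, x ∈ Ioo (-((M : ℝ) + 1)) (M + 1) → deriv f x = w x := by
      intro M
      obtain ⟨v, hv, hfv⟩ := hloc (M + 1) (by positivity)
      obtain ⟨ms, hms, hms'⟩ := (tendstoInMeasure_of_tendsto_Lp
        (hv.comp hns.tendsto_atTop)).exists_seq_tendsto_ae
      have h3 : ∀ᵐ x ∂(volume.restrict (Icc (-((M : ℝ) + 1)) (M + 1))), ∀ n,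
          X.localD (M + 1) (F n) x = deriv (F n) x :=
        ae_all_iff.2 fun n => ((F n).h1.2 _ _).coeFn_toLp
      have h4 : ∀ᵐ x ∂(volume.restrict (Ioo (-((M : ℝ) + 1)) (M + 1))),
          Tendsto (fun i => deriv (F (ns (ms i))) x) atTop (𝓝 (deriv f x)) := by
        have hsub : Ioo (-((M : ℝ) + 1)) (M + 1) ⊆ Icc (-((M : ℝ) + 1)) (M + 1) :=
          Ioo_subset_Icc_self
        filter_upwards [hfv, ae_restrict_of_ae_restrict_of_subset hsub hms',
          ae_restrict_of_ae_restrict_of_subset hsub h3] with x e1 e2 e3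
        rw [e1]
        exact e2.congr fun i => e3 _
      rw [ae_restrict_iff' measurableSet_Ioo] at h4
      filter_upwards [X.ac.ae_le h4, hns', h1] with x h4x hx h1x hxM
      refine tendsto_nhds_unique (h4x hxM) ?_
      refine (hx.comp hms.tendsto_atTop).congr fun i => ?_
      exact h1x _
    filter_upwards [ae_all_iff.2 h2] with x hx
    obtain ⟨M, hM⟩ := exists_nat_gt |x|
    exact hx M ⟨by linarith [neg_abs_le x], by linarith [le_abs_self x]⟩
  have hfm : MemLp f 2 X.m := (Lp.memLp u).ae_eq hfu.symm
  have hfm' : MemLp (deriv f) 2 X.m := (Lp.memLp w).ae_eq hfw.symm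
  have hW : f ∈ X.W := X.closed (fun n => F n) f (fun n => (F n).mem) hpt hf hfm hfm'
  refine ⟨of f hW, ?_⟩
  have hJ : X.J (of f hW) = u := Lp.ext (hfm.coeFn_toLp.trans hfu)
  have hD : X.D (of f hW) = w := Lp.ext (hfm'.coeFn_toLp.trans hfw)
  rw [← hJ] at hu
  rw [← hD] at hw
  rw [tendsto_iff_norm_sub_tendsto_zero] at hu hw ⊢
  have h5 := ((hu.pow 2).add (hw.pow 2)).sqrt
  simp only [ne_eq, OfNat.ofNat_ne_zero, not_false_eq_true, zero_pow, add_zero,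
    Real.sqrt_zero] at h5
  refine h5.congr fun n => ?_
  rw [Function.comp_apply, Function.comp_apply, ← map_sub, ← map_sub, ← X.norm_sq,
    Real.sqrt_sq (norm_nonneg _)]

/-! ### Multiplication operators and forms -/

theorem memLp_mul {b : ℝ → ℂ} (hb : PeriodicL2 ω b) (f : X.Carrier) :
    MemLp (fun x => b x * f x) 2 X.m := by
  obtain ⟨C, -, h⟩ := X.trace b hb 1 one_pos
  refine memLp_two_of_lintegral_lt_top ?_ ((h _ f.mem).trans_lt ?_)
  · exact (hb.aestronglyMeasurable.mono_ac X.ac).mul f.memLp.1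
  · exact ENNReal.add_lt_top.2 ⟨ENNReal.mul_lt_top ENNReal.ofReal_lt_top
      (lintegral_lt_top_of_memLp f.memLp_deriv), ENNReal.mul_lt_top ENNReal.ofReal_lt_top
      (lintegral_lt_top_of_memLp f.memLp)⟩

theorem norm_toLp_mul_sq_le {b : ℝ → ℂ} (hb : PeriodicL2 ω b) {ε : ℝ} (hε : 0 < ε) :
    ∃ C : ℝ, 0 ≤ C ∧ ∀ f : X.Carrier,
      ‖(X.memLp_mul hb f).toLp‖ ^ 2 ≤ ε * ‖X.D f‖ ^ 2 + C * ‖X.J f‖ ^ 2 := by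
  obtain ⟨C, hC, h⟩ := X.trace b hb ε hε
  refine ⟨C, hC, fun f => ?_⟩
  have h1 := h _ f.mem
  change ∫⁻ x, ‖b x * f x‖ₑ ^ 2 ∂X.m ≤ ENNReal.ofReal ε * (∫⁻ x, ‖deriv f x‖ₑ ^ 2 ∂X.m) +
      ENNReal.ofReal C * ∫⁻ x, ‖f x‖ₑ ^ 2 ∂X.m at h1
  rw [← ofReal_integral_norm_sq (X.memLp_mul hb f), ← ofReal_integral_norm_sq f.memLp,
    ← ofReal_integral_norm_sq f.memLp_deriv, ← ENNReal.ofReal_mul hε.le, ← ENNReal.ofReal_mul hC,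
    ← ENNReal.ofReal_add (by positivity) (by positivity),
    ENNReal.ofReal_le_ofReal_iff (by positivity)] at h1
  rw [norm_toLp_sq, X.norm_D_sq, X.norm_J_sq]
  exact h1

open Classical in
/-- Multiplication by a periodic function, from the form domain to `L²` (zero if the function is
not a periodic `L²_loc` function). -/
def mulOp (b : ℝ → ℂ) : X.Carrier →L[ℂ] Lp ℂ 2 X.m :=
  if hb : PeriodicL2 ω b then
    LinearMap.mkContinuousOfExistsBound
      { toFun := fun f => (X.memLp_mul hb f).toLp
        map_add' := fun f g => by
          rw [← MemLp.toLp_add]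
          exact (MemLp.toLp_eq_toLp_iff _ _).2 (Eventually.of_forall fun x => mul_add _ _ _)
        map_smul' := fun c f => by
          rw [RingHom.id_apply, ← MemLp.toLp_const_smul]
          exact (MemLp.toLp_eq_toLp_iff _ _).2 (Eventually.of_forall fun x =>
            mul_left_comm _ _ _) } <| by
      obtain ⟨C, hC, h⟩ := X.norm_toLp_mul_sq_le hb one_pos
      refine ⟨Real.sqrt (1 + C), fun f => ?_⟩
      refine le_of_sq_le_sq ?_ (by positivity)
      rw [mul_pow, Real.sq_sqrt (by positivity)]
      refine (h f).trans ?_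
      rw [X.norm_sq]
      nlinarith [sq_nonneg ‖X.D f‖, sq_nonneg ‖X.J f‖, mul_nonneg hC (sq_nonneg ‖X.D f‖)]
  else 0

theorem mulOp_apply {b : ℝ → ℂ} (hb : PeriodicL2 ω b) (f : X.Carrier) :
    X.mulOp b f = (X.memLp_mul hb f).toLp := by
  rw [mulOp, dif_pos hb]; rfl

theorem norm_mulOp_sq_le {b : ℝ → ℂ} (hb : PeriodicL2 ω b) {ε : ℝ} (hε : 0 < ε) :
    ∃ C : ℝ, 0 ≤ C ∧ ∀ f : X.Carrier,
      ‖X.mulOp b f‖ ^ 2 ≤ ε * ‖X.D f‖ ^ 2 + C * ‖X.J f‖ ^ 2 := by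
  simp only [X.mulOp_apply hb]
  exact X.norm_toLp_mul_sq_le hb hε

end FormDomain

/-- The density of the bilinear form `α v' g' + ⟨Q - Q'', v g⟩`: all the forms below are of this
kind, a distribution in `H⁻¹_loc` being written as `Q - Q''` with `Q ∈ H¹_loc`. -/
def dens (α : ℂ) (Q v g : ℝ → ℂ) (x : ℝ) : ℂ :=
  α * (deriv v x * deriv g x) + Q x * (v x * g x) +
    deriv Q x * (deriv v x * g x + v x * deriv g x)

/-- Periodic, real-valued `H¹_loc` functions, used as potentials for distributions. -/
structure Potential (ω : ℝ) (p : ℝ → ℂ) : Prop where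
  h1 : IsH1Loc p
  periodic : ∀ x, p (x + ω) = p x
  real : ∀ x, conj (p x) = p x

theorem deriv_periodic {p : ℝ → ℂ} {ω : ℝ} (h : ∀ x, p (x + ω) = p x) (x : ℝ) :
    deriv p (x + ω) = deriv p x := by
  have := deriv_comp_add p ω
  have e : (fun x => p (x + ω)) = p := funext h
  rw [e] at this
  exact (congrFun this x).symm

theorem Potential.periodicL2 {ω : ℝ} {p : ℝ → ℂ} (hp : Potential ω p) : PeriodicL2 ω p :=
  ⟨hp.h1.memLp, hp.periodic⟩

theorem Potential.periodicL2_deriv {ω : ℝ} {p : ℝ → ℂ} (hp : Potential ω p) :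
    PeriodicL2 ω (deriv p) :=
  ⟨hp.h1.2, deriv_periodic hp.periodic⟩

theorem Potential.deriv_real {ω : ℝ} {p : ℝ → ℂ} (hp : Potential ω p) (x : ℝ) :
    conj (deriv p x) = deriv p x := by
  have := congrFun (deriv_conj p) x
  rw [show (fun x => conj (p x)) = p from funext hp.real] at this
  exact this.symm

namespace FormDomain

variable {ω : ℝ} (X : FormDomain ω)

/-- The operator of the form `⟨p - p'', f̄ g⟩`. -/
def potOp (p : ℝ → ℂ) : X.Carrier →L[ℂ] X.Carrier :=
  X.J.adjoint ∘L X.mulOp p + X.D.adjoint ∘L X.mulOp (deriv p) + (X.mulOp (deriv p)).adjoint ∘L X.D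

theorem inner_potOp' (p : ℝ → ℂ) (f g : X.Carrier) :
    ⟪f, X.potOp p g⟫_ℂ = ⟪X.J f, X.mulOp p g⟫_ℂ + ⟪X.D f, X.mulOp (deriv p) g⟫_ℂ +
      ⟪X.mulOp (deriv p) f, X.D g⟫_ℂ := by
  simp only [potOp, add_apply, ContinuousLinearMap.comp_apply, inner_add_right,
    ContinuousLinearMap.adjoint_inner_right]

theorem integrable_conj_mul {m : Measure ℝ} {f g : ℝ → ℂ} (hf : MemLp f 2 m) (hg : MemLp g 2 m) :
    Integrable (fun x => conj (f x) * g x) m :=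
  MemLp.integrable_mul (p := 2) (q := 2) hf.star hg

theorem integrable_dens {p : ℝ → ℂ} (hp : Potential ω p) (α : ℂ) (f g : X.Carrier) :
    Integrable (dens α p (fun x => conj (f x)) g) X.m := by
  have h1 := (integrable_conj_mul f.memLp_deriv g.memLp_deriv).const_mul α
  have h2 := integrable_conj_mul f.memLp (X.memLp_mul hp.periodicL2 g)
  have h3 := integrable_conj_mul f.memLp_deriv (X.memLp_mul hp.periodicL2_deriv g)
  have h4 := integrable_conj_mul (X.memLp_mul hp.periodicL2_deriv f) g.memLp_deriv
  refine ((h1.add h2).add (h3.add h4)).congr (Eventually.of_forall fun x => ?_)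
  simp only [dens, Pi.add_apply, deriv_conj, map_mul, hp.deriv_real]
  ring

/-- The operators of the forms, in terms of densities. -/
theorem inner_form_eq {p : ℝ → ℂ} (hp : Potential ω p) (α : ℂ) (f g : X.Carrier) :
    α * ⟪X.D f, X.D g⟫_ℂ + ⟪f, X.potOp p g⟫_ℂ = ∫ x, dens α p (fun x => conj (f x)) g x ∂X.m := by
  rw [inner_potOp', X.mulOp_apply hp.periodicL2, X.mulOp_apply hp.periodicL2_deriv,
    X.mulOp_apply hp.periodicL2_deriv, X.J_apply, X.D_apply, X.D_apply, inner_toLp, inner_toLp,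
    inner_toLp, inner_toLp, ← integral_const_mul]
  have h1 := (integrable_conj_mul f.memLp_deriv g.memLp_deriv).const_mul α
  have h2 := integrable_conj_mul f.memLp (X.memLp_mul hp.periodicL2 g)
  have h3 := integrable_conj_mul f.memLp_deriv (X.memLp_mul hp.periodicL2_deriv g)
  have h4 := integrable_conj_mul (X.memLp_mul hp.periodicL2_deriv f) g.memLp_deriv
  have h23 : Integrable (fun x => conj (f x) * (p x * g x) +
      conj (deriv f x) * (deriv p x * g x)) X.m := h2.add h3
  have h234 : Integrable (fun x => conj (f x) * (p x * g x) +
      conj (deriv f x) * (deriv p x * g x) + conj (deriv p x * f x) * deriv g x) X.m := h23.add h4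
  rw [← integral_add h2 h3, ← integral_add h23 h4, ← integral_add h1 h234]
  refine integral_congr_ae (Eventually.of_forall fun x => ?_)
  simp only [dens, deriv_conj, map_mul, hp.deriv_real]
  ring

theorem potOp_symm {p : ℝ → ℂ} (hp : Potential ω p) (f g : X.Carrier) :
    ⟪X.potOp p f, g⟫_ℂ = ⟪f, X.potOp p g⟫_ℂ := by
  have h1 := X.inner_form_eq hp 0 f g
  have h2 := X.inner_form_eq hp 0 g f
  rw [zero_mul, zero_add] at h1 h2
  rw [← inner_conj_symm, h1, h2, ← integral_conj]
  refine integral_congr_ae (Eventually.of_forall fun x => ?_)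
  simp only [dens, deriv_conj, map_mul, map_add, hp.deriv_real, hp.real, Complex.conj_conj,
    map_zero]
  ring

/-- The form of `p - p''` is form bounded with relative bound zero. -/
theorem norm_inner_potOp_le {p : ℝ → ℂ} (hp : Potential ω p) {ε : ℝ} (hε : 0 < ε) :
    ∃ C : ℝ, 0 ≤ C ∧ ∀ f : X.Carrier,
      ‖⟪f, X.potOp p f⟫_ℂ‖ ≤ ε * ‖X.D f‖ ^ 2 + C * ‖X.J f‖ ^ 2 := by
  obtain ⟨C1, hC1, h1⟩ := X.norm_mulOp_sq_le hp.periodicL2 (ε := ε / 2) (by positivity)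
  obtain ⟨C2, hC2, h2⟩ := X.norm_mulOp_sq_le hp.periodicL2_deriv (ε := ε ^ 2 / 16) (by positivity)
  refine ⟨1 + C1 + (4 / ε) * C2, by positivity, fun f => ?_⟩
  rw [inner_potOp']
  have a1 := norm_inner_le_norm (𝕜 := ℂ) (X.J f) (X.mulOp p f)
  have a2 := norm_inner_le_norm (𝕜 := ℂ) (X.D f) (X.mulOp (deriv p) f)
  have a3 := norm_inner_le_norm (𝕜 := ℂ) (X.mulOp (deriv p) f) (X.D f)
  refine (norm_add₃_le).trans ?_
  have b1 := h1 f
  have b2 := h2 f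
  set d := ‖X.D f‖
  set j := ‖X.J f‖
  set s := ‖X.mulOp p f‖
  set t := ‖X.mulOp (deriv p) f‖
  have c1 : j * s ≤ (j ^ 2 + s ^ 2) / 2 := by nlinarith [sq_nonneg (j - s)]
  have c2 : 2 * (d * t) ≤ ε / 4 * d ^ 2 + 4 / ε * t ^ 2 := by
    have : 0 ≤ (ε / 4 * d - t) ^ 2 * (4 / ε) := by positivity
    have e : (ε / 4 * d - t) ^ 2 * (4 / ε) = ε / 4 * d ^ 2 + 4 / ε * t ^ 2 - 2 * (d * t) := by
      field_simp; ring
    linarith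
  have c3 : 4 / ε * t ^ 2 ≤ ε / 4 * d ^ 2 + 4 / ε * C2 * j ^ 2 := by
    have := mul_le_mul_of_nonneg_left b2 (show 0 ≤ 4 / ε by positivity)
    have e : 4 / ε * (ε ^ 2 / 16 * d ^ 2 + C2 * j ^ 2) = ε / 4 * d ^ 2 + 4 / ε * C2 * j ^ 2 := by
      field_simp; ring
    linarith
  nlinarith [mul_nonneg hC1 (sq_nonneg j), mul_nonneg hε.le (sq_nonneg d)]

end FormDomain

/-! ### The periodic functions and `H¹(ℝ)` as form domains -/

theorem lintegral_union_periods {ω : ℝ} (g : ℝ → ENNReal) (hg : ∀ x, g (x + ω) = g x)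
    (n : ℕ) : ∫⁻ x in Ioc (-(n * ω)) (n * ω), g x ≤ 2 * n * ∫⁻ x in Ioc 0 ω, g x := by
  have hsub : Ioc (-(n * ω)) (n * ω) ⊆
      ⋃ k ∈ Finset.Ico (-(n : ℤ)) n, Ioc ((k : ℝ) * ω) ((k + 1) * ω) := by
    intro x hx
    have hω : 0 < ω := by
      by_contra hneg
      push Not at hneg
      have h1 : (n : ℝ) * ω ≤ 0 := mul_nonpos_of_nonneg_of_nonpos (by positivity) hneg
      linarith [hx.1, hx.2]
    obtain ⟨k, hk, -⟩ := existsUnique_add_zsmul_mem_Ioc hω x 0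
    simp only [zero_add, zsmul_eq_mul, mem_Ioc] at hk
    rw [mem_iUnion₂]
    refine ⟨-k, ?_, ?_⟩
    · rw [Finset.mem_Ico]
      constructor
      · by_contra hc
        have h1 : (-k : ℤ) + 1 ≤ -n := by omega
        have h2 : (-(k : ℝ)) + 1 ≤ -n := by exact_mod_cast h1
        nlinarith [hx.1, hk.2]
      · by_contra hc
        have h1 : (n : ℤ) ≤ -k := by omega
        have h2 : (n : ℝ) ≤ -k := by exact_mod_cast h1
        nlinarith [hx.2, hk.1]
    · push_cast
      constructor <;> nlinarith [hk.1, hk.2]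
  calc ∫⁻ x in Ioc (-(n * ω)) (n * ω), g x
      ≤ ∫⁻ x in ⋃ k ∈ Finset.Ico (-(n : ℤ)) n, Ioc ((k : ℝ) * ω) ((k + 1) * ω), g x :=
        lintegral_mono_set hsub
    _ ≤ ∑ k ∈ Finset.Ico (-(n : ℤ)) n, ∫⁻ x in Ioc ((k : ℝ) * ω) ((k + 1) * ω), g x := by
        rw [← Finset.tsum_subtype (Finset.Ico (-(n : ℤ)) n)
          fun k => ∫⁻ x in Ioc ((k : ℝ) * ω) ((k + 1) * ω), g x]
        refine le_of_eq_of_le ?_ (lintegral_iUnion_le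
          (fun k : Finset.Ico (-(n : ℤ)) n => Ioc ((k : ℝ) * ω) ((k + 1) * ω)) g)
        congr 2
        ext x
        simp
    _ = ∑ k ∈ Finset.Ico (-(n : ℤ)) n, ∫⁻ x in Ioc 0 ω, g x :=
        Finset.sum_congr rfl fun k _ => lintegral_period hg k
    _ = 2 * n * ∫⁻ x in Ioc 0 ω, g x := by
        rw [Finset.sum_const, Int.card_Ico, nsmul_eq_mul]
        congr 1
        have : (((n : ℤ) - -(n : ℤ)).toNat) = 2 * n := by omega
        rw [this]; push_cast; rfl

theorem integral_Icc_le_of_periodic {ω : ℝ} {f : ℝ → ℂ}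
    (hf : ∀ a b : ℝ, MemLp f 2 (volume.restrict (Icc a b))) {g : ℝ → ℂ} (hg : ∀ x, ‖f x‖ = ‖g x‖)
    (hper : ∀ x, ‖g (x + ω)‖ = ‖g x‖) {M : ℝ} {n : ℕ} (hn : M < n * ω) :
    ∫ x in Icc (-M) M, ‖f x‖ ^ 2 ≤ 2 * n * ∫ x in Icc 0 ω, ‖f x‖ ^ 2 := by
  rw [← ENNReal.ofReal_le_ofReal_iff (by positivity), ENNReal.ofReal_mul (by positivity),
    ofReal_integral_norm_sq (hf _ _), ofReal_integral_norm_sq (hf _ _)]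
  have h1 : ∫⁻ x in Icc (-M) M, ‖f x‖ₑ ^ 2 ≤ ∫⁻ x in Ioc (-(n * ω)) (n * ω), ‖f x‖ₑ ^ 2 :=
    lintegral_mono_set fun x hx => ⟨by linarith [hx.1], by linarith [hx.2]⟩
  refine h1.trans ((lintegral_union_periods _ (fun x => ?_) n).trans_eq ?_)
  · rw [← ofReal_norm, ← ofReal_norm, hg, hg, hper]
  · rw [restrict_Icc_eq_Ioc]
    congr 1
    rw [ENNReal.ofReal_mul (by norm_num)]
    simp

/-- The `ω`-periodic `H¹_loc` functions. -/
def periodicDomain {ω : ℝ} (hω : 0 < ω) : FormDomain ω where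
  m := volume.restrict (Icc 0 ω)
  W :=
    { carrier := {f | IsH1Loc f ∧ ∀ x, f (x + ω) = f x}
      add_mem' := fun hf hg => ⟨hf.1.add hg.1, fun x => by
        rw [Pi.add_apply, Pi.add_apply, hf.2, hg.2]⟩
      zero_mem' := ⟨IsH1Loc.zero, fun _ => rfl⟩
      smul_mem' := fun c f hf => ⟨hf.1.const_smul c, fun x => by
        rw [Pi.smul_apply, Pi.smul_apply, hf.2]⟩ }
  ac := Measure.restrict_le_self.absolutelyContinuous
  isH1Loc _ hf := hf.1
  memLp _ hf := hf.1.memLp 0 ω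
  memLp_deriv _ hf := hf.1.2 0 ω
  local_bound M := by
    obtain ⟨n, hn⟩ := exists_nat_gt (M / ω)
    rw [div_lt_iff₀ hω] at hn
    refine ⟨2 * n, by positivity, fun f hf => ⟨?_, ?_⟩⟩
    · exact integral_Icc_le_of_periodic hf.1.memLp (fun _ => rfl) (fun x => by rw [hf.2]) hn
    · exact integral_Icc_le_of_periodic hf.1.2 (fun _ => rfl)
        (fun x => by rw [deriv_periodic hf.2]) hn
  closed F f hF hlim hf _ _ := ⟨hf, fun x =>
    tendsto_nhds_unique ((hlim (x + ω)).congr fun n => (hF n).2 x) (hlim x)⟩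
  trace b hb ε hε := by
    obtain ⟨C, hC, h⟩ := lintegral_mul_le hω hb hε
    refine ⟨C, hC, fun f hf => ?_⟩
    have := h f hf.1 0
    simpa [restrict_Icc_eq_Ioc] using this

/-- `H¹(ℝ)`. -/
def lineDomain {ω : ℝ} (hω : 0 < ω) : FormDomain ω where
  m := volume
  W :=
    { carrier := {f | IsH1 f}
      add_mem' := fun {f g} hf hg => by
        refine ⟨hf.1.add hg.1, hf.2.1.add hg.2.1, (hf.2.2.add hg.2.2).ae_eq ?_⟩
        filter_upwards [hf.1.ae_differentiableAt, hg.1.ae_differentiableAt] with x h1 h2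
        rw [Pi.add_apply, deriv_add h1 h2]
      zero_mem' := ⟨IsH1Loc.zero, MemLp.zero, by
        have : deriv (0 : ℝ → ℂ) = 0 := by ext x; simp
        rw [this]; exact MemLp.zero⟩
      smul_mem' := fun c f hf => ⟨hf.1.const_smul c, hf.2.1.const_smul c, by
        have : deriv (c • f) = c • deriv f := by
          ext x
          simp [Pi.smul_def]
        rw [this]
        exact hf.2.2.const_smul c⟩ }
  ac := Measure.AbsolutelyContinuous.rfl
  isH1Loc _ hf := hf.1
  memLp _ hf := hf.2.1
  memLp_deriv _ hf := hf.2.2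
  local_bound M := ⟨1, zero_le_one, fun f hf => by
    rw [one_mul, one_mul]
    exact ⟨setIntegral_le_integral (integrable_norm_sq_of_memLp hf.2.1)
      (Eventually.of_forall fun x => by positivity),
      setIntegral_le_integral (integrable_norm_sq_of_memLp hf.2.2)
      (Eventually.of_forall fun x => by positivity)⟩⟩
  closed _ _ _ _ hf h1 h2 := ⟨hf, h1, h2⟩
  trace b hb ε hε := by
    obtain ⟨C, hC, h⟩ := lintegral_mul_le hω hb hε
    refine ⟨C, hC, fun f hf => ?_⟩
    rw [lintegral_eq_tsum_period hω, lintegral_eq_tsum_period hω (fun x => ‖deriv f x‖ₑ ^ 2),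
      lintegral_eq_tsum_period hω (fun x => ‖f x‖ₑ ^ 2), ← ENNReal.tsum_mul_left,
      ← ENNReal.tsum_mul_left, ← ENNReal.tsum_add]
    exact ENNReal.tsum_le_tsum fun k => h f hf.1 k

theorem mem_periodicDomain {ω : ℝ} {hω : 0 < ω} {f : ℝ → ℂ} :
    f ∈ (periodicDomain hω).W ↔ IsH1Loc f ∧ ∀ x, f (x + ω) = f x := Iff.rfl

theorem H1c.isH1 (v : H1c) : IsH1 v.1 := by
  obtain ⟨R, hR⟩ := v.2.2.isCompact.isBounded.subset_closedBall 0
  have hz : ∀ x ∉ Icc (-(R + 1)) (R + 1), v.1 =ᶠ[𝓝 x] 0 := by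
    intro x hx
    rw [← notMem_tsupport_iff_eventuallyEq]
    intro hx'
    have := hR hx'
    rw [Metric.mem_closedBall, Real.dist_eq, sub_zero, abs_le] at this
    exact hx ⟨by linarith [this.1], by linarith [this.2]⟩
  have e1 : (Icc (-(R + 1)) (R + 1)).indicator v.1 = v.1 := by
    ext x
    by_cases hx : x ∈ Icc (-(R + 1)) (R + 1)
    · exact indicator_of_mem hx _
    · rw [indicator_of_notMem hx]; exact ((hz x hx).eq_of_nhds).symm
  have e2 : (Icc (-(R + 1)) (R + 1)).indicator (deriv v.1) = deriv v.1 := by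
    ext x
    by_cases hx : x ∈ Icc (-(R + 1)) (R + 1)
    · exact indicator_of_mem hx _
    · rw [indicator_of_notMem hx, (hz x hx).deriv_eq]
      simp
  refine ⟨v.2.1, ?_, ?_⟩
  · rw [← e1, memLp_indicator_iff_restrict measurableSet_Icc]
    exact v.2.1.memLp _ _
  · rw [← e2, memLp_indicator_iff_restrict measurableSet_Icc]
    exact v.2.1.2 _ _

/-- A compactly supported `H¹` function as an element of `H¹(ℝ)`. -/
def H1c.toLine {ω : ℝ} (hω : 0 < ω) (v : H1c) : (lineDomain hω).Carrier :=
  FormDomain.of v.1 (H1c.isH1 v)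

/-- The complex conjugate of a compactly supported function. -/
def H1c.conj (v : H1c) : H1c :=
  ⟨fun x => (starRingEnd ℂ) (v.1 x), v.2.1.conj, by
    have := v.2.2.comp_left (g := fun z : ℂ => (starRingEnd ℂ) z) (map_zero _)
    exact this⟩

/-! ### Cutoff functions -/

/-- The trapezoidal cutoff: `1` on `[-R, R]`, `0` outside `[-(R + ω), R + ω]`, linear between. -/
def trapezoid (ω R : ℝ) (x : ℝ) : ℂ := ((max 0 (min 1 ((R + ω - |x|) / ω)) : ℝ) : ℂ)

theorem trapezoid_lipschitz {ω : ℝ} (hω : 0 < ω) (R : ℝ) :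
    LipschitzWith (Real.toNNReal (1 / ω)) (trapezoid ω R) := by
  refine LipschitzWith.of_dist_le_mul fun x y => ?_
  rw [Real.coe_toNNReal _ (by positivity)]
  unfold trapezoid
  rw [Complex.dist_eq, ← Complex.ofReal_sub, Complex.norm_real, Real.dist_eq, Real.norm_eq_abs]
  calc _ ≤ |(R + ω - |x|) / ω - (R + ω - |y|) / ω| := by
        refine (abs_max_sub_max_le_max _ _ _ _).trans (max_le (by simp) ?_)
        refine (abs_min_sub_min_le_max _ _ _ _).trans (max_le (by simp) le_rfl)
    _ = 1 / ω * |(|y| - |x|)| := by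
        rw [show (R + ω - |x|) / ω - (R + ω - |y|) / ω = 1 / ω * (|y| - |x|) by ring, abs_mul,
          abs_of_pos (by positivity)]
    _ ≤ 1 / ω * |x - y| := by
        refine mul_le_mul_of_nonneg_left ?_ (by positivity)
        rw [abs_sub_comm x y]
        exact abs_abs_sub_abs_le y x

theorem trapezoid_eq_one {ω : ℝ} (hω : 0 < ω) {R x : ℝ} (hx : |x| ≤ R) : trapezoid ω R x = 1 := by
  unfold trapezoid
  have : 1 ≤ (R + ω - |x|) / ω := by rw [le_div_iff₀ hω]; linarith
  rw [min_eq_left this, max_eq_right zero_le_one]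
  simp

theorem trapezoid_eq_zero {ω : ℝ} (hω : 0 < ω) {R x : ℝ} (hx : R + ω ≤ |x|) :
    trapezoid ω R x = 0 := by
  unfold trapezoid
  have : (R + ω - |x|) / ω ≤ 0 := div_nonpos_of_nonpos_of_nonneg (by linarith) hω.le
  rw [max_eq_left ((min_le_right _ _).trans this)]
  simp

theorem norm_trapezoid_le (ω R x : ℝ) : ‖trapezoid ω R x‖ ≤ 1 := by
  unfold trapezoid
  rw [Complex.norm_real, Real.norm_eq_abs, abs_of_nonneg (le_max_left _ _)]
  exact max_le zero_le_one (min_le_left _ _)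

theorem conj_trapezoid (ω R x : ℝ) : conj (trapezoid ω R x) = trapezoid ω R x :=
  Complex.conj_ofReal _

theorem trapezoid_isH1Loc {ω : ℝ} (hω : 0 < ω) (R : ℝ) : IsH1Loc (trapezoid ω R) :=
  IsH1Loc.of_lipschitz (trapezoid_lipschitz hω R)

theorem norm_deriv_trapezoid_le {ω : ℝ} (hω : 0 < ω) (R x : ℝ) :
    ‖deriv (trapezoid ω R) x‖ ≤ 1 / ω := by
  have := norm_deriv_le_of_lipschitz (x₀ := x) (trapezoid_lipschitz hω R)
  rwa [Real.coe_toNNReal _ (by positivity)] at this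

theorem trapezoid_mem {ω : ℝ} (hω : 0 < ω) (R : ℝ) : trapezoid ω R ∈ H1c := by
  refine ⟨trapezoid_isH1Loc hω R, HasCompactSupport.intro
    (isCompact_Icc (a := -(R + ω)) (b := R + ω)) fun x hx => trapezoid_eq_zero hω ?_⟩
  by_contra hc
  exact hx (abs_le.1 (not_le.1 hc).le)

theorem deriv_trapezoid_eq_zero {ω : ℝ} (hω : 0 < ω) {R x : ℝ} (hx : |x| < R ∨ R + ω < |x|) :
    deriv (trapezoid ω R) x = 0 := by
  rcases hx with hx | hx
  · have : trapezoid ω R =ᶠ[𝓝 x] fun _ => 1 := by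
      have h : ∀ᶠ y in 𝓝 x, |y| < R := continuous_abs.continuousAt.eventually (gt_mem_nhds hx)
      filter_upwards [h] with y hy using trapezoid_eq_one hω hy.le
    rw [this.deriv_eq, deriv_const]
  · have : trapezoid ω R =ᶠ[𝓝 x] fun _ => 0 := by
      have h : ∀ᶠ y in 𝓝 x, R + ω < |y| := continuous_abs.continuousAt.eventually (lt_mem_nhds hx)
      filter_upwards [h] with y hy using trapezoid_eq_zero hω hy.le
    rw [this.deriv_eq, deriv_const]

/-- Multiplication by a cutoff function gives a compactly supported function. -/
def cutoff {ω : ℝ} (hω : 0 < ω) (R : ℝ) (f : ℝ → ℂ) (hf : IsH1Loc f) : H1c :=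
  mulH1c ⟨trapezoid ω R, trapezoid_mem hω R⟩ f hf

theorem cutoff_apply {ω : ℝ} (hω : 0 < ω) (R : ℝ) (f : ℝ → ℂ) (hf : IsH1Loc f) (x : ℝ) :
    (cutoff hω R f hf).1 x = trapezoid ω R x * f x := rfl

/-- Compactly supported functions are dense in `H¹(ℝ)`. -/
theorem dense_H1c {ω : ℝ} (hω : 0 < ω) : DenseRange (H1c.toLine hω) := by
  intro f
  refine mem_closure_of_tendsto (b := atTop) (f := fun n : ℕ => H1c.toLine hω (cutoff hω n f f.h1))
    ?_ (Eventually.of_forall fun n => ⟨_, rfl⟩)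
  have hf : IsH1 f := f.mem
  have i1 := integrable_norm_sq_of_memLp hf.2.1
  have i2 := integrable_norm_sq_of_memLp hf.2.2
  -- the `L²` mass of `f` and `f'` far out
  have hJ : Tendsto (fun n : ℕ => ∫ x, ‖trapezoid ω n x * f x - f x‖ ^ 2) atTop (𝓝 0) := by
    have := tendsto_integral_of_dominated_convergence (μ := volume)
      (F := fun (n : ℕ) x => ‖trapezoid ω n x * f x - f x‖ ^ 2) (f := fun _ => 0)
      (fun x => 4 * ‖f x‖ ^ 2) ?_ (i1.const_mul 4) ?_ ?_
    · simpa using this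
    · intro n
      have h1 := (trapezoid_isH1Loc hω n).continuous
      have h2 := f.h1.continuous
      exact Continuous.aestronglyMeasurable (by fun_prop)
    · intro n
      refine Eventually.of_forall fun x => ?_
      rw [Real.norm_eq_abs, abs_of_nonneg (by positivity)]
      have h1 : ‖trapezoid ω n x * f x - f x‖ ≤ 2 * ‖f x‖ := by
        refine (norm_sub_le _ _).trans ?_
        rw [norm_mul]
        nlinarith [norm_trapezoid_le ω n x, norm_nonneg (f x)]
      calc _ ≤ (2 * ‖f x‖) ^ 2 := pow_le_pow_left₀ (norm_nonneg _) h1 2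
        _ = _ := by ring
    · refine Eventually.of_forall fun x => ?_
      refine tendsto_const_nhds.congr' ?_
      obtain ⟨N, hN⟩ := exists_nat_ge |x|
      filter_upwards [eventually_ge_atTop N] with n hn
      rw [trapezoid_eq_one hω (hN.trans (by exact_mod_cast hn))]
      simp
  have hD : Tendsto (fun n : ℕ => ∫ x, ‖deriv (fun x => trapezoid ω n x * f x) x - deriv f x‖ ^ 2)
      atTop (𝓝 0) := by
    have := tendsto_integral_of_dominated_convergence (μ := volume)
      (F := fun (n : ℕ) x => ‖deriv (fun x => trapezoid ω n x * f x) x - deriv f x‖ ^ 2)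
      (f := fun _ => 0)
      (fun x => 8 * ‖deriv f x‖ ^ 2 + 2 * (1 / ω) ^ 2 * ‖f x‖ ^ 2) ?_
      ((i2.const_mul 8).add (i1.const_mul _)) ?_ ?_
    · simpa using this
    · intro n
      exact (((aestronglyMeasurable_deriv _ _).sub (aestronglyMeasurable_deriv _ _)).norm.pow 2)
    · intro n
      filter_upwards [(trapezoid_isH1Loc hω n).deriv_mul_ae f.h1] with x hx
      rw [Real.norm_eq_abs, abs_of_nonneg (by positivity), hx]
      have h1 : ‖deriv (trapezoid ω n) x * f x + trapezoid ω n x * deriv f x - deriv f x‖ ≤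
          1 / ω * ‖f x‖ + 2 * ‖deriv f x‖ := by
        refine (norm_sub_le _ _).trans ?_
        have h2 := norm_add_le (deriv (trapezoid ω n) x * f x) (trapezoid ω n x * deriv f x)
        rw [norm_mul, norm_mul] at h2
        have h3 := mul_le_mul_of_nonneg_right (norm_deriv_trapezoid_le hω n x) (norm_nonneg (f x))
        have h4 := mul_le_mul_of_nonneg_right (norm_trapezoid_le ω n x) (norm_nonneg (deriv f x))
        linarith
      have h2 := pow_le_pow_left₀ (norm_nonneg _) h1 2
      nlinarith [sq_nonneg (1 / ω * ‖f x‖ - 2 * ‖deriv f x‖)]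
    · refine Eventually.of_forall fun x => ?_
      refine tendsto_const_nhds.congr' ?_
      obtain ⟨N, hN⟩ := exists_nat_gt |x|
      filter_upwards [eventually_ge_atTop N] with n hn
      have hn' : |x| < n := hN.trans_le (by exact_mod_cast hn)
      have : (fun x => trapezoid ω n x * f x) =ᶠ[𝓝 x] f := by
        have h : ∀ᶠ y in 𝓝 x, |y| < (n : ℝ) :=
          continuous_abs.continuousAt.eventually (gt_mem_nhds hn')
        filter_upwards [h] with y hy
        rw [trapezoid_eq_one hω hy.le, one_mul]
      rw [this.deriv_eq]
      simp
  rw [tendsto_iff_norm_sub_tendsto_zero]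
  have h5 := (hJ.add hD).sqrt
  simp only [add_zero, Real.sqrt_zero] at h5
  refine h5.congr fun n => ?_
  have e1 := (lineDomain hω).norm_sq (H1c.toLine hω (cutoff hω n f f.h1) - f)
  rw [(lineDomain hω).norm_J_sq, (lineDomain hω).norm_D_sq] at e1
  rw [← Real.sqrt_sq (norm_nonneg (H1c.toLine hω (cutoff hω n f f.h1) - f)), e1]
  congr 2
  refine integral_congr_ae ?_
  filter_upwards [((trapezoid_isH1Loc hω n).mul f.h1).ae_differentiableAt,
    f.h1.ae_differentiableAt] with x h1 h2
  rw [FormDomain.coe_sub]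
  have : deriv ((H1c.toLine hω (cutoff hω n f f.h1)).fn - f.fn) x =
      deriv (fun x => trapezoid ω n x * f x) x - deriv f x := deriv_sub h1 h2
  rw [this]

/-! ### Periodization -/

theorem IsH1Loc.sum {ι : Type*} (s : Finset ι) {f : ι → ℝ → ℂ} (hf : ∀ i ∈ s, IsH1Loc (f i)) :
    IsH1Loc fun x => ∑ i ∈ s, f i x := by
  classical
  induction s using Finset.induction_on with
  | empty => simpa using IsH1Loc.const 0
  | insert a s ha ih =>
    simp only [Finset.sum_insert ha]
    exact (hf a (Finset.mem_insert_self _ _)).add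
      (ih fun i hi => hf i (Finset.mem_insert_of_mem hi))

theorem H1c.exists_support (v : H1c) :
    ∃ R : ℝ, 0 < R ∧ (∀ x, R ≤ |x| → v.1 x = 0) ∧ ∀ x, R ≤ |x| → deriv v.1 x = 0 := by
  obtain ⟨R, hR⟩ := v.2.2.isCompact.isBounded.subset_closedBall 0
  have hz : ∀ x, |R| + 1 ≤ |x| → v.1 =ᶠ[𝓝 x] 0 := by
    intro x hx
    rw [← notMem_tsupport_iff_eventuallyEq]
    intro hx'
    have := hR hx'
    rw [Metric.mem_closedBall, Real.dist_eq, sub_zero] at this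
    linarith [le_abs_self R]
  refine ⟨|R| + 1, by positivity, fun x hx => (hz x hx).eq_of_nhds, fun x hx => ?_⟩
  rw [(hz x hx).deriv_eq]
  simp

theorem integrableOn_dens {Q v g : ℝ → ℂ} (hQ : IsH1Loc Q) (hv : IsH1Loc v) (hg : IsH1Loc g)
    (α : ℂ) (a b : ℝ) : IntegrableOn (dens α Q v g) (Icc a b) := by
  have h1 := (integrableOn_of_memLp_mul (hv.2 a b) (hg.2 a b)).const_mul α
  have h2 := integrableOn_of_memLp_mul (hQ.memLp a b) ((hv.mul hg).memLp a b)
  have h3 := integrableOn_of_memLp_mul (hQ.2 a b) ((hv.mul hg).2 a b)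
  refine ((h1.add h2).add h3).congr (ae_restrict_of_ae ?_)
  filter_upwards [hv.deriv_mul_ae hg] with x hx
  simp only [Pi.add_apply, dens, hx]

theorem integrable_of_integrableOn_Icc {g : ℝ → ℂ} (hg : ∀ a b, IntegrableOn g (Icc a b)) {R : ℝ}
    (hR : ∀ x, R ≤ |x| → g x = 0) : Integrable g := by
  rw [← integrableOn_iff_integrable_of_support_subset (s := Icc (-R) R)]
  · exact hg _ _
  · intro x hx
    rw [mem_Icc, ← abs_le]
    by_contra hc
    exact hx (hR x (not_le.1 hc).le)

theorem integrable_dens_H1c {Q g : ℝ → ℂ} (hQ : IsH1Loc Q) (v : H1c) (hg : IsH1Loc g) (α : ℂ) :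
    Integrable (dens α Q v.1 g) := by
  obtain ⟨R, -, h1, h2⟩ := H1c.exists_support v
  refine integrable_of_integrableOn_Icc (integrableOn_dens hQ v.2.1 hg α) (R := R) fun x hx => ?_
  simp [dens, h1 x hx, h2 x hx]

/-- The sum of the translates of a function, with the weights `σ ^ k`. -/
def periodize (ω : ℝ) (σ : ℂ) (v : ℝ → ℂ) (x : ℝ) : ℂ := ∑' k : ℤ, σ ^ k * v (x + k * ω)

theorem exists_translate_eq_zero {ω : ℝ} (hω : 0 < ω) {R : ℝ} (M : ℝ) :
    ∃ N : ℕ, ∀ n : ℕ, N ≤ n → ∀ x : ℝ, |x| ≤ M → ∀ k : ℤ, k ∉ Finset.Icc (-(n : ℤ)) n →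
      R ≤ |x + k * ω| := by
  obtain ⟨N, hN⟩ := exists_nat_ge ((R + M) / ω)
  rw [div_le_iff₀ hω] at hN
  refine ⟨N, fun n hn x hx k hk => ?_⟩
  have h1 : (N : ℝ) ≤ n := by exact_mod_cast hn
  have h2 : (n : ℝ) ≤ |(k : ℝ)| := by
    rw [Finset.mem_Icc, not_and_or] at hk
    have : (n : ℤ) ≤ |k| := by
      rcases hk with hk | hk
      · exact le_abs.2 (Or.inr (by omega))
      · exact le_abs.2 (Or.inl (by omega))
    exact_mod_cast this
  have h3 : |(k : ℝ) * ω| = |(k : ℝ)| * ω := by rw [abs_mul, abs_of_pos hω]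
  have h4 := abs_sub_abs_le_abs_sub ((k : ℝ) * ω) (-x)
  rw [sub_neg_eq_add, add_comm, abs_neg] at h4
  have h5 : (N : ℝ) * ω ≤ |(k : ℝ)| * ω := mul_le_mul_of_nonneg_right (h1.trans h2) hω.le
  rw [add_comm] at h4
  rw [add_comm x]
  linarith

theorem periodize_eq_sum {ω : ℝ} (hω : 0 < ω) (σ : ℂ) (v : H1c) (M : ℝ) :
    ∃ N : ℕ, ∀ n : ℕ, N ≤ n → ∀ x : ℝ, |x| ≤ M →
      periodize ω σ v.1 x = ∑ k ∈ Finset.Icc (-(n : ℤ)) n, σ ^ k * v.1 (x + k * ω) := by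
  obtain ⟨R, -, h1, -⟩ := H1c.exists_support v
  obtain ⟨N, hN⟩ := exists_translate_eq_zero hω (R := R) M
  refine ⟨N, fun n hn x hx => tsum_eq_sum fun k hk => ?_⟩
  rw [h1 _ (hN n hn x hx k hk), mul_zero]

theorem isH1Loc_periodize {ω : ℝ} (hω : 0 < ω) (σ : ℂ) (v : H1c) : IsH1Loc (periodize ω σ v.1) := by
  refine IsH1Loc.of_eqOn fun M => ?_
  obtain ⟨N, hN⟩ := periodize_eq_sum hω σ v M
  exact ⟨_, IsH1Loc.sum _ fun (k : ℤ) _ => (v.2.1.comp_add ((k : ℝ) * ω)).const_smul (σ ^ k),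
    fun x hx => hN N le_rfl x (abs_le.2 ⟨hx.1.le, hx.2.le⟩)⟩

theorem periodize_add (ω : ℝ) {σ : ℂ} (hσ : σ ≠ 0) (v : ℝ → ℂ) (x : ℝ) :
    periodize ω σ v (x + ω) = σ⁻¹ * periodize ω σ v x := by
  unfold periodize
  rw [← tsum_mul_left, ← (Equiv.addRight (1 : ℤ)).tsum_eq (fun k => σ⁻¹ * (σ ^ k * v (x + k * ω)))]
  refine tsum_congr fun k => ?_
  rw [Equiv.coe_addRight, zpow_add₀ hσ, zpow_one]
  push_cast
  rw [show x + ω + k * ω = x + (k + 1) * ω by ring]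
  field_simp

theorem periodize_eq_self {ω : ℝ} {v : ℝ → ℂ} (hv : ∀ x, x ∉ Ioo 0 ω → v x = 0) {x : ℝ}
    (hx : x ∈ Icc 0 ω) : periodize ω 1 v x = v x := by
  unfold periodize
  have hω : 0 ≤ ω := hx.1.trans hx.2
  rw [tsum_eq_single 0]
  · simp
  · intro k hk
    rw [hv _ fun h => ?_, mul_zero]
    rcases lt_or_gt_of_ne hk with h0 | h0
    · have : (k : ℝ) ≤ -1 := by exact_mod_cast (by omega : k ≤ -1)
      nlinarith [h.1, hx.2]
    · have : (1 : ℝ) ≤ k := by exact_mod_cast (by omega : 1 ≤ k)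
      nlinarith [h.2, hx.1]

theorem zpow_shift {ω : ℝ} {σ : ℂ} (hσ : σ ≠ 0) {g : ℝ → ℂ} (hg : ∀ x, g (x + ω) = σ * g x)
    (k : ℤ) (x : ℝ) : g (x + k * ω) = σ ^ k * g x := by
  induction k using Int.induction_on with
  | zero => simp
  | succ n ih =>
    push_cast at ih ⊢
    rw [show x + ((n : ℝ) + 1) * ω = x + n * ω + ω by ring, hg, ih, zpow_add₀ hσ, zpow_one]
    ring
  | pred n ih =>
    push_cast at ih ⊢
    have := hg (x + (-(n : ℝ) - 1) * ω)
    rw [show x + (-(n : ℝ) - 1) * ω + ω = x + -(n : ℝ) * ω by ring, ih] at this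
    rw [zpow_sub₀ hσ, zpow_one]
    field_simp
    rw [this]; ring

theorem deriv_shift {ω : ℝ} {σ : ℂ} {g : ℝ → ℂ} (hg : ∀ x, g (x + ω) = σ * g x) (x : ℝ) :
    deriv g (x + ω) = σ * deriv g x := by
  have h := congrFun (deriv_comp_add g ω) x
  rw [← h, show (fun x => g (x + ω)) = fun x => σ * g x from funext hg, deriv_const_mul_field]

/-- The integral of an integrable function over the line as a sum over periods. -/
theorem hasSum_integral_period {ω : ℝ} (hω : 0 < ω) {g : ℝ → ℂ} (hg : Integrable g) :
    HasSum (fun k : ℤ => ∫ x in Ioc 0 ω, g (x + k * ω)) (∫ x, g x) := by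
  have h1 := iUnion_Ioc_zsmul hω
  have h2 := pairwise_disjoint_Ioc_zsmul ω
  have h3 := hasSum_integral_iUnion (μ := volume) (f := g) (fun k => measurableSet_Ioc) h2
    (by rw [h1]; exact hg.integrableOn)
  rw [h1, setIntegral_univ] at h3
  refine h3.congr_fun fun k => ?_
  simp only [zsmul_eq_mul]
  rw [← intervalIntegral.integral_of_le hω.le,
    ← intervalIntegral.integral_of_le (by push_cast; nlinarith),
    intervalIntegral.integral_comp_add_right]
  congr 1
  · ring
  · push_cast; ring

theorem dens_add_period {ω : ℝ} {Q : ℝ → ℂ} (hper : ∀ x, Q (x + ω) = Q x) {σ : ℂ} (hσ : σ ≠ 0)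
    {g : ℝ → ℂ} (hg : ∀ x, g (x + ω) = σ * g x) (α : ℂ) (v : ℝ → ℂ) (k : ℤ) (x : ℝ) :
    dens α Q v g (x + k * ω) = σ ^ k * dens α Q (fun y => v (y + k * ω)) g x := by
  have e1 : Q (x + k * ω) = Q x := by
    have := zpow_shift (σ := 1) one_ne_zero (g := Q) (fun x => by rw [hper, one_mul]) k x
    simpa using this
  have e2 : deriv Q (x + k * ω) = deriv Q x := by
    have := zpow_shift (σ := 1) one_ne_zero (g := deriv Q)
      (fun x => by rw [deriv_periodic hper, one_mul]) k x
    simpa using this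
  simp only [dens, e1, e2, zpow_shift hσ hg, zpow_shift hσ (deriv_shift hg), deriv_comp_add]
  ring

theorem dens_sum {ι : Type*} (s : Finset ι) (α : ℂ) (Q g : ℝ → ℂ) (c : ι → ℂ) (v : ι → ℝ → ℂ)
    (x : ℝ) (hv : ∀ i ∈ s, DifferentiableAt ℝ (v i) x) :
    dens α Q (fun y => ∑ i ∈ s, c i * v i y) g x = ∑ i ∈ s, c i * dens α Q (v i) g x := by
  have e : deriv (fun y => ∑ i ∈ s, c i * v i y) x = ∑ i ∈ s, c i * deriv (v i) x := by
    rw [deriv_fun_sum fun i hi => (hv i hi).const_mul (c i)]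
    exact Finset.sum_congr rfl fun i hi => deriv_const_mul _ (hv i hi)
  simp only [dens, e, Finset.sum_mul, Finset.mul_sum, ← Finset.sum_add_distrib]
  refine Finset.sum_congr rfl fun i _ => ?_
  ring

/-- Unfolding: integrating against a quasi-periodic function over the line amounts to integrating
the periodized test function over one period. -/
theorem integral_dens_unfold {ω : ℝ} (hω : 0 < ω) {Q : ℝ → ℂ} (hQ : IsH1Loc Q)
    (hper : ∀ x, Q (x + ω) = Q x) {σ : ℂ} (hσ : σ ≠ 0) {g : ℝ → ℂ} (hg : IsH1Loc g)
    (hgs : ∀ x, g (x + ω) = σ * g x) (α : ℂ) (v : H1c) :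
    ∫ x, dens α Q v.1 g x = ∫ x in Icc 0 ω, dens α Q (periodize ω σ v.1) g x := by
  obtain ⟨R, -, h1, h2⟩ := H1c.exists_support v
  obtain ⟨N1, hN1⟩ := periodize_eq_sum hω σ v (ω + 1)
  obtain ⟨N2, hN2⟩ := exists_translate_eq_zero hω (R := R) (ω + 1)
  set n := max N1 N2
  have hs := hasSum_integral_period hω (integrable_dens_H1c hQ v hg α)
  rw [← hs.tsum_eq, tsum_eq_sum (s := Finset.Icc (-(n : ℤ)) n), restrict_Icc_eq_Ioc,
    ← integral_finsetSum]
  · refine integral_congr_ae ?_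
    have hd : ∀ᵐ x : ℝ, ∀ k : ℤ, DifferentiableAt ℝ (fun y => v.1 (y + k * ω)) x :=
      ae_all_iff.2 fun k => (v.2.1.comp_add (k * ω)).ae_differentiableAt
    filter_upwards [ae_restrict_of_ae hd, ae_restrict_mem measurableSet_Ioc] with x hx hx2
    simp only [dens_add_period hper hσ hgs]
    rw [← dens_sum _ _ _ _ _ _ _ fun k _ => hx k]
    have he : periodize ω σ v.1 =ᶠ[𝓝 x]
        fun y => ∑ k ∈ Finset.Icc (-(n : ℤ)) n, σ ^ k * v.1 (y + k * ω) := by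
      have h : ∀ᶠ y in 𝓝 x, |y| < ω + 1 := by
        refine continuous_abs.continuousAt.eventually (gt_mem_nhds ?_)
        rw [abs_of_pos hx2.1]; linarith [hx2.2]
      filter_upwards [h] with y hy using hN1 n (le_max_left _ _) y hy.le
    simp only [dens, he.deriv_eq, he.eq_of_nhds]
  · intro k _
    have : IntegrableOn (dens α Q v.1 g) (Icc (0 + k * ω) (ω + k * ω)) :=
      integrableOn_dens hQ v.2.1 hg α _ _
    have mp : MeasurePreserving (fun x : ℝ => x + k * ω) (volume.restrict (Icc 0 ω))
        (volume.restrict (Icc (0 + k * ω) (ω + k * ω))) := by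
      have := (measurePreserving_add_right volume ((k : ℝ) * ω)).restrict_preimage
        (s := Icc (0 + k * ω) (ω + k * ω)) measurableSet_Icc
      rw [preimage_add_const_Icc] at this
      simpa using this
    rw [← restrict_Icc_eq_Ioc]
    exact mp.integrable_comp_of_integrable this
  · intro k hk
    refine setIntegral_eq_zero_of_forall_eq_zero fun x hx => ?_
    have h3 := hN2 n (le_max_right _ _) x (by rw [abs_of_pos hx.1]; linarith [hx.2]) k hk
    simp [dens, h1 _ h3, h2 _ h3]

theorem tent_sub_of_mem {ω : ℝ} (hω : 0 < ω) {j : ℤ} {x : ℝ} (hx : x ∈ Icc (j * ω) ((j + 1) * ω)) :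
    tent ω (x + (-j : ℤ) * ω) + tent ω (x + (-j - 1 : ℤ) * ω) = 1 := by
  have e1 : |x + (-j : ℤ) * ω| = x - j * ω := by
    push_cast
    rw [abs_of_nonneg (by linarith [hx.1])]; ring
  have e2 : |x + (-j - 1 : ℤ) * ω| = (j + 1) * ω - x := by
    push_cast
    rw [abs_of_nonpos (by linarith [hx.2])]; ring
  unfold tent
  rw [e1, e2, ← Complex.ofReal_add, ← Complex.ofReal_one]
  congr 1
  have h1 : 0 ≤ 1 - (x - j * ω) / ω := by
    rw [sub_nonneg, div_le_one hω]; linarith [hx.2]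
  have h2 : 0 ≤ 1 - ((j + 1) * ω - x) / ω := by
    rw [sub_nonneg, div_le_one hω]; linarith [hx.1]
  rw [max_eq_right h1, max_eq_right h2]
  field_simp
  ring

theorem tent_eq_zero {ω : ℝ} (hω : 0 < ω) {x : ℝ} (hx : ω ≤ |x|) : tent ω x = 0 := by
  have : 1 - |x| / ω ≤ 0 := by
    rw [sub_nonpos, le_div_iff₀ hω]
    linarith
  simp [tent, max_eq_left this]

theorem hasSum_tent {ω : ℝ} (hω : 0 < ω) (x : ℝ) :
    HasSum (fun k : ℤ => tent ω (x + k * ω)) 1 := by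
  have hm : x ∈ ⋃ n : ℤ, Ioc (n • ω) ((n + 1) • ω) := by rw [iUnion_Ioc_zsmul hω]; trivial
  obtain ⟨j, hj⟩ := mem_iUnion.1 hm
  simp only [zsmul_eq_mul] at hj
  push_cast at hj
  rw [← tent_sub_of_mem hω (Ioc_subset_Icc_self hj), ← Finset.sum_pair (f := fun k : ℤ =>
    tent ω (x + k * ω)) (show (-j : ℤ) ≠ -j - 1 by omega)]
  refine hasSum_sum_of_ne_finset_zero fun k hk => tent_eq_zero hω ?_
  simp only [Finset.mem_insert, Finset.mem_singleton, not_or] at hk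
  rcases lt_or_gt_of_ne hk.1 with h | h
  · have h2 : k ≤ -j - 2 := by omega
    have h3 : (k : ℝ) ≤ -j - 2 := by exact_mod_cast h2
    refine le_abs.2 (Or.inr ?_)
    nlinarith [hj.2]
  · have h2 : -j + 1 ≤ k := by omega
    have h3 : -(j : ℝ) + 1 ≤ k := by exact_mod_cast h2
    refine le_abs.2 (Or.inl ?_)
    nlinarith [hj.1]

theorem periodize_tent_mul {ω : ℝ} (hω : 0 < ω) {σ : ℂ} (hσ : σ ≠ 0) {h : ℝ → ℂ}
    (hh : ∀ x, h (x + ω) = σ⁻¹ * h x) (x : ℝ) :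
    periodize ω σ (fun y => tent ω y * h y) x = h x := by
  unfold periodize
  have : ∀ k : ℤ, σ ^ k * (tent ω (x + k * ω) * h (x + k * ω)) = h x * tent ω (x + k * ω) := by
    intro k
    rw [zpow_shift (inv_ne_zero hσ) hh, inv_zpow]
    have := zpow_ne_zero k hσ
    field_simp
  simp only [this]
  rw [tsum_mul_left, (hasSum_tent hω x).tsum_eq, mul_one]

/-! ### Periodic distributions have periodic potentials -/

theorem FormDomain.inner_eq_integral {ω : ℝ} (X : FormDomain ω) (f h : X.Carrier) :
    ⟪f, h⟫_ℂ = (∫ x, conj (f x) * h x ∂X.m) + ∫ x, conj (deriv f x) * deriv h x ∂X.m := by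
  rw [X.inner_eq, ← FormDomain.inner_toLp f.memLp h.memLp,
    ← FormDomain.inner_toLp f.memLp_deriv h.memLp_deriv]
  rfl

/-- Complex conjugation of periodic functions. -/
def conjPeriodic {ω : ℝ} {hω : 0 < ω} (f : (periodicDomain hω).Carrier) :
    (periodicDomain hω).Carrier :=
  FormDomain.of (fun x => conj (f x))
    ⟨f.h1.conj, fun x => congrArg conj ((mem_periodicDomain.1 f.mem).2 x)⟩

theorem conjPeriodic_fn {ω : ℝ} {hω : 0 < ω} (f : (periodicDomain hω).Carrier) :
    (conjPeriodic f).fn = fun x => conj (f x) := rfl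

theorem conjPeriodic_conjPeriodic {ω : ℝ} {hω : 0 < ω} (f : (periodicDomain hω).Carrier) :
    conjPeriodic (conjPeriodic f) = f :=
  FormDomain.coe_ext fun _ => Complex.conj_conj _

theorem inner_conjPeriodic {ω : ℝ} {hω : 0 < ω} (f h : (periodicDomain hω).Carrier) :
    ⟪conjPeriodic f, conjPeriodic h⟫_ℂ = conj ⟪f, h⟫_ℂ := by
  rw [FormDomain.inner_eq_integral, FormDomain.inner_eq_integral, map_add, ← integral_conj,
    ← integral_conj]
  simp only [conjPeriodic_fn, deriv_conj, map_mul]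

/-- The Riesz representation on one period: a real functional on periodic `H¹` functions is of the
form `p - p''` with a real periodic `H¹_loc` function `p`. -/
theorem exists_potential {ω : ℝ} (hω : 0 < ω) (Λ : (periodicDomain hω).Carrier →L[ℂ] ℂ)
    (hΛ : ∀ f g : (periodicDomain hω).Carrier, (∀ x, g x = conj (f x)) → Λ g = conj (Λ f)) :
    ∃ p, Potential ω p ∧ ∀ f : (periodicDomain hω).Carrier,
      Λ f = ∫ x in Icc 0 ω, dens 0 p f (fun _ => 1) x := by
  obtain ⟨g, hg⟩ := (InnerProductSpace.toDual ℂ (periodicDomain hω).Carrier).surjective Λ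
  have hg' : ∀ f, Λ f = ⟪g, f⟫_ℂ := fun f => by rw [← hg]; rfl
  have hreal : conjPeriodic g = g := by
    refine ext_inner_right ℂ fun f => ?_
    rw [← conjPeriodic_conjPeriodic f, inner_conjPeriodic, ← hg', ← hg',
      hΛ f (conjPeriodic f) fun x => rfl, conjPeriodic_conjPeriodic, Complex.conj_conj]
  have hgr : ∀ x, conj (g x) = g x :=
    fun x => congrArg (fun h : (periodicDomain hω).Carrier => h x) hreal
  have hp : Potential ω g := ⟨g.h1, (mem_periodicDomain.1 g.mem).2, hgr⟩
  refine ⟨g, hp, fun f => ?_⟩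
  rw [hg', FormDomain.inner_eq_integral, ← integral_add
    (FormDomain.integrable_conj_mul g.memLp f.memLp)
    (FormDomain.integrable_conj_mul g.memLp_deriv f.memLp_deriv)]
  refine integral_congr_ae (Eventually.of_forall fun x => ?_)
  simp only [dens, hgr, hp.deriv_real, deriv_const]
  ring

theorem tent_eq_trapezoid {ω : ℝ} (hω : 0 < ω) : tent ω = trapezoid ω 0 := by
  ext x
  unfold tent trapezoid
  have e : (0 + ω - |x|) / ω = 1 - |x| / ω := by field_simp; ring
  rw [e, min_eq_right]
  have : 0 ≤ |x| / ω := by positivity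
  linarith

theorem norm_tent_le {ω : ℝ} (hω : 0 < ω) (x : ℝ) : ‖tent ω x‖ ≤ 1 := by
  rw [tent_eq_trapezoid hω]; exact norm_trapezoid_le _ _ _

/-- `tent · f` as a compactly supported function. -/
abbrev tentMul {ω : ℝ} (hω : 0 < ω) (f : ℝ → ℂ) (hf : IsH1Loc f) : H1c :=
  mulH1c ⟨tent ω, tent_mem hω⟩ f hf

theorem h1Norm_tentMul_le {ω : ℝ} (hω : 0 < ω) :
    ∃ C : ℝ, 0 ≤ C ∧ ∀ f : (periodicDomain hω).Carrier, h1Norm (tentMul hω f f.h1).1 ≤ C * ‖f‖ := by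
  obtain ⟨C, hC, h⟩ := (periodicDomain hω).local_bound ω
  refine ⟨Real.sqrt ((1 + 2 * (1 / ω) ^ 2 + 2) * C), Real.sqrt_nonneg _, fun f => ?_⟩
  obtain ⟨h1, h2⟩ := h _ f.mem
  rw [← (periodicDomain hω).norm_J_sq] at h1
  rw [← (periodicDomain hω).norm_D_sq] at h2
  have hJ := pow_le_pow_left₀ (norm_nonneg _) ((periodicDomain hω).norm_J_le f) 2
  have hD := pow_le_pow_left₀ (norm_nonneg _) ((periodicDomain hω).norm_D_le f) 2
  have i1 := integrable_norm_sq_of_memLp (f.h1.memLp (-ω) ω)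
  have i2 := integrable_norm_sq_of_memLp (f.h1.2 (-ω) ω)
  have hz : ∀ x ∉ Icc (-ω) ω, ω < |x| := by
    intro x hx
    by_contra hc
    exact hx (abs_le.1 (not_lt.1 hc))
  have a1 : ∫ x, ‖(tentMul hω f f.h1).1 x‖ ^ 2 ≤ ∫ x in Icc (-ω) ω, ‖f x‖ ^ 2 := by
    rw [← setIntegral_eq_integral_of_forall_compl_eq_zero (s := Icc (-ω) ω)]
    · refine integral_mono_of_nonneg (Eventually.of_forall fun x => by positivity) i1
        (Eventually.of_forall fun x => ?_)
      refine pow_le_pow_left₀ (norm_nonneg _) ?_ 2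
      change ‖tent ω x * f x‖ ≤ _
      rw [norm_mul]
      exact mul_le_of_le_one_left (norm_nonneg _) (norm_tent_le hω x)
    · intro x hx
      change ‖tent ω x * f x‖ ^ 2 = 0
      rw [tent_eq_zero hω (hz x hx).le]
      simp
  have a2 : ∫ x, ‖deriv (tentMul hω f f.h1).1 x‖ ^ 2 ≤
      ∫ x in Icc (-ω) ω, (2 * (1 / ω) ^ 2 * ‖f x‖ ^ 2 + 2 * ‖deriv f x‖ ^ 2) := by
    rw [← setIntegral_eq_integral_of_ae_compl_eq_zero (s := Icc (-ω) ω)]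
    · refine integral_mono_of_nonneg (Eventually.of_forall fun x => by positivity)
        ((i1.const_mul _).add (i2.const_mul _)) (ae_restrict_of_ae ?_)
      filter_upwards [(tent_mem hω).1.deriv_mul_ae f.h1] with x hx
      change ‖deriv (fun x => tent ω x * f x) x‖ ^ 2 ≤ _
      rw [hx]
      have b1 : ‖deriv (tent ω) x * f x + tent ω x * deriv f x‖ ≤ 1 / ω * ‖f x‖ + ‖deriv f x‖ := by
        refine (norm_add_le _ _).trans ?_
        rw [norm_mul, norm_mul]
        refine add_le_add (mul_le_mul_of_nonneg_right ?_ (norm_nonneg _))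
          (mul_le_of_le_one_left (norm_nonneg _) (norm_tent_le hω x))
        rw [tent_eq_trapezoid hω]
        exact norm_deriv_trapezoid_le hω 0 x
      have b2 := pow_le_pow_left₀ (norm_nonneg _) b1 2
      nlinarith [sq_nonneg (1 / ω * ‖f x‖ - ‖deriv f x‖)]
    · filter_upwards [(tent_mem hω).1.deriv_mul_ae f.h1] with x hx hx2
      change ‖deriv (fun x => tent ω x * f x) x‖ ^ 2 = 0
      have h5 := hz x hx2
      rw [hx, tent_eq_zero hω h5.le, tent_eq_trapezoid hω,
        deriv_trapezoid_eq_zero hω (Or.inr (by simpa using h5))]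
      simp
  rw [integral_add (i1.const_mul _) (i2.const_mul _), integral_const_mul, integral_const_mul] at a2
  unfold h1Norm
  rw [← Real.sqrt_sq (norm_nonneg f), ← Real.sqrt_mul (by positivity)]
  refine Real.sqrt_le_sqrt ?_
  have c1 : ∫ x in Icc (-ω) ω, ‖f x‖ ^ 2 ≤ C * ‖f‖ ^ 2 :=
    h1.trans (mul_le_mul_of_nonneg_left hJ hC)
  have c2 : ∫ x in Icc (-ω) ω, ‖deriv f x‖ ^ 2 ≤ C * ‖f‖ ^ 2 :=
    h2.trans (mul_le_mul_of_nonneg_left hD hC)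
  have c3 := mul_le_mul_of_nonneg_left c1 (show 0 ≤ 2 * (1 / ω) ^ 2 by positivity)
  linarith

theorem HNegOneLoc.IsPeriodic.pair_shift {q : HNegOneLoc} {ω : ℝ} (hq : q.IsPeriodic ω) (k : ℤ) :
    ∀ h h' : H1c, (∀ x, h'.1 x = h.1 (x + k * ω)) → q.pair h' = q.pair h := by
  have tr : ∀ (h : H1c) (c : ℝ), (fun x => h.1 (x + c)) ∈ H1c := fun h c =>
    ⟨h.2.1.comp_add c, h.2.2.comp_homeomorph (Homeomorph.addRight c)⟩
  induction k using Int.induction_on with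
  | zero =>
    intro h h' hh
    congr 1
    exact Subtype.ext (funext fun x => by simpa using hh x)
  | succ n ih =>
    intro h h' hh
    rw [← ih h ⟨_, tr h (n * ω)⟩ fun x => by simp]
    refine (hq h' _ fun x => ?_).symm
    change h.1 (x + n * ω) = h'.1 (x - ω)
    rw [hh]
    push_cast; ring_nf
  | pred n ih =>
    intro h h' hh
    rw [← ih h ⟨_, tr h (-n * ω)⟩ fun x => by simp]
    refine hq _ h' fun x => ?_
    change h'.1 x = h.1 (x - ω + -n * ω)
    rw [hh]
    push_cast; ring_nf

/-- The pairing with a compactly supported function is the pairing over one period with its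
periodization. -/
theorem HNegOneLoc.IsPeriodic.pair_eq {q : HNegOneLoc} {ω : ℝ} (hω : 0 < ω) (hq : q.IsPeriodic ω)
    (v : H1c) : q.pair v = q.pair (tentMul hω (periodize ω 1 v.1) (isH1Loc_periodize hω 1 v)) := by
  obtain ⟨R, -, hR, -⟩ := H1c.exists_support v
  obtain ⟨N1, hN1⟩ := periodize_eq_sum hω 1 v ω
  obtain ⟨N2, hN2⟩ := exists_translate_eq_zero hω (R := ω) R
  set n := max N1 N2
  have hv : ∀ k : ℤ, IsH1Loc fun x => v.1 (x + k * ω) := fun k => v.2.1.comp_add _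
  have ht : ∀ k : ℤ, IsH1Loc fun x => tent ω (x + k * ω) := fun k => (tent_mem hω).1.comp_add _
  have e1 : tentMul hω (periodize ω 1 v.1) (isH1Loc_periodize hω 1 v) =
      ∑ k ∈ Finset.Icc (-(n : ℤ)) n, tentMul hω _ (hv k) := by
    refine Subtype.ext (funext fun x => ?_)
    rw [Submodule.coe_sum, Finset.sum_apply]
    change tent ω x * periodize ω 1 v.1 x =
      ∑ k ∈ Finset.Icc (-(n : ℤ)) n, tent ω x * v.1 (x + k * ω)
    rw [← Finset.mul_sum]
    by_cases hx : |x| ≤ ω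
    · rw [hN1 n (le_max_left _ _) x hx]
      simp
    · rw [tent_eq_zero hω (not_le.1 hx).le]
      simp
  have e2 : v = ∑ k ∈ Finset.Icc (-(n : ℤ)) n, mulH1c v _ (ht k) := by
    refine Subtype.ext (funext fun x => ?_)
    rw [Submodule.coe_sum, Finset.sum_apply]
    change v.1 x = ∑ k ∈ Finset.Icc (-(n : ℤ)) n, v.1 x * tent ω (x + k * ω)
    rw [← Finset.mul_sum]
    by_cases hx : |x| ≤ R
    · rw [← (hasSum_tent hω x).unique (hasSum_sum_of_ne_finset_zero fun k hk =>
        tent_eq_zero hω (hN2 n (le_max_right _ _) x hx k hk)), mul_one]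
    · rw [hR x (not_le.1 hx).le, zero_mul]
  conv_lhs => rw [e2]
  rw [e1, map_sum, map_sum, ← Finset.sum_equiv (Equiv.neg ℤ) (s := Finset.Icc (-(n : ℤ)) n)
    (t := Finset.Icc (-(n : ℤ)) n) (f := fun k => q.pair (mulH1c v _ (ht (-k))))]
  · refine Finset.sum_congr rfl fun k _ => ?_
    refine (hq.pair_shift k _ _ fun x => ?_).symm
    change tent ω x * v.1 (x + k * ω) = v.1 (x + k * ω) * tent ω (x + k * ω + (-k : ℤ) * ω)
    rw [mul_comm]
    congr 2
    push_cast; ring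
  · intro k
    simp only [Finset.mem_Icc, Equiv.neg_apply]
    omega
  · intro k _
    simp

theorem mem_periodicDomain_periodize {ω : ℝ} (hω : 0 < ω) (v : H1c) :
    periodize ω 1 v.1 ∈ (periodicDomain hω).W :=
  ⟨isH1Loc_periodize hω 1 v, fun x => by rw [periodize_add _ one_ne_zero, inv_one, one_mul]⟩

/-- A real periodic `q ∈ H⁻¹_loc(ℝ)` has the form `p - p''`. -/
theorem HNegOneLoc.IsPeriodic.exists_potential {q : HNegOneLoc} {ω : ℝ} (hω : 0 < ω)
    (hq : q.IsPeriodic ω) (hr : q.IsReal) :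
    ∃ p, Potential ω p ∧ ∀ v : H1c, q.pair v = ∫ x, dens 0 p v.1 (fun _ => 1) x := by
  obtain ⟨C, hC⟩ := q.bounded ω
  obtain ⟨C', hC', h'⟩ := h1Norm_tentMul_le hω
  have hb : ∀ f : (periodicDomain hω).Carrier,
      ‖q.pair (tentMul hω f f.h1)‖ ≤ (|C| * C') * ‖f‖ := by
    intro f
    refine (hC _ fun x hx => ?_).trans ?_
    · change tent ω x * f x = 0
      rw [tent_eq_zero hω hx.le, zero_mul]
    · have h0 : 0 ≤ h1Norm (tentMul hω f f.h1).1 := Real.sqrt_nonneg _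
      calc _ ≤ |C| * h1Norm (tentMul hω f f.h1).1 :=
            mul_le_mul_of_nonneg_right (le_abs_self C) h0
        _ ≤ |C| * (C' * ‖f‖) := mul_le_mul_of_nonneg_left (h' f) (abs_nonneg C)
        _ = _ := by ring
  let Λ : (periodicDomain hω).Carrier →L[ℂ] ℂ := LinearMap.mkContinuous
    { toFun := fun f => q.pair (tentMul hω f f.h1)
      map_add' := fun f g => by
        rw [← map_add]
        congr 1
        exact Subtype.ext (funext fun x => mul_add _ _ _)
      map_smul' := fun c f => by
        rw [← map_smul]
        congr 1
        exact Subtype.ext (funext fun x => mul_left_comm _ _ _) } (|C| * C') hb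
  have hΛ : ∀ f, Λ f = q.pair (tentMul hω f f.h1) := fun f => rfl
  obtain ⟨p, hp, h⟩ := PeriodicSL.exists_potential hω Λ fun f g hfg => by
    rw [hΛ, hΛ]
    refine hr _ _ fun x => ?_
    change tent ω x * g x = conj (tent ω x * f x)
    rw [hfg, map_mul]
    congr 1
    exact (Complex.conj_ofReal _).symm
  refine ⟨p, hp, fun v => ?_⟩
  rw [hq.pair_eq hω, integral_dens_unfold hω hp.h1 hp.periodic (one_ne_zero (α := ℂ))
    (IsH1Loc.const 1) (fun x => (one_mul _).symm)]
  exact h (FormDomain.of _ (mem_periodicDomain_periodize hω v))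

theorem dens_mul_ae {Q v g : ℝ → ℂ} (hv : IsH1Loc v) (hg : IsH1Loc g) :
    ∀ᵐ x : ℝ, dens 0 Q (fun y => v y * g y) (fun _ => 1) x = dens 0 Q v g x := by
  filter_upwards [hv.deriv_mul_ae hg] with x hx
  simp only [dens, hx, deriv_const]
  ring

theorem dens_eq_add_dens_zero (α : ℂ) (Q v g : ℝ → ℂ) (x : ℝ) :
    dens α Q v g x = α * (deriv v x * deriv g x) + dens 0 Q v g x := by
  simp only [dens]; ring

section Represent

variable {q : HNegOneLoc} {ω : ℝ} {p : ℝ → ℂ}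

/-- The weak Schrödinger expression with the potential `q = p - p''`. -/
theorem weakSchrodinger_eq (hp : Potential ω p)
    (hq : ∀ v : H1c, q.pair v = ∫ x, dens 0 p v.1 (fun _ => 1) x) (f : ℝ → ℂ) (hf : IsH1Loc f)
    (v : H1c) : weakSchrodinger q f hf v = ∫ x, dens 1 p v.1 f x := by
  have e1 : ∫ x, dens 0 p (mulH1c v f hf).1 (fun _ => 1) x = ∫ x, dens 0 p v.1 f x :=
    integral_congr_ae (dens_mul_ae v.2.1 hf)
  have i1 : Integrable fun x => deriv v.1 x * deriv f x := by
    have := integrable_dens_H1c (IsH1Loc.const 0) v hf 1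
    refine this.congr (Eventually.of_forall fun x => ?_)
    simp [dens]
  rw [weakSchrodinger, hq, e1, ← integral_add i1 (integrable_dens_H1c hp.h1 v hf 0)]
  refine integral_congr_ae (Eventually.of_forall fun x => ?_)
  rw [dens_eq_add_dens_zero 1, one_mul]

theorem thetaForm_eq (hω : 0 < ω) (hp : Potential ω p)
    (hq : ∀ v : H1c, q.pair v = ∫ x, dens 0 p v.1 (fun _ => 1) x) {θ : ℝ} {v f : ℝ → ℂ}
    (hv : IsQuasiPeriodic ω θ v) (hf : IsQuasiPeriodic ω θ f) :
    thetaForm hω q v f hv.1 hf.1 = ∫ x in Icc 0 ω, dens 1 p (fun x => conj (v x)) f x := by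
  have hh : IsH1Loc fun x => conj (v x) * f x := hv.1.conj.mul hf.1
  have hper : ∀ x, conj (v (x + ω)) * f (x + ω) = conj (v x) * f x := by
    intro x
    rw [hv.2, hf.2, map_mul, ← Complex.exp_conj]
    simp only [map_mul, Complex.conj_I, Complex.conj_ofReal]
    have : Complex.exp (-Complex.I * θ) * Complex.exp (Complex.I * θ) = 1 := by
      rw [← Complex.exp_add]; simp
    linear_combination (conj (v x) * f x) * this
  have e1 : ∫ x, dens 0 p (tentMul hω _ hh).1 (fun _ => 1) x =
      ∫ x in Icc 0 ω, dens 0 p (fun x => conj (v x)) f x := by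
    rw [integral_dens_unfold hω hp.h1 hp.periodic (one_ne_zero (α := ℂ))
      (IsH1Loc.const 1) (fun x => (one_mul _).symm)]
    have e2 : periodize ω 1 (tentMul hω _ hh).1 = fun x => conj (v x) * f x := by
      ext x
      exact periodize_tent_mul hω one_ne_zero (h := fun x => conj (v x) * f x)
        (fun x => by rw [hper, inv_one, one_mul]) x
    rw [e2]
    exact integral_congr_ae (ae_restrict_of_ae (dens_mul_ae hv.1.conj hf.1))
  have i1 : IntegrableOn (fun x => conj (deriv v x) * deriv f x) (Icc 0 ω) :=
    FormDomain.integrable_conj_mul (hv.1.2 0 ω) (hf.1.2 0 ω)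
  rw [thetaForm, hq, e1, ← integral_add i1 (integrableOn_dens hp.h1 hv.1.conj hf.1 0 0 ω)]
  refine integral_congr_ae (Eventually.of_forall fun x => ?_)
  simp only
  rw [dens_eq_add_dens_zero 1, one_mul, deriv_conj]

end Represent

/-! ### Periodic weights -/

/-- A signed measure on `[0, ω)`, in the form of its two mutually singular parts. -/
structure Weight (ω : ℝ) where
  /-- the positive part -/
  pos : Measure ℝ
  /-- the negative part -/
  neg : Measure ℝ
  finite_pos : IsFiniteMeasure pos
  finite_neg : IsFiniteMeasure neg
  pos_compl : pos (Ico 0 ω)ᶜ = 0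
  neg_compl : neg (Ico 0 ω)ᶜ = 0
  mutuallySingular : pos ⟂ₘ neg

attribute [instance] Weight.finite_pos Weight.finite_neg

/-- The Jordan decomposition of a signed measure carried by `[0, ω)`. -/
def weightOf {ω : ℝ} (μ : SignedMeasure ℝ)
    (hμ : ∀ E : Set ℝ, MeasurableSet E → Disjoint E (Ico 0 ω) → μ E = 0) : Weight ω where
  pos := posPart μ
  neg := negPart μ
  finite_pos := inferInstance
  finite_neg := inferInstance
  pos_compl := by
    obtain ⟨i, hi, h1, h2, h3, -⟩ := μ.toJordanDecomposition_spec
    rw [posPart, h3, SignedMeasure.toMeasureOfZeroLE_apply _ _ _ measurableSet_Ico.compl]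
    have := hμ (i ∩ (Ico 0 ω)ᶜ) (hi.inter measurableSet_Ico.compl)
      (disjoint_compl_left.mono_left inter_subset_right)
    simp only [this]
    rfl
  neg_compl := by
    obtain ⟨i, hi, h1, h2, -, h3⟩ := μ.toJordanDecomposition_spec
    rw [negPart, h3, SignedMeasure.toMeasureOfLEZero_apply _ _ _ measurableSet_Ico.compl]
    have := hμ (iᶜ ∩ (Ico 0 ω)ᶜ) (hi.compl.inter measurableSet_Ico.compl)
      (disjoint_compl_left.mono_left inter_subset_right)
    simp only [this, neg_zero]
    rfl
  mutuallySingular := μ.toJordanDecomposition.mutuallySingular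

theorem integrable_of_carried {ω : ℝ} {ν : Measure ℝ} [IsFiniteMeasure ν]
    (hν : ν (Ico 0 ω)ᶜ = 0) {h : ℝ → ℂ} (hh : Continuous h) : Integrable h ν := by
  obtain ⟨C, hC⟩ := isCompact_Icc.exists_bound_of_continuousOn (hh.continuousOn (s := Icc 0 ω))
  refine Integrable.of_bound hh.aestronglyMeasurable C ?_
  filter_upwards [measure_eq_zero_iff_ae_notMem.1 hν] with x hx
  exact hC x (Ico_subset_Icc_self (not_not.1 hx))

theorem norm_integral_le_of_carried {ω : ℝ} {ν : Measure ℝ} [IsFiniteMeasure ν]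
    (hν : ν (Ico 0 ω)ᶜ = 0) {h : ℝ → ℂ} {C : ℝ} (hC : ∀ x ∈ Ico 0 ω, ‖h x‖ ≤ C) :
    ‖∫ x, h x ∂ν‖ ≤ C * ν.real univ := by
  refine norm_integral_le_of_norm_le_const ?_
  filter_upwards [measure_eq_zero_iff_ae_notMem.1 hν] with x hx
  exact hC x (not_not.1 hx)

namespace Weight

variable {ω : ℝ} (r : Weight ω)

/-- The weight with the opposite sign. -/
def swap : Weight ω where
  pos := r.neg
  neg := r.pos
  finite_pos := r.finite_neg
  finite_neg := r.finite_pos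
  pos_compl := r.neg_compl
  neg_compl := r.pos_compl
  mutuallySingular := r.mutuallySingular.symm

/-- The integral over one period. -/
def pair (h : ℝ → ℂ) : ℂ := (∫ x, h x ∂r.pos) - ∫ x, h x ∂r.neg

/-- The integral over the line with respect to the periodic extension. -/
def linePair (h : ℝ → ℂ) : ℂ :=
  (∫ x, h x ∂(periodicExt ω r.pos)) - ∫ x, h x ∂(periodicExt ω r.neg)

/-- The total variation. -/
def mass : ℝ := r.pos.real univ + r.neg.real univ

theorem mass_nonneg : 0 ≤ r.mass := add_nonneg measureReal_nonneg measureReal_nonneg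

theorem norm_pair_le {h : ℝ → ℂ} {C : ℝ} (hC : ∀ x ∈ Ico 0 ω, ‖h x‖ ≤ C) :
    ‖r.pair h‖ ≤ C * r.mass := by
  refine (norm_sub_le _ _).trans ?_
  rw [mass, mul_add]
  exact add_le_add (norm_integral_le_of_carried r.pos_compl hC)
    (norm_integral_le_of_carried r.neg_compl hC)

theorem pair_add {f g : ℝ → ℂ} (hf : Continuous f) (hg : Continuous g) :
    r.pair (f + g) = r.pair f + r.pair g := by
  simp only [pair, Pi.add_apply]
  rw [integral_add (integrable_of_carried r.pos_compl hf) (integrable_of_carried r.pos_compl hg),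
    integral_add (integrable_of_carried r.neg_compl hf) (integrable_of_carried r.neg_compl hg)]
  ring

theorem pair_smul (c : ℂ) (f : ℝ → ℂ) : r.pair (c • f) = c * r.pair f := by
  simp only [pair, Pi.smul_apply, smul_eq_mul, integral_const_mul]
  ring

theorem pair_conj (f : ℝ → ℂ) : r.pair (fun x => conj (f x)) = conj (r.pair f) := by
  simp only [pair, integral_conj, map_sub]

theorem exists_potential (hω : 0 < ω) :
    ∃ s, Potential ω s ∧ ∀ h : ℝ → ℂ, IsH1Loc h → (∀ x, h (x + ω) = h x) →
      r.pair h = ∫ x in Icc 0 ω, dens 0 s h (fun _ => 1) x := by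
  obtain ⟨C, hC, hb⟩ := (periodicDomain hω).exists_norm_apply_le ω
  let Λ : (periodicDomain hω).Carrier →L[ℂ] ℂ := LinearMap.mkContinuous
    { toFun := fun f => r.pair f
      map_add' := fun f g => r.pair_add f.h1.continuous g.h1.continuous
      map_smul' := fun c f => r.pair_smul c f } (C * r.mass) fun f => by
    have := r.norm_pair_le (h := f) (C := C * ‖f‖) fun x hx =>
      hb f x ⟨by linarith [hx.1], hx.2.le⟩
    calc _ ≤ C * ‖f‖ * r.mass := this
      _ = _ := by ring
  obtain ⟨s, hs, h⟩ := PeriodicSL.exists_potential hω Λ fun f g hfg => by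
    change r.pair g = conj (r.pair f)
    rw [← pair_conj]
    congr 1
    exact funext hfg
  exact ⟨s, hs, fun f h1 h2 => h (FormDomain.of f ⟨h1, h2⟩)⟩

end Weight

theorem lintegral_periodicExt {ω : ℝ} (ν : Measure ℝ) {g : ℝ → ENNReal} (hg : Measurable g) :
    ∫⁻ x, g x ∂(periodicExt ω ν) = ∑' n : ℤ, ∫⁻ x, g (x + n * ω) ∂ν := by
  rw [periodicExt, lintegral_sum_measure]
  refine tsum_congr fun n => ?_
  rw [lintegral_map hg (by fun_prop)]

/-- `H¹` functions are square integrable with respect to a periodic measure. -/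
theorem lintegral_periodicExt_le {ω : ℝ} (hω : 0 < ω) {ν : Measure ℝ} [IsFiniteMeasure ν]
    (hν : ν (Ico 0 ω)ᶜ = 0) {f : ℝ → ℂ} (hf : IsH1Loc f) :
    ∫⁻ x, ‖f x‖ₑ ^ 2 ∂(periodicExt ω ν) ≤
      ν univ * ((∫⁻ x, ‖deriv f x‖ₑ ^ 2) + ENNReal.ofReal (1 / ω + 1) * ∫⁻ x, ‖f x‖ₑ ^ 2) := by
  rw [lintegral_periodicExt ν (hf.continuous.enorm.measurable.pow_const 2),
    lintegral_eq_tsum_period hω (fun x => ‖deriv f x‖ₑ ^ 2),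
    lintegral_eq_tsum_period hω (fun x => ‖f x‖ₑ ^ 2), ← ENNReal.tsum_mul_left, ← ENNReal.tsum_add,
    ← ENNReal.tsum_mul_left]
  refine ENNReal.tsum_le_tsum fun k => ?_
  rw [mul_comm (ν univ), ← lintegral_const]
  refine lintegral_mono_ae ?_
  filter_upwards [measure_eq_zero_iff_ae_notMem.1 hν] with x hx
  have hx' : x ∈ Ico 0 ω := not_not.1 hx
  have hkk : (k : ℝ) * ω < (k + 1) * ω := by nlinarith
  have h2 := hf.norm_sq_le hkk one_pos (x := x + k * ω) ⟨by linarith [hx'.1], by linarith [hx'.2]⟩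
  have e : ((k : ℝ) + 1) * ω - k * ω = ω := by ring
  rw [e] at h2
  have h3 := ENNReal.ofReal_le_ofReal h2
  rwa [ENNReal.ofReal_pow (norm_nonneg _), ofReal_norm, ENNReal.ofReal_add (by positivity)
    (by positivity), ENNReal.ofReal_mul zero_le_one, ENNReal.ofReal_mul (by positivity),
    ofReal_integral_norm_sq (hf.2 _ _), ofReal_integral_norm_sq (hf.memLp _ _),
    restrict_Icc_eq_Ioc, ENNReal.ofReal_one, one_mul, div_one] at h3

theorem IsH1.memLp_periodicExt {ω : ℝ} (hω : 0 < ω) {ν : Measure ℝ} [IsFiniteMeasure ν]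
    (hν : ν (Ico 0 ω)ᶜ = 0) {f : ℝ → ℂ} (hf : IsH1 f) : MemLp f 2 (periodicExt ω ν) := by
  refine memLp_two_of_lintegral_lt_top hf.1.continuous.aestronglyMeasurable
    ((lintegral_periodicExt_le hω hν hf.1).trans_lt ?_)
  exact ENNReal.mul_lt_top (measure_lt_top _ _) (ENNReal.add_lt_top.2
    ⟨lintegral_lt_top_of_memLp hf.2.2, ENNReal.mul_lt_top ENNReal.ofReal_lt_top
      (lintegral_lt_top_of_memLp hf.2.1)⟩)

/-- The restriction of `H¹(ℝ)` functions to a periodic measure, as a bounded operator. -/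
def traceOp {ω : ℝ} (hω : 0 < ω) (ν : Measure ℝ) [IsFiniteMeasure ν] (hν : ν (Ico 0 ω)ᶜ = 0) :
    (lineDomain hω).Carrier →L[ℂ] Lp ℂ 2 (periodicExt ω ν) :=
  LinearMap.mkContinuousOfExistsBound
    { toFun := fun f => (IsH1.memLp_periodicExt hω hν f.mem).toLp f
      map_add' := fun f g => MemLp.toLp_add _ _
      map_smul' := fun c f => MemLp.toLp_const_smul c _ } <| by
    refine ⟨Real.sqrt (ν.real univ * (1 / ω + 1)), fun f => ?_⟩
    refine le_of_sq_le_sq ?_ (by positivity)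
    rw [mul_pow, Real.sq_sqrt (by positivity)]
    change ‖(IsH1.memLp_periodicExt hω hν f.mem).toLp f‖ ^ 2 ≤ _
    rw [FormDomain.norm_toLp_sq, ← ENNReal.ofReal_le_ofReal_iff (by positivity),
      ofReal_integral_norm_sq (IsH1.memLp_periodicExt hω hν f.mem)]
    refine (lintegral_periodicExt_le hω hν f.h1).trans ?_
    have hf : IsH1 f := f.mem
    rw [(lineDomain hω).norm_sq, (lineDomain hω).norm_J_sq, (lineDomain hω).norm_D_sq, mul_assoc,
      ENNReal.ofReal_mul measureReal_nonneg, ofReal_measureReal]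
    refine mul_le_mul_right ?_ _
    rw [← ofReal_integral_norm_sq hf.2.1, ← ofReal_integral_norm_sq hf.2.2,
      ← ENNReal.ofReal_mul (by positivity), ← ENNReal.ofReal_add (by positivity) (by positivity)]
    refine ENNReal.ofReal_le_ofReal ?_
    change _ ≤ (1 / ω + 1) * ((∫ x, ‖f x‖ ^ 2) + ∫ x, ‖deriv f x‖ ^ 2)
    have h1 : 0 ≤ ∫ x, ‖deriv f x‖ ^ 2 := integral_nonneg fun x => by positivity
    have h2 : 0 ≤ 1 / ω * ∫ x, ‖deriv f x‖ ^ 2 := by positivity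
    linarith

theorem inner_traceOp {ω : ℝ} (hω : 0 < ω) (ν : Measure ℝ) [IsFiniteMeasure ν]
    (hν : ν (Ico 0 ω)ᶜ = 0) (f g : (lineDomain hω).Carrier) :
    ⟪traceOp hω ν hν f, traceOp hω ν hν g⟫_ℂ = ∫ x, conj (f x) * g x ∂(periodicExt ω ν) :=
  FormDomain.inner_toLp (IsH1.memLp_periodicExt hω hν f.mem) (IsH1.memLp_periodicExt hω hν g.mem)

theorem integrable_periodicExt_H1c {ω : ℝ} (hω : 0 < ω) {ν : Measure ℝ} [IsFiniteMeasure ν]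
    (hν : ν (Ico 0 ω)ᶜ = 0) (v : H1c) : Integrable v.1 (periodicExt ω ν) := by
  obtain ⟨R, -, hR, -⟩ := H1c.exists_support v
  have h1 := IsH1.memLp_periodicExt hω hν (H1c.isH1 ⟨trapezoid ω R, trapezoid_mem hω R⟩)
  have h2 := IsH1.memLp_periodicExt hω hν (H1c.isH1 v)
  refine (h1.integrable_mul h2).congr (Eventually.of_forall fun x => ?_)
  change trapezoid ω R x * v.1 x = v.1 x
  by_cases hx : |x| ≤ R
  · rw [trapezoid_eq_one hω hx, one_mul]
  · rw [hR x (not_le.1 hx).le, mul_zero]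

theorem integral_periodicExt_H1c {ω : ℝ} (hω : 0 < ω) {ν : Measure ℝ} [IsFiniteMeasure ν]
    (hν : ν (Ico 0 ω)ᶜ = 0) (v : H1c) :
    ∫ x, v.1 x ∂(periodicExt ω ν) = ∫ x, periodize ω 1 v.1 x ∂ν := by
  obtain ⟨R, -, hR, -⟩ := H1c.exists_support v
  obtain ⟨N1, hN1⟩ := periodize_eq_sum hω 1 v ω
  obtain ⟨N2, hN2⟩ := exists_translate_eq_zero hω (R := R) ω
  set n := max N1 N2
  have hm : ∀ k : ℤ, ∫ x, v.1 x ∂(ν.map fun x => x + k * ω) = ∫ x, v.1 (x + k * ω) ∂ν :=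
    fun k => integral_map (by fun_prop) v.2.1.continuous.aestronglyMeasurable
  have hs := hasSum_integral_measure (integrable_periodicExt_H1c hω hν v)
  have hae : ∀ᵐ x ∂ν, |x| ≤ ω := by
    filter_upwards [measure_eq_zero_iff_ae_notMem.1 hν] with x hx
    have hx' : x ∈ Ico 0 ω := not_not.1 hx
    rw [abs_of_nonneg hx'.1]; exact hx'.2.le
  rw [periodicExt, ← hs.tsum_eq, tsum_eq_sum (s := Finset.Icc (-(n : ℤ)) n)]
  · simp only [hm]
    rw [← integral_finsetSum]
    · refine integral_congr_ae ?_
      filter_upwards [hae] with x hx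
      rw [hN1 n (le_max_left _ _) x hx]
      simp
    · intro k _
      exact integrable_of_carried hν (v.2.1.comp_add _).continuous
  · intro k hk
    rw [hm]
    refine integral_eq_zero_of_ae ?_
    filter_upwards [hae] with x hx
    exact hR _ (hN2 n (le_max_right _ _) x hx k hk)

namespace Weight

variable {ω : ℝ} (r : Weight ω) {s : ℝ → ℂ}

theorem linePair_H1c (hω : 0 < ω) (hs : Potential ω s)
    (h : ∀ h : ℝ → ℂ, IsH1Loc h → (∀ x, h (x + ω) = h x) →
      r.pair h = ∫ x in Icc 0 ω, dens 0 s h (fun _ => 1) x) (v : H1c) :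
    r.linePair v.1 = ∫ x, dens 0 s v.1 (fun _ => 1) x := by
  rw [integral_dens_unfold hω hs.h1 hs.periodic (one_ne_zero (α := ℂ)) (IsH1Loc.const 1)
    (fun x => (one_mul _).symm), linePair, integral_periodicExt_H1c hω r.pos_compl,
    integral_periodicExt_H1c hω r.neg_compl]
  have := mem_periodicDomain_periodize hω v
  exact h _ this.1 this.2

theorem linePair_mul_H1c (hω : 0 < ω) (hs : Potential ω s)
    (h : ∀ h : ℝ → ℂ, IsH1Loc h → (∀ x, h (x + ω) = h x) →
      r.pair h = ∫ x in Icc 0 ω, dens 0 s h (fun _ => 1) x) (v : H1c) {g : ℝ → ℂ}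
    (hg : IsH1Loc g) :
    r.linePair (fun x => v.1 x * g x) = ∫ x, dens 0 s v.1 g x := by
  refine (r.linePair_H1c hω hs h (mulH1c v g hg)).trans ?_
  exact integral_congr_ae (dens_mul_ae v.2.1 hg)

theorem linePair_conj_mul (hω : 0 < ω) (hs : Potential ω s)
    (h : ∀ h : ℝ → ℂ, IsH1Loc h → (∀ x, h (x + ω) = h x) →
      r.pair h = ∫ x in Icc 0 ω, dens 0 s h (fun _ => 1) x) (f g : (lineDomain hω).Carrier) :
    r.linePair (fun x => conj (f x) * g x) = ⟪f, (lineDomain hω).potOp s g⟫_ℂ := by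
  rw [linePair, ← inner_traceOp hω r.pos r.pos_compl, ← inner_traceOp hω r.neg r.neg_compl]
  refine (dense_H1c hω).induction_on₂ (p := fun f g =>
    ⟪traceOp hω r.pos r.pos_compl f, traceOp hω r.pos r.pos_compl g⟫_ℂ -
    ⟪traceOp hω r.neg r.neg_compl f, traceOp hω r.neg r.neg_compl g⟫_ℂ =
    ⟪f, (lineDomain hω).potOp s g⟫_ℂ) ?_ ?_ f g
  · refine isClosed_eq ?_ ?_
    · fun_prop
    · fun_prop
  · intro v w
    rw [inner_traceOp, inner_traceOp]
    have e1 := (lineDomain hω).inner_form_eq hs 0 (H1c.toLine hω v) (H1c.toLine hω w)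
    rw [zero_mul, zero_add] at e1
    rw [e1]
    exact r.linePair_mul_H1c hω hs h (H1c.conj v) w.2.1

theorem pair_conj_mul (hω : 0 < ω) (hs : Potential ω s)
    (h : ∀ h : ℝ → ℂ, IsH1Loc h → (∀ x, h (x + ω) = h x) →
      r.pair h = ∫ x in Icc 0 ω, dens 0 s h (fun _ => 1) x) (f g : (periodicDomain hω).Carrier) :
    r.pair (fun x => conj (f x) * g x) = ⟪f, (periodicDomain hω).potOp s g⟫_ℂ := by
  have e1 := (periodicDomain hω).inner_form_eq hs 0 f g
  rw [zero_mul, zero_add] at e1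
  have hf := mem_periodicDomain.1 f.mem
  have hg := mem_periodicDomain.1 g.mem
  rw [e1, h _ (hf.1.conj.mul hg.1) fun x => by rw [hf.2, hg.2]]
  exact integral_congr_ae (ae_restrict_of_ae (dens_mul_ae hf.1.conj hg.1))

end Weight

/-! ### Solutions of the differential equation: unique continuation and Floquet theory -/

theorem integral_norm_mul_norm_sq_le {m : Measure ℝ} {f g : ℝ → ℂ} (hf : MemLp f 2 m)
    (hg : MemLp g 2 m) :
    (∫ x, ‖f x‖ * ‖g x‖ ∂m) ^ 2 ≤ (∫ x, ‖f x‖ ^ 2 ∂m) * ∫ x, ‖g x‖ ^ 2 ∂m := by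
  have hf' : MemLp (fun x => ((‖f x‖ : ℝ) : ℂ)) 2 m := hf.norm.ofReal
  have hg' : MemLp (fun x => ((‖g x‖ : ℝ) : ℂ)) 2 m := hg.norm.ofReal
  have h1 := norm_inner_le_norm (𝕜 := ℂ) hf'.toLp hg'.toLp
  have h2 := pow_le_pow_left₀ (norm_nonneg _) h1 2
  rw [mul_pow, FormDomain.norm_toLp_sq, FormDomain.norm_toLp_sq, FormDomain.inner_toLp] at h2
  have e : ∫ x, conj ((‖f x‖ : ℝ) : ℂ) * ((‖g x‖ : ℝ) : ℂ) ∂m =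
      ((∫ x, ‖f x‖ * ‖g x‖ ∂m : ℝ) : ℂ) := by
    rw [← integral_complex_ofReal]
    refine integral_congr_ae (Eventually.of_forall fun x => ?_)
    simp only [Complex.conj_ofReal, Complex.ofReal_mul]
  rw [e, Complex.norm_real, Real.norm_eq_abs, sq_abs] at h2
  simpa using h2

/-- A weak solution of `-α ψ'' + (Q - Q'') ψ = 0`. -/
def IsSol (α : ℂ) (Q ψ : ℝ → ℂ) : Prop :=
  IsH1Loc ψ ∧ ∀ v : H1c, ∫ x, dens α Q v.1 ψ x = 0

/-- On intervals of length `ℓ` the energy `A ∫ |ψ'|²` of a function with a zero dominates the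
potential terms. -/
def IsSmallLength (A : ℝ) (Q : ℝ → ℂ) (ℓ : ℝ) : Prop :=
  0 < ℓ ∧ ∀ a : ℝ, ℓ * (∫ x in Icc a (a + ℓ), ‖Q x‖) +
    2 * (√ℓ * √(∫ x in Icc a (a + ℓ), ‖deriv Q x‖ ^ 2)) < A

theorem setIntegral_Icc_le_period {ω : ℝ} (hω : 0 < ω) {g : ℝ → ℝ} (h0 : ∀ x, 0 ≤ g x)
    (hg : ∀ a b, IntegrableOn g (Icc a b)) (hper : ∀ x, g (x + ω) = g x) {ℓ : ℝ} (hℓ : ℓ ≤ ω)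
    (a : ℝ) : ∫ x in Icc a (a + ℓ), g x ≤ ∫ x in Icc 0 ω, g x := by
  have hp : Function.Periodic g ω := hper
  calc ∫ x in Icc a (a + ℓ), g x ≤ ∫ x in Icc a (a + ω), g x :=
        setIntegral_mono_set (hg _ _) (Eventually.of_forall h0)
          (Icc_subset_Icc le_rfl (by linarith)).eventuallyLE
    _ = ∫ x in Icc 0 ω, g x := by
        rw [integral_Icc_eq_integral_Ioc, integral_Icc_eq_integral_Ioc,
          ← intervalIntegral.integral_of_le (by linarith), ← intervalIntegral.integral_of_le hω.le,
          hp.intervalIntegral_add_eq a 0, zero_add]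

theorem eventually_isSmallLength {ω : ℝ} (hω : 0 < ω) {Q : ℝ → ℂ} (hQ : IsH1Loc Q)
    (hper : ∀ x, Q (x + ω) = Q x) {A : ℝ} (hA : 0 < A) :
    ∀ᶠ ℓ in 𝓝[>] (0 : ℝ), IsSmallLength A Q ℓ := by
  set M := ∫ x in Icc 0 ω, ‖Q x‖
  set E := √(∫ x in Icc 0 ω, ‖deriv Q x‖ ^ 2)
  have hc : Continuous fun ℓ : ℝ => ℓ * M + 2 * (√ℓ * E) := by fun_prop
  have h0 := hc.tendsto 0
  simp only [zero_mul, Real.sqrt_zero, mul_zero, add_zero] at h0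
  filter_upwards [(h0.mono_left nhdsWithin_le_nhds).eventually (gt_mem_nhds hA),
    self_mem_nhdsWithin, (nhdsWithin_le_nhds : 𝓝[>] (0 : ℝ) ≤ 𝓝 0) (gt_mem_nhds hω)]
    with ℓ h1 h2 h3
  refine ⟨h2, fun a => lt_of_le_of_lt ?_ h1⟩
  have h2' : (0 : ℝ) ≤ ℓ := le_of_lt h2
  have b1 := setIntegral_Icc_le_period hω (g := fun x => ‖Q x‖) (fun x => norm_nonneg _)
    (fun a b => ((hQ.memLp a b).integrable (by norm_num)).norm) (fun x => by rw [hper])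
    (le_of_lt h3) a
  have b2 := setIntegral_Icc_le_period hω (g := fun x => ‖deriv Q x‖ ^ 2)
    (fun x => by positivity)
    (fun a b => integrable_norm_sq_of_memLp (hQ.2 a b)) (fun x => by rw [deriv_periodic hper])
    (le_of_lt h3) a
  have b3 := Real.sqrt_le_sqrt b2
  gcongr

/-- The energy estimate on a short interval. -/
theorem eq_zero_of_energy {α : ℂ} {Q ψ : ℝ → ℂ} (hQ : IsH1Loc Q) (hψ : IsH1Loc ψ) {a ℓ : ℝ}
    (hℓ : IsSmallLength ‖α‖ Q ℓ) {k : ℂ} {v : ℝ → ℂ} (hv : IsH1Loc v)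
    (hint : ∫ x, dens α Q v ψ x = 0)
    (h1 : ∀ x ∈ Ioo a (a + ℓ), v x = conj (ψ x - k))
    (h2 : ∀ᵐ x, x ∉ Icc a (a + ℓ) → dens α Q v ψ x = 0)
    {x₀ x₁ : ℝ} (hx₀ : x₀ ∈ Icc a (a + ℓ)) (hx₁ : x₁ ∈ Icc a (a + ℓ)) (h0 : ψ x₀ = 0)
    (hk : ψ x₁ = k) {x : ℝ} (hx : x ∈ Icc a (a + ℓ)) : ψ x = 0 := by
  obtain ⟨hℓ0, hℓ⟩ := hℓ
  set I := Icc a (a + ℓ)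
  set N := ∫ t in I, ‖deriv ψ t‖
  set S := ∫ t in I, ‖deriv ψ t‖ ^ 2
  have hN0 : 0 ≤ N := integral_nonneg fun x => norm_nonneg _
  have hS0 : 0 ≤ S := integral_nonneg fun x => by positivity
  -- `ψ` vanishes at `x₀` and equals `k` at `x₁`, so its variation `N` bounds both `ψ` and `ψ - k`
  have b1 : ∀ y ∈ I, ‖ψ y‖ ≤ N := fun y hy => by
    have := hψ.norm_sub_le hy hx₀
    rwa [h0, sub_zero] at this
  have b2 : ∀ y ∈ I, ‖ψ y - k‖ ≤ N := fun y hy => by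
    have := hψ.norm_sub_le hy hx₁
    rwa [hk] at this
  have cs1 : N ^ 2 ≤ ℓ * S := by
    have h3 := integral_norm_mul_norm_sq_le (memLp_const (1 : ℂ)) (hψ.2 a (a + ℓ))
    simp only [norm_one, one_mul, one_pow, integral_const, smul_eq_mul, mul_one] at h3
    have e : (volume.restrict (Icc a (a + ℓ))).real univ = ℓ := by
      rw [measureReal_restrict_apply_univ, Real.volume_real_Icc_of_le (by linarith)]; ring
    rwa [e] at h3
  set M := ∫ t in I, ‖Q t‖
  set E := √(∫ t in I, ‖deriv Q t‖ ^ 2)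
  have cs2 : ∫ t in I, ‖deriv Q t‖ * ‖deriv ψ t‖ ≤ E * √S := by
    rw [← Real.sqrt_mul (integral_nonneg fun x => by positivity)]
    exact Real.le_sqrt_of_sq_le (integral_norm_mul_norm_sq_le (hQ.2 a (a + ℓ)) (hψ.2 a (a + ℓ)))
  have hNs : N ≤ √ℓ * √S := by
    rw [← Real.sqrt_mul hℓ0.le]
    exact Real.le_sqrt_of_sq_le cs1
  have iQ : IntegrableOn (fun t => ‖Q t‖) I := ((hQ.memLp a (a + ℓ)).integrable (by norm_num)).norm
  have iQψ : IntegrableOn (fun t => ‖deriv Q t‖ * ‖deriv ψ t‖) I :=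
    MemLp.integrable_mul (p := 2) (q := 2) (hQ.2 a (a + ℓ)).norm (hψ.2 a (a + ℓ)).norm
  have iS : IntegrableOn (fun t => ‖deriv ψ t‖ ^ 2) I :=
    integrable_norm_sq_of_memLp (hψ.2 a (a + ℓ))
  -- the identity `∫ dens = 0`, solved for the energy
  have key : ‖α‖ * S ≤ N ^ 2 * M + 2 * N * ∫ t in I, ‖deriv Q t‖ * ‖deriv ψ t‖ := by
    have e1 : ∫ t in I, dens α Q v ψ t = 0 := by
      rw [← hint]
      exact setIntegral_eq_integral_of_ae_compl_eq_zero h2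
    have e2 : ∀ᵐ t ∂(volume.restrict I), ‖dens α Q v ψ t - α * ((‖deriv ψ t‖ ^ 2 : ℝ) : ℂ)‖ ≤
        N ^ 2 * ‖Q t‖ + 2 * N * (‖deriv Q t‖ * ‖deriv ψ t‖) := by
      rw [restrict_Icc_eq_Ioc, ← restrict_Ioo_eq_restrict_Ioc]
      filter_upwards [ae_restrict_mem measurableSet_Ioo] with t ht
      have d1 : v t = conj (ψ t - k) := h1 t ht
      have d2 : deriv v t = conj (deriv ψ t) := by
        have : v =ᶠ[𝓝 t] fun y => conj (ψ y - k) := by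
          filter_upwards [isOpen_Ioo.mem_nhds ht] with y hy using h1 y hy
        rw [this.deriv_eq, congrFun (deriv_conj fun y => ψ y - k) t, deriv_sub_const]
      have d3 : dens α Q v ψ t - α * ((‖deriv ψ t‖ ^ 2 : ℝ) : ℂ) = Q t * (conj (ψ t - k) * ψ t) +
          deriv Q t * (conj (deriv ψ t) * ψ t + conj (ψ t - k) * deriv ψ t) := by
        rw [dens, d1, d2, mul_comm (conj (deriv ψ t)) (deriv ψ t), Complex.mul_conj,
          Complex.normSq_eq_norm_sq]
        ring
      rw [d3]
      have c1 := b1 t (Ioo_subset_Icc_self ht)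
      have c2 := b2 t (Ioo_subset_Icc_self ht)
      refine (norm_add_le _ _).trans ?_
      rw [norm_mul, norm_mul, norm_mul, RCLike.norm_conj]
      have c3 : ‖conj (deriv ψ t) * ψ t + conj (ψ t - k) * deriv ψ t‖ ≤ 2 * N * ‖deriv ψ t‖ := by
        refine (norm_add_le _ _).trans ?_
        rw [norm_mul, norm_mul, RCLike.norm_conj, RCLike.norm_conj]
        nlinarith [norm_nonneg (deriv ψ t)]
      have c4 : ‖ψ t - k‖ * ‖ψ t‖ ≤ N ^ 2 := by nlinarith [norm_nonneg (ψ t), norm_nonneg (ψ t - k)]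
      have c5 := mul_le_mul_of_nonneg_left c3 (norm_nonneg (deriv Q t))
      have c6 := mul_le_mul_of_nonneg_left c4 (norm_nonneg (Q t))
      linarith
    have i1 : IntegrableOn (dens α Q v ψ) I := integrableOn_dens hQ hv hψ α a (a + ℓ)
    have i2 : IntegrableOn (fun t => α * ((‖deriv ψ t‖ ^ 2 : ℝ) : ℂ)) I := iS.ofReal.const_mul α
    have e3 : ∫ t in I, (dens α Q v ψ t - α * ((‖deriv ψ t‖ ^ 2 : ℝ) : ℂ)) = -(α * (S : ℂ)) := by
      rw [integral_sub i1 i2, e1, integral_const_mul, integral_complex_ofReal, zero_sub]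
    have e4 := norm_integral_le_of_norm_le ((iQ.const_mul (N ^ 2)).add (iQψ.const_mul (2 * N))) e2
    rw [e3, norm_neg, norm_mul, Complex.norm_real, Real.norm_eq_abs, abs_of_nonneg hS0] at e4
    refine e4.trans_eq ?_
    simp only [Pi.add_apply]
    rw [integral_add (iQ.const_mul (N ^ 2)) (iQψ.const_mul (2 * N)), integral_const_mul,
      integral_const_mul]
  have hM0 : 0 ≤ M := integral_nonneg fun x => norm_nonneg _
  have hE0 : 0 ≤ E := Real.sqrt_nonneg _
  have hS : S = 0 := by
    by_contra hne
    have hSpos : 0 < S := lt_of_le_of_ne hS0 (Ne.symm hne)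
    have hlt := mul_lt_mul_of_pos_right (hℓ a) hSpos
    have f1 : N * ∫ t in I, ‖deriv Q t‖ * ‖deriv ψ t‖ ≤ (√ℓ * √S) * (E * √S) :=
      mul_le_mul hNs cs2 (integral_nonneg fun x => by positivity) (by positivity)
    have f2 : (√ℓ * √S) * (E * √S) = √ℓ * E * S := by
      calc _ = √ℓ * E * (√S * √S) := by ring
        _ = _ := by rw [Real.mul_self_sqrt hS0]
    have f3 := mul_le_mul_of_nonneg_right cs1 hM0
    change (ℓ * M + 2 * (√ℓ * E)) * S < ‖α‖ * S at hlt
    nlinarith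
  have hN : N ≤ 0 := by rw [hS, mul_zero] at cs1; nlinarith
  exact norm_le_zero_iff.1 ((b1 x hx).trans hN)

theorem IsH1Loc.comp_clamp {f : ℝ → ℂ} (hf : IsH1Loc f) {a b : ℝ} (hab : a ≤ b) :
    IsH1Loc fun x => f (clamp a b x) := (hf.hasWeakDeriv_clamp hab).isH1Loc

namespace IsSol

variable {α : ℂ} {Q ψ : ℝ → ℂ}

/-- A solution with two nearby zeros vanishes between them. -/
theorem eq_zero_of_zeros (hQ : IsH1Loc Q) (h : IsSol α Q ψ) {a ℓ : ℝ}
    (hℓ : IsSmallLength ‖α‖ Q ℓ) (h0 : ψ a = 0) (h1 : ψ (a + ℓ) = 0) {x : ℝ}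
    (hx : x ∈ Icc a (a + ℓ)) : ψ x = 0 := by
  have hab : a ≤ a + ℓ := by linarith [hℓ.1]
  have hz : ∀ y ∉ Icc a (a + ℓ), ψ (clamp a (a + ℓ) y) = 0 := by
    intro y hy
    rw [mem_Icc, not_and_or, not_le, not_le] at hy
    rcases hy with hy | hy
    · rw [clamp_of_le hy.le, h0]
    · rw [clamp_of_ge hab hy.le, h1]
  let v : H1c := ⟨fun y => conj (ψ (clamp a (a + ℓ) y)), (h.1.comp_clamp hab).conj,
    HasCompactSupport.intro (isCompact_Icc (a := a) (b := a + ℓ)) fun y hy => by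
      simp [hz y hy]⟩
  refine eq_zero_of_energy hQ h.1 hℓ (k := 0) v.2.1 (h.2 v) (fun y hy => ?_)
    (Eventually.of_forall fun y hy => ?_) (left_mem_Icc.2 hab) (left_mem_Icc.2 hab) h0 h0 hx
  · change conj (ψ (clamp a (a + ℓ) y)) = _
    rw [clamp_of_mem (Ioo_subset_Icc_self hy), sub_zero]
  · have hev : v.1 =ᶠ[𝓝 y] fun _ => 0 := by
      filter_upwards [isClosed_Icc.isOpen_compl.mem_nhds hy] with z hz'
      change conj (ψ (clamp a (a + ℓ) z)) = 0
      rw [hz z hz', map_zero]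
    simp [dens, hev.eq_of_nhds, hev.deriv_eq]

/-- A solution vanishing on an interval vanishes on the next one. -/
theorem eq_zero_of_eqOn (hQ : IsH1Loc Q) (h : IsSol α Q ψ) {a ℓ : ℝ}
    (hℓ : IsSmallLength ‖α‖ Q ℓ) (h0 : ∀ x ∈ Icc (a - ℓ) a, ψ x = 0) {x : ℝ}
    (hx : x ∈ Icc a (a + ℓ)) : ψ x = 0 := by
  have hℓ0 := hℓ.1
  have hab : a ≤ a + ℓ := by linarith
  have ha : ψ a = 0 := h0 a ⟨by linarith, le_rfl⟩
  -- the test function `conj (ψ - ψ(a + ℓ))` on the interval, cut off where `ψ` vanishes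
  have htr : (fun y => trapezoid ℓ ℓ (y + -(a + ℓ))) ∈ H1c :=
    ⟨(trapezoid_isH1Loc hℓ0 ℓ).comp_add _,
      (trapezoid_mem hℓ0 ℓ).2.comp_homeomorph (Homeomorph.addRight (-(a + ℓ)))⟩
  let v : H1c := mulH1c ⟨_, htr⟩ (fun y => conj (ψ (clamp a (a + ℓ) y) - ψ (a + ℓ)))
    ((h.1.comp_clamp hab).sub (IsH1Loc.const _)).conj
  have hv : ∀ y, v.1 y =
      trapezoid ℓ ℓ (y + -(a + ℓ)) * conj (ψ (clamp a (a + ℓ) y) - ψ (a + ℓ)) := fun y => rfl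
  refine eq_zero_of_energy hQ h.1 hℓ (k := ψ (a + ℓ)) v.2.1 (h.2 v) (fun y hy => ?_)
    ?_ (left_mem_Icc.2 hab) (right_mem_Icc.2 hab) ha rfl hx
  · rw [hv, clamp_of_mem (Ioo_subset_Icc_self hy), trapezoid_eq_one hℓ0, one_mul]
    rw [abs_le]; constructor <;> linarith [hy.1, hy.2]
  · have hne : ∀ᵐ y : ℝ, y ≠ a - ℓ := by simp [ae_iff]
    filter_upwards [hne] with y hya hy
    rw [mem_Icc, not_and_or, not_le, not_le] at hy
    rcases hy with hy | hy
    · rcases lt_or_gt_of_ne hya with hlt | hgt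
      · have hev : v.1 =ᶠ[𝓝 y] fun _ => 0 := by
          filter_upwards [gt_mem_nhds hlt] with z hz
          rw [hv, trapezoid_eq_zero hℓ0, zero_mul]
          exact le_abs.2 (Or.inr (by linarith))
        simp [dens, hev.eq_of_nhds, hev.deriv_eq]
      · have hev : ψ =ᶠ[𝓝 y] fun _ => 0 := by
          filter_upwards [gt_mem_nhds hy, lt_mem_nhds hgt] with z hz1 hz2
          exact h0 z ⟨hz2.le, hz1.le⟩
        simp [dens, hev.eq_of_nhds, hev.deriv_eq]
    · have hev : v.1 =ᶠ[𝓝 y] fun _ => 0 := by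
        filter_upwards [lt_mem_nhds hy] with z hz
        rw [hv, clamp_of_ge hab hz.le, sub_self, map_zero, mul_zero]
      simp [dens, hev.eq_of_nhds, hev.deriv_eq]

theorem eq_zero_of_le (hQ : IsH1Loc Q) (h : IsSol α Q ψ) {a ℓ : ℝ}
    (hℓ : IsSmallLength ‖α‖ Q ℓ) (h0 : ∀ x ∈ Icc (a - ℓ) a, ψ x = 0) {x : ℝ}
    (hx : a ≤ x) : ψ x = 0 := by
  have key : ∀ n : ℕ, ∀ x ∈ Icc (a + n * ℓ - ℓ) (a + n * ℓ), ψ x = 0 := by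
    intro n
    induction n with
    | zero => simpa using h0
    | succ n ih =>
      intro y hy
      push_cast at hy
      exact h.eq_zero_of_eqOn hQ hℓ ih ⟨by linarith [hy.1], by linarith [hy.2]⟩
  obtain ⟨n, hn⟩ := exists_nat_ge ((x - a) / ℓ)
  rw [div_le_iff₀ hℓ.1] at hn
  -- the interval of the partition containing `x`
  have hfl := Nat.floor_le (div_nonneg (sub_nonneg.2 hx) hℓ.1.le)
  have hfl2 := Nat.lt_floor_add_one ((x - a) / ℓ)
  rw [le_div_iff₀ hℓ.1] at hfl
  rw [div_lt_iff₀ hℓ.1] at hfl2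
  refine key (⌊(x - a) / ℓ⌋₊ + 1) x ⟨?_, ?_⟩ <;> push_cast <;> linarith

theorem comp_neg (h : IsSol α Q ψ) : IsSol α (fun x => Q (-x)) fun x => ψ (-x) := by
  refine ⟨h.1.comp_neg, fun v => ?_⟩
  let w : H1c := ⟨fun x => v.1 (-x), v.2.1.comp_neg, v.2.2.comp_homeomorph (Homeomorph.neg ℝ)⟩
  rw [← h.2 w, ← integral_neg_eq_self]
  refine integral_congr_ae (Eventually.of_forall fun x => ?_)
  have e : deriv w.1 x = -deriv v.1 (-x) := congrFun (deriv_comp_neg' v.1) x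
  simp only [dens, deriv_comp_neg', e, neg_neg]
  change _ = α * (-deriv v.1 (-x) * deriv ψ x) + Q x * (v.1 (-x) * ψ x) +
    deriv Q x * (-deriv v.1 (-x) * ψ x + v.1 (-x) * deriv ψ x)
  ring

/-- Unique continuation: a solution is determined by its values at two nearby points. -/
theorem exists_injective {ω : ℝ} (hω : 0 < ω) (hα : α ≠ 0) (hQ : IsH1Loc Q)
    (hper : ∀ x, Q (x + ω) = Q x) :
    ∃ ℓ : ℝ, ∀ ψ, IsSol α Q ψ → ψ 0 = 0 → ψ ℓ = 0 → ψ = 0 := by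
  have hper' : ∀ x, (fun x => Q (-x)) (x + ω) = (fun x => Q (-x)) x := fun x => by
    change Q (-(x + ω)) = Q (-x)
    rw [← hper (-(x + ω))]; ring_nf
  have hα' : 0 < ‖α‖ := norm_pos_iff.2 hα
  obtain ⟨ℓ, h1, h2⟩ := ((eventually_isSmallLength hω hQ hper hα').and
    (eventually_isSmallLength hω hQ.comp_neg hper' hα')).exists
  refine ⟨ℓ, fun ψ h h0 hℓ => funext fun x => ?_⟩
  have hz : ∀ y ∈ Icc 0 ℓ, ψ y = 0 := fun y hy =>
    h.eq_zero_of_zeros hQ h1 h0 (by rwa [zero_add]) (by rwa [zero_add])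
  rcases le_total 0 x with hx | hx
  · rcases le_total x ℓ with hx2 | hx2
    · exact hz x ⟨hx, hx2⟩
    · exact h.eq_zero_of_le hQ h1 (a := ℓ) (by rwa [sub_self]) hx2
  · have := h.comp_neg.eq_zero_of_le hQ.comp_neg h2 (a := 0)
      (fun y hy => hz (-y) ⟨by linarith [hy.2], by linarith [hy.1]⟩) (x := -x) (by linarith)
    simpa using this

end IsSol

/-- The space of solutions. -/
def solSpace (α : ℂ) {Q : ℝ → ℂ} (hQ : IsH1Loc Q) : Submodule ℂ (ℝ → ℂ) where
  carrier := {ψ | IsSol α Q ψ}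
  add_mem' {f g} hf hg := by
    refine ⟨hf.1.add hg.1, fun v => ?_⟩
    have e : (∫ x, dens α Q v.1 f x) + ∫ x, dens α Q v.1 g x = 0 := by
      rw [hf.2 v, hg.2 v, add_zero]
    rw [← e, ← integral_add (integrable_dens_H1c hQ v hf.1 α) (integrable_dens_H1c hQ v hg.1 α)]
    refine integral_congr_ae ?_
    filter_upwards [hf.1.ae_differentiableAt, hg.1.ae_differentiableAt] with x h1 h2
    simp only [dens, Pi.add_apply, deriv_add h1 h2]
    ring
  zero_mem' := ⟨IsH1Loc.zero, fun v => by
    refine integral_eq_zero_of_ae (Eventually.of_forall fun x => ?_)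
    have : deriv (0 : ℝ → ℂ) x = 0 := by simp
    simp [dens, this]⟩
  smul_mem' c f hf := by
    refine ⟨hf.1.const_smul c, fun v => ?_⟩
    rw [← mul_zero c, ← hf.2 v, ← integral_const_mul]
    refine integral_congr_ae (Eventually.of_forall fun x => ?_)
    simp only [dens, Pi.smul_apply, FormDomain.deriv_smul_eq, smul_eq_mul]
    ring

/-- Translation by `ω`. -/
def translation (ω : ℝ) : (ℝ → ℂ) →ₗ[ℂ] (ℝ → ℂ) where
  toFun f x := f (x + ω)
  map_add' _ _ := rfl
  map_smul' _ _ := rfl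

section Floquet

variable {ω : ℝ} {α : ℂ} {Q : ℝ → ℂ}

theorem finiteDimensional_solSpace (hω : 0 < ω) (hα : α ≠ 0) (hQ : IsH1Loc Q)
    (hper : ∀ x, Q (x + ω) = Q x) : FiniteDimensional ℂ (solSpace α hQ) := by
  obtain ⟨ℓ, hℓ⟩ := IsSol.exists_injective hω hα hQ hper
  let T : solSpace α hQ →ₗ[ℂ] ℂ × ℂ :=
    ((LinearMap.proj (0 : ℝ)).prod (LinearMap.proj ℓ)) ∘ₗ (solSpace α hQ).subtype
  refine FiniteDimensional.of_injective T ?_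
  rw [injective_iff_map_eq_zero]
  intro ψ h
  exact Subtype.ext (hℓ ψ.1 ψ.2 (congrArg Prod.fst h) (congrArg Prod.snd h))

theorem translation_mem_solSpace (hQ : IsH1Loc Q) (hper : ∀ x, Q (x + ω) = Q x)
    {ψ : ℝ → ℂ} (h : ψ ∈ solSpace α hQ) :
    translation ω ψ ∈ solSpace α hQ := by
  refine ⟨h.1.comp_add ω, fun v => ?_⟩
  let w : H1c := ⟨fun x => v.1 (x + -ω), v.2.1.comp_add _,
    v.2.2.comp_homeomorph (Homeomorph.addRight (-ω))⟩
  rw [← h.2 w, ← integral_add_right_eq_self (dens α Q w.1 ψ) ω]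
  refine integral_congr_ae (Eventually.of_forall fun x => ?_)
  have e1 : deriv w.1 (x + ω) = deriv v.1 x := by
    have := congrFun (deriv_comp_add v.1 (-ω)) (x + ω)
    rw [add_neg_cancel_right] at this
    exact this
  have e2 : w.1 (x + ω) = v.1 x := by
    change v.1 (x + ω + -ω) = _
    rw [add_neg_cancel_right]
  have e3 : deriv (translation ω ψ) x = deriv ψ (x + ω) := congrFun (deriv_comp_add ψ ω) x
  simp only [dens, e1, e2, e3, hper, deriv_periodic hper]
  rfl

/-- Floquet's theorem for a translation invariant space of solutions. -/
theorem exists_floquet (hω : 0 < ω) (hα : α ≠ 0) (hQ : IsH1Loc Q)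
    (hper : ∀ x, Q (x + ω) = Q x)
    (P : Submodule ℂ (ℝ → ℂ)) (hP : P ≤ solSpace α hQ)
    (hinv : ∀ ψ ∈ P, translation ω ψ ∈ P) {ψ : ℝ → ℂ} (hψ : ψ ∈ P) (h0 : ψ ≠ 0) :
    ∃ (ρ : ℂ) (φ : ℝ → ℂ), φ ∈ P ∧ φ ≠ 0 ∧ ρ ≠ 0 ∧ ∀ x, φ (x + ω) = ρ * φ x := by
  have := finiteDimensional_solSpace hω hα hQ hper
  have hfd : FiniteDimensional ℂ P := Submodule.finiteDimensional_of_le hP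
  have hnt : Nontrivial P := ⟨⟨⟨ψ, hψ⟩, 0, fun h => h0 (congrArg Subtype.val h)⟩⟩
  obtain ⟨ρ, hρ⟩ := Module.End.exists_eigenvalue ((translation ω).restrict hinv)
  obtain ⟨φ, hφ⟩ := hρ.exists_hasEigenvector
  have h1 : ∀ x, φ.1 (x + ω) = ρ * φ.1 x := fun x =>
    congrFun (congrArg Subtype.val hφ.apply_eq_smul) x
  have h2 : φ.1 ≠ 0 := fun h => hφ.2 (Subtype.ext h)
  refine ⟨ρ, φ.1, φ.2, h2, fun h => h2 (funext fun x => ?_), h1⟩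
  have := h1 (x - ω)
  rwa [h, zero_mul, sub_add_cancel] at this

/-- Only finitely many numbers occur as Floquet multipliers. -/
theorem finite_multipliers (hω : 0 < ω) (hα : α ≠ 0) (hQ : IsH1Loc Q)
    (hper : ∀ x, Q (x + ω) = Q x) :
    {ρ : ℂ | ∃ φ, IsSol α Q φ ∧ φ ≠ 0 ∧ ∀ x, φ (x + ω) = ρ * φ x}.Finite := by
  have := finiteDimensional_solSpace hω hα hQ hper
  refine (Module.End.finite_hasEigenvalue ((translation ω).restrict
    fun ψ (h : ψ ∈ solSpace α hQ) => translation_mem_solSpace hQ hper h)).subset ?_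
  rintro ρ ⟨φ, h1, h2, h3⟩
  refine Module.End.hasEigenvalue_of_hasEigenvector (x := ⟨φ, h1⟩) ⟨?_, fun h => h2 ?_⟩
  · rw [Module.End.mem_eigenspace_iff]
    exact Subtype.ext (funext h3)
  · exact congrArg Subtype.val h

/-- Otherwise the translates `φ(x + kω) = ρ^k φ(x)` would be unbounded. -/
theorem norm_multiplier_eq_one {ρ : ℂ} (hρ : ρ ≠ 0) {φ : ℝ → ℂ} (h0 : φ ≠ 0)
    (h : ∀ x, φ (x + ω) = ρ * φ x) {C : ℝ} (hC : ∀ x, ‖φ x‖ ≤ C) : ‖ρ‖ = 1 := by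
  obtain ⟨x, hx⟩ := Function.ne_iff.1 h0
  have hx' : 0 < ‖φ x‖ := norm_pos_iff.2 hx
  have hb : ∀ k : ℤ, ‖ρ‖ ^ k * ‖φ x‖ ≤ C := fun k => by
    rw [← norm_zpow, ← norm_mul, ← zpow_shift hρ h]
    exact hC _
  have key : ∀ t : ℝ, (∀ n : ℕ, t ^ n * ‖φ x‖ ≤ C) → t ≤ 1 := by
    intro t ht
    by_contra hcon
    obtain ⟨n, hn⟩ := pow_unbounded_of_one_lt (C / ‖φ x‖) (not_le.1 hcon)
    rw [div_lt_iff₀ hx'] at hn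
    linarith [ht n]
  have hpos : 0 < ‖ρ‖ := norm_pos_iff.2 hρ
  refine le_antisymm (key _ fun n => by simpa using hb n) ?_
  have := key ‖ρ‖⁻¹ fun n => by simpa using hb (-n)
  rwa [inv_le_one₀ hpos] at this

/-- A nontrivial bounded solution yields a quasi-periodic one. -/
theorem exists_quasiPeriodic_of_bounded (hω : 0 < ω) (hα : α ≠ 0) (hQ : IsH1Loc Q)
    (hper : ∀ x, Q (x + ω) = Q x) {ψ : ℝ → ℂ} (hψ : IsSol α Q ψ) (h0 : ψ ≠ 0) {C : ℝ}
    (hC : ∀ x, ‖ψ x‖ ≤ C) :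
    ∃ κ ∈ Icc 0 (2 * Real.pi / ω), ∃ φ, IsSol α Q φ ∧ φ ≠ 0 ∧
      ∀ x, φ (x + ω) = Complex.exp (Complex.I * (κ * ω : ℝ)) * φ x := by
  let P : Submodule ℂ (ℝ → ℂ) :=
    { carrier := {f | f ∈ solSpace α hQ ∧ ∃ C : ℝ, ∀ x, ‖f x‖ ≤ C}
      add_mem' := fun {f g} hf hg => ⟨Submodule.add_mem _ hf.1 hg.1, by
        obtain ⟨C1, h1⟩ := hf.2
        obtain ⟨C2, h2⟩ := hg.2
        exact ⟨C1 + C2, fun x => (norm_add_le _ _).trans (add_le_add (h1 x) (h2 x))⟩⟩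
      zero_mem' := ⟨Submodule.zero_mem _, 0, fun x => by simp⟩
      smul_mem' := fun c f hf => ⟨Submodule.smul_mem _ c hf.1, by
        obtain ⟨C1, h1⟩ := hf.2
        refine ⟨‖c‖ * C1, fun x => ?_⟩
        rw [Pi.smul_apply, norm_smul]
        exact mul_le_mul_of_nonneg_left (h1 x) (norm_nonneg c)⟩ }
  obtain ⟨ρ, φ, h1, h2, h3, h4⟩ := exists_floquet hω hα hQ hper P (fun f hf => hf.1)
    (fun f hf => ⟨translation_mem_solSpace hQ hper hf.1, by
      obtain ⟨C1, h1⟩ := hf.2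
      exact ⟨C1, fun x => h1 _⟩⟩) (ψ := ψ) ⟨hψ, C, hC⟩ h0
  obtain ⟨C1, hC1⟩ := h1.2
  have hn := norm_multiplier_eq_one h3 h2 h4 hC1
  have hπ := Real.pi_pos
  obtain ⟨t, ht, hexp⟩ : ∃ t ∈ Icc 0 (2 * Real.pi), Complex.exp (Complex.I * (t : ℝ)) = ρ := by
    have e := Complex.norm_mul_exp_arg_mul_I ρ
    rw [hn, Complex.ofReal_one, one_mul] at e
    rcases le_total 0 ρ.arg with h | h
    · exact ⟨ρ.arg, ⟨h, by linarith [Complex.arg_le_pi ρ]⟩, by rw [mul_comm]; exact e⟩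
    · refine ⟨ρ.arg + 2 * Real.pi, ⟨by linarith [Complex.neg_pi_lt_arg ρ], by linarith⟩, ?_⟩
      push_cast
      rw [mul_add, Complex.exp_add, mul_comm, mul_comm Complex.I (ρ.arg : ℂ), e,
        mul_comm Complex.I, Complex.exp_two_pi_mul_I, one_mul]
  refine ⟨t / ω, ⟨by have := ht.1; positivity, by gcongr; exact ht.2⟩, φ, h1.1, h2, fun x => ?_⟩
  rw [div_mul_cancel₀ _ hω.ne', hexp, h4]

theorem isH1_bounded (hω : 0 < ω) {f : ℝ → ℂ} (hf : IsH1 f) : ∃ C : ℝ, ∀ x, ‖f x‖ ≤ C := by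
  have i1 := integrable_norm_sq_of_memLp hf.2.1
  have i2 := integrable_norm_sq_of_memLp hf.2.2
  refine ⟨√(1 * (∫ t, ‖deriv f t‖ ^ 2) + (1 / ω + 1 / 1) * ∫ t, ‖f t‖ ^ 2), fun x => ?_⟩
  refine Real.le_sqrt_of_sq_le ?_
  have h := hf.1.norm_sq_le (show x < x + ω by linarith) one_pos (left_mem_Icc.2 (by linarith))
  rw [add_sub_cancel_left] at h
  refine h.trans ?_
  have a1 : ∫ t in Icc x (x + ω), ‖deriv f t‖ ^ 2 ≤ ∫ t, ‖deriv f t‖ ^ 2 :=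
    setIntegral_le_integral i2 (Eventually.of_forall fun x => by positivity)
  have a2 : ∫ t in Icc x (x + ω), ‖f t‖ ^ 2 ≤ ∫ t, ‖f t‖ ^ 2 :=
    setIntegral_le_integral i1 (Eventually.of_forall fun x => by positivity)
  gcongr

/-- There are no nontrivial solutions in `H¹(ℝ)`. -/
theorem eq_zero_of_isH1 (hω : 0 < ω) (hα : α ≠ 0) (hQ : IsH1Loc Q)
    (hper : ∀ x, Q (x + ω) = Q x) {ψ : ℝ → ℂ} (hψ : IsSol α Q ψ) (h1 : IsH1 ψ) : ψ = 0 := by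
  by_contra h0
  let P : Submodule ℂ (ℝ → ℂ) := solSpace α hQ ⊓ (lineDomain hω).W
  obtain ⟨ρ, φ, hφ, hφ0, hρ0, hρ⟩ := exists_floquet hω hα hQ hper P inf_le_left
    (fun f hf => ⟨translation_mem_solSpace hQ hper hf.1, by
      have h : IsH1 f := hf.2
      have mp := measurePreserving_add_right (volume : Measure ℝ) ω
      refine ⟨h.1.comp_add ω, h.2.1.comp_measurePreserving mp, ?_⟩
      have e : deriv (translation ω f) = fun x => deriv f (x + ω) := deriv_comp_add f ω
      rw [e]
      exact h.2.2.comp_measurePreserving mp⟩) (ψ := ψ) ⟨hψ, h1⟩ h0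
  have hφ1 : IsH1 φ := hφ.2
  obtain ⟨C, hC⟩ := isH1_bounded hω hφ1
  have hn := norm_multiplier_eq_one hρ0 hφ0 hρ hC
  have hfin := lintegral_lt_top_of_memLp hφ1.2.1
  have hp : ∀ x, ‖φ (x + ω)‖ₑ ^ 2 = ‖φ x‖ₑ ^ 2 := fun x => by
    rw [hρ, enorm_mul, ← ofReal_norm ρ, hn, ENNReal.ofReal_one, one_mul]
  have hk : ∀ k : ℤ, ∫⁻ x in Ioc (k * ω) ((k + 1) * ω), ‖φ x‖ₑ ^ 2 =
      ∫⁻ x in Ioc 0 ω, ‖φ x‖ₑ ^ 2 := lintegral_period (g := fun x => ‖φ x‖ₑ ^ 2) hp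
  rw [lintegral_eq_tsum_period hω] at hfin
  simp only [hk] at hfin
  -- infinitely many equal contributions
  have hz : ∫⁻ x in Ioc 0 ω, ‖φ x‖ₑ ^ 2 = 0 := by
    by_contra hne
    rw [ENNReal.tsum_const_eq_top_of_ne_zero hne] at hfin
    exact lt_irrefl _ hfin
  have hall : ∫⁻ x, ‖φ x‖ₑ ^ 2 = 0 := by
    rw [lintegral_eq_tsum_period hω]
    simp only [hk, hz, tsum_zero]
  rw [lintegral_eq_zero_iff (hφ1.1.continuous.enorm.measurable.pow_const 2)] at hall
  have hae : φ =ᵐ[volume] fun _ => 0 := by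
    filter_upwards [hall] with x hx
    simpa using hx
  exact hφ0 (hφ1.1.continuous.ae_eq_iff_eq volume continuous_const |>.1 hae)

end Floquet

/-! ### Quasi-periodic forms -/

/-- The function `x ↦ e^{iκx}`. -/
def phase (κ x : ℝ) : ℂ := Complex.exp (Complex.I * (κ * x : ℝ))

theorem phase_add (κ x y : ℝ) : phase κ (x + y) = phase κ x * phase κ y := by
  rw [phase, phase, phase, ← Complex.exp_add]
  congr 1
  push_cast; ring

theorem phase_ne_zero (κ x : ℝ) : phase κ x ≠ 0 := Complex.exp_ne_zero _

theorem norm_phase (κ x : ℝ) : ‖phase κ x‖ = 1 := by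
  rw [phase, mul_comm, Complex.norm_exp_ofReal_mul_I]

theorem conj_phase (κ x : ℝ) : conj (phase κ x) = phase (-κ) x := by
  rw [phase, phase, ← Complex.exp_conj]
  simp only [map_mul, Complex.conj_I, Complex.conj_ofReal]
  congr 1
  push_cast; ring

theorem phase_mul_phase_neg (κ x : ℝ) : phase κ x * phase (-κ) x = 1 := by
  rw [phase, phase, ← Complex.exp_add]
  simp

theorem inv_phase (κ x : ℝ) : (phase κ x)⁻¹ = phase (-κ) x :=
  inv_eq_of_mul_eq_one_right (phase_mul_phase_neg κ x)

theorem hasDerivAt_phase (κ x : ℝ) : HasDerivAt (phase κ) (Complex.I * κ * phase κ x) x := by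
  have h1 : HasDerivAt (fun x : ℝ => Complex.I * ((κ * x : ℝ) : ℂ)) (Complex.I * κ) x := by
    have h2 : HasDerivAt (fun x : ℝ => ((κ * x : ℝ) : ℂ)) ((κ * 1 : ℝ) : ℂ) x :=
      ((hasDerivAt_id x).const_mul κ).ofReal_comp
    have h3 := h2.const_mul Complex.I
    simpa using h3
  have h4 := h1.cexp
  rw [mul_comm] at h4
  exact h4

theorem isH1Loc_phase (κ : ℝ) : IsH1Loc (phase κ) := by
  refine IsH1Loc.of_contDiff ?_
  unfold phase
  have : ContDiff ℝ 1 fun x : ℝ => Complex.I * ((κ * x : ℝ) : ℂ) :=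
    contDiff_const.mul (Complex.ofRealCLM.contDiff.comp (contDiff_const.mul contDiff_id))
  exact this.cexp

/-- Multiplication by `e^{iκx}`, which turns periodic into quasi-periodic functions. -/
def twist (κ : ℝ) (f : ℝ → ℂ) (x : ℝ) : ℂ := phase κ x * f x

theorem IsH1Loc.twist {f : ℝ → ℂ} (hf : IsH1Loc f) (κ : ℝ) : IsH1Loc (twist κ f) :=
  (isH1Loc_phase κ).mul hf

theorem twist_twist_neg (κ : ℝ) (f : ℝ → ℂ) : twist κ (twist (-κ) f) = f := by
  ext x
  rw [twist, twist, ← mul_assoc, phase_mul_phase_neg, one_mul]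

theorem norm_twist (κ : ℝ) (f : ℝ → ℂ) (x : ℝ) : ‖twist κ f x‖ = ‖f x‖ := by
  rw [twist, norm_mul, norm_phase, one_mul]

theorem conj_twist_mul_twist (κ : ℝ) (f g : ℝ → ℂ) (x : ℝ) :
    conj (twist κ f x) * twist κ g x = conj (f x) * g x := by
  rw [twist, twist, map_mul, conj_phase]
  linear_combination (conj (f x) * g x) * phase_mul_phase_neg κ x

theorem deriv_twist (κ : ℝ) {f : ℝ → ℂ} {x : ℝ} (hf : DifferentiableAt ℝ f x) :
    deriv (twist κ f) x = phase κ x * (deriv f x + Complex.I * κ * f x) := by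
  have := (hasDerivAt_phase κ x).mul hf.hasDerivAt
  have e : deriv (twist κ f) x = _ := this.deriv
  rw [e]; ring

theorem twist_add_period {ω : ℝ} (κ : ℝ) {f : ℝ → ℂ} (hf : ∀ x, f (x + ω) = f x) (x : ℝ) :
    twist κ f (x + ω) = phase κ ω * twist κ f x := by
  rw [twist, twist, phase_add, hf]; ring

theorem isQuasiPeriodic_iff {ω : ℝ} (hω : 0 < ω) {θ : ℝ} {f : ℝ → ℂ} :
    IsQuasiPeriodic ω θ f ↔ IsH1Loc f ∧ ∀ x, f (x + ω) = phase (θ / ω) ω * f x := by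
  have : phase (θ / ω) ω = Complex.exp (Complex.I * θ) := by
    rw [phase, div_mul_cancel₀ _ hω.ne']
  rw [this]; rfl

theorem mem_periodicDomain_of_quasiPeriodic {ω : ℝ} (hω : 0 < ω) {κ : ℝ} {f : ℝ → ℂ}
    (hf : IsH1Loc f) (h : ∀ x, f (x + ω) = phase κ ω * f x) :
    twist (-κ) f ∈ (periodicDomain hω).W := by
  refine ⟨hf.twist _, fun x => ?_⟩
  rw [twist, twist, phase_add, h]
  linear_combination (phase (-κ) x * f x) * phase_mul_phase_neg κ ω

section Twist

variable {ω : ℝ} (hω : 0 < ω)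

/-- The derivative `f ↦ f' + iκf`. -/
def twistD (κ : ℝ) : (periodicDomain hω).Carrier →L[ℂ] Lp ℂ 2 (periodicDomain hω).m :=
  (periodicDomain hω).D + (Complex.I * κ) • (periodicDomain hω).J

/-- The operator of the form of `T_θ`, `θ = κω`, transplanted to periodic functions. -/
def twistOp (κ : ℝ) (p : ℝ → ℂ) : (periodicDomain hω).Carrier →L[ℂ] (periodicDomain hω).Carrier :=
  (twistD hω κ).adjoint ∘L twistD hω κ + (periodicDomain hω).potOp p

theorem inner_twistOp (κ : ℝ) (p : ℝ → ℂ) (f g : (periodicDomain hω).Carrier) :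
    ⟪f, twistOp hω κ p g⟫_ℂ =
      ⟪twistD hω κ f, twistD hω κ g⟫_ℂ + ⟪f, (periodicDomain hω).potOp p g⟫_ℂ := by
  rw [twistOp, add_apply, inner_add_right, ContinuousLinearMap.comp_apply,
    ContinuousLinearMap.adjoint_inner_right]

theorem twistOp_symm {p : ℝ → ℂ} (hp : Potential ω p) (κ : ℝ) (f g : (periodicDomain hω).Carrier) :
    ⟪twistOp hω κ p f, g⟫_ℂ = ⟪f, twistOp hω κ p g⟫_ℂ := by
  rw [← inner_conj_symm, inner_twistOp, inner_twistOp, map_add, inner_conj_symm, inner_conj_symm,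
    (periodicDomain hω).potOp_symm hp]

theorem continuous_twistOp (p : ℝ → ℂ) : Continuous fun κ => twistOp hω κ p := by
  have h1 : Continuous fun κ => twistD hω κ := by
    unfold twistD
    fun_prop
  have h2 : Continuous fun κ => (twistD hω κ).adjoint :=
    (ContinuousLinearMap.adjoint (𝕜 := ℂ) (E := (periodicDomain hω).Carrier)
      (F := Lp ℂ 2 (periodicDomain hω).m)).continuous.comp h1
  unfold twistOp
  exact (h2.clm_comp h1).add continuous_const

theorem memLp_twistD (κ : ℝ) (f : (periodicDomain hω).Carrier) :
    MemLp (fun x => deriv f x + Complex.I * κ * f x) 2 (periodicDomain hω).m :=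
  f.memLp_deriv.add (f.memLp.const_mul _)

theorem twistD_apply (κ : ℝ) (f : (periodicDomain hω).Carrier) :
    twistD hω κ f = (memLp_twistD hω κ f).toLp := by
  rw [twistD, add_apply, smul_apply, (periodicDomain hω).D_apply,
    (periodicDomain hω).J_apply, ← MemLp.toLp_const_smul, ← MemLp.toLp_add]
  rfl

/-- The quasi-periodic forms in terms of densities. -/
theorem inner_twist_eq {p : ℝ → ℂ} (hp : Potential ω p) (α : ℂ) (κ : ℝ)
    (f g : (periodicDomain hω).Carrier) :
    α * ⟪twistD hω κ f, twistD hω κ g⟫_ℂ + ⟪f, (periodicDomain hω).potOp p g⟫_ℂ =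
      ∫ x in Icc 0 ω, dens α p (fun x => conj (twist κ f x)) (twist κ g) x := by
  have e0 := (periodicDomain hω).inner_form_eq hp 0 f g
  rw [zero_mul, zero_add] at e0
  rw [e0, twistD_apply, twistD_apply, FormDomain.inner_toLp, ← integral_const_mul, ← integral_add
    ((FormDomain.integrable_conj_mul (memLp_twistD hω κ f) (memLp_twistD hω κ g)).const_mul α)
    ((periodicDomain hω).integrable_dens hp 0 f g)]
  refine integral_congr_ae (ae_restrict_of_ae ?_)
  have hh : (fun y => conj (twist κ f y) * twist κ g y) = fun y => conj (f y) * g y :=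
    funext fun y => conj_twist_mul_twist κ f g y
  filter_upwards [f.h1.ae_differentiableAt, g.h1.ae_differentiableAt,
    dens_mul_ae (Q := p) (f.h1.twist κ).conj (g.h1.twist κ),
    dens_mul_ae (Q := p) f.h1.conj g.h1] with x h1 h2 h3 h4
  rw [dens_eq_add_dens_zero α, ← h3, hh, h4, congrFun (deriv_conj (twist κ f)) x,
    deriv_twist κ h1, deriv_twist κ h2, map_mul, conj_phase]
  congr 1
  linear_combination (-α * (conj (deriv f x + Complex.I * κ * f x) *
    (deriv g x + Complex.I * κ * g x))) * phase_mul_phase_neg κ x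

theorem inner_twistOp_eq {p : ℝ → ℂ} (hp : Potential ω p) (κ : ℝ)
    (f g : (periodicDomain hω).Carrier) :
    ⟪f, twistOp hω κ p g⟫_ℂ =
      ∫ x in Icc 0 ω, dens 1 p (fun x => conj (twist κ f x)) (twist κ g) x := by
  rw [inner_twistOp, ← inner_twist_eq hω hp, one_mul]

/-- The quasi-periodic realization of the form domain in `L²([0, ω])`. -/
def twistJ (κ : ℝ) : (periodicDomain hω).Carrier →L[ℂ] L2Period ω :=
  LinearMap.mkContinuous
    { toFun := fun f => ((f.h1.twist κ).memLp 0 ω).toLp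
      map_add' := fun f g => by
        rw [← MemLp.toLp_add]
        exact (MemLp.toLp_eq_toLp_iff _ _).2 (Eventually.of_forall fun x => mul_add _ _ _)
      map_smul' := fun c f => by
        rw [RingHom.id_apply, ← MemLp.toLp_const_smul]
        exact (MemLp.toLp_eq_toLp_iff _ _).2 (Eventually.of_forall fun x => mul_left_comm _ _ _) }
    1 fun f => by
      rw [one_mul]
      refine le_of_sq_le_sq ?_ (norm_nonneg _)
      change ‖((f.h1.twist κ).memLp 0 ω).toLp‖ ^ 2 ≤ _
      rw [FormDomain.norm_toLp_sq]
      simp only [norm_twist]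
      have := pow_le_pow_left₀ (norm_nonneg _) ((periodicDomain hω).norm_J_le f) 2
      rwa [(periodicDomain hω).norm_J_sq] at this

theorem twistJ_apply (κ : ℝ) (f : (periodicDomain hω).Carrier) :
    twistJ hω κ f = ((f.h1.twist κ).memLp 0 ω).toLp := rfl

theorem norm_twistJ_sq (κ : ℝ) (f : (periodicDomain hω).Carrier) :
    ‖twistJ hω κ f‖ ^ 2 = ‖(periodicDomain hω).J f‖ ^ 2 := by
  rw [twistJ_apply, FormDomain.norm_toLp_sq, (periodicDomain hω).norm_J_sq]
  simp only [norm_twist]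
  rfl

theorem twistJ_injective (κ : ℝ) : Function.Injective (twistJ hω κ) := by
  rw [injective_iff_map_eq_zero]
  intro f hf
  have h := norm_twistJ_sq hω κ f
  rw [hf, norm_zero, zero_pow two_ne_zero, eq_comm, sq_eq_zero_iff, norm_eq_zero] at h
  exact (injective_iff_map_eq_zero _).1 (periodicDomain hω).J_injective f h

theorem denseRange_twistJ (κ : ℝ) : DenseRange (twistJ hω κ) := by
  refine denseRange_of_forall_inner_eq_zero _ fun u hu => ?_
  have hint : IntegrableOn u (Icc 0 ω) := (Lp.memLp u).integrable (by norm_num)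
  have h0 : ∀ᵐ x : ℝ, x ∈ Ioo 0 ω → u x = 0 := by
    refine isOpen_Ioo.ae_eq_zero_of_integral_contDiff_smul_eq_zero (μ := volume) (f := u)
      ((hint.mono_set Ioo_subset_Icc_self).locallyIntegrableOn) ?_
    intro g hg hgc hgs
    have hgC : IsH1Loc fun x => ((g x : ℝ) : ℂ) :=
      IsH1Loc.of_contDiff (Complex.ofRealCLM.contDiff.comp (hg.of_le (by exact_mod_cast le_top)))
    have hgz : ∀ x ∉ Ioo 0 ω, g x = 0 := fun x hx => by
      by_contra hne
      exact hx (hgs (subset_tsupport g hne))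
    let v : H1c := ⟨fun x => twist (-κ) (fun y => ((g y : ℝ) : ℂ)) x, hgC.twist _, by
      have h1 : HasCompactSupport fun x => ((g x : ℝ) : ℂ) :=
        hgc.comp_left (g := fun t : ℝ => (t : ℂ)) Complex.ofReal_zero
      exact h1.mul_left⟩
    -- on the period the periodization of `v` is `v` itself
    have hv : ∀ x ∈ Ioc 0 ω, periodize ω 1 v.1 x = v.1 x := fun x hx =>
      periodize_eq_self (fun y hy => by
        change phase (-κ) _ * ((g y : ℝ) : ℂ) = 0
        rw [hgz y hy, Complex.ofReal_zero, mul_zero]) ⟨hx.1.le, hx.2⟩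
    have h1 := hu (FormDomain.of _ (mem_periodicDomain_periodize hω v))
    rw [← inner_conj_symm, map_eq_zero, twistJ_apply, L2.inner_def] at h1
    rw [← setIntegral_eq_integral_of_forall_compl_eq_zero (s := Icc 0 ω)]
    · rw [← h1]
      have hm := ((FormDomain.of _ (mem_periodicDomain_periodize hω v) :
        (periodicDomain hω).Carrier).h1.twist κ).memLp 0 ω
      refine integral_congr_ae ?_
      have hIoc : ∀ᵐ x ∂(volume.restrict (Icc 0 ω) : Measure ℝ), x ∈ Ioc 0 ω := by
        rw [restrict_Icc_eq_Ioc]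
        exact ae_restrict_mem measurableSet_Ioc
      filter_upwards [hm.coeFn_toLp, hIoc] with x hx hx2
      rw [hx, RCLike.inner_apply]
      have e : twist κ (periodize ω 1 v.1) x = ((g x : ℝ) : ℂ) := by
        rw [twist, hv x hx2]
        exact congrFun (twist_twist_neg κ fun y => ((g y : ℝ) : ℂ)) x
      change _ = u x * conj (twist κ (periodize ω 1 v.1) x)
      rw [e, Complex.conj_ofReal, Complex.real_smul, mul_comm]
    · intro x hx
      rw [hgz x fun h => hx (Ioo_subset_Icc_self h), zero_smul]
  have h1 := (ae_restrict_iff' measurableSet_Ioo).2 h0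
  rw [restrict_Ioo_eq_restrict_Ioc, ← restrict_Icc_eq_Ioc] at h1
  exact (Lp.eq_zero_iff_ae_eq_zero).2 h1

/-- The quasi-periodic forms are bounded below, locally uniformly in the quasi-momentum. -/
theorem twistOp_garding {p : ℝ → ℂ} (hp : Potential ω p) (T : ℝ) :
    ∃ C : ℝ, 0 ≤ C ∧ ∀ κ ∈ Icc (-T) T, ∀ f : (periodicDomain hω).Carrier,
      1 / 4 * ‖f‖ ^ 2 ≤ (⟪f, twistOp hω κ p f⟫_ℂ).re + C * ‖(periodicDomain hω).J f‖ ^ 2 := by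
  obtain ⟨C, hC, h⟩ := (periodicDomain hω).norm_inner_potOp_le hp (ε := 1 / 4) (by norm_num)
  refine ⟨C + T ^ 2 + 1 / 4, by positivity, fun κ hκ f => ?_⟩
  have h1 := h f
  have h2 := (abs_le.1 ((Complex.abs_re_le_norm _).trans h1)).1
  rw [inner_twistOp, Complex.add_re, inner_self_eq_norm_sq_to_K, (periodicDomain hω).norm_sq]
  have h3 : ‖(periodicDomain hω).D f‖ ≤ ‖twistD hω κ f‖ + |κ| * ‖(periodicDomain hω).J f‖ := by
    have e : (periodicDomain hω).D f =
        twistD hω κ f - (Complex.I * κ) • (periodicDomain hω).J f := by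
      rw [twistD, add_apply, smul_apply, add_sub_cancel_right]
    have h4 := norm_sub_le (twistD hω κ f) ((Complex.I * κ) • (periodicDomain hω).J f)
    rw [← e, norm_smul, norm_mul, Complex.norm_I, one_mul, Complex.norm_real,
      Real.norm_eq_abs] at h4
    exact h4
  have h5 := pow_le_pow_left₀ (norm_nonneg _) h3 2
  have h6 : |κ| ^ 2 ≤ T ^ 2 := pow_le_pow_left₀ (abs_nonneg κ) (abs_le.2 hκ) 2
  have h7 := mul_le_mul_of_nonneg_right h6 (sq_nonneg ‖(periodicDomain hω).J f‖)
  have h8 : (((‖twistD hω κ f‖ : ℂ)) ^ 2).re = ‖twistD hω κ f‖ ^ 2 := by norm_cast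
  have h9 := sq_nonneg (‖twistD hω κ f‖ - |κ| * ‖(periodicDomain hω).J f‖)
  change _ ≤ (((‖twistD hω κ f‖ : ℂ)) ^ 2).re + _ + _
  rw [h8]
  nlinarith

/-- A form bounded below by a positive constant is coercive. -/
theorem twistOp_coercive {p : ℝ → ℂ} (hp : Potential ω p) (T : ℝ) {c : ℝ} (hc : 0 < c) :
    ∃ a : ℝ, 0 < a ∧ ∀ κ ∈ Icc (-T) T,
      (∀ f, c * ‖(periodicDomain hω).J f‖ ^ 2 ≤ (⟪f, twistOp hω κ p f⟫_ℂ).re) →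
      ∀ f, a * ‖f‖ ^ 2 ≤ (⟪f, twistOp hω κ p f⟫_ℂ).re := by
  obtain ⟨C, hC, h⟩ := twistOp_garding hω hp T
  refine ⟨1 / 4 / (1 + C / c), by positivity, fun κ hκ hl f => ?_⟩
  have h1 := h κ hκ f
  have h2 := mul_le_mul_of_nonneg_left (hl f) (show 0 ≤ C / c by positivity)
  have e : C / c * (c * ‖(periodicDomain hω).J f‖ ^ 2) = C * ‖(periodicDomain hω).J f‖ ^ 2 := by
    field_simp
  rw [div_mul_eq_mul_div, div_le_iff₀ (by positivity)]
  nlinarith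

/-- The pencil over quasi-momentum `κ` has the density whose potential is the combination of the two
potentials. -/
theorem inner_twist_pencil {p s : ℝ → ℂ} (hp : Potential ω p) (hs : Potential ω s) (α : ℂ) (κ : ℝ)
    (h f : (periodicDomain hω).Carrier) :
    ⟪h, (α • twistOp hω κ p - (periodicDomain hω).potOp s) f⟫_ℂ =
      ∫ x in Icc 0 ω, dens α (fun x => α * p x - s x) (fun x => conj (twist κ h x))
        (twist κ f) x := by
  have e0 := inner_twist_eq hω hs 0 κ h f
  rw [zero_mul, zero_add] at e0
  rw [sub_apply, smul_apply, inner_sub_right, inner_smul_right, inner_twistOp_eq hω hp, e0,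
    ← integral_const_mul,
    ← integral_sub ((integrableOn_dens hp.h1 (h.h1.twist κ).conj (f.h1.twist κ) 1 0 ω).const_mul α)
      (integrableOn_dens hs.h1 (h.h1.twist κ).conj (f.h1.twist κ) 0 0 ω)]
  refine integral_congr_ae (ae_restrict_of_ae ?_)
  filter_upwards [hp.h1.ae_differentiableAt, hs.h1.ae_differentiableAt] with x h1 h2
  have e : deriv (fun x => α * p x - s x) x = α * deriv p x - deriv s x := by
    rw [deriv_fun_sub (h1.const_mul α) h2, deriv_const_mul _ h1]
  simp only [dens, e]
  ring

/-- Eigenvectors of the pencil over quasi-momentum `κ` are the quasi-periodic solutions. -/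
theorem pencil_iff_isSol {p s : ℝ → ℂ} (hp : Potential ω p) (hs : Potential ω s) (α : ℂ) (κ : ℝ)
    (f : (periodicDomain hω).Carrier) :
    (periodicDomain hω).potOp s f = α • twistOp hω κ p f ↔
      IsSol α (fun x => α * p x - s x) (twist κ f) := by
  have hf := mem_periodicDomain.1 f.mem
  have hψ := hf.1.twist κ
  have hQ : IsH1Loc fun x => α * p x - s x := (hp.h1.const_smul α).sub hs.h1
  have hQper : ∀ x, α * p (x + ω) - s (x + ω) = α * p x - s x := fun x => by
    rw [hp.periodic, hs.periodic]
  have key : ∀ h : (periodicDomain hω).Carrier,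
      ∫ x in Icc 0 ω, dens α (fun x => α * p x - s x) (fun x => conj (twist κ h x)) (twist κ f) x =
        ⟪h, α • twistOp hω κ p f - (periodicDomain hω).potOp s f⟫_ℂ := fun h =>
    (inner_twist_pencil hω hp hs α κ h f).symm
  constructor
  · intro h
    refine ⟨hψ, fun v => ?_⟩
    rw [integral_dens_unfold hω hQ hQper (phase_ne_zero κ ω) hψ (twist_add_period κ hf.2)]
    have hV : ∀ x, periodize ω (phase κ ω) v.1 (x + ω) =
        phase (-κ) ω * periodize ω (phase κ ω) v.1 x := fun x => by
      rw [periodize_add _ (phase_ne_zero κ ω), inv_phase]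
    have hV1 := isH1Loc_periodize hω (phase κ ω) v
    have hmem : twist (-κ) (fun x => conj (periodize ω (phase κ ω) v.1 x)) ∈
        (periodicDomain hω).W := by
      refine mem_periodicDomain_of_quasiPeriodic hω hV1.conj fun x => ?_
      rw [hV, map_mul, conj_phase, neg_neg]
    have h1 := key (FormDomain.of _ hmem)
    rw [h, sub_self, inner_zero_right] at h1
    rw [← h1]
    have e : (fun x => conj (twist κ (FormDomain.of (X := periodicDomain hω) _ hmem).fn x)) =
        periodize ω (phase κ ω) v.1 := by
      rw [FormDomain.coe_of, twist_twist_neg]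
      ext x
      exact Complex.conj_conj _
    rw [e]
  · intro h
    rw [eq_comm, ← sub_eq_zero]
    refine ext_inner_left ℂ fun g => ?_
    rw [← key, inner_zero_right]
    have hg := mem_periodicDomain.1 g.mem
    have h1 := h.2 (tentMul hω _ (hg.1.twist κ).conj)
    rw [integral_dens_unfold hω hQ hQper (phase_ne_zero κ ω) hψ (twist_add_period κ hf.2)] at h1
    rw [← h1]
    have e : periodize ω (phase κ ω) (tentMul hω _ (hg.1.twist κ).conj).1 =
        fun x => conj (twist κ g x) := by
      ext x
      refine periodize_tent_mul hω (phase_ne_zero κ ω) (h := fun x => conj (twist κ g x))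
        (fun x => ?_) x
      rw [twist_add_period κ hg.2, map_mul, conj_phase, inv_phase]
    rw [e]

end Twist

/-! ### Infinitely many eigenvalues of a pencil -/

section InfinitePencil

variable {H : Type*} [NormedAddCommGroup H] [InnerProductSpace ℂ H] [CompleteSpace H]

theorem infinite_of_forall_exists_le {S : Set ℝ} (h0 : ∀ t ∈ S, 0 < t)
    (h : ∀ s : ℝ, 0 < s → ∃ t ∈ S, t ≤ s) : S.Infinite := by
  intro hfin
  obtain ⟨t₀, ht₀, -⟩ := h 1 one_pos
  obtain ⟨m, hm, hmin⟩ := hfin.exists_minimal ⟨t₀, ht₀⟩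
  obtain ⟨t, ht, htm⟩ := h (m / 2) (half_pos (h0 m hm))
  have h1 : m ≤ t := by
    rcases le_total m t with h | h
    · exact h
    · exact hmin ht h
  linarith [h0 m hm]

/-- If the quadratic form of a compact `R` is positive definite on subspaces of arbitrarily large
dimension, then the pencil `R f = t A f` has arbitrarily small positive eigenvalues. -/
theorem exists_eigenvalue_le {R A : H →L[ℂ] H} (hRc : IsCompactOperator R)
    (hR : (R : H →ₗ[ℂ] H).IsSymmetric) (hA : (A : H →ₗ[ℂ] H).IsSymmetric) {a : ℝ} (ha : 0 < a)
    (hco : ∀ f, a * ‖f‖ ^ 2 ≤ (⟪f, A f⟫_ℂ).re)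
    (hN : ∀ N : ℕ, ∃ f : Fin N → H, (∀ i j, i ≠ j → ⟪f i, R (f j)⟫_ℂ = 0) ∧
      ∀ i, 0 < (⟪f i, R (f i)⟫_ℂ).re) {s : ℝ} (hs : 0 < s) :
    ∃ t ∈ {t : ℝ | 0 < t ∧ ∃ f, f ≠ 0 ∧ R f = (t : ℂ) • A f}, t ≤ s := by
  by_contra! hsl
  obtain ⟨B, hBc, hB, hPB, hev⟩ := exists_reduction hRc hR hA ha hco
  have hle : upperSpace B 0 ≤ upperSpace B s := by
    refine iSup_le fun t => ?_
    by_cases hb : Module.End.eigenspace (B : Module.End ℂ H) ((t : ℝ) : ℂ) = ⊥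
    · rw [hb]; exact bot_le
    · exact eigenspace_le_upperSpace B (hsl t ⟨t.2, (hev t).1 hb⟩)
  have hfd : FiniteDimensional ℂ (upperSpace B 0) := by
    have := finiteDimensional_upperSpace hBc hB hs
    exact Submodule.finiteDimensional_of_le hle
  obtain ⟨n, v, hv⟩ : ∃ n, PencilBound R A n 0 :=
    ⟨_, (hPB _ _).2 (pencilBound_one_of_finrank_le hBc hB le_rfl hfd le_rfl)⟩
  obtain ⟨f, hf1, hf2⟩ := hN (n + 1)
  -- a combination of the `f i` orthogonal to all `v i`
  let M : (Fin (n + 1) → ℂ) →ₗ[ℂ] (Fin n → ℂ) :=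
    LinearMap.pi fun i => ∑ j, ⟪v i, f j⟫_ℂ • LinearMap.proj j
  have hker : LinearMap.ker M ≠ ⊥ := LinearMap.ker_ne_bot_of_finrank_lt (by simp)
  obtain ⟨c, hc, hc0⟩ := Submodule.exists_mem_ne_zero_of_ne_bot hker
  have h1 := hv (∑ j, c j • f j) fun i => by
    have h2 := congrFun (LinearMap.mem_ker.1 hc) i
    rw [inner_sum]
    simp only [inner_smul_right]
    refine Eq.trans ?_ h2
    simp [M, mul_comm]
  rw [zero_mul] at h1
  have e : ⟪∑ j, c j • f j, R (∑ j, c j • f j)⟫_ℂ =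
      ∑ j, ((‖c j‖ ^ 2 : ℝ) : ℂ) * ⟪f j, R (f j)⟫_ℂ := by
    rw [sum_inner]
    refine Finset.sum_congr rfl fun i _ => ?_
    rw [map_sum, inner_sum, Finset.sum_eq_single i]
    · rw [map_smul, inner_smul_left, inner_smul_right, ← mul_assoc, mul_comm (conj (c i)),
        Complex.mul_conj, Complex.normSq_eq_norm_sq]
    · intro j _ hj
      rw [map_smul, inner_smul_left, inner_smul_right, hf1 i j (Ne.symm hj), mul_zero, mul_zero]
    · simp
  rw [e, Complex.re_sum] at h1
  simp only [Complex.re_ofReal_mul] at h1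
  obtain ⟨j, hj⟩ := Function.ne_iff.1 hc0
  have h3 : 0 < ∑ j, ‖c j‖ ^ 2 * (⟪f j, R (f j)⟫_ℂ).re := by
    refine Finset.sum_pos' (fun i _ => mul_nonneg (by positivity) (hf2 i).le)
      ⟨j, Finset.mem_univ _, mul_pos ?_ (hf2 j)⟩
    have : 0 < ‖c j‖ := norm_pos_iff.2 hj
    positivity
  linarith

end InfinitePencil

/-! ### Compactness of the weight on one period -/

theorem IsH1Loc.norm_sub_sq_le {f : ℝ → ℂ} (hf : IsH1Loc f) {a b : ℝ} (hab : a ≤ b) {x y : ℝ}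
    (hx : x ∈ Icc a b) (hy : y ∈ Icc a b) :
    ‖f x - f y‖ ^ 2 ≤ (b - a) * ∫ t in Icc a b, ‖deriv f t‖ ^ 2 := by
  have h3 := integral_norm_mul_norm_sq_le (memLp_const (1 : ℂ)) (hf.2 a b)
  simp only [norm_one, one_mul, one_pow, integral_const, smul_eq_mul, mul_one] at h3
  rw [measureReal_restrict_apply_univ, Real.volume_real_Icc_of_le hab] at h3
  exact (pow_le_pow_left₀ (norm_nonneg _) (hf.norm_sub_le hx hy) 2).trans h3

section Compact

variable {ω : ℝ} (hω : 0 < ω) (ν : Measure ℝ) [IsFiniteMeasure ν]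

theorem memLp_two_of_carried (hν : ν (Ico 0 ω)ᶜ = 0) {h : ℝ → ℂ} (hh : Continuous h) :
    MemLp h 2 ν := by
  obtain ⟨C, hC⟩ := isCompact_Icc.exists_bound_of_continuousOn (hh.continuousOn (s := Icc 0 ω))
  refine MemLp.of_bound hh.aestronglyMeasurable C ?_
  filter_upwards [measure_eq_zero_iff_ae_notMem.1 hν] with x hx
  exact hC x (Ico_subset_Icc_self (not_not.1 hx))

/-- The restriction of periodic `H¹` functions to a measure on one period. -/
def periodTrace (hν : ν (Ico 0 ω)ᶜ = 0) : (periodicDomain hω).Carrier →L[ℂ] Lp ℂ 2 ν :=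
  LinearMap.mkContinuousOfExistsBound
    { toFun := fun f => (memLp_two_of_carried ν hν f.h1.continuous).toLp f
      map_add' := fun f g => MemLp.toLp_add _ _
      map_smul' := fun c f => MemLp.toLp_const_smul c _ } <| by
    obtain ⟨C, hC, hb⟩ := (periodicDomain hω).exists_norm_apply_le ω
    refine ⟨(ν.real univ) ^ (2 : ENNReal).toReal⁻¹ * C, fun f => ?_⟩
    rw [mul_assoc]
    refine Lp.norm_le_of_ae_bound (by positivity) ?_
    filter_upwards [(memLp_two_of_carried ν hν f.h1.continuous).coeFn_toLp,
      measure_eq_zero_iff_ae_notMem.1 hν] with x hx hx2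
    have hx' : x ∈ Ico 0 ω := not_not.1 hx2
    change ‖(memLp_two_of_carried ν hν f.h1.continuous).toLp f.fn x‖ ≤ _
    rw [hx]
    exact hb f x ⟨by linarith [hx'.1], hx'.2.le⟩

theorem periodTrace_apply (hν : ν (Ico 0 ω)ᶜ = 0) (f : (periodicDomain hω).Carrier) :
    periodTrace hω ν hν f = (memLp_two_of_carried ν hν f.h1.continuous).toLp f := rfl

theorem inner_periodTrace (hν : ν (Ico 0 ω)ᶜ = 0) (f g : (periodicDomain hω).Carrier) :
    ⟪periodTrace hω ν hν f, periodTrace hω ν hν g⟫_ℂ = ∫ x, conj (f x) * g x ∂ν := by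
  rw [periodTrace_apply, periodTrace_apply, FormDomain.inner_toLp]

/-- The function taking the value `c k` on the `k`-th of `n + 1` equal parts of `[0, ω)`. -/
def stepFun (ω : ℝ) (n : ℕ) (c : Fin (n + 1) → ℂ) (x : ℝ) : ℂ :=
  c (Fin.ofNat (n + 1) ⌊x * (n + 1) / ω⌋₊)

theorem memLp_stepFun (n : ℕ) (c : Fin (n + 1) → ℂ) : MemLp (stepFun ω n c) 2 ν := by
  refine MemLp.of_bound (C := ∑ i, ‖c i‖) ?_ (Eventually.of_forall fun x => ?_)
  · have h1 : Measurable fun k : ℕ => c (Fin.ofNat (n + 1) k) := measurable_from_nat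
    have h2 : Measurable fun x : ℝ => ⌊x * (n + 1) / ω⌋₊ := Nat.measurable_floor.comp (by fun_prop)
    exact (h1.comp h2).aestronglyMeasurable
  · exact Finset.single_le_sum (f := fun i => ‖c i‖) (fun i _ => norm_nonneg _) (Finset.mem_univ _)

/-- The step functions as a finite dimensional subspace of `L²`. -/
def stepOp (ω : ℝ) (n : ℕ) : (Fin (n + 1) → ℂ) →L[ℂ] Lp ℂ 2 ν :=
  LinearMap.toContinuousLinearMap
    { toFun := fun c => (memLp_stepFun (ω := ω) ν n c).toLp
      map_add' := fun f g => MemLp.toLp_add (memLp_stepFun ν n f) (memLp_stepFun ν n g)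
      map_smul' := fun c f => MemLp.toLp_const_smul c (memLp_stepFun ν n f) }

theorem norm_sub_stepFun_le (hω : 0 < ω) (f : (periodicDomain hω).Carrier) (n : ℕ) {x : ℝ}
    (hx : x ∈ Ico 0 ω) :
    ‖f x - stepFun ω n (fun i => f (i * ω / (n + 1))) x‖ ≤ √(ω / (n + 1)) * ‖f‖ := by
  set k := ⌊x * (n + 1) / ω⌋₊ with hk
  have hn : (0 : ℝ) < n + 1 := by positivity
  have h1 : (k : ℝ) ≤ x * (n + 1) / ω := Nat.floor_le (by have := hx.1; positivity)
  have h2 : x * (n + 1) / ω < k + 1 := Nat.lt_floor_add_one _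
  rw [le_div_iff₀ hω] at h1
  rw [div_lt_iff₀ hω] at h2
  have hkn : k < n + 1 := by
    have : (k : ℝ) * ω < (n + 1) * ω := by nlinarith [hx.2]
    have := lt_of_mul_lt_mul_right this hω.le
    exact_mod_cast this
  have e : stepFun ω n (fun i => f (i * ω / (n + 1))) x = f (k * ω / (n + 1)) := by
    change f (((Fin.ofNat (n + 1) k : Fin (n + 1)) : ℕ) * ω / (n + 1)) = _
    rw [Fin.val_ofNat, Nat.mod_eq_of_lt hkn]
  rw [e]
  refine le_of_sq_le_sq ?_ (by positivity)
  rw [mul_pow, Real.sq_sqrt (by positivity)]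
  have ha : (k : ℝ) * ω / (n + 1) ≤ x := by rw [div_le_iff₀ hn]; linarith
  have hb : x ≤ (k + 1) * ω / (n + 1) := by rw [le_div_iff₀ hn]; linarith
  have h3 := f.h1.norm_sub_sq_le (ha.trans hb) ⟨ha, hb⟩ ⟨le_rfl, ha.trans hb⟩
  refine h3.trans ?_
  have e2 : ((k : ℝ) + 1) * ω / (n + 1) - k * ω / (n + 1) = ω / (n + 1) := by ring
  rw [e2]
  refine mul_le_mul_of_nonneg_left ?_ (by positivity)
  have h4 := pow_le_pow_left₀ (norm_nonneg _) ((periodicDomain hω).norm_D_le f) 2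
  rw [(periodicDomain hω).norm_D_sq] at h4
  refine le_trans (setIntegral_mono_set f.memLp_deriv.norm.integrable_sq
    (Eventually.of_forall fun x => by positivity) ?_) h4
  refine (Icc_subset_Icc (by positivity) ?_).eventuallyLE
  rw [div_le_iff₀ hn]
  have : (k : ℝ) + 1 ≤ n + 1 := by exact_mod_cast hkn
  nlinarith

theorem isCompactOperator_periodTrace (hν : ν (Ico 0 ω)ᶜ = 0) :
    IsCompactOperator (periodTrace hω ν hν) := by
  let S : ℕ → (periodicDomain hω).Carrier →L[ℂ] Lp ℂ 2 ν := fun n =>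
    stepOp ν ω n ∘L ContinuousLinearMap.pi fun i => (periodicDomain hω).ev (i * ω / (n + 1))
  refine isCompactOperator_of_tendsto (F := S) (l := atTop) ?_ (Eventually.of_forall fun n => ?_)
  · rw [tendsto_iff_norm_sub_tendsto_zero]
    have hlim : Tendsto (fun n : ℕ => (ν.real univ) ^ (2 : ENNReal).toReal⁻¹ * √(ω / (n + 1)))
        atTop (𝓝 0) := by
      have h1 : Tendsto (fun n : ℕ => ω / ((n : ℝ) + 1)) atTop (𝓝 0) :=
        tendsto_const_nhds.div_atTop (tendsto_natCast_atTop_atTop.atTop_add tendsto_const_nhds)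
      have h2 := (h1.sqrt).const_mul ((ν.real univ) ^ (2 : ENNReal).toReal⁻¹)
      rwa [Real.sqrt_zero, mul_zero] at h2
    refine squeeze_zero (fun n => norm_nonneg _) (fun n => ?_) hlim
    refine ContinuousLinearMap.opNorm_le_bound _ (by positivity) fun f => ?_
    rw [sub_apply, norm_sub_rev, mul_assoc]
    refine Lp.norm_le_of_ae_bound (by positivity) ?_
    have e1 : S n f = (memLp_stepFun (ω := ω) ν n fun i => f (i * ω / (n + 1))).toLp := rfl
    rw [periodTrace_apply, e1, ← MemLp.toLp_sub]
    filter_upwards [((memLp_two_of_carried ν hν f.h1.continuous).sub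
      (memLp_stepFun (ω := ω) ν n fun i => f (i * ω / (n + 1)))).coeFn_toLp,
      measure_eq_zero_iff_ae_notMem.1 hν] with x hx hx2
    rw [hx]
    exact norm_sub_stepFun_le hω f n (not_not.1 hx2)
  · exact (isCompactOperator_of_locallyCompactSpace_rng (stepOp ν ω n)).comp_clm _

end Compact

theorem isCompactOperator_of_inner {H L₁ L₂ : Type*} [NormedAddCommGroup H] [InnerProductSpace ℂ H]
    [CompleteSpace H] [NormedAddCommGroup L₁] [InnerProductSpace ℂ L₁] [CompleteSpace L₁]
    [NormedAddCommGroup L₂] [InnerProductSpace ℂ L₂] [CompleteSpace L₂] {R : H →L[ℂ] H}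
    {E : H →L[ℂ] L₁} {F : H →L[ℂ] L₂} (hE : IsCompactOperator E) (hF : IsCompactOperator F)
    (h : ∀ f g, ⟪E f, E g⟫_ℂ - ⟪F f, F g⟫_ℂ = ⟪f, R g⟫_ℂ) : IsCompactOperator R := by
  have e : R = E.adjoint ∘L E - F.adjoint ∘L F := by
    ext1 g
    refine ext_inner_left ℂ fun f => ?_
    rw [← h, sub_apply, inner_sub_right, ContinuousLinearMap.comp_apply,
      ContinuousLinearMap.comp_apply, ContinuousLinearMap.adjoint_inner_right,
      ContinuousLinearMap.adjoint_inner_right]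
  rw [e]
  exact (hE.clm_comp E.adjoint).sub (hF.clm_comp F.adjoint)

/-- The operator of the weight on periodic functions is compact. -/
theorem Weight.isCompactOperator {ω : ℝ} (hω : 0 < ω) (r : Weight ω) {s : ℝ → ℂ}
    (hs : Potential ω s) (h : ∀ h : ℝ → ℂ, IsH1Loc h → (∀ x, h (x + ω) = h x) →
      r.pair h = ∫ x in Icc 0 ω, dens 0 s h (fun _ => 1) x) :
    IsCompactOperator ((periodicDomain hω).potOp s) := by
  refine isCompactOperator_of_inner (isCompactOperator_periodTrace hω r.pos r.pos_compl)
    (isCompactOperator_periodTrace hω r.neg r.neg_compl) fun f g => ?_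
  rw [inner_periodTrace, inner_periodTrace]
  exact r.pair_conj_mul hω hs h f g


/-! ### Test functions seeing only one part of a signed measure -/

section Bumps

/-- The piecewise linear function of the distance to `K` that is `1` on `K` and `0` at distance at
least `ε` from it. -/
def distBump (K : Set ℝ) (ε x : ℝ) : ℝ := max 0 (1 - Metric.infDist x K / ε)

theorem distBump_nonneg (K : Set ℝ) (ε x : ℝ) : 0 ≤ distBump K ε x := le_max_left _ _

theorem distBump_le_one (K : Set ℝ) {ε : ℝ} (hε : 0 < ε) (x : ℝ) : distBump K ε x ≤ 1 := by
  refine max_le zero_le_one ?_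
  have : 0 ≤ Metric.infDist x K / ε := div_nonneg Metric.infDist_nonneg hε.le
  linarith

theorem distBump_eq_zero {K : Set ℝ} {ε x : ℝ} (hε : 0 < ε) (hx : ε ≤ Metric.infDist x K) :
    distBump K ε x = 0 := by
  refine max_eq_left ?_
  rw [sub_nonpos, le_div_iff₀ hε]
  linarith

theorem distBump_lipschitz (K : Set ℝ) {ε : ℝ} (hε : 0 < ε) :
    LipschitzWith (Real.toNNReal (1 / ε)) fun x => (distBump K ε x : ℂ) := by
  refine LipschitzWith.of_dist_le_mul fun x y => ?_
  rw [Real.coe_toNNReal _ (by positivity)]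
  rw [Complex.dist_eq, ← Complex.ofReal_sub, Complex.norm_real, Real.norm_eq_abs]
  unfold distBump
  have h1 := abs_max_sub_max_le_abs (1 - Metric.infDist x K / ε) (1 - Metric.infDist y K / ε) 0
  rw [max_comm _ (0 : ℝ), max_comm _ (0 : ℝ)] at h1
  refine h1.trans ?_
  have h2 := (Metric.lipschitz_infDist_pt K).dist_le_mul y x
  rw [NNReal.coe_one, one_mul, Real.dist_eq, dist_comm] at h2
  rw [show (1 - Metric.infDist x K / ε) - (1 - Metric.infDist y K / ε) =
    1 / ε * (Metric.infDist y K - Metric.infDist x K) by ring, abs_mul,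
    abs_of_pos (by positivity)]
  exact mul_le_mul_of_nonneg_left h2 (by positivity)

theorem continuous_distBump (K : Set ℝ) (ε : ℝ) : Continuous (distBump K ε) :=
  continuous_const.max
    (continuous_const.sub ((Metric.continuous_infDist_pt K).div_const ε))

theorem tendsto_distBump {K : Set ℝ} (hK : IsClosed K) (hne : K.Nonempty) {δ : ℝ} (hδ : 0 < δ)
    (x : ℝ) : Tendsto (fun n : ℕ => distBump K (δ / (n + 1)) x) atTop
      (𝓝 (K.indicator (fun _ => 1) x)) := by
  by_cases hx : x ∈ K
  · rw [indicator_of_mem hx]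
    refine tendsto_const_nhds.congr fun n => ?_
    simp [distBump, Metric.infDist_zero_of_mem hx]
  · rw [indicator_of_notMem hx]
    have hd := (hK.notMem_iff_infDist_pos hne).1 hx
    have h0 : Tendsto (fun n : ℕ => δ / ((n : ℝ) + 1)) atTop (𝓝 0) :=
      tendsto_const_div_atTop_nhds_zero_nat δ |>.comp (tendsto_add_atTop_nat 1) |>.congr
        fun n => by simp
    refine tendsto_const_nhds.congr' ?_
    filter_upwards [h0.eventually (gt_mem_nhds hd)] with n hn
    exact (distBump_eq_zero (by positivity) hn.le).symm

/-- Inside an open set charged by one of two mutually singular measures there is a Lipschitz test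
function to which that measure gives more weight than the other one does: approximate from above a
compact set that is charged by the first and negligible for the second. -/
theorem exists_bump {ν₁ ν₂ : Measure ℝ} [IsFiniteMeasure ν₁] [IsFiniteMeasure ν₂]
    (hs : ν₁ ⟂ₘ ν₂) {O : Set ℝ} (hO : IsOpen O) (hpos : 0 < ν₁ O) {w : ℝ → ℝ} (hw : Continuous w)
    (hwpos : ∀ x ∈ O, 0 < w x) :
    ∃ (b : ℝ → ℝ), (fun x => (b x : ℂ)) ∈ H1c ∧ (∀ x, x ∉ O → b x = 0) ∧
      ∫ x, b x ^ 2 * w x ∂ν₂ < ∫ x, b x ^ 2 * w x ∂ν₁ := by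
  obtain ⟨S, hS, h1, h2⟩ := hs
  have hpos' : 0 < ν₁ (O ∩ Sᶜ) := by
    refine hpos.trans_le ?_
    calc ν₁ O ≤ ν₁ (O ∩ Sᶜ ∪ S) := measure_mono fun x hx => by
          by_cases h : x ∈ S
          · exact Or.inr h
          · exact Or.inl ⟨hx, h⟩
      _ ≤ ν₁ (O ∩ Sᶜ) + ν₁ S := measure_union_le _ _
      _ = ν₁ (O ∩ Sᶜ) := by rw [h1, add_zero]
  obtain ⟨K, hKO, hK, hνK⟩ := (hO.measurableSet.inter hS.compl).exists_lt_isCompact_of_ne_top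
    (measure_ne_top ν₁ _) hpos'
  have hne : K.Nonempty := nonempty_of_measure_ne_zero hνK.ne'
  obtain ⟨δ, hδ, hδO⟩ := hK.exists_cthickening_subset_open hO fun x hx => (hKO hx).1
  have hfar : ∀ (n : ℕ) x, x ∉ Metric.cthickening δ K → distBump K (δ / (n + 1)) x = 0 := by
    intro n x hx
    refine distBump_eq_zero (by positivity) ?_
    by_contra hlt
    push Not at hlt
    obtain ⟨y, hy, hxy⟩ := (Metric.infDist_lt_iff hne).1 hlt
    refine hx (Metric.mem_cthickening_of_dist_le x y δ K hy (hxy.le.trans ?_))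
    refine div_le_self hδ.le ?_
    linarith [(Nat.cast_nonneg n : (0 : ℝ) ≤ n)]
  obtain ⟨C, hC⟩ := (hK.cthickening (r := δ)).exists_bound_of_continuousOn hw.continuousOn
  have hbound : ∀ (n : ℕ) x, ‖distBump K (δ / (n + 1)) x ^ 2 * w x‖ ≤ |C| := by
    intro n x
    by_cases hx : x ∈ Metric.cthickening δ K
    · have h3 := distBump_nonneg K (δ / (n + 1)) x
      have h4 := distBump_le_one K (by positivity : 0 < δ / ((n : ℝ) + 1)) x
      rw [norm_mul, Real.norm_of_nonneg (sq_nonneg _)]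
      calc distBump K (δ / (n + 1)) x ^ 2 * ‖w x‖ ≤ 1 * ‖w x‖ :=
            mul_le_mul_of_nonneg_right (pow_le_one₀ h3 h4) (norm_nonneg _)
        _ ≤ |C| := by rw [one_mul]; exact (hC x hx).trans (le_abs_self C)
    · rw [hfar n x hx]; simp
  have hlim : ∀ ν : Measure ℝ, IsFiniteMeasure ν →
      Tendsto (fun n : ℕ => ∫ x, distBump K (δ / (n + 1)) x ^ 2 * w x ∂ν) atTop
        (𝓝 (∫ x in K, w x ∂ν)) := by
    intro ν _
    rw [← integral_indicator hK.measurableSet]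
    refine tendsto_integral_of_dominated_convergence (fun _ => |C|) (fun n => ?_)
      (integrable_const _) (fun n => Eventually.of_forall (hbound n))
      (Eventually.of_forall fun x => ?_)
    · exact (((continuous_distBump K _).pow 2).mul hw).aestronglyMeasurable
    · have := ((tendsto_distBump hK.isClosed hne hδ x).pow 2).mul_const (w x)
      have e : K.indicator (fun x => w x) x = K.indicator (fun _ => 1) x ^ 2 * w x := by
        by_cases hx : x ∈ K <;> simp [hx]
      rw [e]
      exact this
  have hK2 : ∫ x in K, w x ∂ν₂ = 0 := by
    rw [Measure.restrict_eq_zero.2 (measure_mono_null (fun x hx => (hKO hx).2) h2)]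
    simp
  have hK1 : 0 < ∫ x in K, w x ∂ν₁ := by
    rw [setIntegral_pos_iff_support_of_nonneg_ae]
    · refine hνK.trans_le (measure_mono fun x hx => ⟨(hwpos x (hKO hx).1).ne', hx⟩)
    · exact (ae_restrict_iff' hK.measurableSet).2
        (Eventually.of_forall fun x hx => (hwpos x (hKO hx).1).le)
    · exact hw.continuousOn.integrableOn_compact hK
  have h5 := (hlim ν₁ inferInstance).sub (hlim ν₂ inferInstance)
  rw [hK2, sub_zero] at h5
  obtain ⟨n, hn⟩ := (h5.eventually (lt_mem_nhds hK1)).exists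
  refine ⟨distBump K (δ / (n + 1)), ⟨IsH1Loc.of_lipschitz (distBump_lipschitz K (by positivity)),
    ?_⟩, fun x hx => hfar n x fun h => hx (hδO h), by linarith⟩
  refine HasCompactSupport.intro (hK.cthickening (r := δ)) fun x hx => ?_
  rw [hfar n x hx, Complex.ofReal_zero]

/-- A measure on a period that is not a finite sum of point masses charges arbitrarily many
disjoint open subsets of the period. -/
theorem exists_disjoint_open {ω : ℝ} {ν : Measure ℝ} (hν : ν (Ico 0 ω)ᶜ = 0)
    (h : ¬ FinitelyManyJumps ν) (N : ℕ) :
    ∃ O : Fin N → Set ℝ, (∀ i, IsOpen (O i) ∧ O i ⊆ Ioo 0 ω ∧ 0 < ν (O i)) ∧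
      ∀ i j, i ≠ j → Disjoint (O i) (O j) := by
  have hinf : (ν.support ∩ Ioo 0 ω).Infinite := by
    intro hfin
    refine h ⟨insert 0 hfin.toFinset, ?_⟩
    refine measure_mono_null (t := (Ico 0 ω)ᶜ ∪ ν.supportᶜ) ?_
      (measure_union_null hν Measure.measure_compl_support)
    intro x hx
    by_contra hc
    rw [mem_union, not_or, mem_compl_iff, mem_compl_iff, not_not, not_not] at hc
    refine hx ?_
    rw [Finset.mem_coe, Finset.mem_insert, Finite.mem_toFinset]
    rcases eq_or_lt_of_le hc.1.1 with h0 | h0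
    · exact Or.inl h0.symm
    · exact Or.inr ⟨hc.2, h0, hc.1.2⟩
  obtain ⟨t, ht, htc⟩ := hinf.exists_subset_card_eq N
  obtain ⟨U, hU, hd⟩ := t.finite_toSet.t2_separation
  let e : Fin N ≃ t := (finCongr htc.symm).trans t.equivFin.symm
  refine ⟨fun i => U (e i) ∩ Ioo 0 ω, fun i => ⟨(hU _).2.inter isOpen_Ioo, inter_subset_right, ?_⟩,
    fun i j hij => ?_⟩
  · have h1 := ht (e i).2
    exact Measure.mem_support_iff_forall _ |>.1 h1.1 _
      (((hU _).2.inter isOpen_Ioo).mem_nhds ⟨(hU _).1, h1.2⟩)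
  · refine (hd (e i).2 (e j).2 fun hc => hij ?_).mono inter_subset_left inter_subset_left
    exact e.injective (Subtype.ext hc)

/-- If `R₊` has infinitely many points of increase, then `r` is positive on spaces of periodic
functions of any finite dimension. -/
theorem Weight.exists_orthogonal {ω : ℝ} (hω : 0 < ω) (r : Weight ω)
    (h : ¬ FinitelyManyJumps r.pos) (N : ℕ) :
    ∃ f : Fin N → (periodicDomain hω).Carrier,
      (∀ i j, i ≠ j → r.pair (fun x => conj (f i x) * f j x) = 0) ∧
      ∀ i, 0 < (r.pair fun x => conj (f i x) * f i x).re := by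
  have := r.finite_pos
  have := r.finite_neg
  obtain ⟨O, hO, hd⟩ := exists_disjoint_open r.pos_compl h N
  choose b hb hbO hbpos using fun i => exists_bump r.mutuallySingular (hO i).1 (hO i).2.2
    (w := fun _ => 1) continuous_const fun _ _ => one_pos
  have heq : ∀ i, ∀ x ∈ Ico 0 ω, periodize ω 1 (fun x => (b i x : ℂ)) x = b i x := fun i x hx =>
    periodize_eq_self (fun y hy => by rw [hbO i y fun hc => hy ((hO i).2.1 hc)]; simp)
      ⟨hx.1, hx.2.le⟩
  -- the disjoint supports make the functions orthogonal
  refine ⟨fun i => FormDomain.of _ (mem_periodicDomain_periodize hω ⟨_, hb i⟩), fun i j hij => ?_,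
    fun i => ?_⟩
  · rw [← norm_le_zero_iff]
    refine (r.norm_pair_le (C := 0) fun x hx => ?_).trans (by rw [zero_mul])
    rw [FormDomain.coe_of, FormDomain.coe_of]
    rw [heq i x hx, heq j x hx]
    by_cases hxi : x ∈ O i
    · rw [hbO j x ((hd i j hij).notMem_of_mem_left hxi)]; simp
    · rw [hbO i x hxi]; simp
  · have hint : ∀ ν : Measure ℝ, ν (Ico 0 ω)ᶜ = 0 →
        ∫ x, conj (periodize ω 1 (fun x => (b i x : ℂ)) x) *
          periodize ω 1 (fun x => (b i x : ℂ)) x ∂ν = ((∫ x, b i x ^ 2 * 1 ∂ν : ℝ) : ℂ) := by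
      intro ν hν
      rw [← integral_complex_ofReal]
      refine integral_congr_ae ?_
      filter_upwards [measure_eq_zero_iff_ae_notMem.1 hν] with x hx
      rw [heq i x (not_not.1 hx), Complex.conj_ofReal]
      push_cast
      ring
    have : r.pair (fun x => conj (periodize ω 1 (fun x => (b i x : ℂ)) x) *
          periodize ω 1 (fun x => (b i x : ℂ)) x) =
        (((∫ x, b i x ^ 2 * 1 ∂r.pos) - ∫ x, b i x ^ 2 * 1 ∂r.neg : ℝ) : ℂ) := by
      unfold Weight.pair
      rw [hint _ r.pos_compl, hint _ r.neg_compl, Complex.ofReal_sub]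
    refine lt_of_lt_of_eq (sub_pos.2 (hbpos i)) ?_
    exact (congrArg Complex.re this).symm

end Bumps


/-! ### Birman–Schwinger operators -/

section BirmanSchwinger

variable {H L : Type*} [NormedAddCommGroup H] [InnerProductSpace ℂ H] [CompleteSpace H]
  [NormedAddCommGroup L] [InnerProductSpace ℂ L] [CompleteSpace L]

/-- The operator on `L` whose sesquilinear form is that of `R` on the form domain `H`, transported
by the isomorphism `U`. With `U = A^(-1/2)` this is `A^(-1/2) R A^(-1/2)`. -/
def birmanSchwinger (U : L ≃L[ℂ] H) (R : H →L[ℂ] H) : L →L[ℂ] L :=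
  (U : L →L[ℂ] H).adjoint ∘L R ∘L (U : L →L[ℂ] H)

theorem inner_birmanSchwinger (U : L ≃L[ℂ] H) (R : H →L[ℂ] H) (u v : L) :
    ⟪u, birmanSchwinger U R v⟫_ℂ = ⟪U u, R (U v)⟫_ℂ := by
  change ⟪u, (U : L →L[ℂ] H).adjoint (R (U v))⟫_ℂ = _
  rw [ContinuousLinearMap.adjoint_inner_right]
  rfl

variable {U : L ≃L[ℂ] H} {A : H →L[ℂ] H}

theorem birmanSchwinger_form (hU : ∀ u v, ⟪U u, A (U v)⟫_ℂ = ⟪u, v⟫_ℂ) :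
    birmanSchwinger U A = 1 := by
  ext1 v
  refine ext_inner_left ℂ fun u => ?_
  rw [inner_birmanSchwinger, hU]
  rfl

theorem bijective_adjoint_equiv (U : L ≃L[ℂ] H) :
    Function.Bijective (U : L →L[ℂ] H).adjoint := by
  constructor
  · intro x y hxy
    refine ext_inner_left ℂ fun h => ?_
    have := congrArg (fun z => ⟪U.symm h, z⟫_ℂ) hxy
    simpa [ContinuousLinearMap.adjoint_inner_right] using this
  · intro w
    refine ⟨(U.symm : H →L[ℂ] L).adjoint w, ext_inner_left ℂ fun u => ?_⟩
    rw [ContinuousLinearMap.adjoint_inner_right, ContinuousLinearMap.adjoint_inner_right]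
    simp

theorem birmanSchwinger_sub (hU : ∀ u v, ⟪U u, A (U v)⟫_ℂ = ⟪u, v⟫_ℂ) (R : H →L[ℂ] H) (z : ℂ) :
    birmanSchwinger U R - z • (1 : L →L[ℂ] L) = birmanSchwinger U (R - z • A) := by
  rw [← birmanSchwinger_form hU]
  ext1 v
  simp [birmanSchwinger]

theorem hasEigenvalue_birmanSchwinger_iff (hU : ∀ u v, ⟪U u, A (U v)⟫_ℂ = ⟪u, v⟫_ℂ)
    (R : H →L[ℂ] H) (z : ℂ) :
    Module.End.HasEigenvalue (birmanSchwinger U R).toLinearMap z ↔ ∃ f, f ≠ 0 ∧ R f = z • A f := by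
  have key : ∀ v, birmanSchwinger U R v = z • v ↔ R (U v) = z • A (U v) := by
    intro v
    have h1 := congrArg (fun M : L →L[ℂ] L => M v) (birmanSchwinger_sub hU R z)
    have h2 : birmanSchwinger U R v - z • v =
        (U : L →L[ℂ] H).adjoint (R (U v) - z • A (U v)) := h1
    rw [← sub_eq_zero, h2, ← sub_eq_zero (a := R (U v)),
      (injective_iff_map_eq_zero' _).1 (bijective_adjoint_equiv U).1]
  rw [Module.End.HasEigenvalue, Module.End.HasUnifEigenvalue, Submodule.ne_bot_iff]
  constructor
  · rintro ⟨v, hv, hv0⟩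
    rw [Module.End.mem_eigenspace_iff] at hv
    exact ⟨U v, by simpa using hv0, (key v).1 hv⟩
  · rintro ⟨f, hf0, hf⟩
    refine ⟨U.symm f, Module.End.mem_eigenspace_iff.2 ((key _).2 ?_), by simpa using hf0⟩
    simpa using hf

theorem mem_spectrum_birmanSchwinger_iff (hU : ∀ u v, ⟪U u, A (U v)⟫_ℂ = ⟪u, v⟫_ℂ)
    (R : H →L[ℂ] H) (z : ℂ) :
    z ∈ spectrum ℂ (birmanSchwinger U R) ↔ ¬ Function.Bijective (R - z • A) := by
  rw [spectrum.mem_iff, not_iff_not, Algebra.algebraMap_eq_smul_one, ← IsUnit.neg_iff, neg_sub,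
    birmanSchwinger_sub hU, ContinuousLinearMap.isUnit_iff_bijective]
  have e : ⇑(birmanSchwinger U (R - z • A)) =
      (U : L →L[ℂ] H).adjoint ∘ ⇑(R - z • A) ∘ U := rfl
  rw [e, Function.Bijective.of_comp_iff' (bijective_adjoint_equiv U),
    Function.Bijective.of_comp_iff _ U.bijective]

theorem isSelfAdjoint_birmanSchwinger (U : L ≃L[ℂ] H) {R : H →L[ℂ] H}
    (hR : ∀ f g, ⟪R f, g⟫_ℂ = ⟪f, R g⟫_ℂ) : IsSelfAdjoint (birmanSchwinger U R) := by
  rw [ContinuousLinearMap.isSelfAdjoint_iff_isSymmetric]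
  intro u v
  change ⟪birmanSchwinger U R u, v⟫_ℂ = ⟪u, birmanSchwinger U R v⟫_ℂ
  rw [inner_birmanSchwinger, ← inner_conj_symm, inner_birmanSchwinger, inner_conj_symm, hR]

/-- A form `⟪·, A ·⟫` that is coercive on a dense subspace of `L`, embedded by `J`, has an inverse
square root `K`, and a bounded form `⟪·, R ·⟫` gives the operator `B = K R K`. -/
theorem exists_birmanSchwinger (J : H →L[ℂ] L) (hJ : Function.Injective J) (hd : DenseRange J)
    (A : H →L[ℂ] H) (hA : ∀ x y, ⟪A x, y⟫_ℂ = ⟪x, A y⟫_ℂ) {a : ℝ} (ha : 0 < a)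
    (hco : ∀ f, a * ‖f‖ ^ 2 ≤ (⟪f, A f⟫_ℂ).re) (R : H →L[ℂ] H)
    (hR : ∀ f g, ⟪R f, g⟫_ℂ = ⟪f, R g⟫_ℂ) :
    ∃ (U : L → H) (K B : L →L[ℂ] L), K.IsPositive ∧ (∀ u, K u = J (U u)) ∧
      (∀ u w, (∃ F, J F = u ∧ ∀ g, ⟪g, A F⟫_ℂ = ⟪J g, w⟫_ℂ) ↔ u = K (K w)) ∧
      (∀ u v, ⟪u, B v⟫_ℂ = ⟪U u, R (U v)⟫_ℂ) ∧ IsSelfAdjoint B ∧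
      (∀ z : ℂ, Module.End.HasEigenvalue B.toLinearMap z ↔ ∃ f, f ≠ 0 ∧ R f = z • A f) ∧
      ∀ z : ℂ, z ∈ spectrum ℂ B ↔ ¬ Function.Bijective (R - z • A) := by
  obtain ⟨U, hU, hK⟩ := exists_form_iso J hJ hd A hA ha hco
  exact ⟨U, J ∘L (U : L →L[ℂ] H), birmanSchwinger U R, hK, fun _ => rfl, form_graph_iff hU hK,
    inner_birmanSchwinger U R, isSelfAdjoint_birmanSchwinger U hR,
    hasEigenvalue_birmanSchwinger_iff hU R, mem_spectrum_birmanSchwinger_iff hU R⟩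

end BirmanSchwinger

/-! ### Quasi-periodic boundary conditions -/

section Theta

variable {ω : ℝ} (hω : 0 < ω)

theorem coeFn_twistJ (κ : ℝ) (f : (periodicDomain hω).Carrier) :
    twistJ hω κ f =ᵐ[volume.restrict (Icc 0 ω)] twist κ f :=
  ((f.h1.twist κ).memLp 0 ω).coeFn_toLp

theorem isQuasiPeriodic_twist (θ : ℝ) (f : (periodicDomain hω).Carrier) :
    IsQuasiPeriodic ω θ (twist (θ / ω) f) :=
  (isQuasiPeriodic_iff hω).2 ⟨f.h1.twist _, twist_add_period _ (mem_periodicDomain.1 f.mem).2⟩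

/-- The defining relation of `T_θ` in terms of the form on the fixed space of periodic functions. -/
theorem thetaOp_iff {q : HNegOneLoc} {p : ℝ → ℂ} (hp : Potential ω p)
    (hq : ∀ v : H1c, q.pair v = ∫ x, dens 0 p v.1 (fun _ => 1) x) (θ : ℝ) (u w : L2Period ω) :
    thetaOp hω θ q u w ↔ ∃ F, twistJ hω (θ / ω) F = u ∧
      ∀ g, ⟪g, twistOp hω (θ / ω) p F⟫_ℂ = ⟪twistJ hω (θ / ω) g, w⟫_ℂ := by
  have hJ : ∀ g, ⟪twistJ hω (θ / ω) g, w⟫_ℂ = ∫ x in Icc 0 ω, conj (twist (θ / ω) g x) * w x := by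
    intro g
    refine (L2.inner_def _ _).trans (integral_congr_ae ?_)
    filter_upwards [((g.h1.twist (θ / ω)).memLp 0 ω).coeFn_toLp] with x hx
    rw [twistJ_apply, hx, RCLike.inner_apply, mul_comm]
  have hqp := isQuasiPeriodic_twist hω θ
  have hmem : ∀ f, IsQuasiPeriodic ω θ f → twist (-(θ / ω)) f ∈ (periodicDomain hω).W := fun f hf =>
    mem_periodicDomain_of_quasiPeriodic hω hf.1 ((isQuasiPeriodic_iff hω).1 hf).2
  constructor
  · rintro ⟨f, hf, hu, h⟩
    refine ⟨FormDomain.of _ (hmem f hf), ?_, fun g => ?_⟩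
    · rw [twistJ_apply]
      refine Lp.ext ?_
      refine (MemLp.coeFn_toLp _).trans ?_
      rw [FormDomain.coe_of, twist_twist_neg]
      exact hu.symm
    · rw [hJ, ← h _ (hqp g), inner_twistOp_eq hω hp, FormDomain.coe_of, twist_twist_neg]
      exact (thetaForm_eq hω hp hq (hqp g) hf).symm
  · rintro ⟨F, rfl, h⟩
    refine ⟨twist (θ / ω) F, hqp F, coeFn_twistJ hω _ F, fun v hv => ?_⟩
    have h1 := h (FormDomain.of _ (hmem v hv))
    rw [hJ, inner_twistOp_eq hω hp, FormDomain.coe_of, twist_twist_neg] at h1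
    rw [← h1]
    exact thetaForm_eq hω hp hq hv (hqp F)

theorem Weight.swap_pair (r : Weight ω) (h : ℝ → ℂ) : r.swap.pair h = -r.pair h :=
  (neg_sub _ _).symm

/-- The periodic pencil has arbitrarily small positive eigenvalues, provided `R₊` is not a finite
sum of jumps. -/
theorem Weight.exists_pos_le {r : Weight ω} {s : ℝ → ℂ} (hs : Potential ω s)
    (hrs : ∀ h : ℝ → ℂ, IsH1Loc h → (∀ x, h (x + ω) = h x) →
      r.pair h = ∫ x in Icc 0 ω, dens 0 s h (fun _ => 1) x)
    {A : (periodicDomain hω).Carrier →L[ℂ] (periodicDomain hω).Carrier}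
    (hA : ∀ f g, ⟪A f, g⟫_ℂ = ⟪f, A g⟫_ℂ) {a : ℝ} (ha : 0 < a)
    (hco : ∀ f, a * ‖f‖ ^ 2 ≤ (⟪f, A f⟫_ℂ).re) (h : ¬ FinitelyManyJumps r.pos)
    {ε : ℝ} (hε : 0 < ε) :
    ∃ t ∈ {t : ℝ | 0 < t ∧ ∃ f, f ≠ 0 ∧ (periodicDomain hω).potOp s f = (t : ℂ) • A f},
      t ≤ ε := by
  refine exists_eigenvalue_le (r.isCompactOperator hω hs hrs)
    ((periodicDomain hω).potOp_symm hs) hA ha hco (fun N => ?_) hε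
  obtain ⟨f, h1, h2⟩ := r.exists_orthogonal hω h N
  exact ⟨f, fun i j hij => (r.pair_conj_mul hω hs hrs _ _).symm.trans (h1 i j hij),
    fun i => lt_of_lt_of_eq (h2 i) (congrArg Complex.re (r.pair_conj_mul hω hs hrs _ _))⟩

theorem Weight.exists_neg_le {r : Weight ω} {s : ℝ → ℂ} (hs : Potential ω s)
    (hrs : ∀ h : ℝ → ℂ, IsH1Loc h → (∀ x, h (x + ω) = h x) →
      r.pair h = ∫ x in Icc 0 ω, dens 0 s h (fun _ => 1) x)
    {A : (periodicDomain hω).Carrier →L[ℂ] (periodicDomain hω).Carrier}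
    (hA : ∀ f g, ⟪A f, g⟫_ℂ = ⟪f, A g⟫_ℂ) {a : ℝ} (ha : 0 < a)
    (hco : ∀ f, a * ‖f‖ ^ 2 ≤ (⟪f, A f⟫_ℂ).re) (h : ¬ FinitelyManyJumps r.neg)
    {ε : ℝ} (hε : 0 < ε) :
    ∃ t ∈ {t : ℝ | 0 < t ∧ ∃ f, f ≠ 0 ∧ (-(periodicDomain hω).potOp s) f = (t : ℂ) • A f},
      t ≤ ε := by
  refine exists_eigenvalue_le (r.isCompactOperator hω hs hrs).neg (fun f g => ?_) hA ha hco
    (fun N => ?_) hε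
  · change ⟪-((periodicDomain hω).potOp s f), g⟫_ℂ = ⟪f, -((periodicDomain hω).potOp s g)⟫_ℂ
    rw [inner_neg_left, inner_neg_right, (periodicDomain hω).potOp_symm hs]
  obtain ⟨f, h1, h2⟩ := r.swap.exists_orthogonal hω h N
  have key : ∀ i j, r.swap.pair (fun x => conj (f i x) * f j x) =
      ⟪f i, (-(periodicDomain hω).potOp s) (f j)⟫_ℂ := fun i j => by
    rw [r.swap_pair, r.pair_conj_mul hω hs hrs, neg_apply, inner_neg_right]
  exact ⟨f, fun i j hij => (key i j).symm.trans (h1 i j hij),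
    fun i => lt_of_lt_of_eq (h2 i) (congrArg Complex.re (key i i))⟩

/-- The Birman–Schwinger operators over one period: existence and infinitude of eigenvalues. -/
theorem exists_thetaBS {q : HNegOneLoc} (hq_real : q.IsReal) (hq_per : q.IsPeriodic ω)
    (r : Weight ω) {θ c : ℝ} (hc : 0 < c) (hb : BoundedBelow (thetaOp hω θ q) c) :
    ∃ K B : L2Period ω →L[ℂ] L2Period ω, IsInvSqrt (thetaOp hω θ q) K ∧
      (∀ u v : L2Period ω, ∃ f g : ℝ → ℂ, IsQuasiPeriodic ω θ f ∧ IsQuasiPeriodic ω θ g ∧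
        K u =ᵐ[volume.restrict (Icc 0 ω)] f ∧ K v =ᵐ[volume.restrict (Icc 0 ω)] g ∧
        ⟪u, B v⟫_ℂ = r.pair fun x => conj (f x) * g x) ∧
      (¬ FinitelyManyJumps r.pos →
        {t : ℝ | 0 < t ∧ Module.End.HasEigenvalue B.toLinearMap (t : ℂ)}.Infinite) ∧
      (¬ FinitelyManyJumps r.neg →
        {t : ℝ | t < 0 ∧ Module.End.HasEigenvalue B.toLinearMap (t : ℂ)}.Infinite) := by
  obtain ⟨p, hp, hq⟩ := hq_per.exists_potential hω hq_real
  obtain ⟨s, hs, hrs⟩ := r.exists_potential hω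
  have hA := twistOp_symm hω hp (θ / ω)
  have hlow : ∀ f, c * ‖(periodicDomain hω).J f‖ ^ 2 ≤ (⟪f, twistOp hω (θ / ω) p f⟫_ℂ).re := by
    intro f
    obtain ⟨C, -, hg⟩ := twistOp_garding hω hp |θ / ω|
    rw [← norm_twistJ_sq hω (θ / ω)]
    refine form_lower_bound (twistJ hω (θ / ω)) (twistJ_injective hω _) _ hA
      (show (0 : ℝ) < 1 / 4 by norm_num) (C := C) (fun f => ?_) (fun F w h => ?_) f
    · rw [norm_twistJ_sq]
      exact hg _ ⟨neg_abs_le _, le_abs_self _⟩ f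
    · exact hb _ _ ((thetaOp_iff hω hp hq θ _ _).2 ⟨F, rfl, h⟩)
  obtain ⟨a, ha, hco⟩ := twistOp_coercive hω hp |θ / ω| hc
  replace hco := hco _ ⟨neg_abs_le _, le_abs_self _⟩ hlow
  obtain ⟨U, K, B, hK, hKU, hKK, hB, -, hev, -⟩ := exists_birmanSchwinger (twistJ hω (θ / ω))
    (twistJ_injective hω _) (denseRange_twistJ hω _) _ hA ha hco ((periodicDomain hω).potOp s)
    ((periodicDomain hω).potOp_symm hs)
  refine ⟨K, B, ⟨hK, fun u w => (thetaOp_iff hω hp hq θ u w).trans (hKK u w)⟩, fun u v => ?_,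
    fun h => ?_, fun h => ?_⟩
  · refine ⟨twist (θ / ω) (U u), twist (θ / ω) (U v), isQuasiPeriodic_twist hω θ (U u),
      isQuasiPeriodic_twist hω θ (U v), ?_, ?_, (hB u v).trans ?_⟩
    · rw [hKU]; exact coeFn_twistJ hω _ (U u)
    · rw [hKU]; exact coeFn_twistJ hω _ (U v)
    · rw [funext (conj_twist_mul_twist (θ / ω) (U u) (U v))]
      exact (r.pair_conj_mul hω hs hrs (U u) (U v)).symm
  · exact (infinite_of_forall_exists_le (fun t ht => ht.1) fun ε hε =>
      Weight.exists_pos_le hω hs hrs hA ha hco h hε).mono fun t ht => ⟨ht.1, (hev t).2 ht.2⟩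
  · refine ((infinite_of_forall_exists_le (fun t ht => ht.1) fun ε hε =>
      Weight.exists_neg_le hω hs hrs hA ha hco h hε).image neg_injective.injOn).mono ?_
    rintro _ ⟨t, ⟨ht, f, hf0, hf⟩, rfl⟩
    refine ⟨neg_neg_iff_pos.2 ht, (hev _).2 ⟨f, hf0, ?_⟩⟩
    rw [neg_apply] at hf
    rw [Complex.ofReal_neg, neg_smul, ← hf, neg_neg]

end Theta


/-! ### The form on the line -/

section Line

variable {ω : ℝ} (hω : 0 < ω)

/-- The operator on `H¹(ℝ)` representing the form of `-d²/dx² + q`. -/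
def lineA (p : ℝ → ℂ) : (lineDomain hω).Carrier →L[ℂ] (lineDomain hω).Carrier :=
  (lineDomain hω).D.adjoint ∘L (lineDomain hω).D + (lineDomain hω).potOp p

theorem inner_lineA (p : ℝ → ℂ) (f g : (lineDomain hω).Carrier) :
    ⟪f, lineA hω p g⟫_ℂ =
      ⟪(lineDomain hω).D f, (lineDomain hω).D g⟫_ℂ + ⟪f, (lineDomain hω).potOp p g⟫_ℂ := by
  change ⟪f, (lineDomain hω).D.adjoint ((lineDomain hω).D g) + (lineDomain hω).potOp p g⟫_ℂ = _
  rw [inner_add_right, ContinuousLinearMap.adjoint_inner_right]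

theorem lineA_symm {p : ℝ → ℂ} (hp : Potential ω p) (f g : (lineDomain hω).Carrier) :
    ⟪lineA hω p f, g⟫_ℂ = ⟪f, lineA hω p g⟫_ℂ := by
  rw [← inner_conj_symm, inner_lineA, inner_lineA, map_add, inner_conj_symm, inner_conj_symm,
    (lineDomain hω).potOp_symm hp]

theorem inner_lineA_eq {p : ℝ → ℂ} (hp : Potential ω p) (f g : (lineDomain hω).Carrier) :
    ⟪f, lineA hω p g⟫_ℂ = ∫ x, dens 1 p (fun x => conj (f x)) g x := by
  have h := (lineDomain hω).inner_form_eq hp 1 f g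
  rw [one_mul] at h
  exact (inner_lineA hω p f g).trans h

/-- The pencil on the line has the density whose potential is the combination of the two
potentials. -/
theorem inner_line_pencil {p s : ℝ → ℂ} (hp : Potential ω p) (hs : Potential ω s) (α : ℂ)
    (f g : (lineDomain hω).Carrier) :
    ⟪f, (α • lineA hω p - (lineDomain hω).potOp s) g⟫_ℂ =
      ∫ x, dens α (fun x => α * p x - s x) (fun x => conj (f x)) g x := by
  have e0 := (lineDomain hω).inner_form_eq hs 0 f g
  rw [zero_mul, zero_add] at e0
  have h1 := (lineDomain hω).integrable_dens hp 1 f g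
  have h2 := (lineDomain hω).integrable_dens hs 0 f g
  rw [sub_apply, smul_apply, inner_sub_right, inner_smul_right, inner_lineA_eq hω hp, e0]
  refine (congrArg (· - _) (integral_const_mul α _).symm).trans ?_
  refine (integral_sub (h1.const_mul α) h2).symm.trans ?_
  refine integral_congr_ae ?_
  filter_upwards [hp.h1.ae_differentiableAt, hs.h1.ae_differentiableAt] with x h1 h2
  have e : deriv (fun x => α * p x - s x) x = α * deriv p x - deriv s x := by
    rw [deriv_fun_sub (h1.const_mul α) h2, deriv_const_mul _ h1]
  simp only [dens, e]
  ring

theorem inner_J_eq (v : H1c) (w : L2Line) :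
    ⟪(lineDomain hω).J (H1c.toLine hω v), w⟫_ℂ = ∫ x, conj (v.1 x) * w x := by
  refine (L2.inner_def _ _).trans (integral_congr_ae ?_)
  filter_upwards [(H1c.isH1 v).2.1.coeFn_toLp] with x hx
  rw [RCLike.inner_apply, mul_comm]
  exact congrArg (fun z => conj z * w x) hx

theorem denseRange_lineJ : DenseRange (lineDomain hω).J := by
  refine denseRange_of_forall_inner_eq_zero (H := L2Line) _ fun u hu => ?_
  have h0 : ∀ᵐ x : ℝ, u x = 0 := by
    refine ae_eq_zero_of_integral_contDiff_smul_eq_zero (μ := volume) (f := u)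
      ((Lp.memLp u).locallyIntegrable (by norm_num)) ?_
    intro g hg hgc
    have hgC : IsH1Loc fun x => ((g x : ℝ) : ℂ) :=
      IsH1Loc.of_contDiff (Complex.ofRealCLM.contDiff.comp (hg.of_le (by exact_mod_cast le_top)))
    let v : H1c := ⟨fun x => ((g x : ℝ) : ℂ), hgC,
      hgc.comp_left (g := fun t : ℝ => (t : ℂ)) Complex.ofReal_zero⟩
    have h1 := hu (H1c.toLine hω v)
    have h2 := (inner_J_eq hω v u).symm.trans ((inner_conj_symm _ _).symm.trans
      ((congrArg conj h1).trans (map_zero _)))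
    rw [← h2]
    refine integral_congr_ae (Eventually.of_forall fun x => ?_)
    change g x • u x = conj ((g x : ℝ) : ℂ) * u x
    rw [Complex.conj_ofReal, Complex.real_smul]
  exact (Lp.eq_zero_iff_ae_eq_zero).2 h0

/-- The defining relation of `T` in terms of the form on `H¹(ℝ)`. -/
theorem lineOp_iff {q : HNegOneLoc} {p : ℝ → ℂ} (hp : Potential ω p)
    (hq : ∀ v : H1c, q.pair v = ∫ x, dens 0 p v.1 (fun _ => 1) x) (u w : L2Line) :
    lineOp q u w ↔ ∃ F, (lineDomain hω).J F = u ∧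
      ∀ g, ⟪g, lineA hω p F⟫_ℂ = ⟪(lineDomain hω).J g, w⟫_ℂ := by
  have key : ∀ (F : (lineDomain hω).Carrier) (v : H1c),
      ⟪H1c.toLine hω v, lineA hω p F⟫_ℂ = weakSchrodinger q F F.h1 (H1c.conj v) := fun F v =>
    (inner_lineA_eq hω hp _ F).trans (weakSchrodinger_eq hp hq F F.h1 (H1c.conj v)).symm
  constructor
  · rintro ⟨f, hf, hu, h⟩
    refine ⟨FormDomain.of f hf, Lp.ext (hf.2.1.coeFn_toLp.trans hu.symm), fun g => ?_⟩
    refine (dense_H1c hω).induction_on (p := fun g => ⟪g, lineA hω p (FormDomain.of f hf)⟫_ℂ =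
      ⟪(lineDomain hω).J g, w⟫_ℂ) g ?_ fun v => ?_
    · exact isClosed_eq (continuous_id.inner continuous_const)
        ((lineDomain hω).J.continuous.inner continuous_const)
    · exact (key _ v).trans ((h _).trans (inner_J_eq hω v w).symm)
  · rintro ⟨F, rfl, h⟩
    refine ⟨F, F.mem, F.memLp.coeFn_toLp, fun v => ?_⟩
    have h1 := (key F (H1c.conj v)).symm.trans ((h _).trans (inner_J_eq hω (H1c.conj v) w))
    have e : H1c.conj (H1c.conj v) = v := Subtype.ext (funext fun x => Complex.conj_conj _)
    rw [e] at h1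
    refine h1.trans (integral_congr_ae (Eventually.of_forall fun x => ?_))
    change conj (conj (v.1 x)) * w x = v.1 x * w x
    rw [Complex.conj_conj]

theorem lineA_garding {p : ℝ → ℂ} (hp : Potential ω p) :
    ∃ C : ℝ, 0 ≤ C ∧ ∀ f : (lineDomain hω).Carrier,
      1 / 2 * ‖f‖ ^ 2 ≤ (⟪f, lineA hω p f⟫_ℂ).re + C * ‖(lineDomain hω).J f‖ ^ 2 := by
  obtain ⟨C, hC, h⟩ := (lineDomain hω).norm_inner_potOp_le hp (ε := 1 / 2) (by norm_num)
  refine ⟨C + 1 / 2, by positivity, fun f => ?_⟩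
  have h2 := (abs_le.1 ((Complex.abs_re_le_norm _).trans (h f))).1
  have h3 : (⟪f, lineA hω p f⟫_ℂ).re =
      ‖(lineDomain hω).D f‖ ^ 2 + (⟪f, (lineDomain hω).potOp p f⟫_ℂ).re := by
    refine (congrArg Complex.re (inner_lineA hω p f f)).trans ?_
    rw [Complex.add_re]
    exact congrArg (· + _) (inner_self_eq_norm_sq (𝕜 := ℂ) _)
  rw [h3, (lineDomain hω).norm_sq]
  nlinarith

theorem lineA_coercive {p : ℝ → ℂ} (hp : Potential ω p) {c : ℝ} (hc : 0 < c)
    (hl : ∀ f, c * ‖(lineDomain hω).J f‖ ^ 2 ≤ (⟪f, lineA hω p f⟫_ℂ).re) :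
    ∃ a : ℝ, 0 < a ∧ ∀ f, a * ‖f‖ ^ 2 ≤ (⟪f, lineA hω p f⟫_ℂ).re := by
  obtain ⟨C, hC, h⟩ := lineA_garding hω hp
  refine ⟨1 / 2 / (1 + C / c), by positivity, fun f => ?_⟩
  have h1 := h f
  have h2 := mul_le_mul_of_nonneg_left (hl f) (show 0 ≤ C / c by positivity)
  have e : C / c * (c * ‖(lineDomain hω).J f‖ ^ 2) = C * ‖(lineDomain hω).J f‖ ^ 2 := by
    field_simp
  rw [div_mul_eq_mul_div, div_le_iff₀ (by positivity)]
  nlinarith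

/-- The lower bound of the operator passes to the form, since the operator domain is a form core. -/
theorem lineA_lower_bound {q : HNegOneLoc} {p : ℝ → ℂ} (hp : Potential ω p)
    (hq : ∀ v : H1c, q.pair v = ∫ x, dens 0 p v.1 (fun _ => 1) x) {c : ℝ}
    (hb : BoundedBelow (lineOp q) c) (f : (lineDomain hω).Carrier) :
    c * ‖(lineDomain hω).J f‖ ^ 2 ≤ (⟪f, lineA hω p f⟫_ℂ).re := by
  obtain ⟨C, -, hg⟩ := lineA_garding hω hp
  exact form_lower_bound (lineDomain hω).J (lineDomain hω).J_injective _ (lineA_symm hω hp)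
    (show (0 : ℝ) < 1 / 2 by norm_num) hg
    (fun F w h => hb _ _ ((lineOp_iff hω hp hq _ _).2 ⟨F, rfl, h⟩)) f

/-- A bound for the pairing with test functions is a bound for the norm. -/
theorem norm_le_of_forall_H1c {y : (lineDomain hω).Carrier} {C : ℝ} (hC : 0 ≤ C)
    (h : ∀ v : H1c, ‖⟪H1c.toLine hω v, y⟫_ℂ‖ ≤ C * ‖H1c.toLine hω v‖) : ‖y‖ ≤ C := by
  have h1 : ‖⟪y, y⟫_ℂ‖ ≤ C * ‖y‖ :=
    (dense_H1c hω).induction_on (p := fun g => ‖⟪g, y⟫_ℂ‖ ≤ C * ‖g‖) y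
      (isClosed_le (continuous_id.inner continuous_const).norm
        (continuous_const.mul continuous_norm))
      h
  have h2 : ‖y‖ ^ 2 ≤ ‖⟪y, y⟫_ℂ‖ := by
    rw [← inner_self_eq_norm_sq (𝕜 := ℂ)]
    exact RCLike.re_le_norm _
  rcases eq_or_lt_of_le (norm_nonneg y) with h0 | h0
  · rwa [← h0]
  · nlinarith

end Line


/-! ### Cut-off quasi-periodic functions -/

section Cutoff

/-- Moving a cut-off from one argument of the form to the other. -/
theorem integral_dens_mul_right {Q χ ψ : ℝ → ℂ} (hQ : IsH1Loc Q) (hχ : IsH1Loc χ) (hψ : IsH1Loc ψ)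
    (α : ℂ) (v : H1c) :
    ∫ x, dens α Q v.1 (fun y => χ y * ψ y) x =
      (∫ x, dens α Q (fun y => v.1 y * χ y) ψ x) +
        ∫ x, α * (deriv χ x * (deriv v.1 x * ψ x - v.1 x * deriv ψ x)) := by
  have h1 := integrable_dens_H1c hQ v (hχ.mul hψ) α
  have h2 := integrable_dens_H1c hQ (mulH1c v χ hχ) hψ α
  have h3 := integral_sub h1 h2
  rw [← sub_eq_iff_eq_add']
  refine h3.symm.trans (integral_congr_ae ?_)
  filter_upwards [v.2.1.ae_differentiableAt, hχ.ae_differentiableAt, hψ.ae_differentiableAt]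
    with x d1 d2 d3
  simp only [dens, mulH1c]
  rw [deriv_fun_mul d1 d2, deriv_fun_mul d2 d3]
  ring

variable {ω : ℝ}

theorem setIntegral_Icc_periodic {g : ℝ → ℝ} (hi : ∀ a b, IntegrableOn g (Icc a b))
    (hg : ∀ x, g (x + ω) = g x) (hω : 0 < ω) (t : ℝ)
    (n : ℕ) : ∫ x in Icc t (t + n * ω), g x = n * ∫ x in Icc 0 ω, g x := by
  have hper : Function.Periodic g ω := hg
  rw [restrict_Icc_eq_Ioc, restrict_Icc_eq_Ioc,
    ← intervalIntegral.integral_of_le (by nlinarith [(Nat.cast_nonneg n : (0 : ℝ) ≤ n)]),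
    ← intervalIntegral.integral_of_le hω.le]
  have h1 := hper.intervalIntegral_add_zsmul_eq (n : ℤ) t
    fun a b => (hi (min a b) (max a b)).intervalIntegrable
  have h2 := hper.intervalIntegral_add_eq t 0
  rw [zero_add] at h2
  rw [h2] at h1
  simpa using h1

/-- The set where the cut-off with plateau `[-n ω, n ω]` varies. -/
def ramp (ω : ℝ) (n : ℕ) : Set ℝ := {x | n * ω ≤ |x| ∧ |x| ≤ n * ω + ω}

theorem measurableSet_ramp (n : ℕ) : MeasurableSet (ramp ω n) :=
  (measurableSet_le measurable_const measurable_id.abs).inter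
    (measurableSet_le measurable_id.abs measurable_const)

theorem deriv_trapezoid_of_notMem (hω : 0 < ω) {n : ℕ} {x : ℝ} (hx : x ∉ ramp ω n) :
    deriv (trapezoid ω (n * ω)) x = 0 := by
  refine deriv_trapezoid_eq_zero hω ?_
  by_contra hc
  push Not at hc
  exact hx hc

theorem integrable_indicator_ramp {g : ℝ → ℝ} (hg : ∀ a b, IntegrableOn g (Icc a b)) (n : ℕ) :
    Integrable ((ramp ω n).indicator g) := by
  rw [integrable_indicator_iff (measurableSet_ramp n)]
  exact (hg (-(n * ω + ω)) (n * ω + ω)).mono_set fun x hx => abs_le.1 hx.2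

theorem integral_indicator_ramp_le (hω : 0 < ω) {g : ℝ → ℝ} (hg : ∀ a b, IntegrableOn g (Icc a b))
    (h0 : ∀ x, 0 ≤ g x) (hper : ∀ x, g (x + ω) = g x) (n : ℕ) :
    ∫ x, (ramp ω n).indicator g x ≤ 2 * ∫ x in Icc 0 ω, g x := by
  have hA := setIntegral_Icc_periodic hg hper hω (n * ω) 1
  have hB := setIntegral_Icc_periodic hg hper hω (-(n * ω + ω)) 1
  rw [Nat.cast_one, one_mul, one_mul] at hA hB
  have i1 := (integrable_indicator_iff measurableSet_Icc).2 (hg (n * ω) (n * ω + ω))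
  have i2 := (integrable_indicator_iff measurableSet_Icc).2 (hg (-(n * ω + ω)) (-(n * ω + ω) + ω))
  calc ∫ x, (ramp ω n).indicator g x
      ≤ ∫ x, ((Icc (n * ω) (n * ω + ω)).indicator g x +
          (Icc (-(n * ω + ω)) (-(n * ω + ω) + ω)).indicator g x) := by
        refine integral_mono (integrable_indicator_ramp hg n) (i1.add i2) fun x => ?_
        have n1 := indicator_nonneg (s := Icc (n * ω) (n * ω + ω)) (fun x _ => h0 x) x
        have n2 := indicator_nonneg (s := Icc (-(n * ω + ω)) (-(n * ω + ω) + ω))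
          (fun x _ => h0 x) x
        by_cases hx : x ∈ ramp ω n
        · rw [indicator_of_mem hx]
          rcases abs_cases x with ⟨e, -⟩ | ⟨e, -⟩
          · rw [indicator_of_mem (s := Icc (n * ω) (n * ω + ω)) ⟨e ▸ hx.1, e ▸ hx.2⟩]
            linarith
          · rw [indicator_of_mem (s := Icc (-(n * ω + ω)) (-(n * ω + ω) + ω))
              ⟨by linarith [e ▸ hx.2], by linarith [e ▸ hx.1]⟩]
            linarith
        · rw [indicator_of_notMem hx]
          exact add_nonneg n1 n2
    _ = 2 * ∫ x in Icc 0 ω, g x := by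
        rw [integral_add i1 i2, integral_indicator measurableSet_Icc,
          integral_indicator measurableSet_Icc, hA, hB]
        ring

theorem indicator_norm_sq (S : Set ℝ) (f : ℝ → ℂ) (x : ℝ) :
    ‖S.indicator f x‖ ^ 2 = S.indicator (fun x => ‖f x‖ ^ 2) x := by
  by_cases hx : x ∈ S <;> simp [hx]

theorem memLp_indicator_ramp {f : ℝ → ℂ} (hf : ∀ a b, MemLp f 2 (volume.restrict (Icc a b)))
    (n : ℕ) : MemLp ((ramp ω n).indicator f) 2 volume := by
  rw [memLp_indicator_iff_restrict (measurableSet_ramp n)]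
  exact (hf (-(n * ω + ω)) (n * ω + ω)).mono_measure
    (Measure.restrict_mono (fun x hx => abs_le.1 hx.2) le_rfl)

theorem integral_norm_mul_ramp_le (hω : 0 < ω) {f : ℝ → ℂ}
    (hf : ∀ a b, MemLp f 2 (volume.restrict (Icc a b))) (hper : ∀ x, ‖f (x + ω)‖ = ‖f x‖)
    {v : ℝ → ℂ}
    (hv : MemLp v 2 volume) (n : ℕ) :
    ∫ x, ‖v x‖ * ‖(ramp ω n).indicator f x‖ ≤
      √(∫ x, ‖v x‖ ^ 2) * √(2 * ∫ x in Icc 0 ω, ‖f x‖ ^ 2) := by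
  have h1 := integral_norm_mul_norm_sq_le hv (memLp_indicator_ramp hf n (ω := ω))
  rw [← Real.sqrt_mul (integral_nonneg fun x => by positivity)]
  refine Real.le_sqrt_of_sq_le (h1.trans ?_)
  refine mul_le_mul_of_nonneg_left ?_ (integral_nonneg fun x => by positivity)
  simp only [indicator_norm_sq]
  exact integral_indicator_ramp_le hω (fun a b => integrable_norm_sq_of_memLp (hf a b))
    (fun x => by positivity) (fun x => by rw [hper]) n

/-- Cut-off quasi-periodic solutions are approximate solutions, with an error that does not depend
on the cut-off. -/
theorem IsSol.exists_cutoff_bound (hω : 0 < ω) {α : ℂ} {Q ψ : ℝ → ℂ} (hQ : IsH1Loc Q)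
    (hψ : IsSol α Q ψ) {σ : ℂ} (hσ : ‖σ‖ = 1) (hper : ∀ x, ψ (x + ω) = σ * ψ x) :
    ∃ C : ℝ, 0 ≤ C ∧ ∀ (n : ℕ) (v : H1c),
      ‖∫ x, dens α Q v.1 (cutoff hω (n * ω) ψ hψ.1).1 x‖ ≤ C * ‖H1c.toLine hω v‖ := by
  have hp0 : ∀ x, ‖ψ (x + ω)‖ = ‖ψ x‖ := fun x => by rw [hper, norm_mul, hσ, one_mul]
  have hp1 : ∀ x, ‖deriv ψ (x + ω)‖ = ‖deriv ψ x‖ := fun x => by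
    rw [deriv_shift hper, norm_mul, hσ, one_mul]
  set E₀ := √(2 * ∫ x in Icc 0 ω, ‖ψ x‖ ^ 2)
  set E₁ := √(2 * ∫ x in Icc 0 ω, ‖deriv ψ x‖ ^ 2)
  have hE₀ : 0 ≤ E₀ := Real.sqrt_nonneg _
  have hE₁ : 0 ≤ E₁ := Real.sqrt_nonneg _
  refine ⟨‖α‖ * (1 / ω) * (E₀ + E₁), by positivity, fun n v => ?_⟩
  have hv := H1c.isH1 v
  have e1 : ∫ x, dens α Q v.1 (cutoff hω (n * ω) ψ hψ.1).1 x =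
      ∫ x, α * (deriv (trapezoid ω (n * ω)) x * (deriv v.1 x * ψ x - v.1 x * deriv ψ x)) := by
    refine (integral_dens_mul_right hQ (trapezoid_isH1Loc hω _) hψ.1 α v).trans ?_
    exact (congrArg (· + _) (hψ.2 (mulH1c v _ (trapezoid_isH1Loc hω _)))).trans (zero_add _)
  have m0 := memLp_indicator_ramp (hψ.1.memLp) n (ω := ω)
  have m1 := memLp_indicator_ramp (hψ.1.2) n (ω := ω)
  have i0 : Integrable fun x => ‖deriv v.1 x‖ * ‖(ramp ω n).indicator ψ x‖ :=
    MemLp.integrable_mul (p := 2) (q := 2) hv.2.2.norm m0.norm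
  have i1 : Integrable fun x => ‖v.1 x‖ * ‖(ramp ω n).indicator (deriv ψ) x‖ :=
    MemLp.integrable_mul (p := 2) (q := 2) hv.2.1.norm m1.norm
  rw [e1]
  have n0 : √(∫ x, ‖deriv v.1 x‖ ^ 2) ≤ ‖H1c.toLine hω v‖ := by
    refine Real.sqrt_le_iff.2 ⟨norm_nonneg _, ?_⟩
    refine ((lineDomain hω).norm_D_sq (H1c.toLine hω v)).symm.trans_le ?_
    exact pow_le_pow_left₀ (norm_nonneg _) ((lineDomain hω).norm_D_le _) 2
  have n1 : √(∫ x, ‖v.1 x‖ ^ 2) ≤ ‖H1c.toLine hω v‖ := by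
    refine Real.sqrt_le_iff.2 ⟨norm_nonneg _, ?_⟩
    refine ((lineDomain hω).norm_J_sq (H1c.toLine hω v)).symm.trans_le ?_
    exact pow_le_pow_left₀ (norm_nonneg _) ((lineDomain hω).norm_J_le _) 2
  calc ‖∫ x, α * (deriv (trapezoid ω (n * ω)) x * (deriv v.1 x * ψ x - v.1 x * deriv ψ x))‖
      ≤ ∫ x, ‖α‖ * (1 / ω) * (‖deriv v.1 x‖ * ‖(ramp ω n).indicator ψ x‖ +
          ‖v.1 x‖ * ‖(ramp ω n).indicator (deriv ψ) x‖) := by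
        refine norm_integral_le_of_norm_le ((i0.add i1).const_mul _)
          (Eventually.of_forall fun x => ?_)
        by_cases hx : x ∈ ramp ω n
        · rw [indicator_of_mem hx, indicator_of_mem hx, norm_mul, norm_mul, mul_assoc]
          have h1 := norm_deriv_trapezoid_le hω (n * ω) x
          have h2 := norm_sub_le (deriv v.1 x * ψ x) (v.1 x * deriv ψ x)
          rw [norm_mul, norm_mul] at h2
          gcongr
        · rw [deriv_trapezoid_of_notMem hω hx, zero_mul, mul_zero, norm_zero]
          positivity
    _ = ‖α‖ * (1 / ω) * ((∫ x, ‖deriv v.1 x‖ * ‖(ramp ω n).indicator ψ x‖) +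
          ∫ x, ‖v.1 x‖ * ‖(ramp ω n).indicator (deriv ψ) x‖) := by
        rw [integral_const_mul, integral_add i0 i1]
    _ ≤ ‖α‖ * (1 / ω) * (‖H1c.toLine hω v‖ * E₀ + ‖H1c.toLine hω v‖ * E₁) := by
        refine mul_le_mul_of_nonneg_left (add_le_add ?_ ?_) (by positivity)
        · exact (integral_norm_mul_ramp_le hω hψ.1.memLp hp0 hv.2.2 n).trans
            (mul_le_mul_of_nonneg_right n0 hE₀)
        · exact (integral_norm_mul_ramp_le hω hψ.1.2 hp1 hv.2.1 n).trans
            (mul_le_mul_of_nonneg_right n1 hE₁)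
    _ = ‖α‖ * (1 / ω) * (E₀ + E₁) * ‖H1c.toLine hω v‖ := by ring

theorem le_norm_J_cutoff (hω : 0 < ω) {ψ : ℝ → ℂ} (hψ : IsH1Loc ψ)
    (hper : ∀ x, ‖ψ (x + ω)‖ = ‖ψ x‖) (n : ℕ) :
    2 * n * ∫ x in Icc 0 ω, ‖ψ x‖ ^ 2 ≤
      ‖(lineDomain hω).J (H1c.toLine hω (cutoff hω (n * ω) ψ hψ))‖ ^ 2 := by
  have h1 := setIntegral_Icc_periodic (g := fun x => ‖ψ x‖ ^ 2)
    (fun a b => integrable_norm_sq_of_memLp (hψ.memLp a b)) (fun x => by rw [hper]) hω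
    (-(n * ω)) (2 * n)
  push_cast at h1
  rw [← h1, (lineDomain hω).norm_J_sq]
  have e : ∫ x in Icc (-(n * ω)) (-(n * ω) + 2 * n * ω), ‖ψ x‖ ^ 2 =
      ∫ x in Icc (-(n * ω)) (-(n * ω) + 2 * n * ω), ‖(cutoff hω (n * ω) ψ hψ).1 x‖ ^ 2 := by
    refine setIntegral_congr_fun measurableSet_Icc fun x hx => ?_
    have hx' : |x| ≤ n * ω := abs_le.2 ⟨hx.1, by linarith [hx.2]⟩
    simp only [cutoff_apply, trapezoid_eq_one hω hx', one_mul]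
  rw [e]
  exact setIntegral_le_integral (integrable_norm_sq_of_memLp (H1c.isH1 _).2.1)
    (Eventually.of_forall fun x => by positivity)

/-- A quasi-periodic solution is an obstruction to the invertibility of the operator on the line
(a Weyl sequence is given by its cut-offs). -/
theorem not_bounded_below_of_isSol (hω : 0 < ω) {α : ℂ} {Q : ℝ → ℂ} (hQ : IsH1Loc Q)
    {M : (lineDomain hω).Carrier →L[ℂ] (lineDomain hω).Carrier}
    (hM : ∀ f g, ⟪f, M g⟫_ℂ = ∫ x, dens α Q (fun x => conj (f x)) g x) {κ : ℝ}
    {f : (periodicDomain hω).Carrier} (hf : f ≠ 0) (hsol : IsSol α Q (twist κ f)) {δ : ℝ}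
    (hδ : 0 < δ) (hb : ∀ g, δ * ‖g‖ ≤ ‖M g‖) : False := by
  have hper := twist_add_period κ (mem_periodicDomain.1 f.mem).2
  obtain ⟨C, hC, h⟩ := hsol.exists_cutoff_bound hω hQ (norm_phase κ ω) hper
  have hJ : 0 < ∫ x in Icc 0 ω, ‖twist κ f x‖ ^ 2 := by
    simp only [norm_twist]
    have h1 := (periodicDomain hω).norm_J_sq f
    refine lt_of_lt_of_eq ?_ h1
    have : (periodicDomain hω).J f ≠ 0 := fun h0 =>
      hf ((periodicDomain hω).J_injective (h0.trans (map_zero _).symm))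
    positivity
  -- the cut-offs have bounded images, but their norms grow like the square root of `2 n` periods
  obtain ⟨n, hn⟩ := exists_nat_gt ((C / δ) ^ 2 / (2 * ∫ x in Icc 0 ω, ‖twist κ f x‖ ^ 2))
  rw [div_lt_iff₀ (by positivity)] at hn
  have h1 := le_norm_J_cutoff hω hsol.1
    (fun x => by rw [hper, norm_mul, norm_phase, one_mul]) n
  have h2 : ‖M (H1c.toLine hω (cutoff hω (n * ω) _ hsol.1))‖ ≤ C := by
    refine norm_le_of_forall_H1c hω hC fun v => ?_
    rw [hM]
    refine (h n (H1c.conj v)).trans (le_of_eq ?_)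
    congr 1
    have e : ‖H1c.toLine hω (H1c.conj v)‖ ^ 2 = ‖H1c.toLine hω v‖ ^ 2 := by
      rw [(lineDomain hω).norm_sq, (lineDomain hω).norm_sq, (lineDomain hω).norm_J_sq,
        (lineDomain hω).norm_D_sq, (lineDomain hω).norm_J_sq, (lineDomain hω).norm_D_sq]
      have e1 : ∀ x, ‖H1c.toLine hω (H1c.conj v) x‖ = ‖H1c.toLine hω v x‖ := fun x =>
        Complex.norm_conj _
      have e2 : ∀ x, ‖deriv (H1c.toLine hω (H1c.conj v)) x‖ = ‖deriv (H1c.toLine hω v) x‖ :=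
        fun x => (congrArg norm (congrFun (deriv_conj v.1) x)).trans (Complex.norm_conj _)
      simp only [e1, e2]
    exact (pow_left_inj₀ (norm_nonneg _) (norm_nonneg _) two_ne_zero).1 e
  have h3 := (hb _).trans h2
  have h4 := (lineDomain hω).norm_J_le (H1c.toLine hω (cutoff hω (n * ω) _ hsol.1))
  have h5 := pow_le_pow_left₀ (norm_nonneg _) h4 2
  have h6 : ‖H1c.toLine hω (cutoff hω (n * ω) _ hsol.1)‖ ≤ C / δ := by
    rw [le_div_iff₀ hδ]; linarith
  have h7 := pow_le_pow_left₀ (norm_nonneg _) h6 2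
  linarith

end Cutoff


/-! ### The forms on the fibres inherit the lower bound of the form on the line -/

section FibreBound

variable {ω : ℝ} (hω : 0 < ω)

/-- On a period, the translates of the squared cut-off with plateau `[-n ω, n ω]` sum to `2 n`, up
to a function that does not depend on `n`. -/
theorem tsum_trapezoid_sq (hω : 0 < ω) (n : ℕ) {x : ℝ} (hx : x ∈ Icc 0 ω) :
    ∑' k : ℤ, trapezoid ω (n * ω) (x + k * ω) * trapezoid ω (n * ω) (x + k * ω) =
      2 * n + (((1 - x / ω) ^ 2 + (x / ω) ^ 2 : ℝ) : ℂ) := by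
  have hx1 : x / ω ≤ 1 := (div_le_one hω).2 hx.2
  have hx0 : 0 ≤ x / ω := div_nonneg hx.1 hω.le
  have hin : ∀ k ∈ Finset.Ico (-(n : ℤ)) n, trapezoid ω (n * ω) (x + k * ω) = 1 := by
    intro k hk
    rw [Finset.mem_Ico] at hk
    refine trapezoid_eq_one hω (abs_le.2 ⟨?_, ?_⟩)
    · have : -(n : ℝ) ≤ k := by exact_mod_cast hk.1
      nlinarith [hx.1]
    · have : (k : ℝ) + 1 ≤ n := by exact_mod_cast hk.2
      nlinarith [hx.2]
  have hr : trapezoid ω (n * ω) (x + (n : ℤ) * ω) = ((1 - x / ω : ℝ) : ℂ) := by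
    have : 0 ≤ x + n * ω := by have := hx.1; positivity
    rw [trapezoid, Int.cast_natCast, abs_of_nonneg this,
      show (n * ω + ω - (x + n * ω)) / ω = 1 - x / ω by field_simp; ring,
      min_eq_right (by linarith), max_eq_right (by linarith)]
  have hl : trapezoid ω (n * ω) (x + (-(n : ℤ) - 1 : ℤ) * ω) = ((x / ω : ℝ) : ℂ) := by
    have : x + (-(n : ℤ) - 1 : ℤ) * ω ≤ 0 := by
      push_cast
      nlinarith [hx.2, (Nat.cast_nonneg n : (0 : ℝ) ≤ n)]
    rw [trapezoid, abs_of_nonpos this]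
    simp only [Int.cast_sub, Int.cast_neg, Int.cast_natCast, Int.cast_one]
    rw [show (n * ω + ω - -(x + (-n - 1) * ω)) / ω = x / ω by field_simp; ring,
      min_eq_right hx1, max_eq_right hx0]
  have hout : ∀ k ∉ Finset.Icc (-(n : ℤ) - 1) n,
      trapezoid ω (n * ω) (x + k * ω) * trapezoid ω (n * ω) (x + k * ω) = 0 := by
    intro k hk
    rw [trapezoid_eq_zero hω, zero_mul]
    rw [Finset.mem_Icc, not_and_or, not_le, not_le] at hk
    rcases hk with h | h
    · have : (k : ℝ) ≤ -n - 1 - 1 := by exact_mod_cast (by omega : k ≤ -(n : ℤ) - 1 - 1)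
      rw [le_abs]
      right
      nlinarith [hx.2]
    · have : (n : ℝ) + 1 ≤ k := by exact_mod_cast h
      rw [le_abs]
      left
      nlinarith [hx.1]
  rw [tsum_eq_sum hout]
  have hS : Finset.Icc (-(n : ℤ) - 1) n = insert (-(n : ℤ) - 1) (insert (n : ℤ)
      (Finset.Ico (-(n : ℤ)) n)) := by
    ext k
    simp only [Finset.mem_Icc, Finset.mem_insert, Finset.mem_Ico]
    omega
  rw [hS, Finset.sum_insert, Finset.sum_insert, hr, hl,
    Finset.sum_congr rfl fun k hk => by rw [hin k hk, one_mul]]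
  · rw [Finset.sum_const, Int.card_Ico, nsmul_eq_mul]
    have : (((n : ℤ) - -(n : ℤ)).toNat : ℂ) = 2 * n := by
      have : ((n : ℤ) - -(n : ℤ)).toNat = 2 * n := by omega
      rw [this]; push_cast; rfl
    rw [this]
    push_cast
    ring
  · simp
  · simp only [Finset.mem_insert, Finset.mem_Ico]
    omega

variable {κ : ℝ} {ψ : ℝ → ℂ}

theorem periodize_cutoff_sq (hψ : IsH1Loc ψ) (hper : ∀ x, ψ (x + ω) = phase κ ω * ψ x) (n : ℕ)
    {x : ℝ} (hx : x ∈ Icc 0 ω) :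
    periodize ω (phase κ ω)
      (fun y => conj ((cutoff hω (n * ω) ψ hψ).1 y) * trapezoid ω (n * ω) y) x =
      (2 * n + (((1 - x / ω) ^ 2 + (x / ω) ^ 2 : ℝ) : ℂ)) * conj (ψ x) := by
  rw [← tsum_trapezoid_sq hω n hx, periodize, ← tsum_mul_right]
  refine tsum_congr fun k => ?_
  rw [cutoff_apply, zpow_shift (phase_ne_zero κ ω) hper, map_mul, map_mul, conj_trapezoid,
    map_zpow₀,
    conj_phase]
  have h : phase κ ω ^ k * phase (-κ) ω ^ k = 1 := by
    rw [← mul_zpow, phase_mul_phase_neg, one_zpow]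
  linear_combination (trapezoid ω (n * ω) (x + k * ω)) ^ 2 * conj (ψ x) * h

theorem isH1Loc_square : IsH1Loc fun x => (((1 - x / ω) ^ 2 + (x / ω) ^ 2 : ℝ) : ℂ) := by
  refine IsH1Loc.of_contDiff (Complex.ofRealCLM.contDiff.comp ?_)
  exact ((contDiff_const.sub (contDiff_id.div_const ω)).pow 2).add ((contDiff_id.div_const ω).pow 2)

/-- The form of a cut-off quasi-periodic function is the number of periods inside the plateau times
the form over one period, up to a bounded error. -/
theorem exists_form_cutoff_le {p : ℝ → ℂ} (hp : Potential ω p) (hψ : IsH1Loc ψ)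
    (hper : ∀ x, ψ (x + ω) = phase κ ω * ψ x) :
    ∃ C : ℝ, ∀ n : ℕ, (⟪H1c.toLine hω (cutoff hω (n * ω) ψ hψ),
        lineA hω p (H1c.toLine hω (cutoff hω (n * ω) ψ hψ))⟫_ℂ).re ≤
      2 * n * (∫ x in Icc 0 ω, dens 1 p (fun x => conj (ψ x)) ψ x).re + C := by
  have hp0 : ∀ x, ‖ψ (x + ω)‖ ^ 2 = ‖ψ x‖ ^ 2 := fun x => by
    rw [hper, norm_mul, norm_phase, one_mul]
  let G : ℝ → ℂ := fun x => (((1 - x / ω) ^ 2 + (x / ω) ^ 2 : ℝ) : ℂ)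
  have hG : IsH1Loc G := isH1Loc_square
  refine ⟨(∫ x in Icc 0 ω, dens 1 p (fun x => G x * conj (ψ x)) ψ x).re +
    (1 / ω) ^ 2 * (2 * ∫ x in Icc 0 ω, ‖ψ x‖ ^ 2), fun n => ?_⟩
  set v := cutoff hω (n * ω) ψ hψ with hv
  have hχ := trapezoid_isH1Loc hω (n * ω)
  have e1 := (inner_lineA_eq hω hp (H1c.toLine hω v) (H1c.toLine hω v)).trans
    (integral_dens_mul_right hp.h1 hχ hψ 1 (H1c.conj v))
  -- the main term, one copy per period
  have e2 : ∫ x, dens 1 p (fun y => (H1c.conj v).1 y * trapezoid ω (n * ω) y) ψ x =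
      2 * n * (∫ x in Icc 0 ω, dens 1 p (fun x => conj (ψ x)) ψ x) +
        ∫ x in Icc 0 ω, dens 1 p (fun x => G x * conj (ψ x)) ψ x := by
    refine (integral_dens_unfold hω hp.h1 hp.periodic (phase_ne_zero κ ω) hψ hper 1
      (mulH1c (H1c.conj v) _ hχ)).trans ?_
    rw [← integral_const_mul, ← integral_add
      ((integrableOn_dens hp.h1 hψ.conj hψ 1 0 ω).const_mul _)
      (integrableOn_dens hp.h1 (hG.mul hψ.conj) hψ 1 0 ω)]
    rw [restrict_Icc_eq_Ioc, ← restrict_Ioo_eq_restrict_Ioc]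
    refine integral_congr_ae ?_
    filter_upwards [ae_restrict_mem measurableSet_Ioo, ae_restrict_of_ae hG.ae_differentiableAt,
      ae_restrict_of_ae hψ.conj.ae_differentiableAt] with x hx d1 d2
    have h1 : periodize ω (phase κ ω) (mulH1c (H1c.conj v) _ hχ).1 =ᶠ[𝓝 x]
        fun y => (2 * n + G y) * conj (ψ y) := by
      filter_upwards [isOpen_Ioo.mem_nhds hx] with y hy
      exact periodize_cutoff_sq hω hψ hper n (Ioo_subset_Icc_self hy)
    have h2 : deriv (fun y => (2 * n + G y) * conj (ψ y)) x =
        deriv G x * conj (ψ x) + (2 * n + G x) * deriv (fun y => conj (ψ y)) x := by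
      rw [deriv_fun_mul (d1.const_add _) d2, deriv_const_add]
    simp only [dens]
    rw [h1.deriv_eq, h1.eq_of_nhds, h2, deriv_fun_mul d1 d2]
    ring
  -- the error where the cut-off varies
  have e3 : (∫ x, (1 : ℂ) * (deriv (trapezoid ω (n * ω)) x *
      (deriv (H1c.conj v).1 x * ψ x - (H1c.conj v).1 x * deriv ψ x))).re ≤
      (1 / ω) ^ 2 * (2 * ∫ x in Icc 0 ω, ‖ψ x‖ ^ 2) := by
    have i1 := integrable_dens_H1c hp.h1 (H1c.conj v) (hχ.mul hψ) 1
    have i2 := integrable_dens_H1c hp.h1 (mulH1c (H1c.conj v) _ hχ) hψ 1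
    have hpt : ∀ᵐ x : ℝ, dens 1 p (H1c.conj v).1 (fun y => trapezoid ω (n * ω) y * ψ y) x -
        dens 1 p (fun y => (H1c.conj v).1 y * trapezoid ω (n * ω) y) ψ x =
        (1 : ℂ) * (deriv (trapezoid ω (n * ω)) x *
          (deriv (H1c.conj v).1 x * ψ x - (H1c.conj v).1 x * deriv ψ x)) := by
      filter_upwards [(H1c.conj v).2.1.ae_differentiableAt, hχ.ae_differentiableAt,
        hψ.ae_differentiableAt] with x d1 d2 d3
      simp only [dens]
      rw [deriv_fun_mul d1 d2, deriv_fun_mul d2 d3]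
      ring
    have i3 := (i1.sub i2).congr hpt
    have i4 := integrable_indicator_ramp (ω := ω)
      (fun a b => integrable_norm_sq_of_memLp (hψ.memLp a b)) n
    have h1 := integral_indicator_ramp_le hω
      (fun a b => integrable_norm_sq_of_memLp (hψ.memLp a b)) (fun x => by positivity) hp0 n
    have hre := integral_re i3
    refine hre.symm.trans_le ((integral_mono_ae i3.re (i4.const_mul ((1 / ω) ^ 2)) ?_).trans ?_)
    · filter_upwards [hχ.ae_differentiableAt, hψ.ae_differentiableAt] with x d2 d3
      by_cases hx : x ∈ ramp ω n
      · have h2 := norm_deriv_trapezoid_le hω (n * ω) x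
        have h3 : conj (deriv (trapezoid ω (n * ω)) x) = deriv (trapezoid ω (n * ω)) x := by
          have := congrFun (deriv_conj (trapezoid ω (n * ω))) x
          rw [← this, funext (conj_trapezoid ω (n * ω))]
        have h4 : deriv (H1c.conj v).1 x = deriv (trapezoid ω (n * ω)) x * conj (ψ x) +
            trapezoid ω (n * ω) x * conj (deriv ψ x) := by
          have h5 := congrFun (deriv_conj v.1) x
          refine h5.trans ?_
          have h6 : deriv v.1 x = deriv (trapezoid ω (n * ω)) x * ψ x +
            trapezoid ω (n * ω) x * deriv ψ x := deriv_fun_mul d2 d3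
          rw [h6, map_add, map_mul, map_mul, h3, conj_trapezoid]
        have h5 : (H1c.conj v).1 x = trapezoid ω (n * ω) x * conj (ψ x) := by
          change conj (trapezoid ω (n * ω) x * ψ x) = _
          rw [map_mul, conj_trapezoid]
        -- `χ'` and `χ` are real, so the terms with `ψ'` are purely imaginary
        have h6 : (deriv (trapezoid ω (n * ω)) x).im = 0 := Complex.conj_eq_iff_im.1 h3
        have h7 : (trapezoid ω (n * ω) x).im = 0 :=
          Complex.conj_eq_iff_im.1 (conj_trapezoid ω (n * ω) x)
        have h8 : ‖deriv (trapezoid ω (n * ω)) x‖ ^ 2 =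
            (deriv (trapezoid ω (n * ω)) x).re ^ 2 := by
          rw [← Complex.normSq_eq_norm_sq, Complex.normSq_apply, h6]; ring
        have h9 := pow_le_pow_left₀ (norm_nonneg _) h2 2
        rw [indicator_of_mem hx, h4, h5]
        refine le_trans (le_of_eq ?_) (mul_le_mul_of_nonneg_right (h8 ▸ h9) (sq_nonneg ‖ψ x‖))
        rw [← Complex.normSq_eq_norm_sq (ψ x), Complex.normSq_apply]
        simp only [RCLike.re_eq_complex_re, Complex.mul_re, Complex.mul_im, Complex.sub_re,
          Complex.sub_im, Complex.add_re, Complex.add_im, Complex.conj_re, Complex.conj_im,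
          Complex.one_re, Complex.one_im, h6, h7]
        ring
      · rw [deriv_trapezoid_of_notMem hω hx, indicator_of_notMem hx]
        simp
    · rw [integral_const_mul]
      exact mul_le_mul_of_nonneg_left h1 (by positivity)
  have e4 : (⟪H1c.toLine hω v, lineA hω p (H1c.toLine hω v)⟫_ℂ).re =
      (2 * n * (∫ x in Icc 0 ω, dens 1 p (fun x => conj (ψ x)) ψ x) +
        ∫ x in Icc 0 ω, dens 1 p (fun x => G x * conj (ψ x)) ψ x).re +
      (∫ x, (1 : ℂ) * (deriv (trapezoid ω (n * ω)) x *
      (deriv (H1c.conj v).1 x * ψ x - (H1c.conj v).1 x * deriv ψ x))).re := by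
    rw [← e2, ← Complex.add_re]
    exact congrArg Complex.re e1
  rw [e4, Complex.add_re]
  have e5 : (2 * (n : ℂ) * ∫ x in Icc 0 ω, dens 1 p (fun x => conj (ψ x)) ψ x).re =
      2 * n * (∫ x in Icc 0 ω, dens 1 p (fun x => conj (ψ x)) ψ x).re := by
    rw [show (2 * (n : ℂ)) = ((2 * n : ℝ) : ℂ) by push_cast; rfl, Complex.re_ofReal_mul]
  rw [e5]
  linarith

/-- The lower bound of the form on the line, applied to cut-offs of a quasi-periodic function and
divided by the number of periods, gives the bound on each fibre. -/
theorem twistOp_lower_bound {p : ℝ → ℂ} (hp : Potential ω p) {c : ℝ} (hc : 0 ≤ c)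
    (hl : ∀ f, c * ‖(lineDomain hω).J f‖ ^ 2 ≤ (⟪f, lineA hω p f⟫_ℂ).re) (κ : ℝ)
    (f : (periodicDomain hω).Carrier) :
    c * ‖(periodicDomain hω).J f‖ ^ 2 ≤ (⟪f, twistOp hω κ p f⟫_ℂ).re := by
  have hper := twist_add_period κ (mem_periodicDomain.1 f.mem).2
  obtain ⟨C, hC⟩ := exists_form_cutoff_le hω hp (f.h1.twist κ) hper
  rw [← inner_twistOp_eq hω hp] at hC
  have hJ : ∫ x in Icc 0 ω, ‖twist κ f x‖ ^ 2 = ‖(periodicDomain hω).J f‖ ^ 2 := by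
    simp only [norm_twist]
    exact ((periodicDomain hω).norm_J_sq f).symm
  by_contra hlt
  push Not at hlt
  -- a violated bound loses a fixed amount on each of `2 n` periods, which exceeds the error `C`
  obtain ⟨n, hn⟩ := exists_nat_gt
    (C / (2 * (c * ‖(periodicDomain hω).J f‖ ^ 2 - (⟪f, twistOp hω κ p f⟫_ℂ).re)))
  rw [div_lt_iff₀ (by linarith)] at hn
  have h1 := le_norm_J_cutoff hω (f.h1.twist κ)
    (fun x => by rw [hper, norm_mul, norm_phase, one_mul]) n
  rw [hJ] at h1
  have h2 := mul_le_mul_of_nonneg_left h1 hc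
  have h3 := (hl _).trans (hC n)
  nlinarith

end FibreBound


/-! ### A discrete Floquet transform -/

section Gelfand

variable {ω : ℝ}

theorem integral_Icc_eq_zero_of_multiplier (hω : 0 < ω) {c : ℝ → ℂ} {ρ : ℂ} {N : ℕ}
    (hc : ∀ x, c (x + ω) = ρ * c x) (hρ : ρ ≠ 1)
    (hN : ρ ^ N = 1) (t : ℝ) : ∫ x in Icc t (t + N * ω), c x = 0 := by
  have hN0 : ρ ≠ 0 ∨ N = 0 := by
    by_contra h
    push Not at h
    rw [h.1, zero_pow h.2] at hN
    exact zero_ne_one hN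
  rcases hN0 with h0 | rfl
  swap
  · simp
  have hper : Function.Periodic c (N * ω) := fun x => by
    have := zpow_shift h0 hc (N : ℤ) x
    rw [zpow_natCast, hN, one_mul] at this
    exact_mod_cast this
  rw [restrict_Icc_eq_Ioc,
    ← intervalIntegral.integral_of_le (by nlinarith [(Nat.cast_nonneg N : (0 : ℝ) ≤ N)])]
  have h1 := hper.intervalIntegral_add_eq t (t + ω)
  have h2 : ∫ x in (t + ω)..(t + ω + N * ω), c x = ρ * ∫ x in t..(t + N * ω), c x := by
    rw [← intervalIntegral.integral_const_mul, show t + ω + N * ω = (t + N * ω) + ω by ring,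
      ← intervalIntegral.integral_comp_add_right]
    exact intervalIntegral.integral_congr fun x _ => hc x
  rw [h2] at h1
  have h3 : (1 - ρ) * ∫ x in t..(t + N * ω), c x = 0 := by linear_combination h1
  exact (mul_eq_zero.1 h3).resolve_left (sub_ne_zero.2 (Ne.symm hρ))

/-- Parseval's identity for a sum of functions with different Floquet multipliers `ζ j`, which are
`N`-th roots of unity. -/
theorem integral_norm_sum_sq (hω : 0 < ω) {N : ℕ} {ζ : Fin N → ℂ} (hζ : Function.Injective ζ)
    (hζ1 : ∀ j, ‖ζ j‖ = 1) (hζN : ∀ j, ζ j ^ N = 1) {b : Fin N → ℝ → ℂ}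
    (hb : ∀ j c d, MemLp (b j) 2 (volume.restrict (Icc c d)))
    (hper : ∀ j x, b j (x + ω) = ζ j * b j x) (t : ℝ) :
    ∫ x in Icc t (t + N * ω), ‖∑ j, b j x‖ ^ 2 = N * ∑ j, ∫ x in Icc 0 ω, ‖b j x‖ ^ 2 := by
  have hint : ∀ i j c d, IntegrableOn (fun x => conj (b i x) * b j x) (Icc c d) := fun i j c d =>
    FormDomain.integrable_conj_mul (hb i c d) (hb j c d)
  have hdiag : ∀ i, ∫ x in Icc t (t + N * ω), conj (b i x) * b i x =
      ((N * ∫ x in Icc 0 ω, ‖b i x‖ ^ 2 : ℝ) : ℂ) := by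
    intro i
    rw [← setIntegral_Icc_periodic (fun c d => integrable_norm_sq_of_memLp (hb i c d))
      (fun x => by rw [hper, norm_mul, hζ1, one_mul]) hω t N, ← integral_complex_ofReal]
    refine integral_congr_ae (Eventually.of_forall fun x => ?_)
    simp only
    rw [mul_comm, Complex.mul_conj, Complex.normSq_eq_norm_sq]
  have hoff : ∀ i j, i ≠ j → ∫ x in Icc t (t + N * ω), conj (b i x) * b j x = 0 := by
    intro i j hij
    have hinv : conj (ζ i) * ζ i = 1 := by
      rw [mul_comm, Complex.mul_conj, Complex.normSq_eq_norm_sq, hζ1]; simp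
    refine integral_Icc_eq_zero_of_multiplier hω (ρ := conj (ζ i) * ζ j) (fun x => ?_)
      (fun h => hij (hζ ?_)) ?_ t
    · rw [hper, hper, map_mul]; ring
    · linear_combination ζ j * hinv - ζ i * h
    · rw [mul_pow, ← map_pow, hζN, hζN, map_one, one_mul]
  have h1 : ((∫ x in Icc t (t + N * ω), ‖∑ j, b j x‖ ^ 2 : ℝ) : ℂ) =
      ∑ i, ∑ j, ∫ x in Icc t (t + N * ω), conj (b i x) * b j x := by
    rw [← integral_complex_ofReal]
    simp_rw [← integral_finsetSum Finset.univ fun j _ => hint _ j t (t + N * ω)]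
    rw [← integral_finsetSum Finset.univ
      fun i _ => integrable_finsetSum Finset.univ fun j _ => hint i j t (t + N * ω)]
    refine integral_congr_ae (Eventually.of_forall fun x => ?_)
    simp only
    rw [← Complex.normSq_eq_norm_sq, Complex.normSq_eq_conj_mul_self, map_sum, Finset.sum_mul]
    exact Finset.sum_congr rfl fun i _ => Finset.mul_sum _ _ _
  have h2 : ∀ i, ∑ j, ∫ x in Icc t (t + N * ω), conj (b i x) * b j x =
      ((N * ∫ x in Icc 0 ω, ‖b i x‖ ^ 2 : ℝ) : ℂ) := fun i => by
    rw [Finset.sum_eq_single i (fun j _ hj => hoff i j (Ne.symm hj)) (by simp), hdiag]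
  rw [Finset.sum_congr rfl fun i _ => h2 i, ← Complex.ofReal_sum, Complex.ofReal_inj] at h1
  rw [h1, Finset.mul_sum]

/-- The quasi-momenta `2 π j / (N ω)`. -/
def momentum (ω : ℝ) (N : ℕ) (j : Fin N) : ℝ := 2 * Real.pi * j / (N * ω)

theorem momentum_mem (hω : 0 < ω) {N : ℕ} (j : Fin N) :
    momentum ω N j ∈ Icc 0 (2 * Real.pi / ω) := by
  have hN : (0 : ℝ) < N := Nat.cast_pos.2 (j.pos)
  have hj : (j : ℝ) ≤ N := by exact_mod_cast j.2.le
  have := Real.pi_pos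
  refine ⟨by unfold momentum; positivity, ?_⟩
  rw [momentum, div_le_div_iff₀ (by positivity) hω]
  nlinarith [mul_le_mul_of_nonneg_left hj (by positivity : 0 ≤ 2 * Real.pi * ω)]

theorem phase_momentum (hω : 0 < ω) {N : ℕ} (j : Fin N) :
    phase (momentum ω N j) ω = Complex.exp (2 * Real.pi * Complex.I / N) ^ (j : ℕ) := by
  have hN : (N : ℂ) ≠ 0 := Nat.cast_ne_zero.2 (j.pos).ne'
  have hω' : (ω : ℂ) ≠ 0 := Complex.ofReal_ne_zero.2 hω.ne'
  rw [phase, momentum, ← Complex.exp_nat_mul]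
  congr 1
  push_cast
  field_simp

theorem phase_momentum_pow (hω : 0 < ω) {N : ℕ} (j : Fin N) :
    phase (momentum ω N j) ω ^ N = 1 := by
  rw [phase_momentum hω, ← pow_mul, mul_comm (j : ℕ), pow_mul,
    (Complex.isPrimitiveRoot_exp N (j.pos).ne').pow_eq_one, one_pow]

theorem phase_momentum_injective (hω : 0 < ω) (N : ℕ) :
    Function.Injective fun j : Fin N => phase (momentum ω N j) ω := by
  intro i j hij
  simp only [phase_momentum hω] at hij
  exact Fin.ext ((Complex.isPrimitiveRoot_exp N (j.pos).ne').pow_inj i.2 j.2 hij)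

/-- The functions `∑ σ^k v(x + k ω)`, summed over the `N`-th roots of unity `σ`, give back `N v` on
`N` periods containing the support of `v`. -/
theorem sum_periodize_momentum (hω : 0 < ω) (v : H1c) {n : ℕ} (hv : ∀ x, n * ω ≤ |x| → v.1 x = 0)
    {x : ℝ} (hx : |x| ≤ (n + 1) * ω) :
    ∑ j : Fin (2 * n + 2), periodize ω (phase (-momentum ω (2 * n + 2) j) ω) v.1 x =
      (2 * n + 2 : ℕ) * v.1 x := by
  obtain ⟨M, hM⟩ : ∃ M : ℕ, ∀ σ : ℂ, periodize ω σ v.1 x =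
      ∑ k ∈ Finset.Icc (-(M : ℤ)) M, σ ^ k * v.1 (x + k * ω) := by
    obtain ⟨M, hM⟩ := exists_translate_eq_zero hω (R := n * ω) |x|
    refine ⟨M, fun σ => ?_⟩
    rw [periodize, tsum_eq_sum fun k hk => ?_]
    rw [hv _ (hM M le_rfl x le_rfl k hk), mul_zero]
  simp only [hM]
  rw [Finset.sum_comm]
  have hk0 : (0 : ℤ) ∈ Finset.Icc (-(M : ℤ)) M := by simp
  rw [Finset.sum_eq_single_of_mem 0 hk0]
  · simp
  intro k _ hk
  rw [← Finset.sum_mul]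
  by_cases hdvd : ((2 * n + 2 : ℕ) : ℤ) ∣ k
  · obtain ⟨m, rfl⟩ := hdvd
    rw [hv, mul_zero]
    have hm : m ≠ 0 := fun h => hk (by rw [h, mul_zero])
    have h1 : (1 : ℝ) ≤ |(m : ℝ)| := by exact_mod_cast Int.one_le_abs hm
    have h2 : |(((2 * n + 2 : ℕ) : ℤ) * m : ℤ) * ω| = (2 * n + 2) * ω * |(m : ℝ)| := by
      push_cast
      rw [abs_mul, abs_mul, abs_of_pos hω, abs_of_pos (by positivity : (0 : ℝ) < 2 * n + 2)]
      ring
    have h3 := abs_sub_abs_le_abs_sub ((((2 * n + 2 : ℕ) : ℤ) * m : ℤ) * ω) (-x)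
    rw [abs_neg, h2, sub_neg_eq_add, add_comm _ x] at h3
    have h4 : (2 * n + 2) * ω * 1 ≤ (2 * n + 2) * ω * |(m : ℝ)| :=
      mul_le_mul_of_nonneg_left h1 (by positivity)
    nlinarith
  · -- the powers of a primitive root of unity sum to zero
    have hprim := Complex.isPrimitiveRoot_exp (2 * n + 2) (by omega)
    set ζ := Complex.exp (2 * Real.pi * Complex.I / (2 * n + 2 : ℕ)) with hζ
    have hζ0 : ζ ≠ 0 := Complex.exp_ne_zero _
    have e : ∀ j : Fin (2 * n + 2), phase (-momentum ω (2 * n + 2) j) ω ^ k =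
        (ζ ^ (-k)) ^ (j : ℕ) := by
      intro j
      rw [← inv_phase, phase_momentum hω, ← hζ, inv_zpow', ← zpow_natCast, ← zpow_natCast,
        ← zpow_mul,
        ← zpow_mul]
      congr 1
      ring
    rw [Finset.sum_congr rfl fun j _ => e j, Fin.sum_univ_eq_sum_range
      (fun j => (ζ ^ (-k)) ^ j) (2 * n + 2), geom_sum_eq, ← zpow_natCast, ← zpow_mul, mul_comm (-k),
      zpow_mul, zpow_natCast, hprim.pow_eq_one, one_zpow, sub_self, zero_div, zero_mul]
    intro h1
    rw [hprim.zpow_eq_one_iff_dvd, dvd_neg] at h1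
    exact hdvd h1

theorem norm_twistD_sq (hω : 0 < ω) (κ : ℝ) (f : (periodicDomain hω).Carrier) :
    ‖twistD hω κ f‖ ^ 2 = ∫ x in Icc 0 ω, ‖deriv (twist κ f) x‖ ^ 2 := by
  rw [twistD_apply, FormDomain.norm_toLp_sq]
  refine integral_congr_ae (ae_restrict_of_ae ?_)
  filter_upwards [f.h1.ae_differentiableAt] with x hx
  rw [deriv_twist κ hx, norm_mul, norm_phase, one_mul]

theorem norm_twistD_le (hω : 0 < ω) {κ T : ℝ} (hκ : κ ∈ Icc 0 T) (f : (periodicDomain hω).Carrier) :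
    ‖twistD hω κ f‖ ≤ (1 + T) * ‖f‖ := by
  have h1 : ‖twistD hω κ f‖ ≤ ‖(periodicDomain hω).D f‖ +
      ‖(Complex.I * κ) • (periodicDomain hω).J f‖ := norm_add_le _ _
  rw [norm_smul, norm_mul, Complex.norm_I, one_mul, Complex.norm_real,
    Real.norm_of_nonneg hκ.1] at h1
  have h2 := (periodicDomain hω).norm_D_le f
  have h3 := (periodicDomain hω).norm_J_le f
  have h4 := mul_le_mul hκ.2 h3 (norm_nonneg _) (hκ.1.trans hκ.2)
  linarith

/-- The Floquet component of `v` at quasi-momentum `κ`. -/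
def floquet (hω : 0 < ω) (κ : ℝ) (v : H1c) : (periodicDomain hω).Carrier :=
  FormDomain.of (twist (-κ) (periodize ω (phase (-κ) ω) v.1))
    (mem_periodicDomain_of_quasiPeriodic hω (isH1Loc_periodize hω _ v) fun x => by
      rw [periodize_add _ (phase_ne_zero _ _), inv_phase, neg_neg])

theorem twist_floquet (hω : 0 < ω) (κ : ℝ) (v : H1c) :
    twist κ (floquet hω κ v) = periodize ω (phase (-κ) ω) v.1 := twist_twist_neg _ _

theorem norm_sq_le_sum_floquet (hω : 0 < ω) (v : H1c) {n : ℕ}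
    (hv : ∀ x, n * ω ≤ |x| → v.1 x = 0) :
    (2 * n + 2 : ℕ) * ‖H1c.toLine hω v‖ ^ 2 ≤ ((1 + 2 * Real.pi / ω) ^ 2 + 1) *
      ∑ j : Fin (2 * n + 2), ‖floquet hω (momentum ω (2 * n + 2) j) v‖ ^ 2 := by
  set N := 2 * n + 2 with hN
  have hN0 : (0 : ℝ) < N := by rw [hN]; positivity
  have hW : -((n + 1) * ω) + N * ω = (n + 1) * ω := by rw [hN]; push_cast; ring
  have hper : ∀ (j : Fin N) x, twist (momentum ω N j) (floquet hω (momentum ω N j) v) (x + ω) =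
      phase (momentum ω N j) ω * twist (momentum ω N j) (floquet hω (momentum ω N j) v) x :=
    fun j => twist_add_period _ (mem_periodicDomain.1 (floquet hω (momentum ω N j) v).mem).2
  have hh1 : ∀ j : Fin N, IsH1Loc (twist (momentum ω N j) (floquet hω (momentum ω N j) v)) :=
    fun j => (floquet hω (momentum ω N j) v).h1.twist _
  have hsum : ∀ x, |x| ≤ (n + 1) * ω →
      ∑ j, twist (momentum ω N j) (floquet hω (momentum ω N j) v) x = N * v.1 x := fun x hx => by
    simp only [twist_floquet]
    exact sum_periodize_momentum hω v hv hx
  have hP0 := integral_norm_sum_sq hω (phase_momentum_injective hω N) (fun j => norm_phase _ _)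
    (phase_momentum_pow hω) (fun j c d => (hh1 j).memLp c d) hper (-((n + 1) * ω))
  have hP1 := integral_norm_sum_sq hω (phase_momentum_injective hω N) (fun j => norm_phase _ _)
    (phase_momentum_pow hω) (fun j c d => (hh1 j).2 c d) (fun j => deriv_shift (hper j))
    (-((n + 1) * ω))
  rw [hW] at hP0 hP1
  have hzero : ∀ x, x ∉ Icc (-((n + 1) * ω)) ((n + 1) * ω) → n * ω < |x| := fun x hx => by
    by_contra hc
    push Not at hc
    exact hx (abs_le.1 (hc.trans (by nlinarith)))
  have hI0 : ∫ x in Icc (-((n + 1) * ω)) ((n + 1) * ω),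
      ‖∑ j, twist (momentum ω N j) (floquet hω (momentum ω N j) v) x‖ ^ 2 =
      N ^ 2 * ∫ x, ‖v.1 x‖ ^ 2 := by
    have hs : ∫ x in Icc (-((n + 1) * ω)) ((n + 1) * ω), ‖v.1 x‖ ^ 2 = ∫ x, ‖v.1 x‖ ^ 2 :=
      setIntegral_eq_integral_of_forall_compl_eq_zero fun x hx => by
        rw [hv x (hzero x hx).le]; simp
    rw [← hs, ← integral_const_mul]
    refine setIntegral_congr_fun measurableSet_Icc fun x hx => ?_
    rw [hsum x (abs_le.2 hx), norm_mul, mul_pow, Complex.norm_natCast]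
  have hI1 : ∫ x in Icc (-((n + 1) * ω)) ((n + 1) * ω),
      ‖∑ j, deriv (twist (momentum ω N j) (floquet hω (momentum ω N j) v)) x‖ ^ 2 =
      N ^ 2 * ∫ x, ‖deriv v.1 x‖ ^ 2 := by
    have hd : ∀ x, x ∉ Icc (-((n + 1) * ω)) ((n + 1) * ω) → deriv v.1 x = 0 := fun x hx => by
      have : v.1 =ᶠ[𝓝 x] fun _ => 0 := by
        filter_upwards [(isOpen_lt continuous_const continuous_abs).mem_nhds (hzero x hx)] with y hy
        exact hv y (le_of_lt hy)
      rw [this.deriv_eq, deriv_const]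
    have hs : ∫ x in Icc (-((n + 1) * ω)) ((n + 1) * ω), ‖deriv v.1 x‖ ^ 2 =
        ∫ x, ‖deriv v.1 x‖ ^ 2 :=
      setIntegral_eq_integral_of_forall_compl_eq_zero fun x hx => by rw [hd x hx]; simp
    rw [← hs, ← integral_const_mul, restrict_Icc_eq_Ioc, ← restrict_Ioo_eq_restrict_Ioc]
    refine integral_congr_ae ?_
    have hdiff : ∀ᵐ x : ℝ, ∀ j : Fin N,
        DifferentiableAt ℝ (twist (momentum ω N j) (floquet hω (momentum ω N j) v)) x :=
      ae_all_iff.2 fun j => (hh1 j).ae_differentiableAt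
    filter_upwards [ae_restrict_mem measurableSet_Ioo, ae_restrict_of_ae hdiff,
      ae_restrict_of_ae v.2.1.ae_differentiableAt] with x hx d1 d2
    have h1 : (fun y => ∑ j, twist (momentum ω N j) (floquet hω (momentum ω N j) v) y) =ᶠ[𝓝 x]
        fun y => N * v.1 y := by
      filter_upwards [isOpen_Ioo.mem_nhds hx] with y hy
      exact hsum y (abs_le.2 (Ioo_subset_Icc_self hy))
    have h2 := h1.deriv_eq
    rw [deriv_fun_sum fun j _ => d1 j, deriv_const_mul _ d2] at h2
    rw [h2, norm_mul, mul_pow, Complex.norm_natCast]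
  rw [hP0] at hI0
  rw [hP1] at hI1
  have hbound : ∀ j : Fin N,
      (∫ x in Icc 0 ω, ‖twist (momentum ω N j) (floquet hω (momentum ω N j) v) x‖ ^ 2) +
      ∫ x in Icc 0 ω, ‖deriv (twist (momentum ω N j) (floquet hω (momentum ω N j) v)) x‖ ^ 2 ≤
      ((1 + 2 * Real.pi / ω) ^ 2 + 1) * ‖floquet hω (momentum ω N j) v‖ ^ 2 := by
    intro j
    have h1 := pow_le_pow_left₀ (norm_nonneg _)
      (norm_twistD_le hω (momentum_mem hω j) (floquet hω (momentum ω N j) v)) 2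
    have h2 := pow_le_pow_left₀ (norm_nonneg _)
      ((periodicDomain hω).norm_J_le (floquet hω (momentum ω N j) v)) 2
    have h3 := norm_twistJ_sq hω (momentum ω N j) (floquet hω (momentum ω N j) v)
    rw [twistJ_apply, FormDomain.norm_toLp_sq] at h3
    rw [mul_pow, norm_twistD_sq] at h1
    rw [h3]
    linarith
  have hfin := Finset.sum_le_sum fun j (_ : j ∈ Finset.univ) => hbound j
  rw [Finset.sum_add_distrib, ← Finset.mul_sum] at hfin
  have hline : ‖H1c.toLine hω v‖ ^ 2 = (∫ x, ‖v.1 x‖ ^ 2) + ∫ x, ‖deriv v.1 x‖ ^ 2 := by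
    rw [(lineDomain hω).norm_sq, (lineDomain hω).norm_J_sq, (lineDomain hω).norm_D_sq]
    rfl
  rw [hline]
  refine le_trans (le_of_eq ?_) hfin
  have h0 := mul_left_cancel₀ hN0.ne' (hI0.trans (by ring : _ = (N : ℝ) * (N * ∫ x, ‖v.1 x‖ ^ 2)))
  have h1 := mul_left_cancel₀ hN0.ne'
    (hI1.trans (by ring : _ = (N : ℝ) * (N * ∫ x, ‖deriv v.1 x‖ ^ 2)))
  rw [h0, h1]
  ring

end Gelfand


/-! ### Invertibility on the line from invertibility on the fibres -/

section BoundedBelow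

variable {ω : ℝ}

theorem norm_toLine_cutoff_sq_le (hω : 0 < ω) {h : ℝ → ℂ} (hh : IsH1Loc h) (n : ℕ) :
    ‖H1c.toLine hω (cutoff hω (n * ω) h hh)‖ ^ 2 ≤
      (1 + 2 * (1 / ω) ^ 2) * (∫ x in Icc (-((n + 1) * ω)) ((n + 1) * ω), ‖h x‖ ^ 2) +
        2 * ∫ x in Icc (-((n + 1) * ω)) ((n + 1) * ω), ‖deriv h x‖ ^ 2 := by
  have hχ := trapezoid_isH1Loc hω (n * ω)
  have h1 : ∀ x, x ∉ Icc (-((n + 1) * ω)) ((n + 1) * ω) → n * ω + ω < |x| := fun x hx => by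
    by_contra hc
    push Not at hc
    exact hx (abs_le.1 (hc.trans (by linarith)))
  have z0 : ∀ x, x ∉ Icc (-((n + 1) * ω)) ((n + 1) * ω) → (cutoff hω (n * ω) h hh).1 x = 0 :=
    fun x hx => by rw [cutoff_apply, trapezoid_eq_zero hω (h1 x hx).le, zero_mul]
  have z1 : ∀ x, x ∉ Icc (-((n + 1) * ω)) ((n + 1) * ω) →
      deriv (cutoff hω (n * ω) h hh).1 x = 0 := fun x hx => by
    have : (cutoff hω (n * ω) h hh).1 =ᶠ[𝓝 x] fun _ => 0 := by
      filter_upwards [(isOpen_lt continuous_const continuous_abs).mem_nhds (h1 x hx)] with y hy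
      rw [cutoff_apply, trapezoid_eq_zero hω (le_of_lt hy), zero_mul]
    rw [this.deriv_eq, deriv_const]
  have s0 : ∫ x, ‖(cutoff hω (n * ω) h hh).1 x‖ ^ 2 =
      ∫ x in Icc (-((n + 1) * ω)) ((n + 1) * ω), ‖(cutoff hω (n * ω) h hh).1 x‖ ^ 2 :=
    (setIntegral_eq_integral_of_forall_compl_eq_zero fun x hx => by rw [z0 x hx]; simp).symm
  have s1 : ∫ x, ‖deriv (cutoff hω (n * ω) h hh).1 x‖ ^ 2 =
      ∫ x in Icc (-((n + 1) * ω)) ((n + 1) * ω), ‖deriv (cutoff hω (n * ω) h hh).1 x‖ ^ 2 :=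
    (setIntegral_eq_integral_of_forall_compl_eq_zero fun x hx => by rw [z1 x hx]; simp).symm
  have e : ‖H1c.toLine hω (cutoff hω (n * ω) h hh)‖ ^ 2 =
      (∫ x, ‖(cutoff hω (n * ω) h hh).1 x‖ ^ 2) +
        ∫ x, ‖deriv (cutoff hω (n * ω) h hh).1 x‖ ^ 2 := by
    rw [(lineDomain hω).norm_sq, (lineDomain hω).norm_J_sq, (lineDomain hω).norm_D_sq]
    rfl
  have i0 := integrable_norm_sq_of_memLp (hh.memLp (-((n + 1) * ω)) ((n + 1) * ω))
  have i1 := integrable_norm_sq_of_memLp (hh.2 (-((n + 1) * ω)) ((n + 1) * ω))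
  have b0 : ∫ x, ‖(cutoff hω (n * ω) h hh).1 x‖ ^ 2 ≤
      ∫ x in Icc (-((n + 1) * ω)) ((n + 1) * ω), ‖h x‖ ^ 2 := by
    rw [s0]
    refine integral_mono (integrable_norm_sq_of_memLp
      ((cutoff hω (n * ω) h hh).2.1.memLp _ _)) i0 fun x => ?_
    refine pow_le_pow_left₀ (norm_nonneg _) ?_ 2
    rw [cutoff_apply, norm_mul]
    exact mul_le_of_le_one_left (norm_nonneg _) (norm_trapezoid_le _ _ _)
  have b1 : ∫ x, ‖deriv (cutoff hω (n * ω) h hh).1 x‖ ^ 2 ≤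
      ∫ x in Icc (-((n + 1) * ω)) ((n + 1) * ω),
        (2 * (1 / ω) ^ 2 * ‖h x‖ ^ 2 + 2 * ‖deriv h x‖ ^ 2) := by
    rw [s1]
    refine integral_mono_ae (integrable_norm_sq_of_memLp ((cutoff hω (n * ω) h hh).2.1.2 _ _))
      ((i0.const_mul _).add (i1.const_mul _)) (ae_restrict_of_ae ?_)
    filter_upwards [hχ.ae_differentiableAt, hh.ae_differentiableAt] with x d1 d2
    have e1 : deriv (cutoff hω (n * ω) h hh).1 x = deriv (trapezoid ω (n * ω)) x * h x +
        trapezoid ω (n * ω) x * deriv h x := deriv_fun_mul d1 d2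
    rw [e1]
    have n1 := norm_add_le (deriv (trapezoid ω (n * ω)) x * h x)
      (trapezoid ω (n * ω) x * deriv h x)
    rw [norm_mul, norm_mul] at n1
    have n2 := mul_le_mul_of_nonneg_right (norm_deriv_trapezoid_le hω (n * ω) x) (norm_nonneg (h x))
    have n3 := mul_le_of_le_one_left (norm_nonneg (deriv h x)) (norm_trapezoid_le ω (n * ω) x)
    have n4 := pow_le_pow_left₀ (norm_nonneg _) (n1.trans (add_le_add n2 n3)) 2
    refine n4.trans ?_
    nlinarith [sq_nonneg (1 / ω * ‖h x‖ - ‖deriv h x‖)]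
  rw [integral_add (i0.const_mul _) (i1.const_mul _), integral_const_mul, integral_const_mul] at b1
  rw [e]
  linarith

theorem dens_comm (α : ℂ) (Q v g : ℝ → ℂ) : dens α Q v g = dens α Q g v := by
  funext x
  simp only [dens]
  ring

variable {α : ℂ} {Q : ℝ → ℂ}

/-- The form on the line of `v ∈ H¹_c` and a sum of quasi-periodic functions is the sum of the
forms on the fibres. -/
theorem integral_dens_sum_twist (hω : 0 < ω) (hQ : IsH1Loc Q) (hper : ∀ x, Q (x + ω) = Q x)
    {N : ℕ} (κ : Fin N → ℝ) (G : Fin N → (periodicDomain hω).Carrier) (v : H1c) :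
    ∫ x, dens α Q (fun x => conj (∑ j, twist (κ j) (G j) x)) v.1 x =
      ∑ j, ∫ x in Icc 0 ω, dens α Q (fun x => conj (twist (κ j) (G j) x))
        (twist (κ j) (floquet hω (κ j) v)) x := by
  have hg : ∀ j, IsH1Loc fun x => conj (twist (κ j) (G j) x) := fun j => ((G j).h1.twist _).conj
  have h1 : ∀ j, ∫ x, dens α Q (fun x => conj (twist (κ j) (G j) x)) v.1 x =
      ∫ x in Icc 0 ω, dens α Q (fun x => conj (twist (κ j) (G j) x))
        (twist (κ j) (floquet hω (κ j) v)) x := by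
    intro j
    rw [dens_comm, integral_dens_unfold hω hQ hper (phase_ne_zero (-κ j) ω) (hg j) (fun x => ?_),
      dens_comm, twist_floquet]
    rw [twist_add_period _ (mem_periodicDomain.1 (G j).mem).2, map_mul, conj_phase]
  rw [← Finset.sum_congr rfl fun j _ => h1 j, ← integral_finsetSum Finset.univ fun j _ => by
    rw [dens_comm]; exact integrable_dens_H1c hQ v (hg j) α]
  have hdiff : ∀ᵐ x : ℝ, ∀ j, DifferentiableAt ℝ (fun x => conj (twist (κ j) (G j) x)) x :=
    ae_all_iff.2 fun j => (hg j).ae_differentiableAt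
  refine integral_congr_ae ?_
  filter_upwards [hdiff] with x hx
  have h2 := dens_sum Finset.univ α Q v.1 (fun _ => 1) (fun j y => conj (twist (κ j) (G j) y)) x
    fun j _ => hx j
  simp only [one_mul] at h2
  rw [← h2]
  congr 1
  funext y
  exact map_sum _ _ _

/-- If the operators on the fibres are bounded below, uniformly in the quasi-momentum, then so is
the operator on the line. The Floquet transform is only needed at the quasi-momenta
`2 π j / (N ω)`, where `N` is the number of periods met by the support of a test function. -/
theorem bounded_below_of_fibres (hω : 0 < ω) (hQ : IsH1Loc Q) (hper : ∀ x, Q (x + ω) = Q x)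
    {M : (lineDomain hω).Carrier →L[ℂ] (lineDomain hω).Carrier}
    (hM : ∀ f g, ⟪f, M g⟫_ℂ = ∫ x, dens α Q (fun x => conj (f x)) g x)
    {Mκ : ℝ → (periodicDomain hω).Carrier →L[ℂ] (periodicDomain hω).Carrier}
    (hMκ : ∀ κ f g, ⟪f, Mκ κ g⟫_ℂ =
      ∫ x in Icc 0 ω, dens α Q (fun x => conj (twist κ f x)) (twist κ g) x)
    {δ : ℝ} (hδ : 0 < δ) (hb : ∀ κ ∈ Icc 0 (2 * Real.pi / ω), ∀ f, δ * ‖f‖ ≤ ‖Mκ κ f‖) :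
    ∃ δ' : ℝ, 0 < δ' ∧ ∀ f, δ' * ‖f‖ ≤ ‖M f‖ := by
  have hπ := Real.pi_pos
  set C₁ : ℝ := (1 + 2 * Real.pi / ω) ^ 2 + 1 with hC₁
  set C₂ : ℝ := (1 + 2 * (1 / ω) ^ 2) + 2 * (1 + 2 * Real.pi / ω) ^ 2 with hC₂
  have hC₁0 : 0 < C₁ := by positivity
  have hC₂0 : 0 < C₂ := by positivity
  have key : ∀ v : H1c, ‖H1c.toLine hω v‖ ^ 2 ≤ C₁ * C₂ / δ ^ 2 * ‖M (H1c.toLine hω v)‖ ^ 2 := by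
    intro v
    obtain ⟨R, hR, hv0, hv1⟩ := H1c.exists_support v
    obtain ⟨n, hn⟩ := exists_nat_gt (R / ω)
    rw [div_lt_iff₀ hω] at hn
    set N := 2 * n + 2 with hN
    have hN0 : (0 : ℝ) < N := by rw [hN]; positivity
    have hW : -((n + 1) * ω) + N * ω = (n + 1) * ω := by rw [hN]; push_cast; ring
    let κ : Fin N → ℝ := momentum ω N
    let F : Fin N → (periodicDomain hω).Carrier := fun j => floquet hω (κ j) v
    let G : Fin N → (periodicDomain hω).Carrier := fun j => Mκ (κ j) (F j)
    let h : ℝ → ℂ := fun x => ∑ j, twist (κ j) (G j) x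
    have hg1 : ∀ j, IsH1Loc (twist (κ j) (G j)) := fun j => (G j).h1.twist _
    have hh : IsH1Loc h := IsH1Loc.sum _ fun j _ => hg1 j
    have hF := norm_sq_le_sum_floquet hω v (n := n) fun x hx => hv0 x (hn.le.trans hx)
    -- the hypothesis on the fibres, squared and summed
    have hFG : ∑ j, ‖F j‖ ^ 2 ≤ (∑ j, ‖G j‖ ^ 2) / δ ^ 2 := by
      rw [le_div_iff₀ (by positivity), Finset.sum_mul]
      refine Finset.sum_le_sum fun j _ => ?_
      have h1 := pow_le_pow_left₀ (by positivity) (hb (κ j) (momentum_mem hω j) (F j)) 2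
      rw [mul_pow] at h1
      linarith
    -- testing against the sum of the functions `Mκ F`, cut off outside the support of `v`
    have hpair : ⟪H1c.toLine hω (cutoff hω (n * ω) h hh), M (H1c.toLine hω v)⟫_ℂ =
        ((∑ j, ‖G j‖ ^ 2 : ℝ) : ℂ) := by
      have e1 : ∫ x, dens α Q (fun x => conj ((cutoff hω (n * ω) h hh).1 x)) v.1 x =
          ∫ x, dens α Q (fun x => conj (h x)) v.1 x := by
        refine integral_congr_ae (Eventually.of_forall fun x => ?_)
        by_cases hx : |x| < n * ω
        · have h1 : (fun x => conj ((cutoff hω (n * ω) h hh).1 x)) =ᶠ[𝓝 x] fun x => conj (h x) := by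
            filter_upwards [(isOpen_lt continuous_abs continuous_const).mem_nhds hx] with y hy
            rw [cutoff_apply, trapezoid_eq_one hω (le_of_lt hy), one_mul]
          simp only [dens]
          rw [h1.deriv_eq, h1.eq_of_nhds]
        · have h1 : R ≤ |x| := hn.le.trans (not_lt.1 hx)
          simp only [dens, hv0 x h1, hv1 x h1, mul_zero, add_zero]
      refine (hM _ _).trans (e1.trans ?_)
      refine (integral_dens_sum_twist hω hQ hper κ G v).trans ?_
      rw [Complex.ofReal_sum]
      refine Finset.sum_congr rfl fun j _ => ?_
      rw [← hMκ]
      refine (inner_self_eq_norm_sq_to_K (𝕜 := ℂ) (G j)).trans ?_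
      norm_cast
    have hnorm : ‖H1c.toLine hω (cutoff hω (n * ω) h hh)‖ ^ 2 ≤ C₂ * N * ∑ j, ‖G j‖ ^ 2 := by
      have hp : ∀ (j : Fin N) x, twist (κ j) (G j) (x + ω) = phase (κ j) ω * twist (κ j) (G j) x :=
        fun j => twist_add_period _ (mem_periodicDomain.1 (G j).mem).2
      have hP0 := integral_norm_sum_sq hω (phase_momentum_injective hω N) (fun j => norm_phase _ _)
        (phase_momentum_pow hω) (fun j c d => (hg1 j).memLp c d) hp (-((n + 1) * ω))
      have hP1 := integral_norm_sum_sq hω (phase_momentum_injective hω N) (fun j => norm_phase _ _)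
        (phase_momentum_pow hω) (fun j c d => (hg1 j).2 c d) (fun j => deriv_shift (hp j))
        (-((n + 1) * ω))
      rw [hW] at hP0 hP1
      have hd : ∫ x in Icc (-((n + 1) * ω)) ((n + 1) * ω), ‖deriv h x‖ ^ 2 =
          ∫ x in Icc (-((n + 1) * ω)) ((n + 1) * ω), ‖∑ j, deriv (twist (κ j) (G j)) x‖ ^ 2 := by
        have hdiff : ∀ᵐ x : ℝ, ∀ j, DifferentiableAt ℝ (twist (κ j) (G j)) x :=
          ae_all_iff.2 fun j => (hg1 j).ae_differentiableAt
        refine integral_congr_ae (ae_restrict_of_ae ?_)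
        filter_upwards [hdiff] with x hx
        have : deriv h x = ∑ j, deriv (twist (κ j) (G j)) x := deriv_fun_sum fun j _ => hx j
        rw [this]
      have b0 : ∑ j, ∫ x in Icc 0 ω, ‖twist (κ j) (G j) x‖ ^ 2 ≤ ∑ j, ‖G j‖ ^ 2 := by
        refine Finset.sum_le_sum fun j _ => ?_
        have h2 := pow_le_pow_left₀ (norm_nonneg _) ((periodicDomain hω).norm_J_le (G j)) 2
        have h3 := norm_twistJ_sq hω (κ j) (G j)
        rw [twistJ_apply, FormDomain.norm_toLp_sq] at h3
        exact h3.trans_le h2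
      have b1 : ∑ j, ∫ x in Icc 0 ω, ‖deriv (twist (κ j) (G j)) x‖ ^ 2 ≤
          (1 + 2 * Real.pi / ω) ^ 2 * ∑ j, ‖G j‖ ^ 2 := by
        rw [Finset.mul_sum]
        refine Finset.sum_le_sum fun j _ => ?_
        have h1 := pow_le_pow_left₀ (norm_nonneg _)
          (norm_twistD_le hω (momentum_mem hω j) (G j)) 2
        rwa [mul_pow, norm_twistD_sq] at h1
      have h1 := norm_toLine_cutoff_sq_le hω hh n
      rw [hd, hP1, hP0] at h1
      have h2 := mul_le_mul_of_nonneg_left b0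
        (by positivity : 0 ≤ (1 + 2 * (1 / ω) ^ 2) * (N : ℝ))
      have h3 := mul_le_mul_of_nonneg_left b1 (by positivity : 0 ≤ 2 * (N : ℝ))
      refine h1.trans ?_
      rw [hC₂]
      linarith
    have hS0 : 0 ≤ ∑ j, ‖G j‖ ^ 2 := Finset.sum_nonneg fun j _ => by positivity
    have hcs : ∑ j, ‖G j‖ ^ 2 ≤
        ‖H1c.toLine hω (cutoff hω (n * ω) h hh)‖ * ‖M (H1c.toLine hω v)‖ := by
      have h1 := norm_inner_le_norm (𝕜 := ℂ) (H1c.toLine hω (cutoff hω (n * ω) h hh))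
        (M (H1c.toLine hω v))
      rwa [hpair, Complex.norm_real, Real.norm_of_nonneg hS0] at h1
    have hS : ∑ j, ‖G j‖ ^ 2 ≤ C₂ * N * ‖M (H1c.toLine hω v)‖ ^ 2 := by
      have h1 := pow_le_pow_left₀ hS0 hcs 2
      rw [mul_pow] at h1
      have h2 := h1.trans (mul_le_mul_of_nonneg_right hnorm (sq_nonneg _))
      rcases eq_or_lt_of_le hS0 with h0 | h0
      · rw [← h0]; positivity
      · refine le_of_mul_le_mul_left ?_ h0
        linarith
    have h1 : (N : ℝ) * ‖H1c.toLine hω v‖ ^ 2 ≤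
        C₁ * ((C₂ * N * ‖M (H1c.toLine hω v)‖ ^ 2) / δ ^ 2) :=
      hF.trans (mul_le_mul_of_nonneg_left (hFG.trans
        (div_le_div_of_nonneg_right hS (by positivity))) hC₁0.le)
    refine le_of_mul_le_mul_left (h1.trans (le_of_eq ?_)) hN0
    ring
  refine ⟨1 / √(C₁ * C₂ / δ ^ 2), by positivity, fun f => ?_⟩
  refine (dense_H1c hω).induction_on
    (p := fun f => 1 / √(C₁ * C₂ / δ ^ 2) * ‖f‖ ≤ ‖M f‖) f
    (isClosed_le (continuous_const.mul continuous_norm) M.continuous.norm) fun v => ?_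
  have h1 := Real.sqrt_le_sqrt (key v)
  rw [Real.sqrt_sq (norm_nonneg _), Real.sqrt_mul (by positivity),
    Real.sqrt_sq (norm_nonneg _)] at h1
  rw [one_div, inv_mul_le_iff₀ (by positivity)]
  exact h1

end BoundedBelow


/-! ### The spectrum of the pencil on the line -/

section FredholmPencil

variable {H : Type*} [NormedAddCommGroup H] [InnerProductSpace ℂ H] [CompleteSpace H]

theorem neg_bijective_iff {E : Type*} [NormedAddCommGroup E] [NormedSpace ℂ E] (A B : E →L[ℂ] E) :
    Function.Bijective (A - B) ↔ Function.Bijective (B - A) := by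
  have e : ⇑(A - B) = (Equiv.neg E) ∘ ⇑(B - A) := by
    funext x
    simp
  rw [e, Function.Bijective.of_comp_iff' (Equiv.neg E).bijective]

theorem exists_lower_bound_of_bijective {E : Type*} [NormedAddCommGroup E] [NormedSpace ℂ E]
    [CompleteSpace E] {M : E →L[ℂ] E} (h : Function.Bijective M) :
    ∃ δ : ℝ, 0 < δ ∧ ∀ x, δ * ‖x‖ ≤ ‖M x‖ := by
  obtain ⟨u, hu⟩ := ContinuousLinearMap.isUnit_iff_bijective.2 h
  refine ⟨1 / (‖(↑u⁻¹ : E →L[ℂ] E)‖ + 1), by positivity, fun x => ?_⟩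
  have h1 : (↑u⁻¹ : E →L[ℂ] E) (M x) = x := by
    rw [← hu]
    exact congrArg (fun A : E →L[ℂ] E => A x) u.inv_mul
  have h2 := (↑u⁻¹ : E →L[ℂ] E).le_opNorm (M x)
  rw [h1] at h2
  rw [one_div, inv_mul_le_iff₀ (by positivity)]
  nlinarith [norm_nonneg (M x)]

/-- The Fredholm alternative for a pencil. -/
theorem bijective_pencil {R A : H →L[ℂ] H} (hRc : IsCompactOperator R)
    (hA : ∀ f g, ⟪A f, g⟫_ℂ = ⟪f, A g⟫_ℂ) {a : ℝ} (ha : 0 < a)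
    (hco : ∀ f, a * ‖f‖ ^ 2 ≤ (⟪f, A f⟫_ℂ).re) {z : ℂ} (hz : z ≠ 0)
    (hinj : ∀ f, R f = z • A f → f = 0) : Function.Bijective (z • A - R) := by
  obtain ⟨u, hu⟩ := ContinuousLinearMap.isUnit_iff_bijective.2
    (bijective_of_symmetric_of_bounded_below A hA ha (bounded_below_of_coercive hco))
  have hTc : IsCompactOperator ((↑u⁻¹ : H →L[ℂ] H) ∘L R) := hRc.clm_comp (↑u⁻¹ : H →L[ℂ] H)
  have hfac : z • A - R = A * (algebraMap ℂ (H →L[ℂ] H) z - (↑u⁻¹ : H →L[ℂ] H) ∘L R) := by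
    have h1 : A * ((↑u⁻¹ : H →L[ℂ] H) ∘L R) = R := by
      rw [← hu]
      exact u.mul_inv_cancel_left R
    rw [mul_sub, h1, Algebra.algebraMap_eq_smul_one, mul_smul_comm, mul_one]
  rcases hTc.hasEigenvalue_or_mem_resolventSet hz with h | h
  · exfalso
    obtain ⟨f, hf⟩ := h.exists_hasEigenvector
    refine hf.2 (hinj f ?_)
    have h1 : (↑u⁻¹ : H →L[ℂ] H) (R f) = z • f := hf.apply_eq_smul
    have h2 := congrArg A h1
    rw [map_smul] at h2
    rw [← h2, ← hu]
    exact (congrArg (fun B : H →L[ℂ] H => B (R f)) u.mul_inv).symm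
  · rw [spectrum.mem_resolventSet_iff] at h
    rw [← ContinuousLinearMap.isUnit_iff_bijective, hfac, ← hu]
    exact u.isUnit.mul h

/-- Invertibility is uniform over a compact range of the parameter. -/
theorem exists_uniform_lower_bound {R : H →L[ℂ] H} (hRc : IsCompactOperator R)
    {A : ℝ → H →L[ℂ] H} (hcont : Continuous A) {T : ℝ}
    (hA : ∀ k f g, ⟪A k f, g⟫_ℂ = ⟪f, A k g⟫_ℂ) {a : ℝ} (ha : 0 < a)
    (hco : ∀ k ∈ Icc 0 T, ∀ f, a * ‖f‖ ^ 2 ≤ (⟪f, A k f⟫_ℂ).re) {z : ℂ} (hz : z ≠ 0)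
    (hinj : ∀ k ∈ Icc 0 T, ∀ f, R f = z • A k f → f = 0) :
    ∃ δ : ℝ, 0 < δ ∧ ∀ k ∈ Icc 0 T, ∀ f, δ * ‖f‖ ≤ ‖(z • A k - R) f‖ := by
  have hu : ∀ k ∈ Icc 0 T, IsUnit (z • A k - R) := fun k hk =>
    ContinuousLinearMap.isUnit_iff_bijective.2
      (bijective_pencil hRc (hA k) ha (hco k hk) hz (hinj k hk))
  have hc : ContinuousOn (fun k => Ring.inverse (z • A k - R)) (Icc 0 T) := by
    intro k hk
    obtain ⟨u, hu⟩ := hu k hk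
    have h1 := NormedRing.inverse_continuousAt u
    rw [hu] at h1
    exact (ContinuousAt.comp (f := fun k => z • A k - R) h1
      (((hcont.const_smul z).sub continuous_const).continuousAt)).continuousWithinAt
  obtain ⟨C, hC⟩ := isCompact_Icc.exists_bound_of_continuousOn hc
  refine ⟨1 / (|C| + 1), by positivity, fun k hk f => ?_⟩
  have h1 : Ring.inverse (z • A k - R) ((z • A k - R) f) = f :=
    congrArg (fun B : H →L[ℂ] H => B f) (Ring.inverse_mul_cancel _ (hu k hk))
  have h2 := (Ring.inverse (z • A k - R)).le_opNorm ((z • A k - R) f)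
  rw [h1] at h2
  have h3 := (hC k hk).trans (le_abs_self C)
  rw [one_div, inv_mul_le_iff₀ (by positivity)]
  have h4 := mul_le_mul_of_nonneg_right h3 (norm_nonneg ((z • A k - R) f))
  nlinarith [norm_nonneg ((z • A k - R) f)]

end FredholmPencil

section LineSpectrum

variable {ω : ℝ} (hω : 0 < ω) {p s : ℝ → ℂ}

theorem isH1Loc_pencil (hp : Potential ω p) (hs : Potential ω s) (α : ℂ) :
    IsH1Loc fun x => α * p x - s x := (hp.h1.const_smul α).sub hs.h1

theorem pencil_periodic (hp : Potential ω p) (hs : Potential ω s) (α : ℂ) (x : ℝ) :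
    α * p (x + ω) - s (x + ω) = α * p x - s x := by
  rw [hp.periodic, hs.periodic]

/-- Away from zero, the spectrum of the pencil on the line is the union over the quasi-momenta of
the spectra of the pencils on the fibres. -/
theorem not_bijective_pencil_iff (hp : Potential ω p) (hs : Potential ω s)
    (hRc : IsCompactOperator ((periodicDomain hω).potOp s)) {a : ℝ} (ha : 0 < a)
    (hco : ∀ κ ∈ Icc 0 (2 * Real.pi / ω), ∀ f, a * ‖f‖ ^ 2 ≤ (⟪f, twistOp hω κ p f⟫_ℂ).re)
    {l : ℝ} (hl : l ≠ 0) :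
    ¬ Function.Bijective ((lineDomain hω).potOp s - (l : ℂ) • lineA hω p) ↔
      ∃ κ ∈ Icc 0 (2 * Real.pi / ω), ∃ f, f ≠ 0 ∧
        (periodicDomain hω).potOp s f = (l : ℂ) • twistOp hω κ p f := by
  have hl' : (l : ℂ) ≠ 0 := Complex.ofReal_ne_zero.2 hl
  have hQ := isH1Loc_pencil hp hs (l : ℂ)
  have hM := inner_line_pencil hω hp hs (l : ℂ)
  rw [neg_bijective_iff]
  constructor
  · intro h
    by_contra hc
    refine h ?_
    obtain ⟨δ, hδ, hb⟩ := exists_uniform_lower_bound hRc (continuous_twistOp hω p)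
      (fun κ f g => twistOp_symm hω hp κ f g) ha hco hl' fun κ hκ f hf => by
        by_contra hf0
        exact hc ⟨κ, hκ, f, hf0, hf⟩
    obtain ⟨δ', hδ', hb'⟩ := bounded_below_of_fibres hω hQ (pencil_periodic hp hs (l : ℂ)) hM
      (fun κ f g => inner_twist_pencil hω hp hs (l : ℂ) κ f g) hδ hb
    refine bijective_of_symmetric_of_bounded_below _ (fun f g => ?_) hδ' hb'
    rw [sub_apply, sub_apply, smul_apply, smul_apply, inner_sub_left, inner_sub_right,
      inner_smul_left, inner_smul_right, Complex.conj_ofReal, lineA_symm hω hp,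
      (lineDomain hω).potOp_symm hs]
  · rintro ⟨κ, -, f, hf0, hf⟩ h
    obtain ⟨δ, hδ, hb⟩ := exists_lower_bound_of_bijective h
    exact not_bounded_below_of_isSol hω hQ hM hf0 ((pencil_iff_isSol hω hp hs _ κ f).1 hf) hδ hb

/-- An eigenvector of the pencil on the line would be a solution in `H¹(ℝ)`. -/
theorem eq_zero_of_line_pencil (hp : Potential ω p) (hs : Potential ω s) {z : ℂ} (hz : z ≠ 0)
    {f : (lineDomain hω).Carrier} (hf : (lineDomain hω).potOp s f = z • lineA hω p f) : f = 0 := by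
  have hsol : IsSol z (fun x => z * p x - s x) f := by
    refine ⟨f.h1, fun v => ?_⟩
    have h1 := inner_line_pencil hω hp hs z (H1c.toLine hω (H1c.conj v)) f
    rw [sub_apply, smul_apply, hf, sub_self, inner_zero_right] at h1
    refine Eq.trans ?_ h1.symm
    have e : (fun x => conj (H1c.toLine hω (H1c.conj v) x)) = v.1 :=
      funext fun x => Complex.conj_conj _
    rw [e]
  exact FormDomain.coe_ext fun x => congrFun (eq_zero_of_isH1 hω hz (isH1Loc_pencil hp hs z)
    (pencil_periodic hp hs z) hsol f.mem) x

/-- Narrow tents of height one have a large `H¹` norm, but bounded images under the operator of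
`r`. -/
theorem Weight.not_bijective_potOp (r : Weight ω) (hs : Potential ω s)
    (hrs : ∀ h : ℝ → ℂ, IsH1Loc h → (∀ x, h (x + ω) = h x) →
      r.pair h = ∫ x in Icc 0 ω, dens 0 s h (fun _ => 1) x) :
    ¬ Function.Bijective ((lineDomain hω).potOp s) := by
  intro h
  have := r.finite_pos
  have := r.finite_neg
  obtain ⟨δ, hδ, hb⟩ := exists_lower_bound_of_bijective h
  obtain ⟨C, hC, hev⟩ := (lineDomain hω).exists_norm_apply_le ω
  have hm := r.mass_nonneg
  obtain ⟨ε, hε0, hε1, hε2⟩ : ∃ ε : ℝ, 0 < ε ∧ ε ≤ ω / 2 ∧ ε * (C * r.mass / δ) ^ 2 < 1 := by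
    refine ⟨min (ω / 2) (1 / ((C * r.mass / δ) ^ 2 + 1)), by positivity, min_le_left _ _, ?_⟩
    refine (mul_le_mul_of_nonneg_right (min_le_right _ _) (sq_nonneg _)).trans_lt ?_
    rw [one_div, inv_mul_lt_iff₀ (by positivity)]
    linarith
  -- a tent of half-width `ε` in the middle of the period
  let v : H1c := ⟨fun x => tent ε (x + -(ω / 2)), (tent_mem hε0).1.comp_add _,
    (tent_mem hε0).2.comp_homeomorph (Homeomorph.addRight (-(ω / 2)))⟩
  have hv0 : ∀ x, x ∉ Ioo 0 ω → v.1 x = 0 := fun x hx => by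
    refine tent_eq_zero hε0 ?_
    by_contra hc
    have := abs_lt.1 (not_le.1 hc)
    exact hx ⟨by linarith, by linarith⟩
  -- the tent is bounded by one, whatever its width, whereas its slope is `1 / ε`
  have h1 : ‖(lineDomain hω).potOp s (H1c.toLine hω v)‖ ≤ C * r.mass := by
    refine norm_le_of_forall_H1c hω (by positivity) fun g => ?_
    rw [← r.linePair_conj_mul hω hs hrs]
    have e1 : r.linePair (fun x => conj (H1c.toLine hω g x) * H1c.toLine hω v x) =
        r.pair (periodize ω 1 (mulH1c (H1c.conj g) v.1 v.2.1).1) := by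
      unfold Weight.linePair Weight.pair
      rw [← integral_periodicExt_H1c hω r.pos_compl, ← integral_periodicExt_H1c hω r.neg_compl]
      rfl
    rw [e1]
    refine (r.norm_pair_le (C := C * ‖H1c.toLine hω g‖) fun x hx => ?_).trans (le_of_eq (by ring))
    have hx' : x ∈ Icc 0 ω := ⟨hx.1, hx.2.le⟩
    rw [periodize_eq_self (fun y hy => by
      change conj (g.1 y) * v.1 y = 0
      rw [hv0 y hy, mul_zero]) hx']
    change ‖conj (g.1 x) * v.1 x‖ ≤ _
    rw [norm_mul, Complex.norm_conj]
    refine (mul_le_of_le_one_right (norm_nonneg _) (norm_tent_le hε0 _)).trans ?_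
    exact hev (H1c.toLine hω g) x ⟨by linarith [hx.1], hx.2.le⟩
  have h2 : 1 ≤ ε * ‖H1c.toLine hω v‖ ^ 2 := by
    have e1 : v.1 (ω / 2) = 1 := by simp [v, tent]
    have e2 : v.1 (ω / 2 - ε) = 0 := tent_eq_zero hε0 (by
      rw [show ω / 2 - ε + -(ω / 2) = -ε by ring, abs_neg]; exact le_abs_self ε)
    have h3 := v.2.1.norm_sub_sq_le (by linarith : ω / 2 - ε ≤ ω / 2)
      (right_mem_Icc.2 (by linarith)) (left_mem_Icc.2 (by linarith))
    rw [e1, e2, sub_zero, norm_one, one_pow, sub_sub_cancel] at h3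
    refine h3.trans (mul_le_mul_of_nonneg_left ?_ hε0.le)
    have h4 := pow_le_pow_left₀ (norm_nonneg _) ((lineDomain hω).norm_D_le (H1c.toLine hω v)) 2
    rw [(lineDomain hω).norm_D_sq] at h4
    exact (setIntegral_le_integral (integrable_norm_sq_of_memLp (H1c.isH1 v).2.2)
      (Eventually.of_forall fun x => by positivity)).trans h4
  have h3 : ‖H1c.toLine hω v‖ ≤ C * r.mass / δ := by
    rw [le_div_iff₀ hδ]
    linarith [hb (H1c.toLine hω v)]
  have h4 := pow_le_pow_left₀ (norm_nonneg _) h3 2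
  nlinarith [mul_le_mul_of_nonneg_left h4 hε0.le]

end LineSpectrum


/-! ### Absence of the eigenvalue zero -/

section ZeroEigenvalue

variable {ω : ℝ}

theorem Weight.periodicExt_mutuallySingular (hω : 0 < ω) (r : Weight ω) :
    periodicExt ω r.pos ⟂ₘ periodicExt ω r.neg := by
  have hmeas : ∀ c : ℝ, Measurable fun x : ℝ => x + c := fun c => measurable_id.add_const c
  refine Measure.MutuallySingular.sum_left.2 fun n =>
    Measure.MutuallySingular.sum_right.2 fun m => ?_
  by_cases hnm : n = m
  · subst hnm
    obtain ⟨S, hS, h1, h2⟩ := r.mutuallySingular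
    refine ⟨(fun x : ℝ => x + -(n * ω)) ⁻¹' S, hmeas _ hS, ?_, ?_⟩
    · rw [Measure.map_apply (hmeas _) (hmeas (-(n * ω)) hS)]
      refine measure_mono_null (fun x hx => ?_) h1
      simpa using hx
    · rw [Measure.map_apply (hmeas _) (hmeas (-(n * ω)) hS).compl]
      refine measure_mono_null (fun x hx => ?_) h2
      simpa using hx
  · -- different translates are carried by disjoint periods
    refine ⟨(fun x : ℝ => x + -(n * ω)) ⁻¹' (Ico 0 ω)ᶜ, hmeas _ measurableSet_Ico.compl, ?_, ?_⟩
    · rw [Measure.map_apply (hmeas _) (hmeas (-(n * ω)) measurableSet_Ico.compl)]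
      refine measure_mono_null (fun x hx => ?_) r.pos_compl
      simpa using hx
    · rw [Measure.map_apply (hmeas _) (hmeas (-(n * ω)) measurableSet_Ico.compl).compl]
      refine measure_mono_null (fun x hx => ?_) r.neg_compl
      intro hx'
      have h1 : x + m * ω + -(n * ω) ∈ Ico 0 ω := by
        by_contra hc
        exact hx hc
      rcases lt_or_gt_of_ne hnm with h | h
      · have : (n : ℝ) + 1 ≤ m := by exact_mod_cast h
        nlinarith [h1.2, hx'.1]
      · have : (m : ℝ) + 1 ≤ n := by exact_mod_cast h
        nlinarith [h1.1, hx'.2]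

theorem periodicExt_lt_top (hω : 0 < ω) {ν : Measure ℝ} [IsFiniteMeasure ν]
    (hν : ν (Ico 0 ω)ᶜ = 0) (M : ℝ) : periodicExt ω ν (Icc (-M) M) < ⊤ := by
  have h := (integrable_periodicExt_H1c hω hν ⟨trapezoid ω M, trapezoid_mem hω M⟩)
  refine (measure_mono fun x hx => ?_).trans_lt (h.measure_norm_ge_lt_top one_pos)
  change 1 ≤ ‖trapezoid ω M x‖
  rw [trapezoid_eq_one hω (abs_le.2 hx), norm_one]

/-- A function whose products with all test functions integrate to zero against `r` vanishes on the
open sets charged by `R₊`. -/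
theorem Weight.periodicExt_pos_eq_zero (hω : 0 < ω) (r : Weight ω) {f : ℝ → ℂ} (hf : IsH1Loc f)
    (h : ∀ g : H1c, r.linePair (fun x => g.1 x * f x) = 0) {U : Set ℝ} (hU : IsOpen U) {M : ℝ}
    (hUM : U ⊆ Icc (-M) M) (hfU : ∀ x ∈ U, f x ≠ 0) : periodicExt ω r.pos U = 0 := by
  have := r.finite_pos
  have := r.finite_neg
  by_contra hne
  have fin1 : IsFiniteMeasure ((periodicExt ω r.pos).restrict U) := ⟨by
    rw [Measure.restrict_apply_univ]
    exact (measure_mono hUM).trans_lt (periodicExt_lt_top hω r.pos_compl M)⟩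
  have fin2 : IsFiniteMeasure ((periodicExt ω r.neg).restrict U) := ⟨by
    rw [Measure.restrict_apply_univ]
    exact (measure_mono hUM).trans_lt (periodicExt_lt_top hω r.neg_compl M)⟩
  obtain ⟨b, hb, hbU, hlt⟩ := exists_bump (ν₁ := (periodicExt ω r.pos).restrict U)
    (ν₂ := (periodicExt ω r.neg).restrict U)
    ((r.periodicExt_mutuallySingular hω).mono Measure.restrict_le_self Measure.restrict_le_self)
    hU (by rw [Measure.restrict_apply_self]; exact pos_iff_ne_zero.2 hne)
    (w := fun x => ‖f x‖ ^ 2) (hf.continuous.norm.pow 2)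
    fun x hx => by have := norm_pos_iff.2 (hfU x hx); positivity
  -- the test function `b² f̄` makes the integrand nonnegative
  have hb2 : IsH1Loc fun x => (b x : ℂ) * conj (f x) := hb.1.mul hf.conj
  have h1 := h (mulH1c ⟨_, hb⟩ _ hb2)
  have hint : ∀ ν : Measure ℝ, ∫ x, (mulH1c ⟨_, hb⟩ _ hb2).1 x * f x ∂ν =
      ((∫ x, b x ^ 2 * ‖f x‖ ^ 2 ∂(ν.restrict U) : ℝ) : ℂ) := by
    intro ν
    rw [setIntegral_eq_integral_of_forall_compl_eq_zero fun x hx => by rw [hbU x hx]; ring,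
      ← integral_complex_ofReal]
    refine integral_congr_ae (Eventually.of_forall fun x => ?_)
    change (b x : ℂ) * ((b x : ℂ) * conj (f x)) * f x = ((b x ^ 2 * ‖f x‖ ^ 2 : ℝ) : ℂ)
    rw [← Complex.normSq_eq_norm_sq]
    push_cast
    rw [Complex.normSq_eq_conj_mul_self]
    ring
  rw [Weight.linePair, hint, hint, ← Complex.ofReal_sub, Complex.ofReal_eq_zero] at h1
  linarith

/-- If the closed support of `|r|` is the whole line, the operator of `r` is injective. -/
theorem Weight.eq_zero_of_potOp (hω : 0 < ω) (r : Weight ω) {s : ℝ → ℂ} (hs : Potential ω s)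
    (hrs : ∀ h : ℝ → ℂ, IsH1Loc h → (∀ x, h (x + ω) = h x) →
      r.pair h = ∫ x in Icc 0 ω, dens 0 s h (fun _ => 1) x)
    (hr : ∀ U : Set ℝ, IsOpen U → U.Nonempty →
      0 < periodicExt ω r.pos U + periodicExt ω r.neg U)
    {f : (lineDomain hω).Carrier} (hf : (lineDomain hω).potOp s f = 0) : f = 0 := by
  have hpair : ∀ g : H1c, r.linePair (fun x => g.1 x * f x) = 0 := fun g => by
    have h1 := r.linePair_conj_mul hω hs hrs (H1c.toLine hω (H1c.conj g)) f
    rw [hf, inner_zero_right] at h1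
    rw [← h1]
    congr 1
    funext x
    change _ = conj (conj (g.1 x)) * f x
    rw [Complex.conj_conj]
  have hswap : ∀ g : H1c, r.swap.linePair (fun x => g.1 x * f x) = 0 := fun g => by
    have e : r.swap.linePair (fun x => g.1 x * f x) = -r.linePair (fun x => g.1 x * f x) :=
      (neg_sub _ _).symm
    rw [e, hpair, neg_zero]
  refine FormDomain.coe_ext fun x₀ => ?_
  by_contra hx₀
  have hU : IsOpen ({x | f x ≠ 0} ∩ Ioo (-(|x₀| + 1)) (|x₀| + 1)) :=
    (isOpen_ne_fun f.h1.continuous continuous_const).inter isOpen_Ioo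
  have h1 := r.periodicExt_pos_eq_zero hω f.h1 hpair hU
    (inter_subset_right.trans Ioo_subset_Icc_self) fun x hx => hx.1
  have h2 := r.swap.periodicExt_pos_eq_zero hω f.h1 hswap hU
    (inter_subset_right.trans Ioo_subset_Icc_self) fun x hx => hx.1
  have h3 := hr _ hU ⟨x₀, hx₀, abs_lt.1 (lt_add_one _)⟩
  change periodicExt ω r.neg _ = 0 at h2
  rw [h1, h2, add_zero] at h3
  exact h3.false

end ZeroEigenvalue

/-! ### Spectral bands -/

theorem infinite_bands {𝓘 : Set (ℝ × ℝ)} (h0 : ∀ q ∈ 𝓘, 0 < q.1)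
    (h : ∀ ε : ℝ, 0 < ε → ∃ t, t ≤ ε ∧ ∃ q ∈ 𝓘, t ∈ Icc q.1 q.2) : 𝓘.Infinite := by
  refine Set.Infinite.of_image Prod.fst (infinite_of_forall_exists_le ?_ fun ε hε => ?_)
  · rintro _ ⟨q, hq, rfl⟩
    exact h0 q hq
  · obtain ⟨t, ht, q, hq, htq⟩ := h ε hε
    exact ⟨q.1, ⟨q, hq, rfl⟩, htq.1.trans ht⟩

/-- The bands of the pencils `R - l A k`, for `l` of either sign: those with `l < 0` are the
reflections of the bands of the pencils with `-R` in place of `R`. -/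
theorem exists_signed_bands {H : Type*} [NormedAddCommGroup H] [InnerProductSpace ℂ H]
    [CompleteSpace H] {R : H →L[ℂ] H} (hRc : IsCompactOperator R)
    (hR : (R : H →ₗ[ℂ] H).IsSymmetric) {A : ℝ → H →L[ℂ] H} {T : ℝ} (hT : 0 ≤ T)
    (hcont : Continuous A) (hA : ∀ k, (A k : H →ₗ[ℂ] H).IsSymmetric) {a : ℝ} (ha : 0 < a)
    (hco : ∀ k ∈ Icc 0 T, ∀ f, a * ‖f‖ ^ 2 ≤ (⟪f, A k f⟫_ℂ).re)
    (hflat : ∀ l : ℝ, l ≠ 0 → ∃ k ∈ Icc 0 T, ∀ f, R f = (l : ℂ) • A k f → f = 0) :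
    ∃ 𝓘 : Set (ℝ × ℝ), (∀ q ∈ 𝓘, q.1 < q.2 ∧ (0 : ℝ) ∉ Icc q.1 q.2) ∧
      (∀ ε : ℝ, 0 < ε → {q ∈ 𝓘 | ¬ Icc q.1 q.2 ⊆ Ioo (-ε) ε}.Finite) ∧
      (∀ l : ℝ, l ≠ 0 → (l ∈ unionIntervals 𝓘 ↔
        ∃ k ∈ Icc 0 T, ∃ f, f ≠ 0 ∧ R f = (l : ℂ) • A k f)) ∧
      ((∀ ε : ℝ, 0 < ε → ∃ t : ℝ, 0 < t ∧ t ≤ ε ∧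
        ∃ k ∈ Icc 0 T, ∃ f, f ≠ 0 ∧ R f = (t : ℂ) • A k f) → {q ∈ 𝓘 | 0 < q.1}.Infinite) ∧
      ((∀ ε : ℝ, 0 < ε → ∃ t : ℝ, 0 < t ∧ t ≤ ε ∧
        ∃ k ∈ Icc 0 T, ∃ f, f ≠ 0 ∧ (-R) f = (t : ℂ) • A k f) → {q ∈ 𝓘 | q.2 < 0}.Infinite) := by
  have hneg : ∀ (l k : ℝ) (f : H), (-R) f = (l : ℂ) • A k f ↔ R f = ((-l : ℝ) : ℂ) • A k f :=
    fun l k f => by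
      rw [neg_apply, Complex.ofReal_neg, neg_smul, neg_eq_iff_eq_neg]
  obtain ⟨𝓐, h𝓐0, h𝓐fin, h𝓐⟩ := exists_bands hRc hR hT hcont hA ha hco fun l hl =>
    hflat l hl.ne'
  obtain ⟨𝓑, h𝓑0, h𝓑fin, h𝓑⟩ := exists_bands (R := -R) hRc.neg (fun f g => by
      change ⟪-(R f), g⟫_ℂ = ⟪f, -(R g)⟫_ℂ
      rw [inner_neg_left, inner_neg_right]
      exact congrArg _ (hR f g)) hT hcont hA ha hco
    fun l hl => by
      obtain ⟨k, hk, h⟩ := hflat (-l) (neg_ne_zero.2 hl.ne')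
      exact ⟨k, hk, fun f hf => h f ((hneg l k f).1 hf)⟩
  -- the reflection of the bands of the negative of the pencil
  let refl : ℝ × ℝ → ℝ × ℝ := fun q => (-q.2, -q.1)
  have hrefl : Function.Injective refl := fun q q' h => by
    have h1 := congrArg Prod.fst h
    have h2 := congrArg Prod.snd h
    exact Prod.ext (neg_injective h2) (neg_injective h1)
  have hmem : ∀ l : ℝ, l ∈ unionIntervals (𝓐 ∪ refl '' 𝓑) ↔
      (∃ q ∈ 𝓐, l ∈ Icc q.1 q.2) ∨ ∃ q ∈ 𝓑, -l ∈ Icc q.1 q.2 := by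
    intro l
    simp only [unionIntervals, mem_iUnion, exists_prop]
    constructor
    · rintro ⟨q, hq | ⟨q, hq, rfl⟩, hl⟩
      · exact Or.inl ⟨q, hq, hl⟩
      · exact Or.inr ⟨q, hq, by linarith [hl.2], by linarith [hl.1]⟩
    · rintro (⟨q, hq, hl⟩ | ⟨q, hq, hl⟩)
      · exact ⟨q, Or.inl hq, hl⟩
      · exact ⟨_, Or.inr ⟨q, hq, rfl⟩, by simp only [refl]; linarith [hl.2],
          by simp only [refl]; linarith [hl.1]⟩
  refine ⟨𝓐 ∪ refl '' 𝓑, ?_, fun ε hε => ?_, fun l hl => ?_, fun h => ?_, fun h => ?_⟩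
  · rintro q (hq | ⟨q, hq, rfl⟩)
    · exact ⟨(h𝓐0 q hq).2, fun hc => (h𝓐0 q hq).1.not_ge hc.1⟩
    · refine ⟨neg_lt_neg (h𝓑0 q hq).2, fun hc => (h𝓑0 q hq).1.not_ge ?_⟩
      have := hc.2
      simp only [refl] at this
      linarith
  · refine ((h𝓐fin ε hε).union ((h𝓑fin ε hε).image refl)).subset ?_
    rintro q ⟨hq | ⟨q, hq, rfl⟩, hsub⟩
    · refine Or.inl ⟨hq, ?_⟩
      by_contra hc
      refine hsub fun x hx => ⟨?_, hx.2.trans_lt (not_le.1 hc)⟩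
      linarith [(h𝓐0 q hq).1, hx.1]
    · refine Or.inr ⟨q, ⟨hq, ?_⟩, rfl⟩
      by_contra hc
      refine hsub fun x hx => ⟨?_, ?_⟩
      · linarith [hx.1, not_le.1 hc]
      · linarith [(h𝓑0 q hq).1, hx.2]
  · rw [hmem]
    rcases lt_or_gt_of_ne hl with h | h
    · have h1 := h𝓑 (-l) (neg_pos.2 h)
      simp only [hneg, neg_neg] at h1
      rw [h1, or_iff_right]
      rintro ⟨q, hq, hlq⟩
      linarith [(h𝓐0 q hq).1, hlq.1]
    · rw [h𝓐 l h, or_iff_left]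
      rintro ⟨q, hq, hlq⟩
      linarith [(h𝓑0 q hq).1, hlq.1]
  · refine (infinite_bands (fun q hq => (h𝓐0 q hq).1) fun ε hε => ?_).mono
      fun q hq => ⟨Or.inl hq, (h𝓐0 q hq).1⟩
    obtain ⟨t, ht0, htε, ht⟩ := h ε hε
    exact ⟨t, htε, (h𝓐 t ht0).2 ht⟩
  · refine ((infinite_bands (fun q hq => (h𝓑0 q hq).1) fun ε hε => ?_).image hrefl.injOn).mono ?_
    · obtain ⟨t, ht0, htε, ht⟩ := h ε hε
      exact ⟨t, htε, (h𝓑 t ht0).2 ht⟩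
    · rintro _ ⟨q, hq, rfl⟩
      exact ⟨Or.inr ⟨q, hq, rfl⟩, neg_neg_iff_pos.2 (h𝓑0 q hq).1⟩

section Bands

variable {ω : ℝ} (hω : 0 < ω) {p s : ℝ → ℂ}

/-- No energy is an eigenvalue on all fibres: the differential equation has only finitely many
Floquet multipliers. -/
theorem exists_injective_pencil (hp : Potential ω p) (hs : Potential ω s) {z : ℂ} (hz : z ≠ 0) :
    ∃ κ ∈ Icc 0 (2 * Real.pi / ω), ∀ f,
      (periodicDomain hω).potOp s f = z • twistOp hω κ p f → f = 0 := by
  have hfin := finite_multipliers hω hz (isH1Loc_pencil hp hs z) (pencil_periodic hp hs z)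
  set S := {ρ : ℂ | ∃ φ, IsSol z (fun x => z * p x - s x) φ ∧ φ ≠ 0 ∧ ∀ x, φ (x + ω) = ρ * φ x}
    with hS
  -- one more quasi-momentum than there are multipliers
  obtain ⟨j, hj⟩ : ∃ j : Fin (hfin.toFinset.card + 1),
      phase (momentum ω (hfin.toFinset.card + 1) j) ω ∉ S := by
    by_contra! hc
    have h1 := Finset.card_le_card_of_injOn (s := Finset.univ)
      (fun j => phase (momentum ω (hfin.toFinset.card + 1) j) ω)
      (fun j _ => hfin.mem_toFinset.2 (hc j)) (phase_momentum_injective hω _).injOn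
    rw [Finset.card_univ, Fintype.card_fin] at h1
    omega
  refine ⟨_, momentum_mem hω j, fun f hf => ?_⟩
  by_contra hf0
  refine hj ⟨_, (pencil_iff_isSol hω hp hs z _ f).1 hf, fun h0 => hf0 ?_,
    twist_add_period _ (mem_periodicDomain.1 f.mem).2⟩
  refine FormDomain.coe_ext fun x => norm_eq_zero.1 ?_
  rw [← norm_twist (momentum ω (hfin.toFinset.card + 1) j), h0, Pi.zero_apply, norm_zero]

/-- The bands of the weighted pencils on the fibres. They are infinitely many on a side as soon as
one fibre, here `κ = 0`, has infinitely many eigenvalues there. -/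
theorem Weight.exists_bands (r : Weight ω) (hp : Potential ω p) (hs : Potential ω s)
    (hrs : ∀ h : ℝ → ℂ, IsH1Loc h → (∀ x, h (x + ω) = h x) →
      r.pair h = ∫ x in Icc 0 ω, dens 0 s h (fun _ => 1) x) {a : ℝ} (ha : 0 < a)
    (hco : ∀ κ ∈ Icc 0 (2 * Real.pi / ω), ∀ f, a * ‖f‖ ^ 2 ≤ (⟪f, twistOp hω κ p f⟫_ℂ).re) :
    ∃ 𝓘 : Set (ℝ × ℝ), (∀ q ∈ 𝓘, q.1 < q.2 ∧ (0 : ℝ) ∉ Icc q.1 q.2) ∧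
      (∀ ε : ℝ, 0 < ε → {q ∈ 𝓘 | ¬ Icc q.1 q.2 ⊆ Ioo (-ε) ε}.Finite) ∧
      (∀ l : ℝ, l ≠ 0 → (l ∈ unionIntervals 𝓘 ↔ ∃ κ ∈ Icc 0 (2 * Real.pi / ω), ∃ f, f ≠ 0 ∧
        (periodicDomain hω).potOp s f = (l : ℂ) • twistOp hω κ p f)) ∧
      (¬ FinitelyManyJumps r.pos → {q ∈ 𝓘 | 0 < q.1}.Infinite) ∧
      (¬ FinitelyManyJumps r.neg → {q ∈ 𝓘 | q.2 < 0}.Infinite) := by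
  have hT : 0 ≤ 2 * Real.pi / ω := by have := Real.pi_pos; positivity
  obtain ⟨𝓘, h0, hfin, hmem, hpos, hneg⟩ := exists_signed_bands (r.isCompactOperator hω hs hrs)
    ((periodicDomain hω).potOp_symm hs) hT (continuous_twistOp hω p)
    (fun κ => twistOp_symm hω hp κ) ha hco
    fun l hl => exists_injective_pencil hω hp hs (Complex.ofReal_ne_zero.2 hl)
  have h00 : (0 : ℝ) ∈ Icc 0 (2 * Real.pi / ω) := ⟨le_rfl, hT⟩
  refine ⟨𝓘, h0, hfin, hmem, fun h => hpos fun ε hε => ?_, fun h => hneg fun ε hε => ?_⟩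
  · obtain ⟨t, ⟨ht0, f, hf0, hf⟩, htε⟩ := Weight.exists_pos_le hω hs hrs (twistOp_symm hω hp 0) ha
      (hco 0 h00) h hε
    exact ⟨t, ht0, htε, 0, h00, f, hf0, hf⟩
  · obtain ⟨t, ⟨ht0, f, hf0, hf⟩, htε⟩ := Weight.exists_neg_le hω hs hrs (twistOp_symm hω hp 0) ha
      (hco 0 h00) h hε
    exact ⟨t, ht0, htε, 0, h00, f, hf0, hf⟩

end Bands

/-! ### The conditional stability set -/

/-- Inversion turns bands which accumulate at `0` into bands which tend to infinity. -/
theorem exists_inverse_bands {𝓘 : Set (ℝ × ℝ)} (h0 : ∀ q ∈ 𝓘, q.1 < q.2 ∧ (0 : ℝ) ∉ Icc q.1 q.2)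
    (hfin : ∀ ε : ℝ, 0 < ε → {q ∈ 𝓘 | ¬ Icc q.1 q.2 ⊆ Ioo (-ε) ε}.Finite) :
    ∃ 𝓙 : Set (ℝ × ℝ), (∀ q ∈ 𝓙, q.1 < q.2 ∧ (0 : ℝ) ∉ Icc q.1 q.2) ∧
      (∀ C : ℝ, {q ∈ 𝓙 | (Icc q.1 q.2 ∩ Icc (-C) C).Nonempty}.Finite) ∧
      (∀ z : ℝ, z ∈ unionIntervals 𝓙 ↔ z⁻¹ ∈ unionIntervals 𝓘) ∧
      ({q ∈ 𝓘 | 0 < q.1}.Infinite → {q ∈ 𝓙 | 0 < q.1}.Infinite) ∧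
      ({q ∈ 𝓘 | q.2 < 0}.Infinite → {q ∈ 𝓙 | q.2 < 0}.Infinite) := by
  have hsign : ∀ q ∈ 𝓘, 0 < q.1 ∨ q.2 < 0 := fun q hq => by
    by_contra! hc
    exact (h0 q hq).2 hc
  let inv : ℝ × ℝ → ℝ × ℝ := fun q => (q.2⁻¹, q.1⁻¹)
  have hinv : Function.Injective inv := fun q q' h =>
    Prod.ext (inv_injective (congrArg Prod.snd h)) (inv_injective (congrArg Prod.fst h))
  have hlt : ∀ q ∈ 𝓘, q.2⁻¹ < q.1⁻¹ := fun q hq => by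
    rcases hsign q hq with h | h
    · exact inv_strictAnti₀ h (h0 q hq).1
    · exact (inv_lt_inv_of_neg h ((h0 q hq).1.trans h)).2 (h0 q hq).1
  have hmem : ∀ q ∈ 𝓘, ∀ z : ℝ, z ∈ Icc q.2⁻¹ q.1⁻¹ ↔ z⁻¹ ∈ Icc q.1 q.2 := fun q hq z => by
    have hq12 := (h0 q hq).1
    rcases hsign q hq with h | h
    · constructor
      · intro hz
        have hz0 : 0 < z := (inv_pos.2 (h.trans hq12)).trans_le hz.1
        exact ⟨(le_inv_comm₀ h hz0).2 hz.2, (inv_le_comm₀ hz0 (h.trans hq12)).2 hz.1⟩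
      · intro hz
        have hz0 : 0 < z := inv_pos.1 (h.trans_le hz.1)
        exact ⟨(inv_le_comm₀ hz0 (h.trans hq12)).1 hz.2, (le_inv_comm₀ h hz0).1 hz.1⟩
    · constructor
      · intro hz
        have hz0 : z < 0 := hz.2.trans_lt (inv_lt_zero.2 (hq12.trans h))
        exact ⟨(le_inv_of_neg (hq12.trans h) hz0).2 hz.2, (inv_le_of_neg hz0 h).2 hz.1⟩
      · intro hz
        have hz0 : z < 0 := inv_lt_zero.1 (hz.2.trans_lt h)
        exact ⟨(inv_le_of_neg hz0 h).1 hz.2, (le_inv_of_neg (hq12.trans h) hz0).1 hz.1⟩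
  refine ⟨inv '' 𝓘, ?_, fun C => ?_, fun z => ?_, fun h => ?_, fun h => ?_⟩
  · rintro _ ⟨q, hq, rfl⟩
    refine ⟨hlt q hq, fun hc => (h0 q hq).2 ?_⟩
    have := (hmem q hq 0).1 hc
    rwa [inv_zero] at this
  · refine ((hfin (|C| + 1)⁻¹ (by positivity)).image inv).subset ?_
    rintro _ ⟨⟨q, hq, rfl⟩, z, hz, hzC⟩
    refine ⟨q, ⟨hq, fun hsub => ?_⟩, rfl⟩
    have h1 := (hmem q hq z).1 hz
    have h2 : |z⁻¹| < (|C| + 1)⁻¹ := abs_lt.2 (hsub h1)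
    have hz0 : z ≠ 0 := by
      rintro rfl
      rw [inv_zero] at h1
      exact (h0 q hq).2 h1
    rw [abs_inv, inv_lt_inv₀ (abs_pos.2 hz0) (by positivity)] at h2
    linarith [abs_le.2 hzC, le_abs_self C]
  · simp only [unionIntervals, mem_iUnion, exists_prop]
    constructor
    · rintro ⟨_, ⟨q, hq, rfl⟩, hz⟩
      exact ⟨q, hq, (hmem q hq z).1 hz⟩
    · rintro ⟨q, hq, hz⟩
      exact ⟨_, ⟨q, hq, rfl⟩, (hmem q hq z).2 hz⟩
  · refine (h.image hinv.injOn).mono ?_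
    rintro _ ⟨q, ⟨hq, hq0⟩, rfl⟩
    exact ⟨⟨q, hq, rfl⟩, inv_pos.2 (hq0.trans (h0 q hq).1)⟩
  · refine (h.image hinv.injOn).mono ?_
    rintro _ ⟨q, ⟨hq, hq0⟩, rfl⟩
    exact ⟨⟨q, hq, rfl⟩, inv_lt_zero.2 ((h0 q hq).1.trans hq0)⟩

section Stability

variable {ω : ℝ} (hω : 0 < ω) {p s : ℝ → ℂ}

/-- By Floquet theory, a bounded solution exists precisely when some fibre has an eigenfunction. -/
theorem exists_bounded_isSol_iff (hp : Potential ω p) (hs : Potential ω s) {α : ℂ} (hα : α ≠ 0) :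
    (∃ ψ, IsSol α (fun x => α * p x - s x) ψ ∧ ψ ≠ 0 ∧ ∃ C : ℝ, ∀ x, ‖ψ x‖ ≤ C) ↔
      ∃ κ ∈ Icc 0 (2 * Real.pi / ω), ∃ f, f ≠ 0 ∧
        (periodicDomain hω).potOp s f = α • twistOp hω κ p f := by
  constructor
  · rintro ⟨ψ, hψ, hψ0, C, hC⟩
    obtain ⟨κ, hκ, φ, hφ, hφ0, hper⟩ := exists_quasiPeriodic_of_bounded hω hα
      (isH1Loc_pencil hp hs α) (pencil_periodic hp hs α) hψ hψ0 hC
    have htw : twist κ (twist (-κ) φ) = φ := twist_twist_neg κ φ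
    refine ⟨κ, hκ, FormDomain.of _ (mem_periodicDomain_of_quasiPeriodic hω hφ.1 hper),
      fun h => hφ0 ?_, (pencil_iff_isSol hω hp hs α κ _).2 ?_⟩
    · have h1 : twist (-κ) φ = 0 := congrArg FormDomain.Carrier.fn h
      funext x
      refine norm_eq_zero.1 ?_
      rw [← norm_twist (-κ), h1, Pi.zero_apply, norm_zero]
    · rw [FormDomain.coe_of, htw]
      exact hφ
  · rintro ⟨κ, -, f, hf0, hf⟩
    refine ⟨twist κ f, (pencil_iff_isSol hω hp hs α κ f).1 hf, fun h => hf0 ?_, ?_⟩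
    · refine FormDomain.coe_ext fun x => norm_eq_zero.1 ?_
      rw [← norm_twist κ, h, Pi.zero_apply, norm_zero]
    · have hper : Function.Periodic f.fn ω := (mem_periodicDomain.1 f.mem).2
      obtain ⟨C, hC⟩ := isCompact_Icc.exists_bound_of_continuousOn
        (f.h1.continuous.continuousOn (s := Icc 0 ω))
      refine ⟨C, fun x => ?_⟩
      obtain ⟨y, hy, hxy⟩ := hper.exists_mem_Ico₀ hω x
      rw [norm_twist, hxy]
      exact hC y (Ico_subset_Icc_self hy)

/-- For `α = 1 / z` the solutions are those of `-ψ'' + (p - p'') ψ = z (s - s'') ψ`. -/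
theorem isSol_pencil_iff (hp : Potential ω p) (hs : Potential ω s) {α : ℂ} {ψ : ℝ → ℂ}
    (hψ : IsH1Loc ψ) :
    IsSol α (fun x => α * p x - s x) ψ ↔
      ∀ v : H1c, α * ∫ x, dens 1 p v.1 ψ x = ∫ x, dens 0 s v.1 ψ x := by
  have key : ∀ v : H1c, ∫ x, dens α (fun x => α * p x - s x) v.1 ψ x =
      α * (∫ x, dens 1 p v.1 ψ x) - ∫ x, dens 0 s v.1 ψ x := fun v => by
    rw [← integral_const_mul, ← integral_sub ((integrable_dens_H1c hp.h1 v hψ 1).const_mul α)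
      (integrable_dens_H1c hs.h1 v hψ 0)]
    refine integral_congr_ae ?_
    filter_upwards [hp.h1.ae_differentiableAt, hs.h1.ae_differentiableAt] with x h1 h2
    have h3 : deriv (fun x => α * p x - s x) x = α * deriv p x - deriv s x :=
      ((h1.hasDerivAt.const_mul α).sub h2.hasDerivAt).deriv
    simp only [dens, h3]
    ring
  constructor
  · intro h v
    have := h.2 v
    rw [key, sub_eq_zero] at this
    exact this
  · exact fun h => ⟨hψ, fun v => by rw [key, sub_eq_zero]; exact h v⟩

theorem potential_zero (ω : ℝ) : Potential ω 0 := ⟨IsH1Loc.zero, fun _ => rfl, fun _ => map_zero _⟩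

theorem FormDomain.potOp_zero (X : FormDomain ω) (f : X.Carrier) : X.potOp 0 f = 0 := by
  refine ext_inner_left ℂ fun g => ?_
  have h := X.inner_form_eq (potential_zero ω) 0 g f
  rw [zero_mul, zero_add] at h
  rw [h, inner_zero_right]
  have hd : ∀ x : ℝ, deriv (0 : ℝ → ℂ) x = 0 := fun x => by simp
  simp [dens, hd]

/-- The conditional stability set consists of the inverses of the eigenvalues of the pencils on the
fibres. -/
theorem Weight.exists_bounded_solution_iff (r : Weight ω) {q : HNegOneLoc} (hp : Potential ω p)
    (hs : Potential ω s) (hq : ∀ v : H1c, q.pair v = ∫ x, dens 0 p v.1 (fun _ => 1) x)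
    (hrs : ∀ h : ℝ → ℂ, IsH1Loc h → (∀ x, h (x + ω) = h x) →
      r.pair h = ∫ x in Icc 0 ω, dens 0 s h (fun _ => 1) x) {a : ℝ} (ha : 0 < a)
    (hco : ∀ κ ∈ Icc 0 (2 * Real.pi / ω), ∀ f, a * ‖f‖ ^ 2 ≤ (⟪f, twistOp hω κ p f⟫_ℂ).re)
    (z : ℝ) :
    (∃ (ψ : ℝ → ℂ) (hψ : IsH1Loc ψ), (∃ x, ψ x ≠ 0) ∧ (∃ C : ℝ, ∀ x, ‖ψ x‖ ≤ C) ∧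
      ∀ v : H1c, weakSchrodinger q ψ hψ v = z * r.linePair fun x => v.1 x * ψ x) ↔
      z ≠ 0 ∧ ∃ κ ∈ Icc 0 (2 * Real.pi / ω), ∃ f, f ≠ 0 ∧
        (periodicDomain hω).potOp s f = ((z⁻¹ : ℝ) : ℂ) • twistOp hω κ p f := by
  have hz' : ∀ {z : ℝ}, z ≠ 0 → ((z⁻¹ : ℝ) : ℂ) ≠ 0 := fun h =>
    Complex.ofReal_ne_zero.2 (inv_ne_zero h)
  constructor
  · rintro ⟨ψ, hψ, ⟨x₀, hx₀⟩, ⟨C, hC⟩, h⟩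
    have hψ0 : ψ ≠ 0 := fun h => hx₀ (congrFun h x₀)
    have h1 : ∀ v : H1c, ∫ x, dens 1 p v.1 ψ x = z * ∫ x, dens 0 s v.1 ψ x := fun v => by
      rw [← weakSchrodinger_eq hp hq ψ hψ v, h v, r.linePair_mul_H1c hω hs hrs v hψ]
    have hz : z ≠ 0 := by
      rintro rfl
      -- the form of each fibre is positive, so that the equation with `z = 0` has no solutions
      obtain ⟨κ, hκ, f, hf0, hf⟩ := (exists_bounded_isSol_iff hω hp (potential_zero ω)
        one_ne_zero).1 ⟨ψ, (isSol_pencil_iff hp (potential_zero ω) hψ).2 fun v => by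
          have hd : ∀ x : ℝ, deriv (0 : ℝ → ℂ) x = 0 := fun x => by simp
          rw [h1 v, Complex.ofReal_zero, zero_mul, mul_zero]
          simp [dens, hd], hψ0, C, hC⟩
      rw [FormDomain.potOp_zero, one_smul] at hf
      have h2 := hco κ hκ f
      rw [← hf, inner_zero_right, Complex.zero_re] at h2
      have h3 : 0 < ‖f‖ := norm_pos_iff.2 hf0
      have : 0 < a * ‖f‖ ^ 2 := by positivity
      linarith
    refine ⟨hz, (exists_bounded_isSol_iff hω hp hs (hz' hz)).1 ⟨ψ,
      (isSol_pencil_iff hp hs hψ).2 fun v => ?_, hψ0, C, hC⟩⟩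
    rw [h1 v, Complex.ofReal_inv, inv_mul_cancel_left₀ (Complex.ofReal_ne_zero.2 hz)]
  · rintro ⟨hz, h⟩
    obtain ⟨ψ, hψ, hψ0, hC⟩ := (exists_bounded_isSol_iff hω hp hs (hz' hz)).2 h
    refine ⟨ψ, hψ.1, Function.ne_iff.1 hψ0, hC, fun v => ?_⟩
    have h1 := (isSol_pencil_iff hp hs hψ.1).1 hψ v
    rw [weakSchrodinger_eq hp hq ψ hψ.1 v, r.linePair_mul_H1c hω hs hrs v hψ.1, ← h1,
      Complex.ofReal_inv, mul_inv_cancel_left₀ (Complex.ofReal_ne_zero.2 hz)]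

end Stability

/-! ### The operator on the line -/

/-- The Birman–Schwinger operator on the line: its spectrum and point spectrum, and the conditional
stability set, read off from the pencils on the fibres. -/
theorem exists_lineBS {ω : ℝ} (hω : 0 < ω) {q : HNegOneLoc} (hq_real : q.IsReal)
    (hq_per : q.IsPeriodic ω) (r : Weight ω) {c : ℝ} (hc : 0 < c) (hb : BoundedBelow (lineOp q) c) :
    (∃ K B : L2Line →L[ℂ] L2Line, IsInvSqrt (lineOp q) K ∧
      (∀ u v : L2Line, ∃ f g : ℝ → ℂ, IsH1 f ∧ IsH1 g ∧ K u =ᵐ[volume] f ∧ K v =ᵐ[volume] g ∧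
        ⟪u, B v⟫_ℂ = r.linePair fun x => conj (f x) * g x) ∧
      (∃ 𝓘 : Set (ℝ × ℝ), (∀ p ∈ 𝓘, p.1 < p.2 ∧ (0 : ℝ) ∉ Icc p.1 p.2) ∧
        (∀ ε : ℝ, 0 < ε → {p ∈ 𝓘 | ¬ Icc p.1 p.2 ⊆ Ioo (-ε) ε}.Finite) ∧
        spectrum ℂ B = Complex.ofReal '' (insert 0 (unionIntervals 𝓘)) ∧
        (¬ FinitelyManyJumps r.pos → {p ∈ 𝓘 | 0 < p.1}.Infinite) ∧
        (¬ FinitelyManyJumps r.neg → {p ∈ 𝓘 | p.2 < 0}.Infinite)) ∧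
      (∀ z : ℂ, z ≠ 0 → ¬ Module.End.HasEigenvalue B.toLinearMap z) ∧
      ((∀ U : Set ℝ, IsOpen U → U.Nonempty →
          0 < periodicExt ω r.pos U + periodicExt ω r.neg U) →
        ∀ z : ℂ, ¬ Module.End.HasEigenvalue B.toLinearMap z)) ∧
    ∃ 𝓙 : Set (ℝ × ℝ), (∀ p ∈ 𝓙, p.1 < p.2 ∧ (0 : ℝ) ∉ Icc p.1 p.2) ∧
      (∀ C : ℝ, {p ∈ 𝓙 | (Icc p.1 p.2 ∩ Icc (-C) C).Nonempty}.Finite) ∧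
      {z : ℝ | ∃ (ψ : ℝ → ℂ) (hψ : IsH1Loc ψ), (∃ x, ψ x ≠ 0) ∧ (∃ C : ℝ, ∀ x, ‖ψ x‖ ≤ C) ∧
        ∀ v : H1c, weakSchrodinger q ψ hψ v = z * r.linePair fun x => v.1 x * ψ x} =
        unionIntervals 𝓙 ∧
      (¬ FinitelyManyJumps r.pos → {p ∈ 𝓙 | 0 < p.1}.Infinite) ∧
      (¬ FinitelyManyJumps r.neg → {p ∈ 𝓙 | p.2 < 0}.Infinite) := by
  obtain ⟨p, hp, hq⟩ := hq_per.exists_potential hω hq_real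
  obtain ⟨s, hs, hrs⟩ := r.exists_potential hω
  have hl := lineA_lower_bound hω hp hq hb
  obtain ⟨a, ha, hco⟩ := lineA_coercive hω hp hc hl
  obtain ⟨b, hb0, hbco⟩ : ∃ b : ℝ, 0 < b ∧ ∀ κ ∈ Icc 0 (2 * Real.pi / ω), ∀ f,
      b * ‖f‖ ^ 2 ≤ (⟪f, twistOp hω κ p f⟫_ℂ).re := by
    obtain ⟨b, hb0, h⟩ := twistOp_coercive hω hp (2 * Real.pi / ω) hc
    have hT : 0 ≤ 2 * Real.pi / ω := by have := Real.pi_pos; positivity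
    exact ⟨b, hb0, fun κ hκ => h κ ⟨by linarith [hκ.1], hκ.2⟩
      (twistOp_lower_bound hω hp hc.le hl κ)⟩
  obtain ⟨𝓘, h0, hfin, hmem, hpos, hneg⟩ := r.exists_bands hω hp hs hrs hb0 hbco
  refine ⟨?_, ?_⟩
  · obtain ⟨U, K, B, hK, hKU, hKK, hB, hsa, hev, hsp⟩ := exists_birmanSchwinger (lineDomain hω).J
      (lineDomain hω).J_injective (denseRange_lineJ hω) _ (lineA_symm hω hp) ha hco
      ((lineDomain hω).potOp s) ((lineDomain hω).potOp_symm hs)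
    have hev0 : ∀ z : ℂ, z ≠ 0 → ¬ Module.End.HasEigenvalue B.toLinearMap z := fun z hz h => by
      obtain ⟨f, hf0, hf⟩ := (hev z).1 h
      exact hf0 (eq_zero_of_line_pencil hω hp hs hz hf)
    refine ⟨K, B, ⟨hK, fun u w => (lineOp_iff hω hp hq u w).trans (hKK u w)⟩, fun u v => ?_,
      ⟨𝓘, h0, hfin, ?_, hpos, hneg⟩, hev0, fun hr z h => ?_⟩
    · refine ⟨U u, U v, (U u).mem, (U v).mem, ?_, ?_, (hB u v).trans ?_⟩
      · exact (Lp.ext_iff.1 (hKU u)).trans (U u).memLp.coeFn_toLp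
      · exact (Lp.ext_iff.1 (hKU v)).trans (U v).memLp.coeFn_toLp
      · exact (r.linePair_conj_mul hω hs hrs (U u) (U v)).symm
    · have hreal : ∀ l : ℝ, (l : ℂ) ∈ spectrum ℂ B ↔ l ∈ insert 0 (unionIntervals 𝓘) := fun l => by
        rw [hsp]
        rcases eq_or_ne l 0 with rfl | hl0
        · rw [Complex.ofReal_zero, zero_smul, sub_zero]
          exact iff_of_true (r.not_bijective_potOp hω hs hrs) (mem_insert _ _)
        · rw [mem_insert_iff, or_iff_right hl0, hmem l hl0]
          exact not_bijective_pencil_iff hω hp hs (r.isCompactOperator hω hs hrs) hb0 hbco hl0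
      ext z
      constructor
      · intro hz
        have hzre : z = z.re := hsa.mem_spectrum_eq_re hz
        rw [hzre] at hz
        exact ⟨z.re, (hreal _).1 hz, hzre.symm⟩
      · rintro ⟨l, hl', rfl⟩
        exact (hreal l).2 hl'
    · rcases eq_or_ne z 0 with rfl | hz
      · obtain ⟨f, hf0, hf⟩ := (hev 0).1 h
        exact hf0 (r.eq_zero_of_potOp hω hs hrs hr (by rw [hf, zero_smul]))
      · exact hev0 z hz h
  · obtain ⟨𝓙, h0', hfin', hmem', hpos', hneg'⟩ := exists_inverse_bands h0 hfin
    refine ⟨𝓙, h0', hfin', Set.ext fun z => ?_, fun h => hpos' (hpos h), fun h => hneg' (hneg h)⟩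
    refine (r.exists_bounded_solution_iff hω hp hs hq hrs hb0 hbco z).trans ?_
    rw [hmem']
    constructor
    · rintro ⟨hz, h⟩
      exact (hmem _ (inv_ne_zero hz)).2 h
    · intro h
      have hz : z ≠ 0 := by
        rintro rfl
        simp only [unionIntervals, mem_iUnion, exists_prop, inv_zero] at h
        obtain ⟨q', hq', h⟩ := h
        exact (h0 q' hq').2 h
      exact ⟨hz, (hmem _ (inv_ne_zero hz)).1 h⟩

end PeriodicSL

end

open PeriodicSL in
theorem theorem4p5 (ω : ℝ) (hω : 0 < ω)
    (q : HNegOneLoc) (hq_real : q.IsReal) (hq_per : q.IsPeriodic ω)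
    (μ : SignedMeasure ℝ)
    (hμ : ∀ E : Set ℝ, MeasurableSet E → Disjoint E (Ico 0 ω) → μ E = 0) :
    -- (i)
    (∀ θ c : ℝ, 0 < c → BoundedBelow (thetaOp hω θ q) c →
      ∃ K B : L2Period ω →L[ℂ] L2Period ω,
        IsInvSqrt (thetaOp hω θ q) K ∧ IsThetaBS ω θ μ K B ∧
        (¬ FinitelyManyJumps (posPart μ) →
          {t : ℝ | 0 < t ∧ Module.End.HasEigenvalue B.toLinearMap (t : ℂ)}.Infinite) ∧
        (¬ FinitelyManyJumps (negPart μ) →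
          {t : ℝ | t < 0 ∧ Module.End.HasEigenvalue B.toLinearMap (t : ℂ)}.Infinite)) ∧
    -- (ii)
    (∀ c : ℝ, 0 < c → BoundedBelow (lineOp q) c →
      (∃ K B : L2Line →L[ℂ] L2Line,
        IsInvSqrt (lineOp q) K ∧ IsLineBS ω μ K B ∧
        -- the spectrum consists of compact intervals accumulating at `0`
        (∃ 𝓘 : Set (ℝ × ℝ),
          (∀ p ∈ 𝓘, p.1 < p.2 ∧ (0 : ℝ) ∉ Icc p.1 p.2) ∧
          (∀ ε : ℝ, 0 < ε → {p ∈ 𝓘 | ¬ Icc p.1 p.2 ⊆ Ioo (-ε) ε}.Finite) ∧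
          spectrum ℂ B = Complex.ofReal '' (insert 0 (unionIntervals 𝓘)) ∧
          (¬ FinitelyManyJumps (posPart μ) → {p ∈ 𝓘 | 0 < p.1}.Infinite) ∧
          (¬ FinitelyManyJumps (negPart μ) → {p ∈ 𝓘 | p.2 < 0}.Infinite)) ∧
        -- absence of point spectrum
        (∀ z : ℂ, z ≠ 0 → ¬ Module.End.HasEigenvalue B.toLinearMap z) ∧
        ((∀ U : Set ℝ, IsOpen U → U.Nonempty →
            0 < periodicExt ω (posPart μ) U + periodicExt ω (negPart μ) U) →
          ∀ z : ℂ, ¬ Module.End.HasEigenvalue B.toLinearMap z)) ∧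
      -- the conditional stability set consists of intervals tending to `+∞` and/or `-∞`
      ∃ 𝓙 : Set (ℝ × ℝ),
        (∀ p ∈ 𝓙, p.1 < p.2 ∧ (0 : ℝ) ∉ Icc p.1 p.2) ∧
        (∀ C : ℝ, {p ∈ 𝓙 | (Icc p.1 p.2 ∩ Icc (-C) C).Nonempty}.Finite) ∧
        conditionalStabilitySet ω q μ = unionIntervals 𝓙 ∧
        (¬ FinitelyManyJumps (posPart μ) → {p ∈ 𝓙 | 0 < p.1}.Infinite) ∧
        (¬ FinitelyManyJumps (negPart μ) → {p ∈ 𝓙 | p.2 < 0}.Infinite)) := by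
  let r := weightOf μ hμ
  exact ⟨fun θ c hc hb => exists_thetaBS hω hq_real hq_per r hc hb,
    fun c hc hb => exists_lineBS hω hq_real hq_per r hc hb⟩
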